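/- Fix an integer $n\ge 1$; charges are elements of $\mathbb Z/n$. **Fock spaces.** A twist consists of $q\in\mathbb C^\times$ and numbers $\alpha_{ij}$ ($i,j\in\mathbb Z/n$) with $\alpha_{ii}=1$, $\alpha_{ij}\alpha_{ji}=1$. The twisted $q$-Fock space $\mathcal F$ is spanned by semi-infinite wedges $u_{m_1}\wedge u_{m_2}\wedge\cdots$ ($m_i=c-i$ for some $c$ and all large $i$) modulo the relations, for $l\le m$: $u_l\wedge u_m=-u_m\wedge u_l$ if $l\equiv m \pmod n$, and otherwise $$u_l\wedge u_m=-q\alpha_{lm}u_m\wedge u_l+(q^2-1)\big(u_{m-i}\wedge u_{l+i}-q\alpha_{lm}u_{m-n}\wedge u_{l+n}+q^2u_{m-n-i}\wedge u_{l+n+i}-q^3\alpha_{lm}u_{m-2n}\wedge u_{l+2n}+\cdots\big),$$ where $0<i<n$, $m-i\equiv l \pmod n$, and the sum continues while the wedges have decreasing indices. The wedges with strictly decreasing indices form a basis. The current $J_k$ ($k\neq0$) sends $u_{m_1}\wedge u_{m_2}\wedge\cdots$ to $\sum_i u_{m_1}\wedge\cdots\wedge u_{m_i-kn}\wedge\cdots$.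 For a strict partition $\lambda=(\lambda_1>\dots>\lambda_\ell\ge0)$, $|\lambda\rangle=u_{\lambda_1}\wedge\cdots\wedge u_{\lambda_\ell}\wedge u_{-1}\wedge u_{-2}\wedge\cdots$, and $\langle\lambda|$ is the dual basis vector. For parameters $s^{(j)}_{\pm k}$ ($j,k\ge1$) and a number $N$ of rows, $H_\pm=\sum_{k\ge1}\big(\sum_{j=1}^N s^{(j)}_{\pm k}\big)J_{\pm k}$. If $\alpha_{ij}$ depends only on $i-j$, $\mathcal F$ is called a metaplectic Fock space, with $g(0)=-q^2$ and $g(i-j)=-q\alpha_{ij}$ for $i\ne j$, so that $g(a)g(-a)=-g(0)$ for $a\neq0$; $\mathcal F_*$ is the metaplectic Fock space with the same $\alpha_{ij}$ and $q^{-1}$ in place of $q$, i.e. with $g_*(a)=g(-a)^{-1}$. **Models.** Row $i\ge1$ has nonzero weights $a_1^{(i)},a_2^{(i)}(a),b_1^{(i)},b_2^{(i)}(a),c_1^{(i)},c_2^{(i)}$, $a\in\mathbb Z/n$. Vertical edges carry a spin $\pm$; horizontal edges carry $+$, or $-$ with a charge, written $-_a$. The admissible vertices (left, top, right, bottom) of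 the model $\mathfrak S^q$ are $a_1:(+,+,+,+)$, $a_2(a):(-_{a+1},-,-_a,-)$, $b_1:(+,-,+,-)$, $b_2(a):(-_{a+1},+,-_a,+)$, $c_1:(-_1,+,+,-)$, $c_2:(+,-,-_0,+)$; those of the dual model $\mathfrak S^{*,q}$ are $a_1:(+,+,+,+)$, $a_2(a):(-_a,-,-_{a+1},-)$, $b_1:(+,-,+,-)$, $b_2(a):(-_a,+,-_{a+1},+)$, $c_1:(+,+,-_1,-)$, $c_2:(-_0,-,+,+)$. $\mathfrak S^q_{\lambda/\mu}$ has rows $1,\dots,N$ from bottom to top and columns $0,\dots,M$ from left to right, where $M$ is at least every part of $\lambda$ and $\mu$; side edges are $+$, bottom edges are $-$ exactly on the parts of $\lambda$, top edges exactly on those of $\mu$. $\mathfrak S^{*,q}_{\lambda/\mu}$ is the same with rows $1,\dots,N$ from top to bottom, $\lambda$ at the top and $\mu$ at the bottom. $Z$ is the sum over all admissible states of the product of the vertex weights. Put $A_i=a_1^{(i)}$, $B_i=b_1^{(i)}/a_1^{(i)}$ for $\mathfrak S^q$, and $A_i^{-1}=a_1^{(i)}$, $B_i^{-1}=b_1^{(i)}/a_1^{(i)}$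 for $\mathfrak S^{*,q}$. Consider the matching equations, for all strict partitions $\lambda,\mu$ and all $M,N$ as above, $$(1)\quad Z(\mathfrak S^q_{\lambda/\mu})=\prod_{i=1}^N A_i^{M+1}B_i^{\ell(\lambda)}\cdot\langle\mu|e^{H_+}|\lambda\rangle\ \text{ on }\mathcal F,$$ $$(2)\quad Z(\mathfrak S^{*,q}_{\lambda/\mu})=\prod_{i=1}^N A_i^{-(M+1)}B_i^{-\ell(\lambda)}\cdot\langle\lambda|e^{H_-}|\mu\rangle\ \text{ on }\mathcal F_*.$$ **Conditions.** The weights are $\mathcal F$-free fermionic if for every row $a_1a_2(0)+b_1b_2(0)-c_1c_2=0$ (zero-charge free fermion condition) and, when $n>1$, $\frac{a_1a_2(a)}{b_1b_2(a)}=g(a)$ for all $a$. They are generalized free fermionic if they are $\mathcal F$-free fermionic for some metaplectic Fock space $\mathcal F$. The charge condition for a row is $\frac{a_1a_2(a)a_2(-a)}{b_1b_2(a)b_2(-a)}=-\frac{a_2(0)}{b_2(0)}$ for all $a\ne0$. **Theorem.** (i) Let $\mathfrak S^q$ have the (nonzero) weights $a_1=A_i$, $a_2(a)=h(a)y_iA_iB_i$,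 $b_1=A_iB_i$, $b_2(a)=f(a)x_iA_i$, $c_1=(f(0)x_i+h(0)y_i)A_iB_i$, $c_2=A_i$, and let $\mathcal F$ be a metaplectic Fock space. Then (1) holds if and only if the weights are $\mathcal F$-free fermionic and for all $j,k\ge1$ $$s_k^{(j)}=\frac1k\Big(x_j^{nk}\Big(\prod_a f(a)\Big)^k+(-1)^{k-1}\Big(\tfrac{h(0)}{f(0)}\Big)^ky_j^kx_j^{(n-1)k}\Big(\prod_a f(a)\Big)^k\Big).$$ These weights are generalized free fermionic if and only if every row satisfies the zero-charge free fermion condition and the charge condition. (ii) Let $\mathfrak S^{*,q}$ have the (nonzero) weights $a_1=A_i^{-1}$, $a_2(a)=f(a)x_iA_i^{-1}B_i^{-1}$, $b_1=A_i^{-1}B_i^{-1}$, $b_2(a)=h(a)y_iA_i^{-1}$, $c_1=(f(0)x_i+h(0)y_i)A_i^{-1}$, $c_2=A_i^{-1}B_i^{-1}$, and let $\mathcal F$ be a metaplectic Fock space. Then (2) holds if and only if the weights are $\mathcal F_*$-free fermionic and for all $j,k\ge1$ $$s_{-k}^{(j)}=\frac1k\Big(y_j^{nk}\Big(\prod_a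 h(a)\Big)^k+(-1)^{k-1}\Big(\tfrac{h(0)}{f(0)}\Big)^{-k}x_j^ky_j^{(n-1)k}\Big(\prod_a h(a)\Big)^k\Big).$$ These weights are generalized free fermionic if and only if every row satisfies the zero-charge free fermion condition and the charge condition. (iii) For arbitrary nonzero row weights: they are generalized free fermionic if and only if every row satisfies the zero-charge free fermion condition and the charge condition and, when $n>1$, the quotients $\frac{a_1a_2(a)}{b_1b_2(a)}$ do not depend on the row. There are a metaplectic Fock space $\mathcal F$ and parameters such that (1) holds if and only if the weights are generalized free fermionic; likewise for (2). In particular, if the weights are not generalized free fermionic, no Hamiltonian matches. -/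

import Mathlib

noncomputable section

namespace ChargedModel

/-! ### Twisted `q`-Fock spaces -/

/-- Index sequences `(m₁, m₂, …)` of semi-infinite wedges `u_{m₁} ∧ u_{m₂} ∧ ⋯`: from some point on
the sequence decreases by one at each step. -/
def SemiInfinite : Type :=
  {m : ℕ → ℤ // ∃ (c : ℤ) (r : ℕ), ∀ i, r ≤ i → m i = c - (i : ℤ)}

/-- Replace the entry at position `i` by `a`. -/
def SemiInfinite.set (m : SemiInfinite) (i : ℕ) (a : ℤ) : SemiInfinite :=
  ⟨Function.update m.1 i a, by
    obtain ⟨c, r, h⟩ := m.2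
    refine ⟨c, max r (i + 1), fun j hj => ?_⟩
    have hji : j ≠ i := by
      have := le_trans (le_max_right r (i + 1)) hj
      omega
    rw [Function.update_of_ne hji]
    exact h j (le_trans (le_max_left _ _) hj)⟩

/-- Normally ordered: strictly decreasing indices. -/
def SemiInfinite.NormallyOrdered (m : SemiInfinite) : Prop := StrictAnti m.1

/-- The data on which the wedge relations of a Drinfeld-Reshetikhin twist of `q`-Fock space (for
`U_q` of affine `sl_n`) depend: the quantum parameter `q` and the numbers `α_{ij}`, with `i, j` taken
modulo `n`. -/
structure Twist (n : ℕ) where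
  q : ℂ
  q_ne_zero : q ≠ 0
  α : ZMod n → ZMod n → ℂ
  α_self : ∀ i, α i i = 1
  α_mul : ∀ i j, α i j * α j i = 1

namespace Twist

variable {n : ℕ}

/-- The right hand side of the normal ordering relation for the adjacent factors
`u_l ∧ u_m` (`l ≤ m`) standing at the positions `p` and `p + 1` of the wedge `w`.
The sums run over the `j` for which the wedge is still normally ordered. -/
def straighten (D : Twist n) (w : SemiInfinite) (p : ℕ) : SemiInfinite →₀ ℂ :=
  let l : ℤ := w.1 p
  let m : ℤ := w.1 (p + 1)
  let i : ℤ := (m - l) % (n : ℤ)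
  let a : ℂ := D.α (l : ZMod n) (m : ZMod n)
  let u : ℤ → ℤ → (SemiInfinite →₀ ℂ) := fun s t => Finsupp.single ((w.set p s).set (p + 1) t) 1
  if i = 0 then - u m l
  else
    (-D.q * a) • u m l
      + (D.q ^ 2 - 1) •
        ∑ j ∈ Finset.range (m - l).toNat,
          ((if l + i + j * n < m - i - j * n
              then D.q ^ (2 * j) • u (m - i - j * n) (l + i + j * n) else 0)
            + (if l + (j + 1) * n < m - (j + 1) * n
              then (-D.q ^ (2 * j + 1) * a) • u (m - (j + 1) * n) (l + (j + 1) * n) else 0))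

/-- The span of all normal ordering relations. -/
def relations (D : Twist n) : Submodule ℂ (SemiInfinite →₀ ℂ) :=
  Submodule.span ℂ
    {r | ∃ (w : SemiInfinite) (p : ℕ), w.1 p ≤ w.1 (p + 1) ∧
      r = Finsupp.single w 1 - D.straighten w p}

/-- The twisted `q`-Fock space: semi-infinite wedges modulo the normal ordering relations. -/
abbrev Fock (D : Twist n) : Type := (SemiInfinite →₀ ℂ) ⧸ D.relations

/-- The wedge `u_{m₁} ∧ u_{m₂} ∧ ⋯`. -/
def wedge (D : Twist n) (m : SemiInfinite) : D.Fock :=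
  D.relations.mkQ (Finsupp.single m 1)

/-- The linear operator `T` is the current `J_k`: it acts on wedges by
`u_{m₁} ∧ u_{m₂} ∧ ⋯ ↦ ∑_i u_{m₁} ∧ ⋯ ∧ u_{m_i - k n} ∧ ⋯`
(for `k ≠ 0` all but finitely many summands vanish). -/
def IsCurrent (D : Twist n) (k : ℤ) (T : D.Fock →ₗ[ℂ] D.Fock) : Prop :=
  ∀ m : SemiInfinite, T (D.wedge m) = ∑ᶠ i : ℕ, D.wedge (m.set i (m.1 i - k * n))

open Classical in
/-- The current operator `J_k`; it is unique because the wedges span. -/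
def current (D : Twist n) (k : ℤ) : D.Fock →ₗ[ℂ] D.Fock :=
  if h : ∃ T, D.IsCurrent k T then h.choose else 0

end Twist

/-- The index sequence of `|lam⟩ = u_{lam₁} ∧ ⋯ ∧ u_{lam_ℓ} ∧ u_{-1} ∧ u_{-2} ∧ ⋯`. A strict partition
`lam₁ > ⋯ > lam_ℓ ≥ 0` is given by the finite set of its parts; its length is the cardinality. -/
def partitionSeq (lam : Finset ℕ) : SemiInfinite :=
  ⟨fun i => if h : i < lam.card then (lam.orderEmbOfFin rfl (Fin.rev ⟨i, h⟩) : ℤ)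
      else (lam.card : ℤ) - 1 - i,
    (lam.card : ℤ) - 1, lam.card, fun i hi => by
      have h : ¬ i < lam.card := by omega
      simp only [dif_neg h]⟩

namespace Twist

variable {n : ℕ}

/-- The basis vector `|lam⟩`. -/
def ket (D : Twist n) (lam : Finset ℕ) : D.Fock := D.wedge (partitionSeq lam)

open Classical in
/-- The linear functional `φ` is `⟨mu|`: dual to `|mu⟩` in the basis of normally ordered wedges. -/
def IsBra (D : Twist n) (mu : Finset ℕ) (φ : D.Fock →ₗ[ℂ] ℂ) : Prop :=
  ∀ m : SemiInfinite, m.NormallyOrdered →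
    φ (D.wedge m) = if m = partitionSeq mu then 1 else 0

open Classical in
/-- The dual basis vector `⟨mu|`; it is unique because the normally ordered wedges span. -/
def bra (D : Twist n) (mu : Finset ℕ) : D.Fock →ₗ[ℂ] ℂ :=
  if h : ∃ φ, D.IsBra mu φ then h.choose else 0

/-- The matrix coefficient `⟨mu| e^H |lam⟩` for `H = ∑_{k ≥ 1} s_k J_{ε k}`, where `ε = 1` or
`ε = -1`, from the expansion `e^H = ∑_r H^r / r!`: the list `[k₁, …, k_r]` stands for the term
`s_{k₁} ⋯ s_{k_r} J_{ε k₁} ⋯ J_{ε k_r} / r!`. Only finitely many terms are nonzero, as `J_k` lowers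
the degree by `n k`. -/
def expCoeff (D : Twist n) (ε : ℤ) (s : ℕ+ → ℂ) (mu lam : Finset ℕ) : ℂ :=
  ∑ᶠ ks : List ℕ+, ((ks.length.factorial : ℂ))⁻¹ * (ks.map s).prod *
    D.bra mu (ks.foldr (fun k ψ => D.current (ε * (k : ℤ)) ψ) (D.ket lam))

/-- `⟨mu| e^{H_+} |lam⟩` with `H_+ = ∑_{k ≥ 1} s_k J_k`. -/
def expPlus (D : Twist n) (s : ℕ+ → ℂ) (mu lam : Finset ℕ) : ℂ := D.expCoeff 1 s mu lam

/-- `⟨lam| e^{H_-} |mu⟩` with `H_- = ∑_{k ≥ 1} s_{-k} J_{-k}`; here `s k` stands for `s_{-k}`. -/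
def expMinus (D : Twist n) (s : ℕ+ → ℂ) (lam mu : Finset ℕ) : ℂ := D.expCoeff (-1) s lam mu

/-- Shift invariance: `α_{ij}` depends only on `i - j`. The shift invariant twists give the
metaplectic Fock spaces. -/
def IsShiftInvariant (D : Twist n) : Prop := ∀ i j c, D.α (i + c) (j + c) = D.α i j

/-- The function `g` on charges of a shift invariant twist. -/
def g (D : Twist n) (a : ZMod n) : ℂ := if a = 0 then -D.q ^ 2 else -D.q * D.α a 0

/-- The twist of `𝓕_*`: `q ↦ q⁻¹`, with the same `α`. -/
def star (D : Twist n) : Twist n where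
  q := D.q⁻¹
  q_ne_zero := inv_ne_zero D.q_ne_zero
  α := D.α
  α_self := D.α_self
  α_mul := D.α_mul

/-- `g_*(a) = g(-a)⁻¹`. -/
theorem g_star (D : Twist n) (hD : D.IsShiftInvariant) (a : ZMod n) :
    D.star.g a = (D.g (-a))⁻¹ := by
  unfold g star
  by_cases ha : a = 0
  · simp [ha, inv_neg]
  · have h1 : D.α (-a) 0 = D.α 0 a := by simpa using (hD (-a) 0 a).symm
    have h2 : D.α a 0 * D.α 0 a = 1 := D.α_mul a 0
    simp only [ha, neg_eq_zero, if_false, h1]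
    refine eq_inv_of_mul_eq_one_left ?_
    calc -D.q⁻¹ * D.α a 0 * (-D.q * D.α 0 a) = (D.q⁻¹ * D.q) * (D.α a 0 * D.α 0 a) := by ring
      _ = 1 := by rw [inv_mul_cancel₀ D.q_ne_zero, h2, one_mul]

end Twist

/-! ### Lattice models with charge -/

/-- The Boltzmann weights of one row of a `(2n+4)`-vertex model. -/
structure Weights (n : ℕ) where
  a1 : ℂ
  a2 : ZMod n → ℂ
  b1 : ℂ
  b2 : ZMod n → ℂ
  c1 : ℂ
  c2 : ℂ

namespace Weights

variable {n : ℕ}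

/-- All `2n + 4` weights are nonzero. -/
def Nonvanishing (w : Weights n) : Prop :=
  w.a1 ≠ 0 ∧ (∀ a, w.a2 a ≠ 0) ∧ w.b1 ≠ 0 ∧ (∀ a, w.b2 a ≠ 0) ∧ w.c1 ≠ 0 ∧ w.c2 ≠ 0

/-- Weight of a vertex of the model `𝔖^q`, the spins being listed as left, top, right, bottom.
A vertical spin is `true` for `-` and `false` for `+`; a horizontal spin is `none` for `+` and
`some a` for `-` with charge `a`. -/
def vertex (w : Weights n) :
    Option (ZMod n) → Bool → Option (ZMod n) → Bool → ℂ
  | none, false, none, false => w.a1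
  | some c, true, some a, true => if c = a + 1 then w.a2 a else 0
  | none, true, none, true => w.b1
  | some c, false, some a, false => if c = a + 1 then w.b2 a else 0
  | some c, false, none, true => if c = 1 then w.c1 else 0
  | none, true, some a, false => if a = 0 then w.c2 else 0
  | _, _, _, _ => 0

/-- Weight of a vertex of the dual model `𝔖^{*,q}`, with the same conventions. -/
def dualVertex (w : Weights n) :
    Option (ZMod n) → Bool → Option (ZMod n) → Bool → ℂ
  | none, false, none, false => w.a1
  | some a, true, some c, true => if c = a + 1 then w.a2 a else 0
  | none, true, none, true => w.b1
  | some a, false, some c, false => if c = a + 1 then w.b2 a else 0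
  | none, false, some c, true => if c = 1 then w.c1 else 0
  | some a, true, none, false => if a = 0 then w.c2 else 0
  | _, _, _, _ => 0

/-- Zero-charge free fermion condition. -/
def ZeroChargeFreeFermion (w : Weights n) : Prop :=
  w.a1 * w.a2 0 + w.b1 * w.b2 0 - w.c1 * w.c2 = 0

/-- The quotient `a₁ a₂(a) / (b₁ b₂(a))`. -/
def ratio (w : Weights n) (a : ZMod n) : ℂ := w.a1 * w.a2 a / (w.b1 * w.b2 a)

/-- Charge condition. -/
def ChargeCondition (w : Weights n) : Prop :=
  ∀ a : ZMod n, a ≠ 0 →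
    w.a1 * w.a2 a * w.a2 (-a) / (w.b1 * w.b2 a * w.b2 (-a)) = -(w.a2 0 / w.b2 0)

end Weights

/-- The `𝓕`-free fermion condition for the family `W` of row weights, where `𝓕` is the metaplectic
Fock space of the shift invariant twist `D`. For `n = 1` there is only the charge `0`, the space `𝓕`
is the classical Fock space whatever `q` is, and the condition is the usual free fermion condition. -/
def FreeFermionicFor {n : ℕ} (D : Twist n) (W : ℕ → Weights n) : Prop :=
  (∀ i, (W i).ZeroChargeFreeFermion) ∧ (n ≠ 1 → ∀ i a, (W i).ratio a = D.g a)

/-- The generalized free fermion condition: the `𝓕`-free fermion condition holds for some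
metaplectic Fock space `𝓕`. -/
def GeneralizedFreeFermionic {n : ℕ} (W : ℕ → Weights n) : Prop :=
  ∃ D : Twist n, D.IsShiftInvariant ∧ FreeFermionicFor D W

/-- Spins along a horizontal line of vertical edges: `-` exactly on the parts of `lam`. -/
def boundary (lam : Finset ℕ) (M : ℕ) : Fin (M + 1) → Bool := fun j => decide ((j : ℕ) ∈ lam)

/-- The partition function of `𝔖^q_{lam/mu}` with row weights `W`, with `N` rows and `M + 1` columns.
In a state, `V k` lists the spins on the vertical edges at height `k` (from the bottom), and
`E i` those on the horizontal edges of row `i` (from the left); row `i` lies between the heights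
`i` and `i + 1`. -/
def partitionFunction {n : ℕ} [NeZero n] (W : ℕ → Weights n) (N M : ℕ) (lam mu : Finset ℕ) : ℂ :=
  ∑ V : Fin (N + 1) → Fin (M + 1) → Bool, ∑ E : Fin N → Fin (M + 2) → Option (ZMod n),
    if V 0 = boundary lam M ∧ V (Fin.last N) = boundary mu M ∧
        ∀ i, E i 0 = none ∧ E i (Fin.last (M + 1)) = none
    then ∏ i : Fin N, ∏ j : Fin (M + 1),
      (W i).vertex (E i j.castSucc) (V i.succ j) (E i j.succ) (V i.castSucc j)
    else 0

/-- The partition function of `𝔖^{*,q}_{lam/mu}`: now rows and heights are numbered from the top. -/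
def dualPartitionFunction {n : ℕ} [NeZero n] (W : ℕ → Weights n) (N M : ℕ) (lam mu : Finset ℕ) :
    ℂ :=
  ∑ V : Fin (N + 1) → Fin (M + 1) → Bool, ∑ E : Fin N → Fin (M + 2) → Option (ZMod n),
    if V 0 = boundary lam M ∧ V (Fin.last N) = boundary mu M ∧
        ∀ i, E i 0 = none ∧ E i (Fin.last (M + 1)) = none
    then ∏ i : Fin N, ∏ j : Fin (M + 1),
      (W i).dualVertex (E i j.castSucc) (V i.castSucc j) (E i j.succ) (V i.succ j)
    else 0

/-- The model `𝔖^q` with row weights `W` matches `e^{H_+}` on the Fock space of `D`, where `H_+` has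
the parameters `s_k = ∑_{j ≤ N} s_k^{(j)}`. The normalizing factor is
`∏ A_i^{M+1} B_i^ℓ` with `A_i = a₁^{(i)}` and `B_i = b₁^{(i)} / a₁^{(i)}`. -/
def Matches {n : ℕ} [NeZero n] (D : Twist n) (W : ℕ → Weights n) (s : ℕ → ℕ+ → ℂ) : Prop :=
  ∀ (N M : ℕ) (lam mu : Finset ℕ), (∀ p ∈ lam, p ≤ M) → (∀ p ∈ mu, p ≤ M) →
    partitionFunction W N M lam mu =
      (∏ i ∈ Finset.range N, (W i).a1 ^ (M + 1) * ((W i).b1 / (W i).a1) ^ lam.card) *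
        D.expPlus (fun k => ∑ j ∈ Finset.range N, s j k) mu lam

/-- The model `𝔖^{*,q}` with row weights `W` matches `e^{H_-}` on the Fock space of `D`; here
`s j k` stands for `s_{-k}^{(j)}`. -/
def DualMatches {n : ℕ} [NeZero n] (D : Twist n) (W : ℕ → Weights n) (s : ℕ → ℕ+ → ℂ) : Prop :=
  ∀ (N M : ℕ) (lam mu : Finset ℕ), (∀ p ∈ lam, p ≤ M) → (∀ p ∈ mu, p ≤ M) →
    dualPartitionFunction W N M lam mu =
      (∏ i ∈ Finset.range N, (W i).a1 ^ (M + 1) * ((W i).b1 / (W i).a1) ^ lam.card) *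
        D.expMinus (fun k => ∑ j ∈ Finset.range N, s j k) lam mu

/-- The Boltzmann weights of `𝔖^q(x, y, A, B, f, h)`. -/
def modelWeights {n : ℕ} (x y A B : ℕ → ℂ) (f h : ZMod n → ℂ) (i : ℕ) : Weights n where
  a1 := A i
  a2 := fun a => h a * y i * A i * B i
  b1 := A i * B i
  b2 := fun a => f a * x i * A i
  c1 := (f 0 * x i + h 0 * y i) * A i * B i
  c2 := A i

/-- The Boltzmann weights of `𝔖^{*,q}(x, y, A, B, f, h)`. -/
def dualModelWeights {n : ℕ} (x y A B : ℕ → ℂ) (f h : ZMod n → ℂ) (i : ℕ) : Weights n where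
  a1 := (A i)⁻¹
  a2 := fun a => f a * x i * (A i)⁻¹ * (B i)⁻¹
  b1 := (A i)⁻¹ * (B i)⁻¹
  b2 := fun a => h a * y i * (A i)⁻¹
  c1 := (f 0 * x i + h 0 * y i) * (A i)⁻¹
  c2 := (A i)⁻¹ * (B i)⁻¹

end ChargedModel

end

/-! Write ψ_m for left multiplication by u_m (`Twist.create`). The currents act on wedges by the
Leibniz rule, so e^{H_+} ψ_m e^{-H_+} = Σ_k f_k ψ_{m-nk}, where f = exp(Σ s_k X^k), and e^{H_+}
fixes the vacuum (`Twist.expH_create`, `Twist.expH_descending`). Hence e^{H_+}|λ⟩ is obtained from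
the vacuum by applying one such series for each part of λ.

A row of the lattice is built column by column. The charge of a path drops by one at every column,
so a path of charge a after m columns started in a fixed class modulo n, and each further period
contributes the factor z = ∏ b₂(a)/a₁. If v is the generating vector of the partial rows ending in
+, those ending in charge a should therefore give a multiple of E_p v, with E_p = Σ_k z^k ψ_{p-nk}.
This shape (`RowInvariant`) survives every column that is not a part of λ. At a part m the vector v
becomes R_m v with R_m = ψ_m + κ z E_{m-n} and κ = c₁c₂/(b₁b₂(0)), and the shape survives if E_p R_m
is the right multiple of ψ_m E_p (`rowOp_rowImage`). The ordering relations give E_m R_m = (κ-1) z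
ψ_m E_{m-n}, and E_p R_m = -qα ψ_m E_p + (κ+q²-1) z E_p E_{m-n} for p < m < p+n. So the free fermion
conditions are what is needed, and matching forces f = 1 + κ Σ_{k≥1} z^k X^k. With ρ =
a₁a₂(0)/(b₁b₂(0)) and κ = 1+ρ this is (1+ρzX)/(1-zX), whose logarithm gives the stated parameters.

Conversely, partitions with one part determine f, and suitable partitions with two parts recover the
exchange relation on the vacuum; its coefficients at distinct basis vectors are the conditions on
the weights (`RowMatch.expSeries_eq`, `RowMatch.exchange`, `RowMatch.rowCondition`). The matrices of
the exponentials are multiplicative and invertible, so matching for all N means matching of every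
single row (`matches_iff_rowMatch`). The dual model is the mirror image: for shift invariant twists
the reflection x ↦ M - x turns e^{H_-} into e^{H_+} (`Twist.expMinus_eq_expPlus`).

Underneath lies the fact that the normally ordered wedges are independent, so that ⟨μ| exists. This
is a diamond lemma: straightening terminates, and only overlaps of three adjacent factors need
inspection (`BelowAntisymmetric.confluence`). In exponent form the relation for two different
charges is a Demazure-Lusztig operator; its braid relation is confluence for three distinct charges,
and symmetry statements settle repeated charges. These operators also commute with multiplication by
X^k + Y^k, which makes J_k well defined.

Finally, up to the choice of a square root q, the functions g of metaplectic spaces are exactly the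
nowhere zero functions with g(a)g(-a) = -g(0) for a ≠ 0 (`exists_twist`). So the generalized
condition consists of the two row conditions and independence of the row, and the latter is
automatic when the quotients of different rows are proportional. -/

noncomputable section

namespace ChargedModel

open Finset

/-! ### Nested ordering relations, as linear algebra of two sequences. -/

section Sequences

variable {M : Type*} [AddCommGroup M] [Module ℂ M]

/-- The normal ordering relation for a pair of factors of distinct charges, in terms of the values
`A j`, `B j` on the wedges obtained by moving the two indices towards each other. -/
def orderingDefect (q a : ℂ) (A B : ℕ → M) (N : ℕ) : M :=
  A 0 + (q * a) • B N - (q ^ 2 - 1) • ∑ j ∈ range N,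
    ((if 2 * j + 1 ≤ N then q ^ (2 * j) • A (N - j) else 0) +
      (if 2 * j + 2 ≤ N then (-q ^ (2 * j + 1) * a) • B (N - 1 - j) else 0))

/-- The coefficients attached to the family without its outermost pairs are again geometric,
starting from q². Multiplying the inner relation by q² therefore reproduces all but a few outer
terms, which gives a recursion in steps of two. -/
theorem orderingDefect_succ_succ (q a : ℂ) (A B : ℕ → M) (N : ℕ) :
    orderingDefect q a A B (N + 2) =
      q ^ 2 • orderingDefect q a (fun j => A (1 + j)) (fun j => B (1 + j)) N +
        (A 0 - q ^ 2 • A 1 + (q * a) • (B (N + 2) - B (N + 1)) - (q ^ 2 - 1) • A (N + 2)) := by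
  unfold orderingDefect
  rw [sum_range_succ', sum_range_succ]
  have h1 : ∀ j ∈ range N,
      ((if 2 * (j + 1) + 1 ≤ N + 2 then q ^ (2 * (j + 1)) • A (N + 2 - (j + 1)) else 0) +
        (if 2 * (j + 1) + 2 ≤ N + 2 then
          (-q ^ (2 * (j + 1) + 1) * a) • B (N + 2 - 1 - (j + 1)) else 0)) =
      q ^ 2 • ((if 2 * j + 1 ≤ N then q ^ (2 * j) • A (1 + (N - j)) else 0) +
        (if 2 * j + 2 ≤ N then (-q ^ (2 * j + 1) * a) • B (1 + (N - 1 - j)) else 0)) := by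
    intro j hj
    rw [mem_range] at hj
    rw [smul_add, smul_ite, smul_ite, smul_zero, smul_smul, smul_smul]
    congr 1
    · by_cases h : 2 * j + 1 ≤ N
      · rw [if_pos (by omega), if_pos h, show N + 2 - (j + 1) = 1 + (N - j) by omega]
        congr 1; ring
      · rw [if_neg (by omega), if_neg h]
    · by_cases h : 2 * j + 2 ≤ N
      · rw [if_pos (by omega), if_pos h, show N + 2 - 1 - (j + 1) = 1 + (N - 1 - j) by omega]
        congr 1; ring
      · rw [if_neg (by omega), if_neg h]
  rw [sum_congr rfl h1, ← smul_sum, if_neg (by omega), if_neg (by omega), if_pos (by omega),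
    if_pos (by omega), show N + 2 - 1 - 0 = N + 1 by omega]
  beta_reduce
  rw [add_comm 1 N]
  simp only [Nat.mul_zero, pow_zero, Nat.sub_zero, add_zero, Nat.zero_add, pow_one]
  module

/-- Under the relations for all inner pairs, the sum over all positions on one side. -/
theorem orderingDefect_eq_sum_left (q a : ℂ) (N : ℕ) : ∀ (A B : ℕ → M),
    (∀ k, 1 ≤ k → 2 * k ≤ N →
      orderingDefect q a (fun j => A (k + j)) (fun j => B (k + j)) (N - 2 * k) = 0) →
    orderingDefect q a A B N =
      A 0 + (q * a) • B N - (q ^ 2 - 1) • ∑ j ∈ range N, A (j + 1) := by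
  induction N using Nat.twoStepInduction with
  | zero => intro A B _; simp [orderingDefect]
  | one => intro A B _; simp [orderingDefect]
  | more N ih _ =>
    intro A B h
    have h1 := h 1 le_rfl (by omega)
    rw [show N + 2 - 2 * 1 = N by omega] at h1
    have h2 := ih (fun j => A (1 + j)) (fun j => B (1 + j)) (by
      intro k hk hk2
      have := h (k + 1) (by omega) (by omega)
      rw [show N + 2 - 2 * (k + 1) = N - 2 * k by omega] at this
      rw [← this]
      simp only [show ∀ j, 1 + (k + j) = k + 1 + j by intro j; omega])
    rw [orderingDefect_succ_succ, h1, smul_zero, zero_add]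
    rw [h1] at h2
    rw [sum_range_succ, sum_range_succ']
    simp only [show ∀ j, 1 + (j + 1) = j + 1 + 1 by intro j; omega] at h2
    -- The inner defect is zero and also has the summed form, so the terms left over by the
    -- recursion can be traded for the missing part of the sum.
    have h3 : A 1 + (q * a) • B (N + 1) =
        (q ^ 2 - 1) • ∑ j ∈ range N, A (j + 1 + 1) := by
      rw [eq_comm, sub_eq_zero, add_comm 1 N] at h2; simpa using h2
    rw [smul_add, smul_add, ← h3]
    simp only [Nat.zero_add]
    module

/-- The relations for a family of nested pairs, summed over all positions on both sides. -/
theorem sum_add_sum_eq_zero (q a b : ℂ) (hab : a * b = 1) (N : ℕ) : ∀ (A B : ℕ → M),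
    (∀ k, 1 ≤ k → 2 * k ≤ N →
      orderingDefect q a (fun j => A (k + j)) (fun j => B (k + j)) (N - 2 * k) = 0) →
    (∀ k, 2 * k + 1 ≤ N →
      orderingDefect q b (fun j => B (k + j)) (fun j => A (k + 1 + j)) (N - 1 - 2 * k) = 0) →
    ∑ j ∈ range N, B j + (q * b) • ∑ j ∈ range N, A (j + 1) = 0 := by
  induction N using Nat.twoStepInduction with
  | zero => intro A B _ _; simp
  | one =>
    intro A B _ hB
    have := hB 0 (by omega)
    simpa [orderingDefect] using this
  | more N ih _ =>
    intro A B hA hB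
    have S1 := ih (fun j => A (1 + j)) (fun j => B (1 + j)) (by
      intro k hk hk2
      have := hA (k + 1) (by omega) (by omega)
      rw [show N + 2 - 2 * (k + 1) = N - 2 * k by omega] at this
      rw [← this]
      simp only [show ∀ j, 1 + (k + j) = k + 1 + j by intro j; omega]) (by
      intro k hk
      have := hB (k + 1) (by omega)
      rw [show N + 2 - 1 - 2 * (k + 1) = N - 1 - 2 * k by omega] at this
      rw [← this]
      simp only [show ∀ j, 1 + (k + j) = k + 1 + j by intro j; omega,
        show ∀ j, 1 + (k + 1 + j) = k + 1 + 1 + j by intro j; omega])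
    -- Three linear equations suffice: the claim for the family one step further in, and the
    -- outermost assumed relation of either kind in the form with constant coefficients. They cancel
    -- because `a * b = 1`.
    have DA := orderingDefect_eq_sum_left q a N (fun j => A (1 + j)) (fun j => B (1 + j)) (by
      intro k hk hk2
      have := hA (k + 1) (by omega) (by omega)
      rw [show N + 2 - 2 * (k + 1) = N - 2 * k by omega] at this
      rw [← this]
      simp only [show ∀ j, 1 + (k + j) = k + 1 + j by intro j; omega])
    have h1 := hA 1 le_rfl (by omega)
    rw [show N + 2 - 2 * 1 = N by omega] at h1
    rw [h1] at DA
    have DB := orderingDefect_eq_sum_left q b (N + 1) B (fun j => A (1 + j)) (by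
      intro k hk hk2
      have := hB k (by omega)
      rw [show N + 2 - 1 - 2 * k = N + 1 - 2 * k by omega] at this
      rw [← this]
      simp only [show ∀ j, 1 + (k + j) = k + 1 + j by intro j; omega])
    have h2 := hB 0 (by omega)
    simp only [Nat.mul_zero, Nat.sub_zero, Nat.zero_add, show N + 2 - 1 = N + 1 by omega] at h2
    rw [h2] at DB
    simp only [show ∀ j, 1 + (j + 1) = j + 2 by intro j; omega, show ∀ j, 1 + j = j + 1 by
      intro j; omega, Nat.zero_add] at S1 DA DB
    rw [sum_range_succ, sum_range_succ', sum_range_succ _ (N + 1), sum_range_succ']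
    rw [sum_range_succ] at DB
    simp only [show ∀ j, j + 1 + 1 = j + 2 by intro j; omega, Nat.zero_add] at S1 DA DB ⊢
    generalize ∑ j ∈ range N, B (j + 1) = SB at *
    generalize ∑ j ∈ range N, A (j + 2) = SA at *
    have hq : (q * b) * (q * a) = q ^ 2 := by
      calc (q * b) * (q * a) = q ^ 2 * (a * b) := by ring
        _ = q ^ 2 := by rw [hab, mul_one]
    have e1 : SB = -((q * b) • SA) := eq_neg_of_add_eq_zero_left S1
    have e2 : (q * b) • A 1 = -(q ^ 2 • B (N + 1)) + ((q * b) * (q ^ 2 - 1)) • SA := by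
      have := congrArg (fun v => (q * b) • v) DA
      simp only [smul_zero, smul_sub, smul_add, smul_smul, hq] at this
      have h3 := sub_eq_zero.mp this.symm
      rw [← h3]; abel
    have e3 : B 0 + (q * b) • A (N + 2) = (q ^ 2 - 1) • (SB + B (N + 1)) :=
      sub_eq_zero.mp DB.symm
    calc SB + B 0 + B (N + 1) + (q * b) • (SA + A 1 + A (N + 2))
        = SB + (B 0 + (q * b) • A (N + 2)) + B (N + 1) + (q * b) • SA + (q * b) • A 1 := by
          module
      _ = 0 := by rw [e3, e2, e1]; module

/-- The sums over the two sequences are proportional, so either may appear in the relation. The two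
resulting forms later become the two branches of one exchange operator. -/
theorem orderingDefect_eq_sum_right (q a b : ℂ) (hq : q ≠ 0) (hab : a * b = 1) (N : ℕ)
    (A B : ℕ → M)
    (hA : ∀ k, 1 ≤ k → 2 * k ≤ N →
      orderingDefect q a (fun j => A (k + j)) (fun j => B (k + j)) (N - 2 * k) = 0)
    (hB : ∀ k, 2 * k + 1 ≤ N →
      orderingDefect q b (fun j => B (k + j)) (fun j => A (k + 1 + j)) (N - 1 - 2 * k) = 0) :
    orderingDefect q a A B N =
      A 0 + (q * a) • B N + (q * a * (1 - (q ^ 2)⁻¹)) • ∑ j ∈ range N, B j := by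
  rw [orderingDefect_eq_sum_left q a N A B hA]
  have h := sum_add_sum_eq_zero q a b hab N A B hA hB
  rw [eq_neg_of_add_eq_zero_left h]
  have hc : q * a * (1 - (q ^ 2)⁻¹) * (q * b) = q ^ 2 - 1 := by
    have : q * a * (1 - (q ^ 2)⁻¹) * (q * b) = (a * b) * (q ^ 2 - q ^ 2 * (q ^ 2)⁻¹) := by ring
    rw [this, hab, mul_inv_cancel₀ (pow_ne_zero 2 hq), one_mul]
  rw [smul_neg, smul_smul, hc, sub_eq_add_neg]

end Sequences

end ChargedModel

end

/-! ### Straightening a pair of factors, and the defect of a relation. -/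

noncomputable section

namespace ChargedModel

open Finset

namespace Twist

variable {n : ℕ}

/-- The right hand side of the normal ordering relation for `u_l ∧ u_m`, as a combination of pairs
of indices. -/
def straightenPair (D : Twist n) (l m : ℤ) : ℤ × ℤ →₀ ℂ :=
  if (m - l) % (n : ℤ) = 0 then - Finsupp.single (m, l) 1
  else
    (-D.q * D.α (l : ZMod n) (m : ZMod n)) • Finsupp.single (m, l) 1
      + (D.q ^ 2 - 1) •
        ∑ j ∈ Finset.range (m - l).toNat,
          ((if l + (m - l) % (n : ℤ) + j * n < m - (m - l) % (n : ℤ) - j * n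
              then D.q ^ (2 * j) •
                Finsupp.single (m - (m - l) % (n : ℤ) - j * n, l + (m - l) % (n : ℤ) + j * n) 1
              else 0)
            + (if l + (j + 1) * n < m - (j + 1) * n
              then (-D.q ^ (2 * j + 1) * D.α (l : ZMod n) (m : ZMod n)) •
                Finsupp.single (m - (j + 1) * n, l + (j + 1) * n) 1 else 0))

/-- The normal form of `u_l ∧ u_m` for `l ≤ m`: equal indices give zero. -/
def normalForm (D : Twist n) (l m : ℤ) : ℤ × ℤ →₀ ℂ :=
  if l = m then 0 else D.straightenPair l m

theorem straightenPair_self (D : Twist n) (l : ℤ) :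
    D.straightenPair l l = - Finsupp.single (l, l) 1 := by
  simp [straightenPair]

theorem normalForm_self (D : Twist n) (l : ℤ) : D.normalForm l l = 0 := by
  simp [normalForm]

theorem normalForm_of_ne (D : Twist n) {l m : ℤ} (h : l ≠ m) :
    D.normalForm l m = D.straightenPair l m := by
  simp [normalForm, h]

theorem straighten_eq (D : Twist n) (w : SemiInfinite) (p : ℕ) :
    D.straighten w p = Finsupp.lmapDomain ℂ ℂ
      (fun st : ℤ × ℤ => (w.set p st.1).set (p + 1) st.2)
      (D.straightenPair (w.1 p) (w.1 (p + 1))) := by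
  unfold straighten straightenPair
  dsimp only
  split_ifs
  · rw [map_neg, Finsupp.lmapDomain_apply, Finsupp.mapDomain_single]
  · simp only [map_add, map_smul, map_sum, apply_ite (Finsupp.lmapDomain ℂ ℂ _), map_zero,
      Finsupp.lmapDomain_apply, Finsupp.mapDomain_single]

/-- Pairs of indices strictly inside the interval from `l` to `m`, in decreasing order. -/
def innerPairs (l m : ℤ) : Set (ℤ × ℤ) :=
  {st | l ≤ st.2 ∧ st.2 < st.1 ∧ st.1 ≤ m ∧ st.1 + st.2 = l + m}

/-- This is the reason for setting the normal form of an equal pair to zero: the given relation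
would return such a pair to itself, whereas now every pair that occurs is strictly decreasing and a
reduction always makes progress. -/
theorem normalForm_mem_supported (D : Twist n) [NeZero n] {l m : ℤ} (hlm : l ≤ m) :
    D.normalForm l m ∈ Finsupp.supported ℂ ℂ (innerPairs l m) := by
  have hn : (0 : ℤ) < n := by exact_mod_cast Nat.pos_of_ne_zero (NeZero.ne n)
  rcases hlm.eq_or_lt with rfl | hlt
  · rw [normalForm_self]; exact Submodule.zero_mem _
  rw [normalForm_of_ne D hlt.ne, straightenPair]
  have hi := Int.emod_nonneg (m - l) hn.ne'
  have h0 : Finsupp.single (m, l) (1 : ℂ) ∈ Finsupp.supported ℂ ℂ (innerPairs l m) :=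
    Finsupp.single_mem_supported ℂ 1 ⟨le_rfl, hlt, le_rfl, by simp; ring⟩
  split_ifs with h
  · exact Submodule.neg_mem _ h0
  · refine Submodule.add_mem _ (Submodule.smul_mem _ _ h0) (Submodule.smul_mem _ _
      (Submodule.sum_mem _ fun j _ => Submodule.add_mem _ ?_ ?_))
    · split_ifs with h'
      · refine Submodule.smul_mem _ _ (Finsupp.single_mem_supported ℂ 1 ⟨?_, h', ?_, ?_⟩)
        · dsimp only; nlinarith
        · dsimp only; nlinarith
        · dsimp only; ring
      · exact Submodule.zero_mem _
    · split_ifs with h'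
      · refine Submodule.smul_mem _ _ (Finsupp.single_mem_supported ℂ 1 ⟨?_, h', ?_, ?_⟩)
        · dsimp only; nlinarith
        · dsimp only; nlinarith
        · dsimp only; ring
      · exact Submodule.zero_mem _

end Twist

section Pairs

variable {n : ℕ} {M : Type*} [AddCommGroup M] [Module ℂ M]

/-- The linear extension of a function on pairs of indices. -/
def pairEval (U : ℤ → ℤ → M) : (ℤ × ℤ →₀ ℂ) →ₗ[ℂ] M :=
  Finsupp.linearCombination ℂ fun st => U st.1 st.2

theorem pairEval_single (U : ℤ → ℤ → M) (s t : ℤ) (c : ℂ) :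
    pairEval U (Finsupp.single (s, t) c) = c • U s t := by
  simp [pairEval]

theorem pairEval_congr {U V : ℤ → ℤ → M} {S : Set (ℤ × ℤ)} {f : ℤ × ℤ →₀ ℂ}
    (hf : f ∈ Finsupp.supported ℂ ℂ S) (h : ∀ st ∈ S, U st.1 st.2 = V st.1 st.2) :
    pairEval U f = pairEval V f := by
  unfold pairEval
  rw [Finsupp.linearCombination_apply, Finsupp.linearCombination_apply]
  refine Finsupp.sum_congr fun st hst => ?_
  rw [h st (hf hst)]

theorem map_pairEval {M' : Type*} [AddCommGroup M'] [Module ℂ M'] (L : M →ₗ[ℂ] M')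
    (U : ℤ → ℤ → M) (f : ℤ × ℤ →₀ ℂ) :
    L (pairEval U f) = pairEval (fun s t => L (U s t)) f := by
  unfold pairEval
  rw [Finsupp.linearCombination_apply, Finsupp.linearCombination_apply, map_finsuppSum]
  simp

theorem pairEval_mem (U : ℤ → ℤ → M) {S : Set (ℤ × ℤ)} {f : ℤ × ℤ →₀ ℂ}
    (hf : f ∈ Finsupp.supported ℂ ℂ S) (P : Submodule ℂ M) (h : ∀ st ∈ S, U st.1 st.2 ∈ P) :
    pairEval U f ∈ P := by
  unfold pairEval
  rw [Finsupp.linearCombination_apply]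
  exact Submodule.sum_mem _ fun st hst => P.smul_mem _ (h st (hf hst))

/-- The failure of the normal ordering relation for the pair `u_l ∧ u_m`. -/
def pairDefect (D : Twist n) (U : ℤ → ℤ → M) (l m : ℤ) : M :=
  U l m - pairEval U (D.normalForm l m)

/-- All normal ordering relations hold for `U`. -/
def Antisymmetric (D : Twist n) (U : ℤ → ℤ → M) : Prop :=
  ∀ l m, l ≤ m → pairDefect D U l m = 0

theorem pairDefect_self (D : Twist n) (U : ℤ → ℤ → M) (l : ℤ) : pairDefect D U l l = U l l := by
  simp [pairDefect, Twist.normalForm_self]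

theorem pairDefect_of_dvd (D : Twist n) (U : ℤ → ℤ → M) {l m : ℤ} (h : l ≠ m)
    (hd : (m - l) % (n : ℤ) = 0) : pairDefect D U l m = U l m + U m l := by
  rw [pairDefect, D.normalForm_of_ne h, Twist.straightenPair, if_pos hd, map_neg, pairEval_single]
  simp

/-- All index pairs on the right hand side lie on two arithmetic progressions of step n, starting at
l and at l + i; the two kinds of terms in the relation alternate between them. -/
theorem pairDefect_eq_orderingDefect (D : Twist n) [NeZero n] (U : ℤ → ℤ → M) {l m i : ℤ} {N : ℕ}
    (hi0 : 0 < i) (hin : i < n) (hm : m = l + i + n * N) :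
    pairDefect D U l m = orderingDefect D.q (D.α (l : ZMod n) (m : ZMod n))
      (fun j => U (l + n * j) (m - n * j)) (fun j => U (l + i + n * j) (m - i - n * j)) N := by
  have hn : (0 : ℤ) < n := by exact_mod_cast Nat.pos_of_ne_zero (NeZero.ne n)
  have hmod : (m - l) % (n : ℤ) = i := by
    rw [hm, show l + i + n * (N : ℤ) - l = i + n * N by ring, Int.add_mul_emod_self_left]
    exact Int.emod_eq_of_lt hi0.le hin
  have hlm : l < m := by rw [hm]; have : (0 : ℤ) ≤ n * N := by positivity
                         linarith
  have hNm : N ≤ (m - l).toNat := by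
    have : (N : ℤ) ≤ m - l := by
      rw [hm]; have : (1 : ℤ) * N ≤ n * N := by gcongr; omega
      linarith
    omega
  have hc1 : ∀ j : ℕ, l + i + j * n < m - i - j * n ↔ 2 * j + 1 ≤ N := by
    intro j
    rw [hm]
    constructor
    · intro h
      by_contra h'
      have h2 : (N : ℤ) ≤ 2 * j := by omega
      have : (n : ℤ) * N ≤ n * (2 * j) := by gcongr
      linarith
    · intro h
      have h2 : (2 * j + 1 : ℤ) ≤ N := by exact_mod_cast h
      have : (n : ℤ) * (2 * j + 1) ≤ n * N := by gcongr
      linarith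
  have hc2 : ∀ j : ℕ, l + (j + 1) * n < m - (j + 1) * n ↔ 2 * j + 2 ≤ N := by
    intro j
    rw [hm]
    constructor
    · intro h
      by_contra h'
      have h2 : (N : ℤ) ≤ 2 * j + 1 := by omega
      have : (n : ℤ) * N ≤ n * (2 * j + 1) := by gcongr
      linarith
    · intro h
      have h2 : (2 * j + 2 : ℤ) ≤ N := by exact_mod_cast h
      have : (n : ℤ) * (2 * j + 2) ≤ n * N := by gcongr
      linarith
  rw [pairDefect, D.normalForm_of_ne hlm.ne, Twist.straightenPair, hmod, if_neg hi0.ne']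
  simp only [map_add, map_smul, map_sum, apply_ite (pairEval U), map_zero, pairEval_single,
    one_smul, hc1, hc2]
  unfold orderingDefect
  -- The range in the defining sum is only an upper bound; from `N` on both order conditions fail
  -- and the terms vanish.
  rw [← Finset.sum_subset (Finset.range_subset_range.mpr hNm)]
  · have e1 : U (l + i + n * N) (m - i - n * N) = U m l := by
      congr 1
      · exact hm.symm
      · rw [hm]; ring
    beta_reduce
    rw [e1]
    simp only [Nat.cast_zero, mul_zero, add_zero, sub_zero]
    rw [neg_mul, neg_smul, neg_add_eq_sub, sub_sub_eq_add_sub]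
    congr 2
    refine Finset.sum_congr rfl fun j hj => ?_
    congr 1
    · split_ifs with h
      · congr 2
        · rw [hm]; push_cast [show j ≤ N by omega]; ring
        · rw [hm]; push_cast [show j ≤ N by omega]; ring
      · rfl
    · split_ifs with h
      · congr 2
        · rw [hm, Nat.sub_sub]; push_cast [show 1 + j ≤ N by omega]; ring
        · rw [hm, Nat.sub_sub]; push_cast [show 1 + j ≤ N by omega]; ring
      · rfl
  · intro j _ hj
    rw [Finset.mem_range] at hj
    rw [if_neg (by omega), if_neg (by omega), add_zero]

/-- The relations hold for all pairs strictly inside the interval from `l` to `m`. -/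
def InnerAntisymmetric (D : Twist n) (U : ℤ → ℤ → M) (l m : ℤ) : Prop :=
  ∀ l' m', l < l' → l' < m' → l' + m' = l + m → pairDefect D U l' m' = 0

theorem inner_orderingDefect_left (D : Twist n) [NeZero n] (U : ℤ → ℤ → M) {l m i : ℤ} {N : ℕ}
    (hi0 : 0 < i) (hin : i < n) (hm : m = l + i + n * N) (h : InnerAntisymmetric D U l m)
    (k : ℕ) (hk : 1 ≤ k) (hk2 : 2 * k ≤ N) :
    orderingDefect D.q (D.α (l : ZMod n) (m : ZMod n))
      (fun j => U (l + n * (k + j : ℕ)) (m - n * (k + j : ℕ)))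
      (fun j => U (l + i + n * (k + j : ℕ)) (m - i - n * (k + j : ℕ))) (N - 2 * k) = 0 := by
  have hn : (0 : ℤ) < n := by exact_mod_cast Nat.pos_of_ne_zero (NeZero.ne n)
  have hk' : (1 : ℤ) ≤ k := by exact_mod_cast hk
  have h1 : (n : ℤ) * 1 ≤ n * k := by gcongr
  have h2 : (n : ℤ) * (2 * k) ≤ n * N := by gcongr; exact_mod_cast hk2
  have := h (l + n * k) (m - n * k) (by linarith) (by rw [hm]; linarith) (by ring)
  rw [pairDefect_eq_orderingDefect (N := N - 2 * k) D U hi0 hin (by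
    rw [hm]; push_cast [hk2]; ring)] at this
  rw [← this]
  push_cast
  simp only [CharP.cast_eq_zero, zero_mul, add_zero, sub_zero]
  congr 1 <;> funext j <;> congr 1 <;> ring

/-- A pair starting on the second progression has the complementary residue n - i. The two
progressions exchange roles, the first one entering with a shift by one. -/
theorem inner_orderingDefect_right (D : Twist n) [NeZero n] (U : ℤ → ℤ → M) {l m i : ℤ} {N : ℕ}
    (hi0 : 0 < i) (hin : i < n) (hm : m = l + i + n * N) (h : InnerAntisymmetric D U l m)
    (k : ℕ) (hk : 2 * k + 1 ≤ N) :
    orderingDefect D.q (D.α (m : ZMod n) (l : ZMod n))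
      (fun j => U (l + i + n * (k + j : ℕ)) (m - i - n * (k + j : ℕ)))
      (fun j => U (l + n * (k + 1 + j : ℕ)) (m - n * (k + 1 + j : ℕ))) (N - 1 - 2 * k) = 0 := by
  have hn : (0 : ℤ) < n := by exact_mod_cast Nat.pos_of_ne_zero (NeZero.ne n)
  have h1 : (0 : ℤ) ≤ n * k := by positivity
  have h2 : (n : ℤ) * (2 * k + 1) ≤ n * N := by gcongr; exact_mod_cast hk
  have := h (l + i + n * k) (m - i - n * k) (by linarith) (by rw [hm]; linarith) (by ring)
  rw [pairDefect_eq_orderingDefect (N := N - 1 - 2 * k) (i := n - i) D U (by linarith)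
    (by linarith) (by
      rw [hm, Nat.sub_sub]; push_cast [show 1 + 2 * k ≤ N by omega]; ring)] at this
  rw [← this]
  have e1 : ((l + i + n * k : ℤ) : ZMod n) = m := by rw [hm]; push_cast; simp
  have e2 : ((m - i - n * k : ℤ) : ZMod n) = l := by rw [hm]; push_cast; simp
  rw [e1, e2]
  push_cast
  congr 1 <;> funext j <;> congr 1 <;> ring

/-- Modulo the relations for inner pairs, the alternating terms with powers of q collapse to a sum
with one constant coefficient. This is the form in which generating series can be formed. -/
theorem pairDefect_eq_sum_left (D : Twist n) [NeZero n] (U : ℤ → ℤ → M) {l m i : ℤ} {N : ℕ}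
    (hi0 : 0 < i) (hin : i < n) (hm : m = l + i + n * N) (h : InnerAntisymmetric D U l m) :
    pairDefect D U l m = U l m + (D.q * D.α (l : ZMod n) (m : ZMod n)) • U m l -
      (D.q ^ 2 - 1) • ∑ j ∈ range N, U (l + n * (j + 1 : ℕ)) (m - n * (j + 1 : ℕ)) := by
  rw [pairDefect_eq_orderingDefect D U hi0 hin hm, orderingDefect_eq_sum_left _ _ _ _ _
    (fun k hk hk2 => inner_orderingDefect_left D U hi0 hin hm h k hk hk2)]
  have e1 : U (l + i + n * N) (m - i - n * N) = U m l := by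
    congr 1
    · exact hm.symm
    · rw [hm]; ring
  simp [e1]

theorem pairDefect_eq_sum_right (D : Twist n) [NeZero n] (U : ℤ → ℤ → M) {l m i : ℤ} {N : ℕ}
    (hi0 : 0 < i) (hin : i < n) (hm : m = l + i + n * N) (h : InnerAntisymmetric D U l m) :
    pairDefect D U l m = U l m + (D.q * D.α (l : ZMod n) (m : ZMod n)) • U m l +
      (D.q * D.α (l : ZMod n) (m : ZMod n) * (1 - (D.q ^ 2)⁻¹)) •
        ∑ j ∈ range N, U (l + i + n * j) (m - i - n * j) := by
  rw [pairDefect_eq_orderingDefect D U hi0 hin hm, orderingDefect_eq_sum_right _ _ _ D.q_ne_zero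
    (D.α_mul _ _) _ _ _
    (fun k hk hk2 => inner_orderingDefect_left D U hi0 hin hm h k hk hk2)
    (fun k hk => inner_orderingDefect_right D U hi0 hin hm h k hk)]
  have e1 : U (l + i + n * N) (m - i - n * N) = U m l := by
    congr 1
    · exact hm.symm
    · rw [hm]; ring
  simp [e1]

end Pairs

end ChargedModel

end

/-! ### Exchange operators of Demazure-Lusztig type on Laurent polynomials. -/

noncomputable section

namespace ChargedModel

open Finset

section Exchange

/-- Exchange of the exponents of two adjacent factors of distinct charges; a Demazure-Lusztig
operator on Laurent monomials. -/
def exchangePair (τ : ℂ) (e p r : ℤ) : ℤ × ℤ →₀ ℂ :=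
  if p - e ≤ r then
    Finsupp.single (r, p) 1 +
      (1 - τ) • ∑ j ∈ range (r - (p - e)).toNat, Finsupp.single (p - e + j, r + e - j) 1
  else
    τ • Finsupp.single (r, p) 1 +
      (τ - 1) • ∑ j ∈ range (p - e - r - 1).toNat, Finsupp.single (r + 1 + j, p - 1 - j) 1

/-- Multiplication by X - Y telescopes the sum in either branch, and both branches give the same
result. The operator defined by cases is thus one rational expression. -/
theorem pairEval_exchangePair_sub {M : Type*} [AddCommGroup M] [Module ℂ M] (τ : ℂ) (e p r : ℤ)
    (G : ℤ → ℤ → M) :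
    pairEval (fun s t => G (s + 1) t - G s (t + 1)) (exchangePair τ e p r) =
      (τ - 1) • G (p - e) (r + e + 1) + G (r + 1) p - τ • G r (p + 1) := by
  unfold exchangePair
  split_ifs with h
  · have key : ∑ j ∈ range (r - (p - e)).toNat,
        (G (p - e + j + 1) (r + e - j) - G (p - e + j) (r + e - j + 1)) =
        G r (p + 1) - G (p - e) (r + e + 1) := by
      have := Finset.sum_range_sub (fun j : ℕ => G (p - e + j) (r + e + 1 - j))
        (r - (p - e)).toNat
      have h2 : (((r - (p - e)).toNat : ℕ) : ℤ) = r - (p - e) := Int.toNat_of_nonneg (by linarith)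
      rw [h2] at this
      simp only [Nat.cast_add, Nat.cast_one, CharP.cast_eq_zero, add_zero, sub_zero] at this
      rw [show p - e + (r - (p - e)) = r by ring, show r + e + 1 - (r - (p - e)) = p + 1 by ring]
        at this
      rw [← this]
      refine sum_congr rfl fun j _ => ?_
      congr 2 <;> ring
    simp only [map_add, map_smul, map_sum, pairEval_single, one_smul, key]
    module
  · have key : ∑ j ∈ range (p - e - r - 1).toNat,
        (G (r + 1 + j + 1) (p - 1 - j) - G (r + 1 + j) (p - 1 - j + 1)) =
        G (p - e) (r + e + 1) - G (r + 1) p := by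
      have := Finset.sum_range_sub (fun j : ℕ => G (r + 1 + j) (p - j))
        (p - e - r - 1).toNat
      have h2 : (((p - e - r - 1).toNat : ℕ) : ℤ) = p - e - r - 1 :=
        Int.toNat_of_nonneg (by linarith)
      rw [h2] at this
      simp only [Nat.cast_add, Nat.cast_one, CharP.cast_eq_zero, add_zero, sub_zero] at this
      rw [show r + 1 + (p - e - r - 1) = p - e by ring,
        show p - (p - e - r - 1) = r + e + 1 by ring]
        at this
      rw [← this]
      refine sum_congr rfl fun j _ => ?_
      congr 2 <;> ring
    simp only [map_add, map_smul, map_sum, pairEval_single, one_smul, key]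
    module

/-- Finitely supported functions on triples of exponents, that is, Laurent polynomials. -/
abbrev Laurent : Type := ℤ × ℤ × ℤ →₀ ℂ

/-- Exchange of the first two exponents. -/
def exchangeLeft (τ : ℂ) (e : ℤ) : Laurent →ₗ[ℂ] Laurent :=
  Finsupp.linearCombination ℂ fun x : ℤ × ℤ × ℤ =>
    pairEval (fun s t => Finsupp.single (s, t, x.2.2) 1) (exchangePair τ e x.1 x.2.1)

/-- Exchange of the last two exponents. -/
def exchangeRight (τ : ℂ) (e : ℤ) : Laurent →ₗ[ℂ] Laurent :=
  Finsupp.linearCombination ℂ fun x : ℤ × ℤ × ℤ =>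
    pairEval (fun s t => Finsupp.single (x.1, s, t) 1) (exchangePair τ e x.2.1 x.2.2)

theorem exchangeLeft_single (τ : ℂ) (e x y z : ℤ) :
    exchangeLeft τ e (Finsupp.single (x, y, z) 1) =
      pairEval (fun s t => Finsupp.single (s, t, z) 1) (exchangePair τ e x y) := by
  simp [exchangeLeft]

theorem exchangeRight_single (τ : ℂ) (e x y z : ℤ) :
    exchangeRight τ e (Finsupp.single (x, y, z) 1) =
      pairEval (fun s t => Finsupp.single (x, s, t) 1) (exchangePair τ e y z) := by
  simp [exchangeRight]

/-- The transposition of the first two exponents. -/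
def swapLeftEquiv : ℤ × ℤ × ℤ ≃+ ℤ × ℤ × ℤ where
  toFun x := (x.2.1, x.1, x.2.2)
  invFun x := (x.2.1, x.1, x.2.2)
  left_inv _ := rfl
  right_inv _ := rfl
  map_add' _ _ := rfl

/-- The transposition of the last two exponents. -/
def swapRightEquiv : ℤ × ℤ × ℤ ≃+ ℤ × ℤ × ℤ where
  toFun x := (x.1, x.2.2, x.2.1)
  invFun x := (x.1, x.2.2, x.2.1)
  left_inv _ := rfl
  right_inv _ := rfl
  map_add' _ _ := rfl

/-- The ring of Laurent polynomials in three variables. -/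
abbrev LaurentRing : Type := AddMonoidAlgebra ℂ (ℤ × ℤ × ℤ)

/-- A finitely supported function as an element of the ring. -/
def toRing : Laurent →ₗ[ℂ] LaurentRing where
  toFun f := AddMonoidAlgebra.ofCoeff f
  map_add' _ _ := rfl
  map_smul' _ _ := rfl

theorem toRing_injective : Function.Injective toRing := fun f g h => by
  have := congrArg AddMonoidAlgebra.coeff h
  exact this

def swapLeft : LaurentRing ≃ₐ[ℂ] LaurentRing := AddMonoidAlgebra.domCongr ℂ ℂ swapLeftEquiv
def swapRight : LaurentRing ≃ₐ[ℂ] LaurentRing := AddMonoidAlgebra.domCongr ℂ ℂ swapRightEquiv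

theorem swapLeft_single (x y z : ℤ) (c : ℂ) :
    swapLeft (AddMonoidAlgebra.single (x, y, z) c) = AddMonoidAlgebra.single (y, x, z) c := by
  simp [swapLeft, swapLeftEquiv]

theorem swapRight_single (x y z : ℤ) (c : ℂ) :
    swapRight (AddMonoidAlgebra.single (x, y, z) c) = AddMonoidAlgebra.single (x, z, y) c := by
  simp [swapRight, swapRightEquiv]

/-- The monomial with the given exponents. -/
def monomial (a b c : ℤ) : LaurentRing := AddMonoidAlgebra.single (a, b, c) 1

theorem monomial_mul_monomial (a b c a' b' c' : ℤ) :
    monomial a b c * monomial a' b' c' = monomial (a + a') (b + b') (c + c') := by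
  simp [monomial, AddMonoidAlgebra.single_mul_single]

theorem swapLeft_monomial (a b c : ℤ) : swapLeft (monomial a b c) = monomial b a c :=
  swapLeft_single a b c 1

theorem swapRight_monomial (a b c : ℤ) : swapRight (monomial a b c) = monomial a c b :=
  swapRight_single a b c 1

theorem toRing_single_one (a b c : ℤ) : toRing (Finsupp.single (a, b, c) 1) = monomial a b c := rfl

theorem monomial_injective {a b c a' b' c' : ℤ} (h : monomial a b c = monomial a' b' c') :
    (a, b, c) = (a', b', c') := by
  unfold monomial at h
  exact (Finsupp.single_left_injective one_ne_zero) (congrArg AddMonoidAlgebra.coeff h)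

theorem swapLeft_swapLeft (f : LaurentRing) : swapLeft (swapLeft f) = f := by
  induction f using AddMonoidAlgebra.induction_linear with
  | zero => simp
  | add f g hf hg => simp [hf, hg]
  | single x c => obtain ⟨x, y, z⟩ := x; rw [swapLeft_single, swapLeft_single]

theorem swapRight_swapRight (f : LaurentRing) : swapRight (swapRight f) = f := by
  induction f using AddMonoidAlgebra.induction_linear with
  | zero => simp
  | add f g hf hg => simp [hf, hg]
  | single x c => obtain ⟨x, y, z⟩ := x; rw [swapRight_single, swapRight_single]

theorem swap_braid (f : LaurentRing) :
    swapRight (swapLeft (swapRight f)) = swapLeft (swapRight (swapLeft f)) := by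
  induction f using AddMonoidAlgebra.induction_linear with
  | zero => simp
  | add f g hf hg => simp [hf, hg]
  | single x c =>
    obtain ⟨x, y, z⟩ := x
    rw [swapRight_single, swapLeft_single, swapRight_single, swapLeft_single, swapRight_single,
      swapLeft_single]

theorem laurent_ext {M : Type*} [AddCommGroup M] [Module ℂ M] {L L' : Laurent →ₗ[ℂ] M}
    (h : ∀ x y z, L (Finsupp.single (x, y, z) 1) = L' (Finsupp.single (x, y, z) 1)) : L = L' := by
  refine Finsupp.lhom_ext' fun x => LinearMap.ext_ring ?_
  obtain ⟨x, y, z⟩ := x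
  exact h x y z

/-- In closed form the operator is f ↦ ((τ - 1) X^{-e} Y^{e+1} f + (X - τY) s(f)) / (X - Y), s being
the transposition. Identities between exchange operators follow by cancelling such denominators in
the domain of Laurent polynomials. -/
theorem sub_mul_exchangeLeft (τ : ℂ) (e : ℤ) (f : Laurent) :
    (monomial 1 0 0 - monomial 0 1 0) * toRing (exchangeLeft τ e f) =
      (algebraMap ℂ LaurentRing τ - 1) * (monomial (-e) (e + 1) 0 * toRing f) +
        (monomial 1 0 0 - algebraMap ℂ LaurentRing τ * monomial 0 1 0) * swapLeft (toRing f) := by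
  have : (LinearMap.mulLeft ℂ (monomial 1 0 0 - monomial 0 1 0)) ∘ₗ toRing ∘ₗ exchangeLeft τ e =
      (LinearMap.mulLeft ℂ ((algebraMap ℂ LaurentRing τ - 1) * monomial (-e) (e + 1) 0)) ∘ₗ toRing +
        (LinearMap.mulLeft ℂ (monomial 1 0 0 - algebraMap ℂ LaurentRing τ * monomial 0 1 0)) ∘ₗ
          swapLeft.toLinearMap ∘ₗ toRing := by
    refine laurent_ext fun x y z => ?_
    have h := pairEval_exchangePair_sub τ e x y (fun s t => monomial s t z)
    simp only [LinearMap.comp_apply, LinearMap.mulLeft_apply, LinearMap.add_apply,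
      exchangeLeft_single, toRing_single_one, AlgEquiv.toLinearMap_apply, swapLeft_monomial,
      map_pairEval toRing]
    have h2 := map_pairEval (LinearMap.mulLeft ℂ (monomial 1 0 0 - monomial 0 1 0))
      (fun s t => monomial s t z) (exchangePair τ e x y)
    rw [LinearMap.mulLeft_apply] at h2
    rw [h2]
    simp only [LinearMap.mulLeft_apply, sub_mul, monomial_mul_monomial, mul_assoc]
    simp only [zero_add, add_comm (1 : ℤ)]
    rw [h, Algebra.smul_def, Algebra.smul_def, map_sub, map_one, show -e + x = x - e by ring,
      show e + 1 + y = y + e + 1 by ring]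
    ring
  have := congrArg (fun L => L f) this
  simpa [mul_assoc] using this

theorem sub_mul_exchangeRight (τ : ℂ) (e : ℤ) (f : Laurent) :
    (monomial 0 1 0 - monomial 0 0 1) * toRing (exchangeRight τ e f) =
      (algebraMap ℂ LaurentRing τ - 1) * (monomial 0 (-e) (e + 1) * toRing f) +
        (monomial 0 1 0 - algebraMap ℂ LaurentRing τ * monomial 0 0 1) * swapRight (toRing f) := by
  have : (LinearMap.mulLeft ℂ (monomial 0 1 0 - monomial 0 0 1)) ∘ₗ toRing ∘ₗ exchangeRight τ e =
      (LinearMap.mulLeft ℂ ((algebraMap ℂ LaurentRing τ - 1) * monomial 0 (-e) (e + 1))) ∘ₗ toRing +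
        (LinearMap.mulLeft ℂ (monomial 0 1 0 - algebraMap ℂ LaurentRing τ * monomial 0 0 1)) ∘ₗ
          swapRight.toLinearMap ∘ₗ toRing := by
    refine laurent_ext fun x y z => ?_
    have h := pairEval_exchangePair_sub τ e y z (fun s t => monomial x s t)
    simp only [LinearMap.comp_apply, LinearMap.mulLeft_apply, LinearMap.add_apply,
      exchangeRight_single, toRing_single_one, AlgEquiv.toLinearMap_apply, swapRight_monomial,
      map_pairEval toRing]
    have h2 := map_pairEval (LinearMap.mulLeft ℂ (monomial 0 1 0 - monomial 0 0 1))
      (fun s t => monomial x s t) (exchangePair τ e y z)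
    rw [LinearMap.mulLeft_apply] at h2
    rw [h2]
    simp only [LinearMap.mulLeft_apply, sub_mul, monomial_mul_monomial, mul_assoc]
    simp only [zero_add, add_comm (1 : ℤ)]
    rw [h, Algebra.smul_def, Algebra.smul_def, map_sub, map_one, show -e + y = y - e by ring,
      show e + 1 + z = z + e + 1 by ring]
    ring
  have := congrArg (fun L => L f) this
  simpa [mul_assoc] using this

/-- The rational function identity behind the braid relation of the exchange operators. -/
theorem exchange_braid_identity {R : Type*} [CommRing R] [IsDomain R] {X Y Z τ c ζ c' ζ' d η : R}
    (hXY : X - Y ≠ 0) (hXZ : X - Z ≠ 0) (hYZ : Y - Z ≠ 0) (hc : c ≠ 0) (hc' : c' ≠ 0) (hd : d ≠ 0)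
    {f f1 f2 f12 f21 f121 g g2 g1 g12 h h1 k g' g1' g2' g21' h' h2' k' : R}
    (E1 : (X - Y) * g = (τ - 1) * (Y * f) + (X - τ * Y) * f1)
    (E1s2 : (X - Z) * g2 = (τ - 1) * (Z * f2) + (X - τ * Z) * f21)
    (E1s1 : (Y - X) * g1 = (τ - 1) * (X * f1) + (Y - τ * X) * f)
    (E1s12 : (Y - Z) * g12 = (τ - 1) * (Z * f12) + (Y - τ * Z) * f121)
    (E2 : c * ((Y - Z) * h) = (τ - 1) * (ζ * g) + c * ((Y - τ * Z) * g2))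
    (E2s1 : c' * ((X - Z) * h1) = (τ - 1) * (ζ' * g1) + c' * ((X - τ * Z) * g12))
    (E3 : (X - Y) * k = (τ - 1) * (Y * h) + (X - τ * Y) * h1)
    (F1 : (Y - Z) * g' = (τ - 1) * (Z * f) + (Y - τ * Z) * f2)
    (F1s1 : (X - Z) * g1' = (τ - 1) * (Z * f1) + (X - τ * Z) * f12)
    (F1s2 : (Z - Y) * g2' = (τ - 1) * (Y * f2) + (Z - τ * Y) * f)
    (F1s21 : (X - Y) * g21' = (τ - 1) * (Y * f21) + (X - τ * Y) * f121)
    (F2 : d * ((X - Y) * h') = (τ - 1) * (η * g') + d * ((X - τ * Y) * g1'))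
    (F2s2 : c' * ((X - Z) * h2') = (τ - 1) * (ζ' * g2') + c' * ((X - τ * Z) * g21'))
    (F3 : (Y - Z) * k' = (τ - 1) * (Z * h') + (Y - τ * Z) * h2')
    (cases : (c = 1 ∧ ζ = Z ∧ c' = 1 ∧ ζ' = Z ∧ d = 1 ∧ η = Y) ∨
      (c = Y ∧ ζ = Z ^ 2 ∧ c' = X ∧ ζ' = Z ^ 2 ∧ d = X ∧ η = Y ^ 2)) : k = k' := by
  -- The factors `c`, `c'`, `d` clear the negative exponent present when e = 1. After that `k` and
  -- `k'` are combinations of the six images of `f` under permutations of the variables, and these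
  -- combinations are compared.
  have key : (c * c' * d * ((X - Y) ^ 2 * (Y - Z) ^ 2 * (X - Z))) * (k - k') = 0 := by
    have e1 : (c * c' * ((X - Y) ^ 2 * (Y - Z) * (X - Z))) * k =
        (τ - 1) * Y * c' * (X - Z) * (τ - 1) * ζ * ((τ - 1) * (Y * f) + (X - τ * Y) * f1) +
        (τ - 1) * Y * c * c' * (X - Y) * (Y - τ * Z) * ((τ - 1) * (Z * f2) + (X - τ * Z) * f21) -
        (X - τ * Y) * c * (Y - Z) * (τ - 1) * ζ' * ((τ - 1) * (X * f1) + (Y - τ * X) * f) +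
        (X - τ * Y) * c * c' * (X - Y) * (X - τ * Z) *
          ((τ - 1) * (Z * f12) + (Y - τ * Z) * f121) := by
      linear_combination (c * c' * ((X - Y) * (Y - Z) * (X - Z))) * E3 +
        (τ - 1) * Y * c' * (X - Y) * (X - Z) * E2 +
        (τ - 1) * Y * c' * (X - Z) * (τ - 1) * ζ * E1 +
        (τ - 1) * Y * c * c' * (X - Y) * (Y - τ * Z) * E1s2 +
        (X - τ * Y) * c * (X - Y) * (Y - Z) * E2s1 -
        (X - τ * Y) * c * (Y - Z) * (τ - 1) * ζ' * E1s1 +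
        (X - τ * Y) * c * c' * (X - Y) * (X - τ * Z) * E1s12
    have e2 : (d * c' * ((Y - Z) ^ 2 * (X - Y) * (X - Z))) * k' =
        (τ - 1) * Z * c' * (X - Z) * (τ - 1) * η * ((τ - 1) * (Z * f) + (Y - τ * Z) * f2) +
        (τ - 1) * Z * d * c' * (Y - Z) * (X - τ * Y) * ((τ - 1) * (Z * f1) + (X - τ * Z) * f12) -
        (Y - τ * Z) * d * (X - Y) * (τ - 1) * ζ' * ((τ - 1) * (Y * f2) + (Z - τ * Y) * f) +
        (Y - τ * Z) * d * c' * (Y - Z) * (X - τ * Z) *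
          ((τ - 1) * (Y * f21) + (X - τ * Y) * f121) := by
      linear_combination (d * c' * ((Y - Z) * (X - Y) * (X - Z))) * F3 +
        (τ - 1) * Z * c' * (Y - Z) * (X - Z) * F2 +
        (τ - 1) * Z * c' * (X - Z) * (τ - 1) * η * F1 +
        (τ - 1) * Z * d * c' * (Y - Z) * (X - τ * Y) * F1s1 +
        (Y - τ * Z) * d * (X - Y) * (Y - Z) * F2s2 -
        (Y - τ * Z) * d * (X - Y) * (τ - 1) * ζ' * F1s2 +
        (Y - τ * Z) * d * c' * (Y - Z) * (X - τ * Z) * F1s21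
    rcases cases with ⟨h1, h2, h3, h4, h5, h6⟩ | ⟨h1, h2, h3, h4, h5, h6⟩
    · rw [h1, h2, h3, h4] at e1
      rw [h3, h4, h5, h6] at e2
      rw [h1, h3, h5]
      linear_combination (Y - Z) * e1 - (X - Y) * e2
    · rw [h1, h2, h3, h4] at e1
      rw [h3, h4, h5, h6] at e2
      rw [h1, h3, h5]
      linear_combination (X * (Y - Z)) * e1 - (Y * (X - Y)) * e2
  have h0 : c * c' * d * ((X - Y) ^ 2 * (Y - Z) ^ 2 * (X - Z)) ≠ 0 :=
    mul_ne_zero (mul_ne_zero (mul_ne_zero hc hc') hd)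
      (mul_ne_zero (mul_ne_zero (pow_ne_zero 2 hXY) (pow_ne_zero 2 hYZ)) hXZ)
  exact sub_eq_zero.mp ((mul_eq_zero.mp key).resolve_left h0)

end Exchange

end ChargedModel

end

noncomputable section

namespace ChargedModel

open Finset

section ExchangeIdentities

theorem monomial_sub_ne_zero {a b c a' b' c' : ℤ} (h : (a, b, c) ≠ (a', b', c')) :
    monomial a b c - monomial a' b' c' ≠ 0 :=
  fun h' => h (monomial_injective (sub_eq_zero.mp h'))

theorem monomial_ne_zero (a b c : ℤ) : monomial a b c ≠ 0 := by
  unfold monomial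
  intro h
  have := congrArg AddMonoidAlgebra.coeff h
  exact one_ne_zero ((Finsupp.single_eq_zero).mp this)

theorem swapLeft_algebraMap (τ : ℂ) :
    swapLeft (algebraMap ℂ LaurentRing τ) = algebraMap ℂ LaurentRing τ := swapLeft.commutes τ

theorem swapRight_algebraMap (τ : ℂ) :
    swapRight (algebraMap ℂ LaurentRing τ) = algebraMap ℂ LaurentRing τ := swapRight.commutes τ

theorem swapLeft_exchangeLeft (τ : ℂ) (e : ℤ) (f : Laurent) :
    (monomial 0 1 0 - monomial 1 0 0) * swapLeft (toRing (exchangeLeft τ e f)) =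
      (algebraMap ℂ LaurentRing τ - 1) * (monomial (e + 1) (-e) 0 * swapLeft (toRing f)) +
        (monomial 0 1 0 - algebraMap ℂ LaurentRing τ * monomial 1 0 0) * toRing f := by
  have := congrArg swapLeft (sub_mul_exchangeLeft τ e f)
  simpa only [map_mul, map_sub, map_add, map_one, swapLeft_monomial, swapLeft_algebraMap,
    swapLeft_swapLeft] using this

theorem swapRight_exchangeLeft (τ : ℂ) (e : ℤ) (f : Laurent) :
    (monomial 1 0 0 - monomial 0 0 1) * swapRight (toRing (exchangeLeft τ e f)) =
      (algebraMap ℂ LaurentRing τ - 1) * (monomial (-e) 0 (e + 1) * swapRight (toRing f)) +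
        (monomial 1 0 0 - algebraMap ℂ LaurentRing τ * monomial 0 0 1) *
          swapRight (swapLeft (toRing f)) := by
  have := congrArg swapRight (sub_mul_exchangeLeft τ e f)
  simpa only [map_mul, map_sub, map_add, map_one, swapRight_monomial, swapRight_algebraMap]
    using this

theorem swapLeft_swapRight_exchangeLeft (τ : ℂ) (e : ℤ) (f : Laurent) :
    (monomial 0 1 0 - monomial 0 0 1) * swapLeft (swapRight (toRing (exchangeLeft τ e f))) =
      (algebraMap ℂ LaurentRing τ - 1) *
        (monomial 0 (-e) (e + 1) * swapLeft (swapRight (toRing f))) +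
        (monomial 0 1 0 - algebraMap ℂ LaurentRing τ * monomial 0 0 1) *
          swapLeft (swapRight (swapLeft (toRing f))) := by
  have := congrArg swapLeft (swapRight_exchangeLeft τ e f)
  simpa only [map_mul, map_sub, map_add, map_one, swapLeft_monomial, swapLeft_algebraMap]
    using this

theorem swapRight_exchangeRight (τ : ℂ) (e : ℤ) (f : Laurent) :
    (monomial 0 0 1 - monomial 0 1 0) * swapRight (toRing (exchangeRight τ e f)) =
      (algebraMap ℂ LaurentRing τ - 1) * (monomial 0 (e + 1) (-e) * swapRight (toRing f)) +
        (monomial 0 0 1 - algebraMap ℂ LaurentRing τ * monomial 0 1 0) * toRing f := by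
  have := congrArg swapRight (sub_mul_exchangeRight τ e f)
  simpa only [map_mul, map_sub, map_add, map_one, swapRight_monomial, swapRight_algebraMap,
    swapRight_swapRight] using this

theorem swapLeft_exchangeRight (τ : ℂ) (e : ℤ) (f : Laurent) :
    (monomial 1 0 0 - monomial 0 0 1) * swapLeft (toRing (exchangeRight τ e f)) =
      (algebraMap ℂ LaurentRing τ - 1) * (monomial (-e) 0 (e + 1) * swapLeft (toRing f)) +
        (monomial 1 0 0 - algebraMap ℂ LaurentRing τ * monomial 0 0 1) *
          swapLeft (swapRight (toRing f)) := by
  have := congrArg swapLeft (sub_mul_exchangeRight τ e f)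
  simpa only [map_mul, map_sub, map_add, map_one, swapLeft_monomial, swapLeft_algebraMap]
    using this

theorem swapRight_swapLeft_exchangeRight (τ : ℂ) (e : ℤ) (f : Laurent) :
    (monomial 1 0 0 - monomial 0 1 0) * swapRight (swapLeft (toRing (exchangeRight τ e f))) =
      (algebraMap ℂ LaurentRing τ - 1) *
        (monomial (-e) (e + 1) 0 * swapRight (swapLeft (toRing f))) +
        (monomial 1 0 0 - algebraMap ℂ LaurentRing τ * monomial 0 1 0) *
          swapRight (swapLeft (swapRight (toRing f))) := by
  have := congrArg swapRight (swapLeft_exchangeRight τ e f)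
  simpa only [map_mul, map_sub, map_add, map_one, swapRight_monomial, swapRight_algebraMap]
    using this

/-- The braid relation. -/
theorem exchange_braid (τ : ℂ) {e : ℤ} (he : e = 0 ∨ e = 1) (f : Laurent) :
    exchangeLeft τ 0 (exchangeRight τ e (exchangeLeft τ 0 f)) =
      exchangeRight τ 0 (exchangeLeft τ e (exchangeRight τ 0 f)) := by
  apply toRing_injective
  have hXY : monomial 1 0 0 - monomial 0 1 0 ≠ 0 := monomial_sub_ne_zero (by decide)
  have hXZ : monomial 1 0 0 - monomial 0 0 1 ≠ 0 := monomial_sub_ne_zero (by decide)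
  have hYZ : monomial 0 1 0 - monomial 0 0 1 ≠ 0 := monomial_sub_ne_zero (by decide)
  -- The closed forms of all operators involved, together with their images under the permutations
  -- that the outer operators introduce.
  have E1 := sub_mul_exchangeLeft τ 0 f
  have E1s2 := swapRight_exchangeLeft τ 0 f
  have E1s1 := swapLeft_exchangeLeft τ 0 f
  have E1s12 := swapLeft_swapRight_exchangeLeft τ 0 f
  have E2 := sub_mul_exchangeRight τ e (exchangeLeft τ 0 f)
  have E2s1 := swapLeft_exchangeRight τ e (exchangeLeft τ 0 f)
  have E3 := sub_mul_exchangeLeft τ 0 (exchangeRight τ e (exchangeLeft τ 0 f))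
  have F1 := sub_mul_exchangeRight τ 0 f
  have F1s1 := swapLeft_exchangeRight τ 0 f
  have F1s2 := swapRight_exchangeRight τ 0 f
  have F1s21 := swapRight_swapLeft_exchangeRight τ 0 f
  have F2 := sub_mul_exchangeLeft τ e (exchangeRight τ 0 f)
  have F2s2 := swapRight_exchangeLeft τ e (exchangeRight τ 0 f)
  have F3 := sub_mul_exchangeRight τ 0 (exchangeLeft τ e (exchangeRight τ 0 f))
  rw [swap_braid] at F1s21
  simp only [neg_zero, zero_add] at E1 E1s2 E1s1 E1s12 E3 F1 F1s1 F1s2 F1s21 F3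
  rcases he with rfl | rfl
  · simp only [neg_zero, zero_add] at E2 E2s1 F2 F2s2
    exact exchange_braid_identity (c := 1) (c' := 1) (d := 1) hXY hXZ hYZ one_ne_zero one_ne_zero
      one_ne_zero E1 E1s2 E1s1 E1s12 (by simpa only [one_mul] using E2)
      (by simpa only [one_mul] using E2s1) E3 F1 F1s1 F1s2 F1s21 (by simpa only [one_mul] using F2)
      (by simpa only [one_mul] using F2s2) F3 (Or.inl ⟨rfl, rfl, rfl, rfl, rfl, rfl⟩)
  · have hX : monomial 1 0 0 * monomial (-1) 0 (1 + 1) = monomial 0 0 1 ^ 2 := by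
      rw [sq, monomial_mul_monomial, monomial_mul_monomial]; rfl
    have hX' : monomial 1 0 0 * monomial (-1) (1 + 1) 0 = monomial 0 1 0 ^ 2 := by
      rw [sq, monomial_mul_monomial, monomial_mul_monomial]; rfl
    have hY : monomial 0 1 0 * monomial 0 (-1) (1 + 1) = monomial 0 0 1 ^ 2 := by
      rw [sq, monomial_mul_monomial, monomial_mul_monomial]; rfl
    refine exchange_braid_identity hXY hXZ hYZ (monomial_ne_zero 0 1 0)
      (monomial_ne_zero 1 0 0) (monomial_ne_zero 1 0 0) E1 E1s2 E1s1 E1s12 ?_ ?_ E3 F1 F1s1 F1s2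
      F1s21 ?_ ?_ F3 (Or.inr ⟨rfl, rfl, rfl, rfl, rfl, rfl⟩)
    · rw [E2, ← hY]; ring
    · rw [E2s1, ← hX]; ring
    · rw [F2, ← hX']; ring
    · rw [F2s2, ← hX]; ring

/-- Meant for two factors of equal charge: moving a third factor to the left of a combination
symmetric in these two leaves it symmetric, and symmetric combinations of factors of equal charge
vanish. -/
theorem exchangeLeft_exchangeRight_symm (τ : ℂ) (f : Laurent)
    (hf : swapLeft (toRing f) = toRing f) :
    swapRight (toRing (exchangeLeft τ 0 (exchangeRight τ 0 f))) =
      toRing (exchangeLeft τ 0 (exchangeRight τ 0 f)) := by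
  have hXY : monomial 1 0 0 - monomial 0 1 0 ≠ 0 := monomial_sub_ne_zero (by decide)
  have hXZ : monomial 1 0 0 - monomial 0 0 1 ≠ 0 := monomial_sub_ne_zero (by decide)
  have hYZ : monomial 0 1 0 - monomial 0 0 1 ≠ 0 := monomial_sub_ne_zero (by decide)
  have F1 := sub_mul_exchangeRight τ 0 f
  have F1s1 := swapLeft_exchangeRight τ 0 f
  have F1s2 := swapRight_exchangeRight τ 0 f
  have F1s21 := swapRight_swapLeft_exchangeRight τ 0 f
  have F2 := sub_mul_exchangeLeft τ 0 (exchangeRight τ 0 f)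
  have F2s2 := swapRight_exchangeLeft τ 0 (exchangeRight τ 0 f)
  rw [swap_braid] at F1s21
  simp only [neg_zero, zero_add, hf] at F1 F1s1 F1s2 F1s21 F2 F2s2
  have h0 : (monomial 1 0 0 - monomial 0 1 0) * (monomial 1 0 0 - monomial 0 0 1) *
      (monomial 0 1 0 - monomial 0 0 1) ≠ 0 := mul_ne_zero (mul_ne_zero hXY hXZ) hYZ
  refine mul_left_cancel₀ h0 ?_
  generalize monomial 1 0 0 = X at *
  generalize monomial 0 1 0 = Y at *
  generalize monomial 0 0 1 = Z at *
  generalize algebraMap ℂ LaurentRing τ = T at *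
  linear_combination (X - Y) * (Y - Z) * F2s2 - (X - Z) * (Y - Z) * F2 -
    (X - Y) * (T - 1) * Z * F1s2 + (Y - Z) * (X - T * Z) * F1s21 -
    (X - Z) * (T - 1) * Y * F1 - (Y - Z) * (X - T * Y) * F1s1

theorem exchangeRight_exchangeLeft_symm (τ : ℂ) (f : Laurent)
    (hf : swapRight (toRing f) = toRing f) :
    swapLeft (toRing (exchangeRight τ 0 (exchangeLeft τ 0 f))) =
      toRing (exchangeRight τ 0 (exchangeLeft τ 0 f)) := by
  have hXY : monomial 1 0 0 - monomial 0 1 0 ≠ 0 := monomial_sub_ne_zero (by decide)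
  have hXZ : monomial 1 0 0 - monomial 0 0 1 ≠ 0 := monomial_sub_ne_zero (by decide)
  have hYZ : monomial 0 1 0 - monomial 0 0 1 ≠ 0 := monomial_sub_ne_zero (by decide)
  have E1 := sub_mul_exchangeLeft τ 0 f
  have E1s2 := swapRight_exchangeLeft τ 0 f
  have E1s1 := swapLeft_exchangeLeft τ 0 f
  have E1s12 := swapLeft_swapRight_exchangeLeft τ 0 f
  have E2 := sub_mul_exchangeRight τ 0 (exchangeLeft τ 0 f)
  have E2s1 := swapLeft_exchangeRight τ 0 (exchangeLeft τ 0 f)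
  rw [← swap_braid] at E1s12
  simp only [neg_zero, zero_add, hf] at E1 E1s2 E1s1 E1s12 E2 E2s1
  have h0 : (monomial 1 0 0 - monomial 0 1 0) * (monomial 1 0 0 - monomial 0 0 1) *
      (monomial 0 1 0 - monomial 0 0 1) ≠ 0 := mul_ne_zero (mul_ne_zero hXY hXZ) hYZ
  refine mul_left_cancel₀ h0 ?_
  generalize monomial 1 0 0 = X at *
  generalize monomial 0 1 0 = Y at *
  generalize monomial 0 0 1 = Z at *
  generalize algebraMap ℂ LaurentRing τ = T at *
  linear_combination (X - Y) * (Y - Z) * E2s1 - (X - Y) * (X - Z) * E2 -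
    (Y - Z) * (T - 1) * Z * E1s1 + (X - Y) * (X - T * Z) * E1s12 -
    (X - Z) * (T - 1) * Z * E1 - (X - Y) * (Y - T * Z) * E1s2

/-- Exchange commutes with multiplication by `X ^ k + Y ^ k`. -/
theorem exchangeLeft_power_sum (τ : ℂ) (k x y z : ℤ) :
    exchangeLeft τ 0 (Finsupp.single (x + k, y, z) 1 + Finsupp.single (x, y + k, z) 1) =
      pairEval (fun s t => Finsupp.single (s + k, t, z) 1 + Finsupp.single (s, t + k, z) 1)
        (exchangePair τ 0 x y) := by
  apply toRing_injective
  have hXY : monomial 1 0 0 - monomial 0 1 0 ≠ 0 := monomial_sub_ne_zero (by decide)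
  refine mul_left_cancel₀ hXY ?_
  have e1 : toRing (pairEval (fun s t => Finsupp.single (s + k, t, z) 1 +
      Finsupp.single (s, t + k, z) 1) (exchangePair τ 0 x y)) =
      (monomial k 0 0 + monomial 0 k 0) *
        toRing (exchangeLeft τ 0 (Finsupp.single (x, y, z) 1)) := by
    rw [exchangeLeft_single, map_pairEval, map_pairEval]
    have h2 := map_pairEval (LinearMap.mulLeft ℂ (monomial k 0 0 + monomial 0 k 0))
      (fun s t => toRing (Finsupp.single (s, t, z) 1)) (exchangePair τ 0 x y)
    rw [LinearMap.mulLeft_apply] at h2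
    rw [h2]
    congr 2
    funext s t
    simp only [map_add, toRing_single_one, LinearMap.mulLeft_apply, add_mul,
      monomial_mul_monomial, zero_add, add_comm k]
  have e2 : toRing (Finsupp.single (x + k, y, z) 1 + Finsupp.single (x, y + k, z) 1) =
      (monomial k 0 0 + monomial 0 k 0) * toRing (Finsupp.single (x, y, z) 1) := by
    simp only [map_add, toRing_single_one, add_mul, monomial_mul_monomial, zero_add, add_comm k]
  rw [e1, sub_mul_exchangeLeft, e2]
  have h := sub_mul_exchangeLeft τ 0 (Finsupp.single (x, y, z) 1)
  simp only [map_mul, map_add, swapLeft_monomial]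
  linear_combination -(monomial k 0 0 + monomial 0 k 0) * h

end ExchangeIdentities

end ChargedModel

end

/-! ### The exchange form of the ordering relations. -/

noncomputable section

namespace ChargedModel

open Finset

section PairCalculus

variable {n : ℕ} {M : Type*} [AddCommGroup M] [Module ℂ M]

/-- The relation of the exchange operator, on exponents relative to base points `b₁`, `b₂`. -/
def exchangeDefect (D : Twist n) (U : ℤ → ℤ → M) (e b₁ b₂ p r : ℤ) : M :=
  U (b₁ + n * p) (b₂ + n * r) + (D.q * D.α (b₁ : ZMod n) (b₂ : ZMod n)) •
    pairEval (fun s t => U (b₂ + n * s) (b₁ + n * t)) (exchangePair (D.q ^ 2)⁻¹ e p r)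

/-- For an increasing pair with valid inner relations, the first branch of the operator with τ = q⁻²
is exactly the form of the relation summed over the second progression. -/
theorem exchangeDefect_of_le (D : Twist n) [NeZero n] (U : ℤ → ℤ → M) {e b₁ b₂ i p r : ℤ}
    (hi0 : 0 < i) (hin : i < n) (hb : b₂ = b₁ + n * e + i) (hpr : p - e ≤ r)
    (h : InnerAntisymmetric D U (b₁ + n * p) (b₂ + n * r)) :
    exchangeDefect D U e b₁ b₂ p r = pairDefect D U (b₁ + n * p) (b₂ + n * r) := by
  have hN : (((r - (p - e)).toNat : ℕ) : ℤ) = r - (p - e) := Int.toNat_of_nonneg (by linarith)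
  rw [pairDefect_eq_sum_right D U hi0 hin (N := (r - (p - e)).toNat)
    (by rw [hN, hb]; ring) h, exchangeDefect, exchangePair, if_pos hpr]
  have e1 : ((b₁ + n * p : ℤ) : ZMod n) = b₁ := by push_cast; simp
  have e2 : ((b₂ + n * r : ℤ) : ZMod n) = b₂ := by push_cast; simp
  rw [e1, e2]
  simp only [map_add, map_smul, map_sum, pairEval_single, one_smul]
  have e3 : ∀ j : ℕ, U (b₂ + n * (p - e + j)) (b₁ + n * (r + e - j)) =
      U (b₁ + n * p + i + n * j) (b₂ + n * r - i - n * j) := by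
    intro j; congr 1
    · rw [hb]; ring
    · rw [hb]; ring
  simp only [e3]
  module

/-- For a decreasing pair, the relation of the reversed pair is taken in its other summed form and
rescaled. Hence one exchange relation covers both orders of the indices, which is what the algebra
of operators needs. -/
theorem exchangeDefect_of_lt (D : Twist n) [NeZero n] (U : ℤ → ℤ → M) {e b₁ b₂ i p r : ℤ}
    (hi0 : 0 < i) (hin : i < n) (hb : b₂ = b₁ + n * e + i) (hpr : r < p - e)
    (h : InnerAntisymmetric D U (b₂ + n * r) (b₁ + n * p)) :
    exchangeDefect D U e b₁ b₂ p r =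
      (D.q * D.α (b₁ : ZMod n) (b₂ : ZMod n) * (D.q ^ 2)⁻¹) •
        pairDefect D U (b₂ + n * r) (b₁ + n * p) := by
  have hN : (((p - e - r - 1).toNat : ℕ) : ℤ) = p - e - r - 1 := Int.toNat_of_nonneg (by linarith)
  rw [pairDefect_eq_sum_left D U (i := n - i) (by linarith) (by linarith)
    (N := (p - e - r - 1).toNat)
    (by rw [hN, hb]; ring) h, exchangeDefect, exchangePair, if_neg (by linarith)]
  have e1 : ((b₁ + n * p : ℤ) : ZMod n) = b₁ := by push_cast; simp
  have e2 : ((b₂ + n * r : ℤ) : ZMod n) = b₂ := by push_cast; simp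
  rw [e1, e2]
  simp only [map_add, map_smul, map_sum, pairEval_single, one_smul]
  have e3 : ∀ j : ℕ, U (b₂ + n * (r + 1 + j)) (b₁ + n * (p - 1 - j)) =
      U (b₂ + n * r + n * (j + 1 : ℕ)) (b₁ + n * p - n * (j + 1 : ℕ)) := by
    intro j; congr 1
    · push_cast; ring
    · push_cast; ring
  simp only [e3]
  have hq := D.q_ne_zero
  have ha := D.α_mul b₁ b₂
  have h1 : D.q * D.α b₁ b₂ * (D.q ^ 2)⁻¹ * (D.q * D.α b₂ b₁) = 1 := by
    rw [show D.q * D.α b₁ b₂ * (D.q ^ 2)⁻¹ * (D.q * D.α b₂ b₁) =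
      (D.α b₁ b₂ * D.α b₂ b₁) * (D.q ^ 2 * (D.q ^ 2)⁻¹) by ring, ha,
      mul_inv_cancel₀ (pow_ne_zero 2 hq), one_mul]
  have h2 : D.q * D.α b₁ b₂ * (D.q ^ 2)⁻¹ * (D.q ^ 2 - 1) =
      -(D.q * D.α b₁ b₂ * ((D.q ^ 2)⁻¹ - 1)) := by
    field_simp
    ring
  simp only [smul_sub, smul_add, smul_smul, h1, h2]
  module

theorem Antisymmetric.inner {D : Twist n} {U : ℤ → ℤ → M} (h : Antisymmetric D U) (l m : ℤ) :
    InnerAntisymmetric D U l m := fun l' m' _ h2 _ => h l' m' h2.le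

theorem Antisymmetric.exchangeDefect_eq_zero [NeZero n] {D : Twist n} {U : ℤ → ℤ → M}
    (h : Antisymmetric D U) {e b₁ b₂ i : ℤ} (hi0 : 0 < i) (hin : i < n)
    (hb : b₂ = b₁ + n * e + i) (p r : ℤ) : exchangeDefect D U e b₁ b₂ p r = 0 := by
  have hn : (0 : ℤ) < n := by exact_mod_cast Nat.pos_of_ne_zero (NeZero.ne n)
  rcases le_or_gt (p - e) r with hpr | hpr
  · rw [exchangeDefect_of_le D U hi0 hin hb hpr (h.inner _ _)]
    refine h _ _ ?_
    rw [hb]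
    have : (n : ℤ) * (p - e) ≤ n * r := by gcongr
    linarith
  · rw [exchangeDefect_of_lt D U hi0 hin hb hpr (h.inner _ _), h, smul_zero]
    rw [hb]
    have : (n : ℤ) * (r + 1) ≤ n * (p - e) := by gcongr; linarith
    linarith

theorem Antisymmetric.swap_of_dvd {D : Twist n} {U : ℤ → ℤ → M} (h : Antisymmetric D U)
    {l m : ℤ} (hd : (n : ℤ) ∣ m - l) : U l m + U m l = 0 := by
  rcases lt_trichotomy l m with hlt | rfl | hlt
  · rw [← pairDefect_of_dvd D U hlt.ne (Int.emod_eq_zero_of_dvd hd)]; exact h _ _ hlt.le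
  · have := h l l le_rfl
    rw [pairDefect_self] at this
    rw [this, add_zero]
  · rw [add_comm, ← pairDefect_of_dvd D U hlt.ne
      (Int.emod_eq_zero_of_dvd (by rw [← neg_sub]; exact hd.neg_right))]
    exact h _ _ hlt.le

theorem emod_pos_of_not_dvd [NeZero n] {x : ℤ} (hd : ¬ (n : ℤ) ∣ x) :
    0 < x % n ∧ x % n < n := by
  have hn : (0 : ℤ) < n := by exact_mod_cast Nat.pos_of_ne_zero (NeZero.ne n)
  refine ⟨lt_of_le_of_ne (Int.emod_nonneg _ hn.ne') fun h => hd (Int.dvd_of_emod_eq_zero h.symm),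
    Int.emod_lt_of_pos _ hn⟩

/-- The relations are compatible with shifting both factors in turn by a multiple of `n`. -/
theorem Antisymmetric.shift [NeZero n] {D : Twist n} {U : ℤ → ℤ → M} (h : Antisymmetric D U)
    (k : ℤ) : Antisymmetric D (fun l m => U (l + n * k) m + U l (m + n * k)) := by
  have hn : (0 : ℤ) < n := by exact_mod_cast Nat.pos_of_ne_zero (NeZero.ne n)
  intro l m hlm
  -- Induction on the distance m - l provides the relations for inner pairs, without which the
  -- defect of the shifted function could not be rewritten as an exchange defect.
  obtain ⟨w, hw⟩ : ∃ w : ℕ, m - l = w := ⟨(m - l).toNat, by omega⟩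
  induction w using Nat.strong_induction_on generalizing l m with
  | _ w ih =>
    by_cases hd : (n : ℤ) ∣ m - l
    · rcases hlm.eq_or_lt with rfl | hlt
      · rw [pairDefect_self, add_comm]
        exact h.swap_of_dvd (by rw [show l + n * k - l = n * k by ring]; exact dvd_mul_right _ _)
      · rw [pairDefect_of_dvd _ _ hlt.ne (Int.emod_eq_zero_of_dvd hd)]
        have h1 := h.swap_of_dvd (l := l + n * k) (m := m) (by
          rw [show m - (l + n * k) = m - l + n * (-k) by ring]; exact hd.add (dvd_mul_right _ _))
        have h2 := h.swap_of_dvd (l := l) (m := m + n * k) (by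
          rw [show m + n * k - l = m - l + n * k by ring]; exact hd.add (dvd_mul_right _ _))
        rw [show U (l + n * k) m + U l (m + n * k) + (U (m + n * k) l + U m (l + n * k)) =
          U (l + n * k) m + U m (l + n * k) + (U l (m + n * k) + U (m + n * k) l) by abel, h1, h2,
          add_zero]
    · have hi := emod_pos_of_not_dvd hd
      set i := (m - l) % n with hidef
      have hr0 : 0 ≤ (m - l) / n := Int.ediv_nonneg (by linarith) hn.le
      have hm : m = l + i + n * ((m - l) / n) := by
        have := Int.emod_add_mul_ediv (m - l) n
        rw [← hidef] at this
        linarith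
      set r := (m - l) / n
      have key := exchangeDefect_of_le D (fun l m => U (l + n * k) m + U l (m + n * k))
        (e := 0) (b₁ := l) (b₂ := l + i) (p := 0) (r := r) hi.1 hi.2 (by ring) (by linarith) (by
          intro l' m' h1 h2 h3
          rw [mul_zero, add_zero] at h1
          refine ih (m' - l').toNat (by omega) l' m' h2.le (by omega))
      rw [mul_zero, add_zero, ← hm] at key
      rw [← key]
      -- The exchange relations of `U` at the exponents (k, r) and (0, r + k) add up to the one
      -- sought, because exchange commutes with multiplication by X^k + Y^k.
      have y1 := h.exchangeDefect_eq_zero (e := 0) (b₁ := l) (b₂ := l + i) hi.1 hi.2 (by ring) k r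
      have y2 := h.exchangeDefect_eq_zero (e := 0) (b₁ := l) (b₂ := l + i) hi.1 hi.2 (by ring)
        0 (r + k)
      have hL := congrArg (Finsupp.linearCombination ℂ
        fun x : ℤ × ℤ × ℤ => U (l + i + n * x.1) (l + n * x.2.1))
        (exchangeLeft_power_sum (D.q ^ 2)⁻¹ k 0 r 0)
      rw [map_add, exchangeLeft_single, exchangeLeft_single, map_add, map_pairEval, map_pairEval,
        map_pairEval] at hL
      simp only [map_add, Finsupp.linearCombination_single, one_smul] at hL
      unfold exchangeDefect at y1 y2 ⊢
      have e1 : pairEval (fun s t => U (l + i + n * s + n * k) (l + n * t) +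
          U (l + i + n * s) (l + n * t + n * k)) (exchangePair (D.q ^ 2)⁻¹ 0 0 r) =
        pairEval (fun s t => U (l + i + n * (s + k)) (l + n * t) +
          U (l + i + n * s) (l + n * (t + k))) (exchangePair (D.q ^ 2)⁻¹ 0 0 r) := by
        congr 2; funext s t; congr 2 <;> ring
      rw [zero_add] at hL
      rw [e1, ← hL, smul_add]
      beta_reduce
      rw [show l + n * 0 + n * k = l + n * k by ring,
        show l + i + n * r + n * k = l + i + n * (r + k) by ring]
      calc _ = _ := by abel
        _ = 0 + 0 := congrArg₂ (· + ·) y1 y2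
        _ = 0 := add_zero 0

end PairCalculus

end ChargedModel

end

/-! ### Three factors: defects and exchange relations within a window. -/

noncomputable section

namespace ChargedModel

open Finset

section Confluence

variable {n : ℕ} {M : Type*} [AddCommGroup M] [Module ℂ M]

/-- The failure of the relation for the first two of three factors. -/
def leftDefect (D : Twist n) (Φ : ℤ → ℤ → ℤ → M) (x y z : ℤ) : M :=
  pairDefect D (fun a b => Φ a b z) x y

/-- The failure of the relation for the last two of three factors. -/
def rightDefect (D : Twist n) (Φ : ℤ → ℤ → ℤ → M) (x y z : ℤ) : M :=
  pairDefect D (fun a b => Φ x a b) y z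

/-- Triples with the same sum as `x, y, z` and all entries between `x` and `z`. -/
def InWindow (x y z a b c : ℤ) : Prop :=
  a + b + c = x + y + z ∧ (x ≤ a ∧ a ≤ z) ∧ (x ≤ b ∧ b ≤ z) ∧ (x ≤ c ∧ c ≤ z)

/-- The relations hold for all triples in the window other than `x, y, z`. -/
def BelowAntisymmetric (D : Twist n) (Φ : ℤ → ℤ → ℤ → M) (x y z : ℤ) : Prop :=
  ∀ a b c, InWindow x y z a b c → (a, b, c) ≠ (x, y, z) →
    (a ≤ b → leftDefect D Φ a b c = 0) ∧ (b ≤ c → rightDefect D Φ a b c = 0)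

/-- The exponents of the triples in the window, relative to base points. -/
def windowSet (n : ℕ) (x y z b₁ b₂ b₃ : ℤ) : Set (ℤ × ℤ × ℤ) :=
  {p | InWindow x y z (b₁ + n * p.1) (b₂ + n * p.2.1) (b₃ + n * p.2.2)}

/-- The linear extension of a function of three indices, relative to base points. -/
def tripleEval (n : ℕ) (Φ : ℤ → ℤ → ℤ → M) (b₁ b₂ b₃ : ℤ) : Laurent →ₗ[ℂ] M :=
  Finsupp.linearCombination ℂ fun p => Φ (b₁ + n * p.1) (b₂ + n * p.2.1) (b₃ + n * p.2.2)

theorem tripleEval_single (Φ : ℤ → ℤ → ℤ → M) (b₁ b₂ b₃ p r s : ℤ) :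
    tripleEval n Φ b₁ b₂ b₃ (Finsupp.single (p, r, s) 1) =
      Φ (b₁ + n * p) (b₂ + n * r) (b₃ + n * s) := by
  simp [tripleEval]

theorem eq_zero_of_supported {L : Laurent →ₗ[ℂ] M} {S : Set (ℤ × ℤ × ℤ)} {f : Laurent}
    (hf : f ∈ Finsupp.supported ℂ ℂ S) (h : ∀ p r s, (p, r, s) ∈ S →
      L (Finsupp.single (p, r, s) 1) = 0) : L f = 0 := by
  rw [Finsupp.supported_eq_span_single] at hf
  refine (Submodule.span_le (p := LinearMap.ker L)).mpr ?_ hf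
  rintro _ ⟨⟨p, r, s⟩, hx, rfl⟩
  exact h p r s hx

theorem map_supported {L : Laurent →ₗ[ℂ] Laurent} {S T : Set (ℤ × ℤ × ℤ)} {f : Laurent}
    (hf : f ∈ Finsupp.supported ℂ ℂ S) (h : ∀ p r s, (p, r, s) ∈ S →
      L (Finsupp.single (p, r, s) 1) ∈ Finsupp.supported ℂ ℂ T) :
    L f ∈ Finsupp.supported ℂ ℂ T := by
  rw [Finsupp.supported_eq_span_single] at hf
  refine (Submodule.span_le (p := (Finsupp.supported ℂ ℂ T).comap L)).mpr ?_ hf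
  rintro _ ⟨⟨p, r, s⟩, hx, rfl⟩
  exact h p r s hx

/-- Exchange only produces indices between the two given ones, so common bounds persist and every
computation stays in the window where relations are assumed. -/
theorem exchangePair_mem_supported [NeZero n] (τ : ℂ) {e b₁ b₂ i p r lo hi : ℤ} (hi0 : 0 < i)
    (hin : i < n) (hb : b₂ = b₁ + n * e + i) (h1 : lo ≤ b₁ + n * p) (h2 : b₁ + n * p ≤ hi)
    (h3 : lo ≤ b₂ + n * r) (h4 : b₂ + n * r ≤ hi) :
    exchangePair τ e p r ∈ Finsupp.supported ℂ ℂ {st : ℤ × ℤ | st.1 + st.2 = p + r ∧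
      (lo ≤ b₂ + n * st.1 ∧ b₂ + n * st.1 ≤ hi) ∧ (lo ≤ b₁ + n * st.2 ∧ b₁ + n * st.2 ≤ hi)} := by
  have hn : (0 : ℤ) < n := by exact_mod_cast Nat.pos_of_ne_zero (NeZero.ne n)
  have h0 : Finsupp.single (r, p) (1 : ℂ) ∈ Finsupp.supported ℂ ℂ {st : ℤ × ℤ | st.1 + st.2 = p + r ∧
      (lo ≤ b₂ + n * st.1 ∧ b₂ + n * st.1 ≤ hi) ∧ (lo ≤ b₁ + n * st.2 ∧ b₁ + n * st.2 ≤ hi)} :=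
    Finsupp.single_mem_supported ℂ 1 ⟨add_comm _ _, ⟨h3, h4⟩, h1, h2⟩
  unfold exchangePair
  split_ifs with h
  · refine Submodule.add_mem _ h0 (Submodule.smul_mem _ _ (Submodule.sum_mem _ fun j hj =>
      Finsupp.single_mem_supported ℂ 1 ?_))
    have hj' : (j : ℤ) + 1 ≤ r - (p - e) := by rw [mem_range] at hj; omega
    have hj0 : (0 : ℤ) ≤ n * j := by positivity
    have hj2 : (n : ℤ) * (j + 1) ≤ n * (r - (p - e)) := by gcongr
    refine ⟨by dsimp only; ring, ⟨?_, ?_⟩, ?_, ?_⟩ <;> dsimp only <;> nlinarith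
  · refine Submodule.add_mem _ (Submodule.smul_mem _ _ h0) (Submodule.smul_mem _ _
      (Submodule.sum_mem _ fun j hj => Finsupp.single_mem_supported ℂ 1 ?_))
    have hj' : (j : ℤ) + 1 ≤ p - e - r - 1 := by rw [mem_range] at hj; omega
    have hj0 : (0 : ℤ) ≤ n * j := by positivity
    have hj2 : (n : ℤ) * (j + 1) ≤ n * (p - e - r - 1) := by gcongr
    refine ⟨by dsimp only; ring, ⟨?_, ?_⟩, ?_, ?_⟩ <;> dsimp only <;> nlinarith

theorem exchangeLeft_mem_window [NeZero n] (τ : ℂ) {x y z e b₁ b₂ b₃ i : ℤ} (hi0 : 0 < i)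
    (hin : i < n) (hb : b₂ = b₁ + n * e + i) {f : Laurent}
    (hf : f ∈ Finsupp.supported ℂ ℂ (windowSet n x y z b₁ b₂ b₃)) :
    exchangeLeft τ e f ∈ Finsupp.supported ℂ ℂ (windowSet n x y z b₂ b₁ b₃) := by
  refine map_supported hf fun p r s ⟨hs, h1, h2, h3⟩ => ?_
  rw [exchangeLeft_single]
  refine pairEval_mem _ (exchangePair_mem_supported τ hi0 hin hb h1.1 h1.2 h2.1 h2.2) _ ?_
  rintro ⟨s', t'⟩ ⟨k1, k2, k3⟩
  refine Finsupp.single_mem_supported ℂ 1 ⟨?_, k2, k3, h3⟩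
  dsimp only at *
  have : (n : ℤ) * (s' + t') = n * (p + r) := by rw [k1]
  linarith

theorem exchangeRight_mem_window [NeZero n] (τ : ℂ) {x y z e b₁ b₂ b₃ i : ℤ} (hi0 : 0 < i)
    (hin : i < n) (hb : b₃ = b₂ + n * e + i) {f : Laurent}
    (hf : f ∈ Finsupp.supported ℂ ℂ (windowSet n x y z b₁ b₂ b₃)) :
    exchangeRight τ e f ∈ Finsupp.supported ℂ ℂ (windowSet n x y z b₁ b₃ b₂) := by
  refine map_supported hf fun p r s ⟨hs, h1, h2, h3⟩ => ?_
  rw [exchangeRight_single]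
  refine pairEval_mem _ (exchangePair_mem_supported τ hi0 hin hb h2.1 h2.2 h3.1 h3.2) _ ?_
  rintro ⟨s', t'⟩ ⟨k1, k2, k3⟩
  refine Finsupp.single_mem_supported ℂ 1 ⟨?_, h1, k2, k3⟩
  dsimp only at *
  have : (n : ℤ) * (s' + t') = n * (r + s) := by rw [k1]
  linarith

/-- The exchange relation for the first two factors. -/
def leftExchange (D : Twist n) (Φ : ℤ → ℤ → ℤ → M) (e b₁ b₂ b₃ : ℤ) : Laurent →ₗ[ℂ] M :=
  tripleEval n Φ b₁ b₂ b₃ + (D.q * D.α (b₁ : ZMod n) (b₂ : ZMod n)) •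
    (tripleEval n Φ b₂ b₁ b₃ ∘ₗ exchangeLeft (D.q ^ 2)⁻¹ e)

/-- The exchange relation for the last two factors. -/
def rightExchange (D : Twist n) (Φ : ℤ → ℤ → ℤ → M) (e b₁ b₂ b₃ : ℤ) : Laurent →ₗ[ℂ] M :=
  tripleEval n Φ b₁ b₂ b₃ + (D.q * D.α (b₂ : ZMod n) (b₃ : ZMod n)) •
    (tripleEval n Φ b₁ b₃ b₂ ∘ₗ exchangeRight (D.q ^ 2)⁻¹ e)

theorem leftExchange_single (D : Twist n) (Φ : ℤ → ℤ → ℤ → M) (e b₁ b₂ b₃ p r s : ℤ) :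
    leftExchange D Φ e b₁ b₂ b₃ (Finsupp.single (p, r, s) 1) =
      exchangeDefect D (fun a b => Φ a b (b₃ + n * s)) e b₁ b₂ p r := by
  simp only [leftExchange, LinearMap.add_apply, LinearMap.smul_apply, LinearMap.comp_apply,
    tripleEval_single, exchangeLeft_single, map_pairEval, exchangeDefect]

theorem rightExchange_single (D : Twist n) (Φ : ℤ → ℤ → ℤ → M) (e b₁ b₂ b₃ p r s : ℤ) :
    rightExchange D Φ e b₁ b₂ b₃ (Finsupp.single (p, r, s) 1) =
      exchangeDefect D (fun a b => Φ (b₁ + n * p) a b) e b₂ b₃ r s := by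
  simp only [rightExchange, LinearMap.add_apply, LinearMap.smul_apply, LinearMap.comp_apply,
    tripleEval_single, exchangeRight_single, map_pairEval, exchangeDefect]

variable {D : Twist n} {Φ : ℤ → ℤ → ℤ → M} {x y z : ℤ}

theorem BelowAntisymmetric.inner_left (H : BelowAntisymmetric D Φ x y z) {a b c : ℤ}
    (hw : InWindow x y z a b c) : InnerAntisymmetric D (fun u v => Φ u v c) a b := by
  intro l' m' h1 h2 h3
  obtain ⟨hs, ha, hb, hc⟩ := hw
  refine (H l' m' c ⟨by linarith, ⟨by linarith, by linarith⟩, ⟨by linarith, by linarith⟩, hc⟩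
    ?_).1 h2.le
  intro h
  simp only [Prod.mk.injEq] at h
  linarith [h.1]

theorem BelowAntisymmetric.inner_right (H : BelowAntisymmetric D Φ x y z) {a b c : ℤ}
    (hw : InWindow x y z a b c) : InnerAntisymmetric D (fun u v => Φ a u v) b c := by
  intro l' m' h1 h2 h3
  obtain ⟨hs, ha, hb, hc⟩ := hw
  refine (H a l' m' ⟨by linarith, ha, ⟨by linarith, by linarith⟩, ⟨by linarith, by linarith⟩⟩
    ?_).2 h2.le
  intro h
  simp only [Prod.mk.injEq] at h
  linarith [h.2.2]

theorem InWindow.swap_left {x y z a b c : ℤ} (h : InWindow x y z a b c) : InWindow x y z b a c :=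
  ⟨by linarith [h.1], h.2.2.1, h.2.1, h.2.2.2⟩

theorem InWindow.swap_right {x y z a b c : ℤ} (h : InWindow x y z a b c) : InWindow x y z a c b :=
  ⟨by linarith [h.1], h.2.1, h.2.2.2, h.2.2.1⟩

theorem mul_le_iff_base_le [NeZero n] {e b₁ b₂ i p r : ℤ} (hi0 : 0 < i) (hin : i < n)
    (hb : b₂ = b₁ + n * e + i) : p - e ≤ r ↔ b₁ + n * p < b₂ + n * r := by
  have hn : (0 : ℤ) < n := by exact_mod_cast Nat.pos_of_ne_zero (NeZero.ne n)
  constructor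
  · intro h
    have : (n : ℤ) * (p - e) ≤ n * r := by gcongr
    rw [hb]; linarith
  · intro h
    by_contra h'
    have : (n : ℤ) * (r + 1) ≤ n * (p - e) := by gcongr; linarith
    rw [hb] at h
    linarith

/-- Both orders of the first two factors must differ from the excluded triple, since the exchange
relation of a decreasing pair rests on the relation of the reversed pair. -/
theorem BelowAntisymmetric.leftExchange_single_eq_zero [NeZero n] (H : BelowAntisymmetric D Φ x y z)
    {e b₁ b₂ b₃ i p r s : ℤ} (hi0 : 0 < i) (hin : i < n) (hb : b₂ = b₁ + n * e + i)
    (hw : InWindow x y z (b₁ + n * p) (b₂ + n * r) (b₃ + n * s))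
    (h1 : (b₁ + n * p, b₂ + n * r, b₃ + n * s) ≠ (x, y, z))
    (h2 : (b₂ + n * r, b₁ + n * p, b₃ + n * s) ≠ (x, y, z)) :
    leftExchange D Φ e b₁ b₂ b₃ (Finsupp.single (p, r, s) 1) = 0 := by
  rw [leftExchange_single]
  rcases le_or_gt (p - e) r with h | h
  · rw [exchangeDefect_of_le D _ hi0 hin hb h (H.inner_left hw)]
    exact (H _ _ _ hw h1).1 ((mul_le_iff_base_le hi0 hin hb).mp h).le
  · rw [exchangeDefect_of_lt D _ hi0 hin hb h (H.inner_left hw.swap_left)]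
    have := (H _ _ _ hw.swap_left h2).1
      (le_of_not_gt fun h' => absurd ((mul_le_iff_base_le hi0 hin hb).mpr h') (by linarith))
    unfold leftDefect at this
    rw [this, smul_zero]

theorem BelowAntisymmetric.rightExchange_single_eq_zero [NeZero n]
    (H : BelowAntisymmetric D Φ x y z)
    {e b₁ b₂ b₃ i p r s : ℤ} (hi0 : 0 < i) (hin : i < n) (hb : b₃ = b₂ + n * e + i)
    (hw : InWindow x y z (b₁ + n * p) (b₂ + n * r) (b₃ + n * s))
    (h1 : (b₁ + n * p, b₂ + n * r, b₃ + n * s) ≠ (x, y, z))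
    (h2 : (b₁ + n * p, b₃ + n * s, b₂ + n * r) ≠ (x, y, z)) :
    rightExchange D Φ e b₁ b₂ b₃ (Finsupp.single (p, r, s) 1) = 0 := by
  rw [rightExchange_single]
  rcases le_or_gt (r - e) s with h | h
  · rw [exchangeDefect_of_le D _ hi0 hin hb h (H.inner_right hw)]
    exact (H _ _ _ hw h1).2 ((mul_le_iff_base_le hi0 hin hb).mp h).le
  · rw [exchangeDefect_of_lt D _ hi0 hin hb h (H.inner_right hw.swap_right)]
    have := (H _ _ _ hw.swap_right h2).2
      (le_of_not_gt fun h' => absurd ((mul_le_iff_base_le hi0 hin hb).mpr h') (by linarith))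
    unfold rightDefect at this
    rw [this, smul_zero]

/-- If the third base point does not have the charge of z, the excluded triple is never met. -/
theorem BelowAntisymmetric.leftExchange_eq_zero [NeZero n] (H : BelowAntisymmetric D Φ x y z)
    {e b₁ b₂ b₃ i : ℤ} (hi0 : 0 < i) (hin : i < n) (hb : b₂ = b₁ + n * e + i)
    (hz : ∀ s : ℤ, b₃ + n * s ≠ z) {f : Laurent}
    (hf : f ∈ Finsupp.supported ℂ ℂ (windowSet n x y z b₁ b₂ b₃)) :
    leftExchange D Φ e b₁ b₂ b₃ f = 0 := by
  refine eq_zero_of_supported hf fun p r s hw =>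
    H.leftExchange_single_eq_zero hi0 hin hb hw ?_ ?_ <;>
  · intro h
    simp only [Prod.mk.injEq] at h
    exact hz s h.2.2

theorem BelowAntisymmetric.rightExchange_eq_zero [NeZero n] (H : BelowAntisymmetric D Φ x y z)
    {e b₁ b₂ b₃ i : ℤ} (hi0 : 0 < i) (hin : i < n) (hb : b₃ = b₂ + n * e + i)
    (hx : ∀ s : ℤ, b₁ + n * s ≠ x) {f : Laurent}
    (hf : f ∈ Finsupp.supported ℂ ℂ (windowSet n x y z b₁ b₂ b₃)) :
    rightExchange D Φ e b₁ b₂ b₃ f = 0 := by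
  refine eq_zero_of_supported hf fun p r s hw =>
    H.rightExchange_single_eq_zero hi0 hin hb hw ?_ ?_ <;>
  · intro h
    simp only [Prod.mk.injEq] at h
    exact hx p h.1

/-- A symmetric combination of factors of equal charge in the last two places vanishes. -/
theorem BelowAntisymmetric.tripleEval_right_eq_zero (H : BelowAntisymmetric D Φ x y z)
    {b₁ b₂ : ℤ} {f : Laurent} (hsym : swapRight (toRing f) = toRing f)
    {S : Set (ℤ × ℤ × ℤ)} (hf : f ∈ Finsupp.supported ℂ ℂ S)
    (hS : ∀ p r s, (p, r, s) ∈ S → (p, r, s) ∈ windowSet n x y z b₁ b₂ b₂ ∧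
      (b₁ + n * p, b₂ + n * r, b₂ + n * s) ≠ (x, y, z) ∧
      (b₁ + n * p, b₂ + n * s, b₂ + n * r) ≠ (x, y, z)) :
    tripleEval n Φ b₁ b₂ b₂ f = 0 := by
  have h1 : toRing (Finsupp.lmapDomain ℂ ℂ swapRightEquiv f) = swapRight (toRing f) := by
    have : toRing ∘ₗ Finsupp.lmapDomain ℂ ℂ swapRightEquiv =
        swapRight.toLinearMap ∘ₗ toRing := by
      refine laurent_ext fun x y z => ?_
      simp only [LinearMap.comp_apply, Finsupp.lmapDomain_apply, Finsupp.mapDomain_single,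
        AlgEquiv.toLinearMap_apply, toRing_single_one, swapRight_monomial]
      rfl
    exact congrArg (fun L => L f) this
  have h2 : Finsupp.lmapDomain ℂ ℂ swapRightEquiv f = f := toRing_injective (h1.trans hsym)
  -- Antisymmetry of equal charges kills the value on each monomial plus the value on its transpose;
  -- for a symmetric `f` this sum is twice the value.
  have h3 : (tripleEval n Φ b₁ b₂ b₂ +
      tripleEval n Φ b₁ b₂ b₂ ∘ₗ Finsupp.lmapDomain ℂ ℂ swapRightEquiv) f = 0 := by
    refine eq_zero_of_supported hf fun p r s hp => ?_
    obtain ⟨hw, hne, hne'⟩ := hS p r s hp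
    simp only [LinearMap.add_apply, LinearMap.comp_apply, Finsupp.lmapDomain_apply,
      Finsupp.mapDomain_single]
    rw [show swapRightEquiv (p, r, s) = (p, s, r) from rfl, tripleEval_single, tripleEval_single]
    have hd : ∀ u v : ℤ, (b₂ + n * u - (b₂ + n * v)) % (n : ℤ) = 0 := fun u v => by
      rw [show b₂ + n * u - (b₂ + n * v) = n * (u - v) by ring]
      exact Int.mul_emod_right _ _
    rcases lt_trichotomy (b₂ + n * r) (b₂ + n * s) with h | h | h
    · have := (H _ _ _ hw hne).2 h.le
      rwa [rightDefect, pairDefect_of_dvd _ _ h.ne (hd s r)] at this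
    · have := (H _ _ _ hw hne).2 h.le
      simp only [← h] at this ⊢
      rw [rightDefect, pairDefect_self] at this
      rw [this, add_zero]
    · have := (H _ _ _ hw.swap_right hne').2 h.le
      rw [rightDefect, pairDefect_of_dvd _ _ h.ne (hd r s)] at this
      rw [add_comm]; exact this
  rw [LinearMap.add_apply, LinearMap.comp_apply, h2, ← two_smul ℂ] at h3
  exact (smul_eq_zero.mp h3).resolve_left two_ne_zero

/-- A symmetric combination of factors of equal charge in the first two places vanishes. -/
theorem BelowAntisymmetric.tripleEval_left_eq_zero (H : BelowAntisymmetric D Φ x y z)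
    {b₁ b₃ : ℤ} {f : Laurent} (hsym : swapLeft (toRing f) = toRing f)
    {S : Set (ℤ × ℤ × ℤ)} (hf : f ∈ Finsupp.supported ℂ ℂ S)
    (hS : ∀ p r s, (p, r, s) ∈ S → (p, r, s) ∈ windowSet n x y z b₁ b₁ b₃ ∧
      (b₁ + n * p, b₁ + n * r, b₃ + n * s) ≠ (x, y, z) ∧
      (b₁ + n * r, b₁ + n * p, b₃ + n * s) ≠ (x, y, z)) :
    tripleEval n Φ b₁ b₁ b₃ f = 0 := by
  have h1 : toRing (Finsupp.lmapDomain ℂ ℂ swapLeftEquiv f) = swapLeft (toRing f) := by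
    have : toRing ∘ₗ Finsupp.lmapDomain ℂ ℂ swapLeftEquiv =
        swapLeft.toLinearMap ∘ₗ toRing := by
      refine laurent_ext fun x y z => ?_
      simp only [LinearMap.comp_apply, Finsupp.lmapDomain_apply, Finsupp.mapDomain_single,
        AlgEquiv.toLinearMap_apply, toRing_single_one, swapLeft_monomial]
      rfl
    exact congrArg (fun L => L f) this
  have h2 : Finsupp.lmapDomain ℂ ℂ swapLeftEquiv f = f := toRing_injective (h1.trans hsym)
  have h3 : (tripleEval n Φ b₁ b₁ b₃ +
      tripleEval n Φ b₁ b₁ b₃ ∘ₗ Finsupp.lmapDomain ℂ ℂ swapLeftEquiv) f = 0 := by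
    refine eq_zero_of_supported hf fun p r s hp => ?_
    obtain ⟨hw, hne, hne'⟩ := hS p r s hp
    simp only [LinearMap.add_apply, LinearMap.comp_apply, Finsupp.lmapDomain_apply,
      Finsupp.mapDomain_single]
    rw [show swapLeftEquiv (p, r, s) = (r, p, s) from rfl, tripleEval_single, tripleEval_single]
    have hd : ∀ u v : ℤ, (b₁ + n * u - (b₁ + n * v)) % (n : ℤ) = 0 := fun u v => by
      rw [show b₁ + n * u - (b₁ + n * v) = n * (u - v) by ring]
      exact Int.mul_emod_right _ _
    rcases lt_trichotomy (b₁ + n * p) (b₁ + n * r) with h | h | h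
    · have := (H _ _ _ hw hne).1 h.le
      rwa [leftDefect, pairDefect_of_dvd _ _ h.ne (hd r p)] at this
    · have := (H _ _ _ hw hne).1 h.le
      simp only [← h] at this ⊢
      rw [leftDefect, pairDefect_self] at this
      rw [this, add_zero]
    · have := (H _ _ _ hw.swap_left hne').1 h.le
      rw [leftDefect, pairDefect_of_dvd _ _ h.ne (hd p r)] at this
      rw [add_comm]; exact this
  rw [LinearMap.add_apply, LinearMap.comp_apply, h2, ← two_smul ℂ] at h3
  exact (smul_eq_zero.mp h3).resolve_left two_ne_zero

end Confluence

end ChargedModel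

end

/-! ### Confluence of the two ways of straightening three factors. -/

noncomputable section

namespace ChargedModel

open Finset

section ConfluenceCases

variable {n : ℕ} {M : Type*} [AddCommGroup M] [Module ℂ M]

theorem exists_base [NeZero n] {x y : ℤ} (h : ¬ (n : ℤ) ∣ y - x) :
    ∃ i r : ℤ, 0 < i ∧ i < n ∧ y = x + i + n * r := by
  refine ⟨(y - x) % n, (y - x) / n, (emod_pos_of_not_dvd h).1, (emod_pos_of_not_dvd h).2, ?_⟩
  have := Int.emod_add_mul_ediv (y - x) n
  linarith

theorem not_dvd_of_between {i : ℤ} (hi0 : 0 < i) (hin : i < n) : ¬ (n : ℤ) ∣ i :=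
  fun h => absurd (Int.le_of_dvd hi0 h) (by linarith)

theorem base_ne {b d : ℤ} (h : ¬ (n : ℤ) ∣ d - b) (s : ℤ) : b + n * s ≠ d := by
  intro h'
  exact h ⟨s, by linarith⟩

theorem leftExchange_apply (D : Twist n) (Φ : ℤ → ℤ → ℤ → M) (e b₁ b₂ b₃ : ℤ) (f : Laurent) :
    leftExchange D Φ e b₁ b₂ b₃ f = tripleEval n Φ b₁ b₂ b₃ f +
      (D.q * D.α (b₁ : ZMod n) (b₂ : ZMod n)) •
        tripleEval n Φ b₂ b₁ b₃ (exchangeLeft (D.q ^ 2)⁻¹ e f) := rfl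

theorem rightExchange_apply (D : Twist n) (Φ : ℤ → ℤ → ℤ → M) (e b₁ b₂ b₃ : ℤ) (f : Laurent) :
    rightExchange D Φ e b₁ b₂ b₃ f = tripleEval n Φ b₁ b₂ b₃ f +
      (D.q * D.α (b₂ : ZMod n) (b₃ : ZMod n)) •
        tripleEval n Φ b₁ b₃ b₂ (exchangeRight (D.q ^ 2)⁻¹ e f) := rfl

variable {D : Twist n} {Φ : ℤ → ℤ → ℤ → M} {x y z : ℤ}

theorem inWindow_self (hxy : x ≤ y) (hyz : y ≤ z) : InWindow x y z x y z :=
  ⟨rfl, ⟨le_rfl, hxy.trans hyz⟩, ⟨hxy, hyz⟩, ⟨hxy.trans hyz, le_rfl⟩⟩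

/-- The top triple is the one place where no relation is assumed: there the exchange expression is
the unknown defect instead of zero. -/
theorem BelowAntisymmetric.leftExchange_top [NeZero n] (H : BelowAntisymmetric D Φ x y z)
    (hxy : x ≤ y) (hyz : y ≤ z) {b₁ b₂ b₃ i p r s : ℤ} (hi0 : 0 < i) (hin : i < n)
    (hb : b₂ = b₁ + i) (hx : x = b₁ + n * p) (hy : y = b₂ + n * r) (hz : z = b₃ + n * s) :
    leftExchange D Φ 0 b₁ b₂ b₃ (Finsupp.single (p, r, s) 1) = leftDefect D Φ x y z := by
  have hb' : b₂ = b₁ + n * 0 + i := by rw [hb]; ring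
  have hlt : x < y := lt_of_le_of_ne hxy fun h => by
    have hd : ¬ (n : ℤ) ∣ i := not_dvd_of_between hi0 hin
    exact hd ⟨p - r, by linarith⟩
  have hw := inWindow_self hxy hyz
  rw [leftExchange_single, exchangeDefect_of_le D _ hi0 hin hb'
    ((mul_le_iff_base_le hi0 hin hb').mpr (by rw [← hx, ← hy]; exact hlt)), ← hx, ← hy, ← hz]
  · rfl
  · rw [← hx, ← hy, ← hz]; exact H.inner_left hw

theorem BelowAntisymmetric.rightExchange_top [NeZero n] (H : BelowAntisymmetric D Φ x y z)
    (hxy : x ≤ y) (hyz : y ≤ z) {b₁ b₂ b₃ i p r s : ℤ} (hi0 : 0 < i) (hin : i < n)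
    (hb : b₃ = b₂ + i) (hx : x = b₁ + n * p) (hy : y = b₂ + n * r) (hz : z = b₃ + n * s) :
    rightExchange D Φ 0 b₁ b₂ b₃ (Finsupp.single (p, r, s) 1) = rightDefect D Φ x y z := by
  have hb' : b₃ = b₂ + n * 0 + i := by rw [hb]; ring
  have hlt : y < z := lt_of_le_of_ne hyz fun h => by
    have hd : ¬ (n : ℤ) ∣ i := not_dvd_of_between hi0 hin
    exact hd ⟨r - s, by linarith⟩
  have hw := inWindow_self hxy hyz
  rw [rightExchange_single, exchangeDefect_of_le D _ hi0 hin hb'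
    ((mul_le_iff_base_le hi0 hin hb').mpr (by rw [← hy, ← hz]; exact hlt)), ← hx, ← hy, ← hz]
  · rfl
  · rw [← hx, ← hy, ← hz]; exact H.inner_right hw

/-- Confluence for three distinct charges. -/
theorem BelowAntisymmetric.confluence_distinct [NeZero n] (H : BelowAntisymmetric D Φ x y z)
    (hxy : x ≤ y) (hyz : y ≤ z) (h12 : ¬ (n : ℤ) ∣ y - x) (h23 : ¬ (n : ℤ) ∣ z - y)
    (h13 : ¬ (n : ℤ) ∣ z - x) : leftDefect D Φ x y z = rightDefect D Φ x y z := by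
  obtain ⟨i, r, hi0, hin, hy⟩ := exists_base h12
  obtain ⟨j, k, hj0, hjn, hz⟩ := exists_base h23
  set b₂ := x + i with hb₂
  set b₃ := b₂ + j with hb₃
  have hz' : z = b₃ + n * (r + k) := by rw [hz, hy]; ring
  -- The outer base points are i + j apart; e = 1 records a carry beyond n, and i + j = n is
  -- excluded because x and z have different charges.
  obtain ⟨e, i', he, hi'0, hi'n, hb⟩ : ∃ e i' : ℤ, (e = 0 ∨ e = 1) ∧ 0 < i' ∧ i' < n ∧
      b₃ = x + n * e + i' := by
    rcases lt_trichotomy (i + j) n with h | h | h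
    · exact ⟨0, i + j, Or.inl rfl, by linarith, h, by rw [hb₃, hb₂]; ring⟩
    · refine absurd ⟨1 + (r + k), ?_⟩ h13
      rw [hz', hb₃, hb₂]; linarith
    · exact ⟨1, i + j - n, Or.inr rfl, by linarith, by linarith, by rw [hb₃, hb₂]; ring⟩
  have hd : ¬ (n : ℤ) ∣ j := not_dvd_of_between hj0 hjn
  have hd' : ¬ (n : ℤ) ∣ i := not_dvd_of_between hi0 hin
  have nz2 : ∀ s : ℤ, b₂ + n * s ≠ z := fun s h => hd ⟨s - (r + k), by linarith⟩
  have nz1 : ∀ s : ℤ, x + n * s ≠ z := base_ne h13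
  have nx2 : ∀ s : ℤ, b₂ + n * s ≠ x := fun s h => hd' ⟨-s, by linarith⟩
  have nx3 : ∀ s : ℤ, b₃ + n * s ≠ x := fun s h => h13 ⟨r + k - s, by linarith⟩
  have hb0 : b₂ = x + n * 0 + i := by rw [hb₂]; ring
  have hb0' : b₃ = b₂ + n * 0 + j := by rw [hb₃]; ring
  set f : Laurent := Finsupp.single (0, r, r + k) 1 with hf
  have hfw : f ∈ Finsupp.supported ℂ ℂ (windowSet n x y z x b₂ b₃) := by
    refine Finsupp.single_mem_supported ℂ 1 ?_
    show InWindow x y z (x + n * 0) (b₂ + n * r) (b₃ + n * (r + k))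
    rw [mul_zero, add_zero, ← hy, ← hz']
    exact inWindow_self hxy hyz
  set τ := (D.q ^ 2)⁻¹ with hτ
  have A1 := H.leftExchange_top hxy hyz (b₃ := b₃) (p := 0) hi0 hin hb₂ (by ring) hy hz'
  have B1 := H.rightExchange_top hxy hyz (b₁ := x) (p := 0) hj0 hjn hb₃ (by ring) hy hz'
  have hL := exchangeLeft_mem_window τ hi0 hin hb0 hfw
  have hR := exchangeRight_mem_window τ hj0 hjn hb0' hfw
  have hRL := exchangeRight_mem_window τ hi'0 hi'n hb hL
  have hLR := exchangeLeft_mem_window τ hi'0 hi'n hb hR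
  have A2 := H.leftExchange_eq_zero hi'0 hi'n hb nz2 hR
  have A3 := H.leftExchange_eq_zero hj0 hjn hb0' nz1 hRL
  have B2 := H.rightExchange_eq_zero hi'0 hi'n hb nx2 hL
  have B3 := H.rightExchange_eq_zero hi0 hin hb0 nx3 hLR
  rw [leftExchange_apply] at A1 A2 A3
  rw [rightExchange_apply] at B1 B2 B3
  rw [← hτ] at A1 A2 A3 B1 B2 B3
  -- Both chains of exchanges end with the charges reversed. They agree there by the braid relation,
  -- and the products of the three scalars are the same.
  rw [← exchange_braid τ he f] at B3
  rw [← A1, ← B1, ← hf]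
  have A2' := eq_neg_of_add_eq_zero_left A2
  have A3' := eq_neg_of_add_eq_zero_left A3
  have B2' := eq_neg_of_add_eq_zero_left B2
  have B3' := eq_neg_of_add_eq_zero_left B3
  rw [B2', A3', A2', B3']
  module

/-- Confluence when the first two charges agree. -/
theorem BelowAntisymmetric.confluence_left_eq [NeZero n] (H : BelowAntisymmetric D Φ x y z)
    (hxy : x ≤ y) (hyz : y ≤ z) (h12 : (n : ℤ) ∣ y - x) (h13 : ¬ (n : ℤ) ∣ z - x) :
    leftDefect D Φ x y z = rightDefect D Φ x y z := by
  obtain ⟨i, s, hi0, hin, hz⟩ := exists_base h13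
  obtain ⟨r, hr⟩ := h12
  have hy : y = x + n * r := by linarith
  set d := x + i with hd
  have hb : d = x + n * 0 + i := by rw [hd]; ring
  have hdi : ¬ (n : ℤ) ∣ i := not_dvd_of_between hi0 hin
  have nxd : ∀ s : ℤ, d + n * s ≠ x := fun s h => hdi ⟨-s, by linarith⟩
  set τ := (D.q ^ 2)⁻¹ with hτ
  have hw := inWindow_self hxy hyz
  have B1 := H.rightExchange_top hxy hyz (b₁ := x) (b₂ := x) (p := 0) hi0 hin hd (by ring) hy hz
  -- The defect of two factors of equal charge is the value on the symmetrized monomial, except that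
  -- for x = y the monomial is counted only once.
  obtain ⟨f, hsym, hfw, hleft, hright⟩ : ∃ f : Laurent, swapLeft (toRing f) = toRing f ∧
      f ∈ Finsupp.supported ℂ ℂ (windowSet n x y z x x d) ∧
      tripleEval n Φ x x d f = leftDefect D Φ x y z ∧
      rightExchange D Φ 0 x x d f = rightDefect D Φ x y z := by
    have hw1 : (0, r, s) ∈ windowSet n x y z x x d := by
      show InWindow x y z (x + n * 0) (x + n * r) (d + n * s)
      rwa [mul_zero, add_zero, ← hy, ← hz]
    rcases hxy.eq_or_lt with h | h
    · have hr0 : (n : ℤ) * r = 0 := by linarith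
      have hr0 : r = 0 := by
        rcases mul_eq_zero.mp hr0 with h' | h'
        · exact absurd (by exact_mod_cast h') (NeZero.ne n)
        · exact h'
      refine ⟨Finsupp.single (0, r, s) 1, ?_, Finsupp.single_mem_supported ℂ 1 hw1, ?_, B1⟩
      · rw [toRing_single_one, swapLeft_monomial, hr0]
      · rw [tripleEval_single, ← hy, ← hz, ← h, leftDefect, pairDefect_self]
        simp
    · have hw2 : (r, 0, s) ∈ windowSet n x y z x x d := hw1.swap_left
      refine ⟨Finsupp.single (0, r, s) 1 + Finsupp.single (r, 0, s) 1, ?_,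
        Submodule.add_mem _ (Finsupp.single_mem_supported ℂ 1 hw1)
          (Finsupp.single_mem_supported ℂ 1 hw2), ?_, ?_⟩
      · rw [map_add, toRing_single_one, toRing_single_one, map_add, swapLeft_monomial,
          swapLeft_monomial, add_comm]
      · rw [map_add, tripleEval_single, tripleEval_single, ← hy, ← hz, leftDefect,
          pairDefect_of_dvd _ _ h.ne (Int.emod_eq_zero_of_dvd ⟨r, hr⟩)]
        simp
      · rw [map_add, B1, H.rightExchange_single_eq_zero hi0 hin hb hw2, add_zero]
        · rw [← hy]; intro h'; simp only [Prod.mk.injEq] at h'; linarith [h'.1]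
        · rw [← hy]; intro h'; simp only [Prod.mk.injEq] at h'; linarith [h'.1]
  have hR := exchangeRight_mem_window τ hi0 hin hb hfw
  have hLR := exchangeLeft_mem_window τ hi0 hin hb hR
  have A2 := H.leftExchange_eq_zero hi0 hin hb (base_ne h13) hR
  have B2 := H.tripleEval_right_eq_zero (exchangeLeft_exchangeRight_symm τ f hsym) hLR
    fun p r s hp => ⟨hp, fun h' => nxd p (by simp only [Prod.mk.injEq] at h'; exact h'.1),
      fun h' => nxd p (by simp only [Prod.mk.injEq] at h'; exact h'.1)⟩
  rw [leftExchange_apply, ← hτ, B2, smul_zero, add_zero] at A2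
  rw [rightExchange_apply, ← hτ, A2, smul_zero, add_zero] at hright
  rw [← hleft, hright]

/-- Confluence when the last two charges agree. -/
theorem BelowAntisymmetric.confluence_right_eq [NeZero n] (H : BelowAntisymmetric D Φ x y z)
    (hxy : x ≤ y) (hyz : y ≤ z) (h23 : (n : ℤ) ∣ z - y) (h12 : ¬ (n : ℤ) ∣ y - x) :
    leftDefect D Φ x y z = rightDefect D Φ x y z := by
  obtain ⟨i, r, hi0, hin, hy⟩ := exists_base h12
  obtain ⟨k, hk⟩ := h23
  set d := x + i with hd
  have hz : z = d + n * (r + k) := by rw [mul_add]; linarith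
  have hb : d = x + n * 0 + i := by rw [hd]; ring
  have hdi : ¬ (n : ℤ) ∣ i := not_dvd_of_between hi0 hin
  have nxd : ∀ s : ℤ, d + n * s ≠ x := fun s h => hdi ⟨-s, by linarith⟩
  have nzx : ∀ s : ℤ, x + n * s ≠ z := fun s h => hdi ⟨s - (r + k), by rw [mul_sub]; linarith⟩
  set τ := (D.q ^ 2)⁻¹ with hτ
  have hw := inWindow_self hxy hyz
  have A1 := H.leftExchange_top hxy hyz (b₁ := x) (b₃ := d) (p := 0) hi0 hin hd (by ring) hy hz
  obtain ⟨f, hsym, hfw, hright, hleft⟩ : ∃ f : Laurent, swapRight (toRing f) = toRing f ∧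
      f ∈ Finsupp.supported ℂ ℂ (windowSet n x y z x d d) ∧
      tripleEval n Φ x d d f = rightDefect D Φ x y z ∧
      leftExchange D Φ 0 x d d f = leftDefect D Φ x y z := by
    have hw1 : (0, r, r + k) ∈ windowSet n x y z x d d := by
      show InWindow x y z (x + n * 0) (d + n * r) (d + n * (r + k))
      rwa [mul_zero, add_zero, ← hy, ← hz]
    rcases hyz.eq_or_lt with h | h
    · have hr0 : (n : ℤ) * k = 0 := by linarith
      have hr0 : k = 0 := by
        rcases mul_eq_zero.mp hr0 with h' | h'
        · exact absurd (by exact_mod_cast h') (NeZero.ne n)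
        · exact h'
      refine ⟨Finsupp.single (0, r, r + k) 1, ?_, Finsupp.single_mem_supported ℂ 1 hw1, ?_, A1⟩
      · rw [toRing_single_one, swapRight_monomial, hr0, add_zero]
      · rw [tripleEval_single, ← hy, ← hz, ← h, rightDefect, pairDefect_self]
        simp
    · have hw2 : (0, r + k, r) ∈ windowSet n x y z x d d := hw1.swap_right
      refine ⟨Finsupp.single (0, r, r + k) 1 + Finsupp.single (0, r + k, r) 1, ?_,
        Submodule.add_mem _ (Finsupp.single_mem_supported ℂ 1 hw1)
          (Finsupp.single_mem_supported ℂ 1 hw2), ?_, ?_⟩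
      · rw [map_add, toRing_single_one, toRing_single_one, map_add, swapRight_monomial,
          swapRight_monomial, add_comm]
      · rw [map_add, tripleEval_single, tripleEval_single, ← hy, ← hz, rightDefect,
          pairDefect_of_dvd _ _ h.ne (Int.emod_eq_zero_of_dvd ⟨k, hk⟩)]
        simp
      · rw [map_add, A1, H.leftExchange_single_eq_zero hi0 hin hb hw2, add_zero]
        · rw [← hy]; intro h'; simp only [Prod.mk.injEq] at h'; linarith [h'.2.2]
        · rw [← hy]; intro h'; simp only [Prod.mk.injEq] at h'; linarith [h'.2.2]
  have hL := exchangeLeft_mem_window τ hi0 hin hb hfw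
  have hRL := exchangeRight_mem_window τ hi0 hin hb hL
  have B2 := H.rightExchange_eq_zero hi0 hin hb nxd hL
  have A2 := H.tripleEval_left_eq_zero (exchangeRight_exchangeLeft_symm τ f hsym) hRL
    fun p r s hp => ⟨hp, fun h' => nzx s (by simp only [Prod.mk.injEq] at h'; exact h'.2.2),
      fun h' => nzx s (by simp only [Prod.mk.injEq] at h'; exact h'.2.2)⟩
  rw [rightExchange_apply, ← hτ, A2, smul_zero, add_zero] at B2
  rw [leftExchange_apply, ← hτ, B2, smul_zero, add_zero] at hleft
  rw [← hright, hleft]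

/-- Confluence when the outer charges agree. -/
theorem BelowAntisymmetric.confluence_outer_eq [NeZero n] (H : BelowAntisymmetric D Φ x y z)
    (hxy : x ≤ y) (hyz : y ≤ z) (h13 : (n : ℤ) ∣ z - x) (h12 : ¬ (n : ℤ) ∣ y - x) :
    leftDefect D Φ x y z = rightDefect D Φ x y z := by
  have hn : (0 : ℤ) < n := by exact_mod_cast Nat.pos_of_ne_zero (NeZero.ne n)
  obtain ⟨i, r, hi0, hin, hy⟩ := exists_base h12
  obtain ⟨s, hs⟩ := h13
  have hz : z = x + n * s := by linarith
  set d := x + i with hd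
  have hb : d = x + n * 0 + i := by rw [hd]; ring
  have hdi : ¬ (n : ℤ) ∣ i := not_dvd_of_between hi0 hin
  have nxd : ∀ s : ℤ, d + n * s ≠ x := fun s h => hdi ⟨-s, by linarith⟩
  have nzd : ∀ s : ℤ, d + n * s ≠ z := fun s' h => hdi ⟨s - s', by rw [mul_sub]; linarith⟩
  have hxy' : x < y := lt_of_le_of_ne hxy fun h => nxd r (by linarith)
  have hyz' : y < z := lt_of_le_of_ne hyz fun h => nzd r (by linarith)
  set τ := (D.q ^ 2)⁻¹ with hτ
  have hw := inWindow_self hxy hyz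
  have hrs : r < s - 0 := by
    by_contra h
    have := (mul_le_iff_base_le (p := s) (r := r) hi0 hin hb).mp (by linarith)
    linarith
  have hw1 : (0, s, r) ∈ windowSet n x y z x x d := by
    show InWindow x y z (x + n * 0) (x + n * s) (d + n * r)
    rw [mul_zero, add_zero, ← hy, ← hz]
    exact hw.swap_right
  have hw2 : (s, 0, r) ∈ windowSet n x y z x x d := hw1.swap_left
  -- Here y separates two factors of equal charge. The starting point is therefore the combination
  -- symmetric in these two with y moved to the right end; moving y back to the left passes through
  -- the triple x, y, z.
  set f : Laurent := Finsupp.single (0, s, r) 1 + Finsupp.single (s, 0, r) 1 with hf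
  have hsym : swapLeft (toRing f) = toRing f := by
    rw [hf, map_add, toRing_single_one, toRing_single_one, map_add, swapLeft_monomial,
      swapLeft_monomial, add_comm]
  have hfw : f ∈ Finsupp.supported ℂ ℂ (windowSet n x y z x x d) :=
    Submodule.add_mem _ (Finsupp.single_mem_supported ℂ 1 hw1)
      (Finsupp.single_mem_supported ℂ 1 hw2)
  have hR := exchangeRight_mem_window τ hi0 hin hb hfw
  have hLR := exchangeLeft_mem_window τ hi0 hin hb hR
  have A0 := H.tripleEval_left_eq_zero hsym hfw
    fun p r s hp => ⟨hp, fun h' => nzd s (by simp only [Prod.mk.injEq] at h'; exact h'.2.2),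
      fun h' => nzd s (by simp only [Prod.mk.injEq] at h'; exact h'.2.2)⟩
  have B2 := H.tripleEval_right_eq_zero (exchangeLeft_exchangeRight_symm τ f hsym) hLR
    fun p r s hp => ⟨hp, fun h' => nxd p (by simp only [Prod.mk.injEq] at h'; exact h'.1),
      fun h' => nxd p (by simp only [Prod.mk.injEq] at h'; exact h'.1)⟩
  -- In (x, z, y) the last two entries decrease, so its exchange relation is a multiple of the
  -- relation for (y, z) at the top triple.
  have B1 : rightExchange D Φ 0 x x d f =
      (D.q * D.α (x : ZMod n) (d : ZMod n) * τ) • rightDefect D Φ x y z := by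
    rw [hf, map_add, H.rightExchange_single_eq_zero hi0 hin hb hw2, add_zero, rightExchange_single,
      exchangeDefect_of_lt D _ hi0 hin hb hrs, ← hy, ← hz, mul_zero, add_zero]
    · rfl
    · rw [← hy, ← hz, mul_zero, add_zero]
      exact H.inner_right hw
    · rw [← hz]; intro h'; simp only [Prod.mk.injEq] at h'; linarith [h'.1]
    · rw [← hz]; intro h'; simp only [Prod.mk.injEq] at h'; linarith [h'.1]
  -- Among the monomials created by the exchange, only the top triple escapes the assumed relations;
  -- it carries the coefficient τ.
  have A1 : leftExchange D Φ 0 x d x (exchangeRight τ 0 f) = τ • leftDefect D Φ x y z := by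
    have htop := H.leftExchange_top hxy hyz (b₁ := x) (b₃ := x) (p := 0) hi0 hin hd (by ring) hy hz
    have h1 : leftExchange D Φ 0 x d x (exchangeRight τ 0 (Finsupp.single (s, 0, r) 1)) = 0 := by
      rw [exchangeRight_single]
      have hmem := pairEval_mem (fun s' t => (Finsupp.single (s, s', t) 1 : Laurent))
        (exchangePair_mem_supported τ hi0 hin hb hw2.2.2.1.1 hw2.2.2.1.2 hw2.2.2.2.1 hw2.2.2.2.2)
        (Finsupp.supported ℂ ℂ {p : ℤ × ℤ × ℤ | p ∈ windowSet n x y z x d x ∧ p.1 = s}) (by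
          rintro ⟨s', t'⟩ ⟨k1, k2, k3⟩
          refine Finsupp.single_mem_supported ℂ 1 ⟨⟨?_, hw2.2.1, k2, k3⟩, rfl⟩
          have h0 := hw2.1
          dsimp only at *
          have : (n : ℤ) * (s' + t') = n * (0 + r) := by rw [k1]
          linarith)
      refine eq_zero_of_supported hmem fun p r' s' hp =>
        H.leftExchange_single_eq_zero hi0 hin hb hp.1 ?_ ?_
      · have : p = s := hp.2
        rw [this, ← hz]; intro h'; simp only [Prod.mk.injEq] at h'; linarith [h'.1]
      · have : p = s := hp.2
        rw [this, ← hz]; intro h'; simp only [Prod.mk.injEq] at h'; linarith [h'.2.1]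
    rw [hf, map_add, map_add, h1, add_zero, exchangeRight_single, exchangePair,
      if_neg (by linarith)]
    simp only [map_add, map_smul, map_sum, pairEval_single, one_smul]
    rw [htop, sum_eq_zero, smul_zero, add_zero]
    intro j hj
    have hj' : (j : ℤ) + 1 ≤ s - 0 - r - 1 := by rw [mem_range] at hj; omega
    have hj0 : (0 : ℤ) ≤ n * j := by positivity
    have hj2 : (n : ℤ) * (j + 1) ≤ n * (s - 0 - r - 1) := by gcongr
    refine H.leftExchange_single_eq_zero hi0 hin hb ?_ ?_ ?_
    · refine ⟨?_, ⟨?_, ?_⟩, ⟨?_, ?_⟩, ?_, ?_⟩ <;> nlinarith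
    · intro h'; simp only [Prod.mk.injEq] at h'
      nlinarith [h'.2.2]
    · intro h'; simp only [Prod.mk.injEq] at h'
      nlinarith [h'.2.2]
  rw [leftExchange_apply, ← hτ, B2, smul_zero, add_zero] at A1
  rw [rightExchange_apply, ← hτ, A0, zero_add, A1, smul_smul] at B1
  have hne : D.q * D.α (x : ZMod n) (d : ZMod n) * τ ≠ 0 :=
    mul_ne_zero (mul_ne_zero D.q_ne_zero (left_ne_zero_of_mul_eq_one (D.α_mul _ _)))
      (inv_ne_zero (pow_ne_zero 2 D.q_ne_zero))
  exact smul_right_injective _ hne B1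

/-- Confluence for three equal charges. -/
theorem BelowAntisymmetric.confluence_eq (H : BelowAntisymmetric D Φ x y z)
    (hxy : x ≤ y) (hyz : y ≤ z) (h12 : (n : ℤ) ∣ y - x) (h23 : (n : ℤ) ∣ z - y) :
    leftDefect D Φ x y z = rightDefect D Φ x y z := by
  have h13 : (n : ℤ) ∣ z - x := by
    rw [show z - x = (z - y) + (y - x) by ring]; exact h23.add h12
  have hw := inWindow_self hxy hyz
  rcases hxy.eq_or_lt with rfl | hlt
  · rcases hyz.eq_or_lt with rfl | hlt'
    · rw [leftDefect, rightDefect, pairDefect_self, pairDefect_self]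
    · rw [leftDefect, rightDefect, pairDefect_self, pairDefect_of_dvd _ _ hlt'.ne
        (Int.emod_eq_zero_of_dvd h23)]
      have h1 := (H x z x hw.swap_right (by
        intro h; simp only [Prod.mk.injEq] at h; linarith [h.2.1])).1 hlt'.le
      have h2 := (H z x x hw.swap_right.swap_left (by
        intro h; simp only [Prod.mk.injEq] at h; linarith [h.1])).2 le_rfl
      rw [leftDefect, pairDefect_of_dvd _ _ hlt'.ne (Int.emod_eq_zero_of_dvd h23)] at h1
      rw [rightDefect, pairDefect_self] at h2
      rw [h2, add_zero] at h1
      rw [h1, add_zero]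
  · rcases hyz.eq_or_lt with rfl | hlt'
    · rw [leftDefect, rightDefect, pairDefect_self, pairDefect_of_dvd _ _ hlt.ne
        (Int.emod_eq_zero_of_dvd h12)]
      have h1 := (H y x y hw.swap_left (by
        intro h; simp only [Prod.mk.injEq] at h; linarith [h.1])).2 hlt.le
      have h2 := (H y y x hw.swap_left.swap_right (by
        intro h; simp only [Prod.mk.injEq] at h; linarith [h.1])).1 le_rfl
      rw [rightDefect, pairDefect_of_dvd _ _ hlt.ne (Int.emod_eq_zero_of_dvd h12)] at h1
      rw [leftDefect, pairDefect_self] at h2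
      rw [h2, add_zero] at h1
      rw [h1, add_zero]
    -- Ordinary antisymmetry: both sides equal the value at (x, y, z) plus the value at (z, y, x).
    · have hxz := hlt.trans hlt'
      have k1 := (H y x z hw.swap_left (by
        intro h; simp only [Prod.mk.injEq] at h; linarith [h.1])).2 hxz.le
      have k2 := (H y z x hw.swap_left.swap_right (by
        intro h; simp only [Prod.mk.injEq] at h; linarith [h.1])).1 hlt'.le
      have k3 := (H x z y hw.swap_right (by
        intro h; simp only [Prod.mk.injEq] at h; linarith [h.2.1])).1 hxz.le
      have k4 := (H z x y hw.swap_right.swap_left (by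
        intro h; simp only [Prod.mk.injEq] at h; linarith [h.1])).2 hlt.le
      rw [rightDefect, pairDefect_of_dvd _ _ hxz.ne (Int.emod_eq_zero_of_dvd h13)] at k1
      rw [leftDefect, pairDefect_of_dvd _ _ hlt'.ne (Int.emod_eq_zero_of_dvd h23)] at k2
      rw [leftDefect, pairDefect_of_dvd _ _ hxz.ne (Int.emod_eq_zero_of_dvd h13)] at k3
      rw [rightDefect, pairDefect_of_dvd _ _ hlt.ne (Int.emod_eq_zero_of_dvd h12)] at k4
      rw [leftDefect, rightDefect, pairDefect_of_dvd _ _ hlt.ne (Int.emod_eq_zero_of_dvd h12),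
        pairDefect_of_dvd _ _ hlt'.ne (Int.emod_eq_zero_of_dvd h23)]
      rw [eq_neg_of_add_eq_zero_left k1, eq_neg_of_add_eq_zero_left k2,
        eq_neg_of_add_eq_zero_left k3, eq_neg_of_add_eq_zero_left k4]

/-- The two ways of straightening three factors agree. -/
theorem BelowAntisymmetric.confluence [NeZero n] (H : BelowAntisymmetric D Φ x y z)
    (hxy : x ≤ y) (hyz : y ≤ z) : leftDefect D Φ x y z = rightDefect D Φ x y z := by
  by_cases h12 : (n : ℤ) ∣ y - x
  · by_cases h23 : (n : ℤ) ∣ z - y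
    · exact H.confluence_eq hxy hyz h12 h23
    · refine H.confluence_left_eq hxy hyz h12 fun h => h23 ?_
      rw [show z - y = (z - x) - (y - x) by ring]; exact h.sub h12
  · by_cases h23 : (n : ℤ) ∣ z - y
    · exact H.confluence_right_eq hxy hyz h23 h12
    · by_cases h13 : (n : ℤ) ∣ z - x
      · exact H.confluence_outer_eq hxy hyz h13 h12
      · exact H.confluence_distinct hxy hyz h12 h23 h13

end ConfluenceCases

end ChargedModel

end

/-! ### Semi-infinite sequences and termination of straightening. -/

noncomputable section

namespace ChargedModel

open Finset

namespace SemiInfinite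

theorem ext {w v : SemiInfinite} (h : ∀ i, w.1 i = v.1 i) : w = v := Subtype.ext (funext h)

/-- Replace the entries at the positions `p` and `p + 1`. -/
def setPair (w : SemiInfinite) (p : ℕ) (s t : ℤ) : SemiInfinite := (w.set p s).set (p + 1) t

theorem set_apply (w : SemiInfinite) (p : ℕ) (a : ℤ) (i : ℕ) :
    (w.set p a).1 i = if i = p then a else w.1 i := by
  unfold set
  simp [Function.update_apply]

theorem setPair_apply (w : SemiInfinite) (p : ℕ) (s t : ℤ) (i : ℕ) :
    (w.setPair p s t).1 i = if i = p then s else if i = p + 1 then t else w.1 i := by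
  unfold setPair
  rw [set_apply, set_apply]
  split_ifs <;> first | rfl | omega

theorem setPair_self (w : SemiInfinite) (p : ℕ) : w.setPair p (w.1 p) (w.1 (p + 1)) = w := by
  apply ext
  intro i
  rw [setPair_apply]
  split_ifs with h1 h2
  · rw [h1]
  · rw [h2]
  · rfl

theorem setPair_setPair (w : SemiInfinite) (p : ℕ) (s t s' t' : ℤ) :
    (w.setPair p s t).setPair p s' t' = w.setPair p s' t' := by
  apply ext
  intro i
  simp only [setPair_apply]
  split_ifs <;> rfl

theorem setPair_comm (w : SemiInfinite) {p r : ℕ} (h : p + 1 < r) (s t s' t' : ℤ) :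
    (w.setPair p s t).setPair r s' t' = (w.setPair r s' t').setPair p s t := by
  apply ext
  intro i
  simp only [setPair_apply]
  split_ifs <;> first | rfl | omega

/-- Replace the entries at the positions `p`, `p + 1` and `p + 2`. -/
def setTriple (w : SemiInfinite) (p : ℕ) (a b c : ℤ) : SemiInfinite :=
  (w.setPair p a b).set (p + 2) c

theorem setTriple_apply (w : SemiInfinite) (p : ℕ) (a b c : ℤ) (i : ℕ) :
    (w.setTriple p a b c).1 i =
      if i = p then a else if i = p + 1 then b else if i = p + 2 then c else w.1 i := by
  unfold setTriple
  rw [set_apply, setPair_apply]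
  split_ifs <;> first | rfl | omega

theorem setTriple_self (w : SemiInfinite) (p : ℕ) :
    w.setTriple p (w.1 p) (w.1 (p + 1)) (w.1 (p + 2)) = w := by
  apply ext
  intro i
  rw [setTriple_apply]
  split_ifs with h1 h2 h3
  · rw [h1]
  · rw [h2]
  · rw [h3]
  · rfl

theorem setPair_setTriple_left (w : SemiInfinite) (p : ℕ) (a b c s t : ℤ) :
    (w.setTriple p a b c).setPair p s t = w.setTriple p s t c := by
  apply ext
  intro i
  simp only [setPair_apply, setTriple_apply]
  split_ifs <;> rfl

theorem setPair_setTriple_right (w : SemiInfinite) (p : ℕ) (a b c s t : ℤ) :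
    (w.setTriple p a b c).setPair (p + 1) s t = w.setTriple p a s t := by
  apply ext
  intro i
  simp only [setPair_apply, setTriple_apply]
  split_ifs <;> first | rfl | omega

/-- From position `r` on the sequence decreases by one at each step, and all earlier entries
exceed the entry at position `r`. -/
def Settled (r : ℕ) (w : SemiInfinite) : Prop :=
  (∀ i, r ≤ i → w.1 i = w.1 r + r - i) ∧ ∀ i, i < r → w.1 r < w.1 i

theorem exists_settled (w : SemiInfinite) : ∃ r, Settled r w := by
  obtain ⟨c, r₀, h⟩ := w.2
  obtain ⟨b, hb⟩ : ∃ b : ℤ, ∀ i ∈ range r₀, b ≤ w.1 i := by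
    obtain ⟨b, hb⟩ := ((range r₀).image w.1).finite_toSet.bddBelow
    exact ⟨b, fun i hi => hb (by simpa using ⟨i, by simpa using hi, rfl⟩)⟩
  have hr : r₀ ≤ r₀ + (c - b + 1).toNat := Nat.le_add_right _ _
  -- `b` bounds the finitely many entries before the tail from below; c - b + 1 further steps take
  -- the tail below it.
  refine ⟨r₀ + (c - b + 1).toNat, fun i hi => ?_, fun i hi => ?_⟩
  · rw [h i (hr.trans hi), h _ hr]; ring
  · rw [h _ hr]
    by_cases hi' : i < r₀
    · have := hb i (by simpa using hi')
      push_cast; omega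
    · rw [h i (by omega)]; omega

/-- Weak ascents occur only to the left of r, so one r serves through a whole course of reductions
and makes `disorder` a measure of progress. -/
theorem Settled.lt_of_le {r p : ℕ} {w : SemiInfinite} (hw : Settled r w)
    (h : w.1 p ≤ w.1 (p + 1)) : p + 1 < r := by
  by_contra h'
  have h2 := hw.1 (p + 1) (by omega)
  rcases Nat.lt_or_ge p r with h1 | h1
  · have := hw.2 p h1
    have : p + 1 = r := by omega
    rw [this] at h2 h
    omega
  · have := hw.1 p h1
    push_cast at h2
    omega

/-- Decreases when a pair of entries in increasing order is replaced by a pair between them in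
decreasing order. -/
def disorder (r : ℕ) (w : SemiInfinite) : ℤ := ∑ i ∈ range r, (i : ℤ) * (w.1 i - w.1 r)

theorem Settled.disorder_nonneg {r : ℕ} {w : SemiInfinite} (hw : Settled r w) :
    0 ≤ disorder r w := by
  refine sum_nonneg fun i hi => mul_nonneg (by positivity) ?_
  have := hw.2 i (by simpa using hi)
  omega

theorem Settled.setTriple {r p : ℕ} {w : SemiInfinite} (hw : Settled r w) (hp : p + 2 < r)
    {a b c : ℤ} (ha : w.1 r < a) (hb : w.1 r < b) (hc : w.1 r < c) :
    Settled r (w.setTriple p a b c) := by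
  have hr : (w.setTriple p a b c).1 r = w.1 r := by
    rw [setTriple_apply, if_neg (by omega), if_neg (by omega), if_neg (by omega)]
  refine ⟨fun i hi => ?_, fun i hi => ?_⟩
  · rw [hr, setTriple_apply, if_neg (by omega), if_neg (by omega), if_neg (by omega)]
    exact hw.1 i hi
  · rw [hr, setTriple_apply]
    split_ifs
    · exact ha
    · exact hb
    · exact hc
    · exact hw.2 i hi

theorem disorder_setTriple {r p : ℕ} {w : SemiInfinite} (hp : p + 2 < r) (a b c : ℤ) :
    disorder r (w.setTriple p a b c) - disorder r w =
      p * (a - w.1 p) + (p + 1) * (b - w.1 (p + 1)) + (p + 2) * (c - w.1 (p + 2)) := by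
  have hr : (w.setTriple p a b c).1 r = w.1 r := by
    rw [setTriple_apply, if_neg (by omega), if_neg (by omega), if_neg (by omega)]
  unfold disorder
  rw [← sum_sub_distrib, ← sum_subset (s₁ := {p, p + 1, p + 2})]
  · rw [sum_insert (by simp), sum_insert (by simp), sum_singleton]
    simp only [hr, setTriple_apply]
    simp
    ring
  · intro i
    simp only [mem_insert, mem_singleton, mem_range]
    omega
  · intro i _ hi
    simp only [mem_insert, mem_singleton, not_or] at hi
    rw [hr, setTriple_apply, if_neg hi.1, if_neg hi.2.1, if_neg hi.2.2, sub_self]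

theorem Settled.setPair {r p : ℕ} {w : SemiInfinite} (hw : Settled r w) (hp : p + 1 < r)
    {a b : ℤ} (ha : w.1 r < a) (hb : w.1 r < b) :
    Settled r (w.setPair p a b) := by
  have hr : (w.setPair p a b).1 r = w.1 r := by
    rw [setPair_apply, if_neg (by omega), if_neg (by omega)]
  refine ⟨fun i hi => ?_, fun i hi => ?_⟩
  · rw [hr, setPair_apply, if_neg (by omega), if_neg (by omega)]
    exact hw.1 i hi
  · rw [hr, setPair_apply]
    split_ifs
    · exact ha
    · exact hb
    · exact hw.2 i hi

theorem disorder_setPair {r p : ℕ} {w : SemiInfinite} (hp : p + 1 < r) (a b : ℤ) :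
    disorder r (w.setPair p a b) - disorder r w =
      p * (a - w.1 p) + (p + 1) * (b - w.1 (p + 1)) := by
  have hr : (w.setPair p a b).1 r = w.1 r := by
    rw [setPair_apply, if_neg (by omega), if_neg (by omega)]
  unfold disorder
  rw [← sum_sub_distrib, ← sum_subset (s₁ := {p, p + 1})]
  · rw [sum_insert (by simp), sum_singleton]
    simp only [hr, setPair_apply]
    simp
    ring
  · intro i
    simp only [mem_insert, mem_singleton, mem_range]
    omega
  · intro i _ hi
    simp only [mem_insert, mem_singleton, not_or] at hi
    rw [hr, setPair_apply, if_neg hi.1, if_neg hi.2, sub_self]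

/-- `w'` arises from `w` by replacing a pair of adjacent entries in increasing order by a pair
between them in decreasing order. -/
def Step (w' w : SemiInfinite) : Prop :=
  ∃ p s t, w.1 p ≤ w.1 (p + 1) ∧ (s, t) ∈ Twist.innerPairs (w.1 p) (w.1 (p + 1)) ∧
    w' = w.setPair p s t

/-- The sum of the two entries is preserved while the weights p and p + 1 differ by one, so
`disorder` changes by t - w(p+1), which is negative. -/
theorem Settled.setPair_inner {r p : ℕ} {w : SemiInfinite} (hw : Settled r w)
    (h : w.1 p ≤ w.1 (p + 1)) {s t : ℤ} (hst : (s, t) ∈ Twist.innerPairs (w.1 p) (w.1 (p + 1))) :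
    Settled r (w.setPair p s t) ∧ disorder r (w.setPair p s t) < disorder r w := by
  obtain ⟨h1, h2, h3, h4⟩ := hst
  have hp := hw.lt_of_le h
  have := hw.2 p (by omega)
  dsimp only at h1 h2 h3 h4
  refine ⟨hw.setPair hp (by omega) (by omega), ?_⟩
  have h5 := disorder_setPair (w := w) hp s t
  have h6 : (p : ℤ) * (s - w.1 p) + (p + 1) * (t - w.1 (p + 1)) = t - w.1 (p + 1) := by
    linear_combination (p : ℤ) * h4
  omega

theorem Settled.induction {r : ℕ} {P : SemiInfinite → Prop}
    (ih : ∀ w, Settled r w → (∀ v, Settled r v → disorder r v < disorder r w → P v) → P w)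
    (w : SemiInfinite) (hw : Settled r w) : P w := by
  have key : ∀ N : ℕ, ∀ w, Settled r w → disorder r w < N → P w := by
    intro N
    induction N with
    | zero => intro w hw h; have := hw.disorder_nonneg; push_cast at h; omega
    | succ N IH => intro w hw h; exact ih w hw fun v hv hvw => IH v hv (by push_cast at h; omega)
  refine key ((disorder r w).toNat + 1) w hw ?_
  have := hw.disorder_nonneg
  push_cast; omega

theorem wellFounded_step : WellFounded Step := by
  refine ⟨fun w => ?_⟩
  obtain ⟨r, hr⟩ := exists_settled w
  refine Settled.induction (r := r) (P := Acc Step) (fun w hw ih => ⟨_, ?_⟩) w hr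
  rintro v ⟨p, s, t, h, hst, rfl⟩
  have := hw.setPair_inner h hst
  exact ih _ this.1 this.2

end SemiInfinite

open SemiInfinite

/-! ### Linear maps out of Fock space. -/

section Lift

variable {n : ℕ} (D : Twist n) {M : Type*} [AddCommGroup M] [Module ℂ M]

/-- The function `φ` is compatible with the normal ordering relation at position `p` of `w`. -/
def ReducesAt (φ : SemiInfinite → M) (w : SemiInfinite) (p : ℕ) : Prop :=
  φ w = pairEval (fun s t => φ (w.setPair p s t)) (D.normalForm (w.1 p) (w.1 (p + 1)))

theorem linearCombination_straighten (φ : SemiInfinite → M) (w : SemiInfinite) (p : ℕ) :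
    Finsupp.linearCombination ℂ φ (D.straighten w p) =
      pairEval (fun s t => φ (w.setPair p s t)) (D.straightenPair (w.1 p) (w.1 (p + 1))) := by
  rw [D.straighten_eq, Finsupp.lmapDomain_apply, Finsupp.linearCombination_mapDomain]
  rfl

theorem setPair_of_eq {w : SemiInfinite} {p : ℕ} (h : w.1 p = w.1 (p + 1)) :
    w.setPair p (w.1 p) (w.1 p) = w := by
  conv_rhs => rw [← setPair_self w p, ← h]

/-- The linear map on Fock space given by a function on wedges compatible with the relations. -/
def Twist.lift (φ : SemiInfinite → M)
    (h : ∀ w p, w.1 p ≤ w.1 (p + 1) → ReducesAt D φ w p) : D.Fock →ₗ[ℂ] M :=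
  D.relations.liftQ (Finsupp.linearCombination ℂ φ) <| by
    rw [Twist.relations, Submodule.span_le]
    rintro _ ⟨w, p, hp, rfl⟩
    rw [SetLike.mem_coe, LinearMap.mem_ker, map_sub, sub_eq_zero, linearCombination_straighten,
      Finsupp.linearCombination_single, one_smul]
    have h := h w p hp
    unfold ReducesAt at h
    rcases hp.eq_or_lt with heq | hlt
    · rw [← heq, D.normalForm_self, map_zero] at h
      rw [← heq, D.straightenPair_self, map_neg, pairEval_single, setPair_of_eq heq, h]
      simp
    · rw [D.normalForm_of_ne hlt.ne] at h
      exact h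

theorem Twist.lift_wedge (φ : SemiInfinite → M) (h) (w : SemiInfinite) :
    D.lift φ h (D.wedge w) = φ w := by
  rw [Twist.lift, Twist.wedge, Submodule.mkQ_apply, Submodule.liftQ_apply,
    Finsupp.linearCombination_single, one_smul]

end Lift

/-! ### The diamond lemma for normally ordered wedges. -/

section Diamond

variable {n : ℕ} (D : Twist n) (β : SemiInfinite → ℂ)

open Classical in
/-- The extension of a function on normally ordered wedges to all wedges, obtained by reducing a
wedge at some chosen place. -/
def reduction : SemiInfinite → ℂ :=
  wellFounded_step.fix fun w rec =>
    if h : ∃ p, w.1 p ≤ w.1 (p + 1) then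
      pairEval (fun s t => if hs : Step (w.setPair h.choose s t) w then rec _ hs else 0)
        (D.normalForm (w.1 h.choose) (w.1 (h.choose + 1)))
    else β w

theorem reduction_of_normallyOrdered {w : SemiInfinite} (hw : w.NormallyOrdered) :
    reduction D β w = β w := by
  rw [reduction, WellFounded.fix_eq, dif_neg]
  rintro ⟨p, hp⟩
  exact absurd (hw (Nat.lt_succ_self p)) (not_lt.mpr hp)

theorem pairEval_comm {M : Type*} [AddCommGroup M] [Module ℂ M] (F : ℤ → ℤ → ℤ → ℤ → M)
    (f g : ℤ × ℤ →₀ ℂ) :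
    pairEval (fun s t => pairEval (fun s' t' => F s t s' t') g) f =
      pairEval (fun s' t' => pairEval (fun s t => F s t s' t') f) g := by
  unfold pairEval
  simp only [Finsupp.linearCombination_apply, Finsupp.sum, smul_sum]
  rw [sum_comm]
  refine sum_congr rfl fun x _ => sum_congr rfl fun y _ => ?_
  rw [smul_comm]

variable [NeZero n]

/-- Compatibility holds by construction at the position chosen in the recursion. The default value 0
there is never used, since the normal form is supported on pairs that give a `Step`. -/
theorem exists_reducesAt {w : SemiInfinite} (h : ∃ p, w.1 p ≤ w.1 (p + 1)) :
    ∃ p, w.1 p ≤ w.1 (p + 1) ∧ ReducesAt D (reduction D β) w p := by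
  refine ⟨h.choose, h.choose_spec, ?_⟩
  unfold ReducesAt
  conv_lhs => rw [reduction, WellFounded.fix_eq, dif_pos h]
  refine pairEval_congr (D.normalForm_mem_supported h.choose_spec) fun st hst => ?_
  rw [dif_pos ⟨_, _, _, h.choose_spec, hst, rfl⟩]
  rfl

/-- Reductions at disjoint places commute; the hypothesis allows the second one to be applied after
the first, in either order. -/
theorem reducesAt_far {φ : SemiInfinite → ℂ} {w : SemiInfinite} {p p' : ℕ} (hpp : p + 1 < p')
    (hp : w.1 p ≤ w.1 (p + 1)) (hp' : w.1 p' ≤ w.1 (p' + 1))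
    (ih : ∀ v, Step v w → ∀ p, v.1 p ≤ v.1 (p + 1) → ReducesAt D φ v p) :
    ReducesAt D φ w p ↔ ReducesAt D φ w p' := by
  unfold ReducesAt
  have e1 : pairEval (fun s t => φ (w.setPair p s t)) (D.normalForm (w.1 p) (w.1 (p + 1))) =
      pairEval (fun s t => pairEval (fun s' t' => φ ((w.setPair p s t).setPair p' s' t'))
        (D.normalForm (w.1 p') (w.1 (p' + 1)))) (D.normalForm (w.1 p) (w.1 (p + 1))) := by
    refine pairEval_congr (D.normalForm_mem_supported hp) fun st hst => ?_
    have a1 : (w.setPair p st.1 st.2).1 p' = w.1 p' := by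
      rw [setPair_apply, if_neg (by omega), if_neg (by omega)]
    have a2 : (w.setPair p st.1 st.2).1 (p' + 1) = w.1 (p' + 1) := by
      rw [setPair_apply, if_neg (by omega), if_neg (by omega)]
    have := ih (w.setPair p st.1 st.2) ⟨p, _, _, hp, hst, rfl⟩ p' (by rw [a1, a2]; exact hp')
    rw [ReducesAt, a1, a2] at this
    exact this
  have e2 : pairEval (fun s t => φ (w.setPair p' s t)) (D.normalForm (w.1 p') (w.1 (p' + 1))) =
      pairEval (fun s' t' => pairEval (fun s t => φ ((w.setPair p' s' t').setPair p s t))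
        (D.normalForm (w.1 p) (w.1 (p + 1)))) (D.normalForm (w.1 p') (w.1 (p' + 1))) := by
    refine pairEval_congr (D.normalForm_mem_supported hp') fun st hst => ?_
    have a1 : (w.setPair p' st.1 st.2).1 p = w.1 p := by
      rw [setPair_apply, if_neg (by omega), if_neg (by omega)]
    have a2 : (w.setPair p' st.1 st.2).1 (p + 1) = w.1 (p + 1) := by
      rw [setPair_apply, if_neg (by omega), if_neg (by omega)]
    have := ih (w.setPair p' st.1 st.2) ⟨p', _, _, hp', hst, rfl⟩ p (by rw [a1, a2]; exact hp)
    rw [ReducesAt, a1, a2] at this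
    exact this
  rw [e1, e2, pairEval_comm]
  simp only [setPair_comm w hpp]

/-- Every other triple of the window yields a sequence of smaller disorder, so the induction
hypothesis is precisely the hypothesis of `BelowAntisymmetric.confluence`. -/
theorem reducesAt_adjacent {φ : SemiInfinite → ℂ} {r : ℕ} {w : SemiInfinite} (hw : Settled r w)
    {p : ℕ} (hp : w.1 p ≤ w.1 (p + 1)) (hp' : w.1 (p + 1) ≤ w.1 (p + 2))
    (ih : ∀ v, Settled r v → disorder r v < disorder r w →
      ∀ p, v.1 p ≤ v.1 (p + 1) → ReducesAt D φ v p) :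
    ReducesAt D φ w p ↔ ReducesAt D φ w (p + 1) := by
  have hr := hw.lt_of_le hp'
  have hx := hw.2 p (by omega)
  set Φ : ℤ → ℤ → ℤ → ℂ := fun a b c => φ (w.setTriple p a b c) with hΦ
  have key : ∀ a b c, (leftDefect D Φ a b c = 0 ↔ ReducesAt D φ (w.setTriple p a b c) p) ∧
      (rightDefect D Φ a b c = 0 ↔ ReducesAt D φ (w.setTriple p a b c) (p + 1)) := by
    intro a b c
    have a1 : (w.setTriple p a b c).1 p = a := by simp [setTriple_apply]
    have a2 : (w.setTriple p a b c).1 (p + 1) = b := by simp [setTriple_apply]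
    have a3 : (w.setTriple p a b c).1 (p + 1 + 1) = c := by
      rw [setTriple_apply, if_neg (by omega), if_neg (by omega), if_pos rfl]
    constructor
    · unfold leftDefect ReducesAt pairDefect
      rw [sub_eq_zero, a1, a2]
      simp only [setPair_setTriple_left, hΦ]
    · unfold rightDefect ReducesAt pairDefect
      rw [sub_eq_zero, a2, a3]
      simp only [setPair_setTriple_right, hΦ]
  have H : BelowAntisymmetric D Φ (w.1 p) (w.1 (p + 1)) (w.1 (p + 2)) := by
    rintro a b c ⟨hs, ⟨ha1, ha2⟩, ⟨hb1, hb2⟩, hc1, hc2⟩ hne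
    have hset := hw.setTriple hr (a := a) (b := b) (c := c) (by omega) (by omega) (by omega)
    have hlt : disorder r (w.setTriple p a b c) < disorder r w := by
      have h5 := disorder_setTriple (w := w) hr a b c
      -- With a fixed sum the weights p, p + 1, p + 2 only see the outer entries; in the window this
      -- change is at most zero, with equality only for the triple itself.
      have h6 : (p : ℤ) * (a - w.1 p) + (p + 1) * (b - w.1 (p + 1)) + (p + 2) * (c - w.1 (p + 2))
          = (c - w.1 (p + 2)) - (a - w.1 p) := by
        linear_combination ((p : ℤ) + 1) * hs
      have h7 : ¬ (a = w.1 p ∧ c = w.1 (p + 2)) := by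
        rintro ⟨h1, h2⟩
        exact hne (by rw [h1, h2, show b = w.1 (p + 1) by omega])
      omega
    have := ih _ hset hlt
    refine ⟨fun h => (key a b c).1.mpr (this p ?_), fun h => (key a b c).2.mpr (this (p + 1) ?_)⟩
    · simpa [setTriple_apply] using h
    · simpa [setTriple_apply, show p + 1 + 1 ≠ p by omega] using h
  have hc := H.confluence hp hp'
  have := key (w.1 p) (w.1 (p + 1)) (w.1 (p + 2))
  rw [setTriple_self] at this
  rw [← this.1, ← this.2, hc]

/-- By induction on disorder, any reducible position is compared with the one chosen by the
recursion; the two are far apart, adjacent or equal. -/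
theorem reduction_reducesAt (w : SemiInfinite) (p : ℕ) (hp : w.1 p ≤ w.1 (p + 1)) :
    ReducesAt D (reduction D β) w p := by
  obtain ⟨r, hr⟩ := exists_settled w
  revert p
  refine Settled.induction (r := r) (P := fun w => ∀ p, w.1 p ≤ w.1 (p + 1) →
    ReducesAt D (reduction D β) w p) (fun w hw ih p hp => ?_) w hr
  obtain ⟨p₀, hp₀, h₀⟩ := exists_reducesAt D β ⟨p, hp⟩
  have ih' : ∀ v, Step v w → ∀ p, v.1 p ≤ v.1 (p + 1) → ReducesAt D (reduction D β) v p := by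
    rintro v ⟨p, s, t, h, hst, rfl⟩
    have := hw.setPair_inner h hst
    exact ih _ this.1 this.2
  rcases lt_trichotomy p p₀ with h | rfl | h
  · rcases Nat.lt_or_ge (p + 1) p₀ with h' | h'
    · exact (reducesAt_far D h' hp hp₀ ih').mpr h₀
    · obtain rfl : p₀ = p + 1 := by omega
      exact (reducesAt_adjacent D hw hp hp₀ ih).mpr h₀
  · exact h₀
  · rcases Nat.lt_or_ge (p₀ + 1) p with h' | h'
    · exact (reducesAt_far D h' hp₀ hp ih').mp h₀
    · obtain rfl : p = p₀ + 1 := by omega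
      exact (reducesAt_adjacent D hw hp₀ hp ih).mp h₀

/-- Every function on normally ordered wedges extends to a linear functional on Fock space. -/
theorem exists_functional : ∃ φ : D.Fock →ₗ[ℂ] ℂ, ∀ w : SemiInfinite, w.NormallyOrdered →
    φ (D.wedge w) = β w := by
  refine ⟨D.lift (reduction D β) (reduction_reducesAt D β), fun w hw => ?_⟩
  rw [D.lift_wedge, reduction_of_normallyOrdered D β hw]

theorem Twist.isBra_bra (mu : Finset ℕ) : D.IsBra mu (D.bra mu) := by
  classical
  have h : ∃ φ, D.IsBra mu φ := exists_functional D _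
  rw [Twist.bra, dif_pos h]
  exact h.choose_spec

end Diamond

end ChargedModel

end

/-! ### The relations in Fock space and vanishing of wedges. -/

noncomputable section

namespace ChargedModel

open Finset SemiInfinite

section Fock

variable {n : ℕ} (D : Twist n) {M : Type*} [AddCommGroup M] [Module ℂ M]

theorem Antisymmetric.add {D : Twist n} {U V : ℤ → ℤ → M} (hU : Antisymmetric D U)
    (hV : Antisymmetric D V) : Antisymmetric D (fun s t => U s t + V s t) := by
  intro l m h
  have e : pairEval (fun s t => U s t + V s t) (D.normalForm l m) =
      pairEval U (D.normalForm l m) + pairEval V (D.normalForm l m) := by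
    unfold pairEval
    simp [Finsupp.linearCombination_apply, Finsupp.sum, sum_add_distrib]
  have h1 := hU l m h
  have h2 := hV l m h
  unfold pairDefect at *
  rw [e, add_sub_add_comm, h1, h2, add_zero]

theorem antisymmetric_zero : Antisymmetric D (fun _ _ => (0 : M)) := by
  intro l m _
  simp [pairDefect, pairEval, Finsupp.linearCombination_apply]

theorem Antisymmetric.sum {D : Twist n} {ι : Type*} (S : Finset ι) {U : ι → ℤ → ℤ → M}
    (hU : ∀ i ∈ S, Antisymmetric D (U i)) : Antisymmetric D (fun s t => ∑ i ∈ S, U i s t) := by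
  classical
  induction S using Finset.induction_on with
  | empty => simpa using antisymmetric_zero D
  | insert a S ha ih =>
    simp only [sum_insert ha]
    exact (hU a (mem_insert_self a S)).add (ih fun i hi => hU i (mem_insert_of_mem hi))

theorem Twist.ext_wedge {f g : D.Fock →ₗ[ℂ] M} (h : ∀ w, f (D.wedge w) = g (D.wedge w)) :
    f = g := by
  apply Submodule.linearMap_qext
  apply Finsupp.lhom_ext'
  intro w
  apply LinearMap.ext_ring
  exact h w

theorem Twist.span_wedge : Submodule.span ℂ (Set.range D.wedge) = ⊤ := by
  rw [eq_top_iff]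
  rintro v -
  obtain ⟨f, rfl⟩ := D.relations.mkQ_surjective v
  induction f using Finsupp.induction_linear with
  | zero => simp
  | add f g hf hg => rw [map_add]; exact Submodule.add_mem _ hf hg
  | single w c =>
    rw [← mul_one c, ← smul_eq_mul, ← Finsupp.smul_single, map_smul]
    exact Submodule.smul_mem _ _ (Submodule.subset_span ⟨w, rfl⟩)

theorem Twist.mem_of_wedge_mem {P : Submodule ℂ D.Fock} (h : ∀ w, D.wedge w ∈ P) (v : D.Fock) :
    v ∈ P := by
  have : v ∈ (⊤ : Submodule ℂ D.Fock) := trivial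
  rw [← D.span_wedge] at this
  exact Submodule.span_le.mpr (by rintro _ ⟨w, rfl⟩; exact h w) this

/-- For equal indices the defining relation reads v = -v, hence v = 0, in accordance with the
convention for normal forms. -/
theorem Twist.antisymmetric_wedge (w : SemiInfinite) (p : ℕ) :
    Antisymmetric D (fun s t => D.wedge (w.setPair p s t)) := by
  intro l m hlm
  set v := w.setPair p l m with hv
  have a1 : v.1 p = l := by simp [hv, setPair_apply]
  have a2 : v.1 (p + 1) = m := by simp [hv, setPair_apply]
  have hr : Finsupp.single v 1 - D.straighten v p ∈ D.relations :=
    Submodule.subset_span ⟨v, p, by rw [a1, a2]; exact hlm, rfl⟩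
  have key : D.wedge v = pairEval (fun s t => D.wedge (w.setPair p s t))
      (D.straightenPair l m) := by
    have h1 : D.relations.mkQ (Finsupp.single v 1) = D.relations.mkQ (D.straighten v p) := by
      rw [← sub_eq_zero, ← map_sub, Submodule.mkQ_apply, Submodule.Quotient.mk_eq_zero]
      exact hr
    have h2 : D.relations.mkQ = Finsupp.linearCombination ℂ D.wedge := by
      apply Finsupp.lhom_ext'
      intro u
      apply LinearMap.ext_ring
      simp [Twist.wedge]
    rw [Twist.wedge, h1, h2, linearCombination_straighten, a1, a2]
    simp only [hv, setPair_setPair]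
  rw [pairDefect, sub_eq_zero]
  rcases hlm.eq_or_lt with rfl | hlt
  · rw [D.normalForm_self, map_zero]
    rw [D.straightenPair_self, map_neg, pairEval_single, one_smul, ← hv] at key
    have h2 : (2 : ℂ) • D.wedge v = 0 := by
      rw [two_smul]; nth_rewrite 1 [key]; exact neg_add_cancel _
    exact (smul_eq_zero.mp h2).resolve_left two_ne_zero
  · rw [D.normalForm_of_ne hlt.ne]
    exact key

theorem Twist.wedge_reducesAt (w : SemiInfinite) (p : ℕ) (h : w.1 p ≤ w.1 (p + 1)) :
    ReducesAt D D.wedge w p := by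
  have := D.antisymmetric_wedge w p _ _ h
  rw [pairDefect, sub_eq_zero, setPair_self] at this
  exact this

theorem reducesAt_of_antisymmetric {φ : SemiInfinite → M}
    (h : ∀ (w : SemiInfinite) (p : ℕ), Antisymmetric D (fun s t => φ (w.setPair p s t)))
    (w : SemiInfinite) (p : ℕ)
    (hp : w.1 p ≤ w.1 (p + 1)) : ReducesAt D φ w p := by
  have := h w p _ _ hp
  rw [pairDefect, sub_eq_zero, setPair_self] at this
  exact this

variable [NeZero n]

/-- A wedge lies in every submodule containing the wedges obtained by reducing it at `p`. -/
theorem Twist.wedge_mem_of_reduce {P : Submodule ℂ D.Fock} {w : SemiInfinite} {p : ℕ}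
    (h : w.1 p ≤ w.1 (p + 1))
    (hP : ∀ s t, w.1 p ≤ t → t < s → s ≤ w.1 (p + 1) → s + t = w.1 p + w.1 (p + 1) →
      D.wedge (w.setPair p s t) ∈ P) : D.wedge w ∈ P := by
  rw [show D.wedge w = _ from D.wedge_reducesAt w p h]
  exact pairEval_mem _ (D.normalForm_mem_supported h) P
    fun st hst => hP st.1 st.2 hst.1 hst.2.1 hst.2.2.1 hst.2.2.2

/-- Reducing the entry against the first element of the block leaves an entry that belongs to the
remaining, shorter block. Induction on the length of the block ends with an impossible inequality.
-/
theorem Twist.wedge_eq_zero_of_right (B : ℕ) : ∀ (w : SemiInfinite) (p : ℕ) (b : ℤ),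
    (∀ j : ℕ, j < B → w.1 (p + 1 + j) = b - j) → b - B < w.1 p → w.1 p ≤ b → D.wedge w = 0 := by
  induction B with
  | zero => intro w p b _ h1 h2; push_cast at h1; omega
  | succ B ih =>
    intro w p b hb h1 h2
    have h0 := hb 0 (by omega)
    simp only [Nat.cast_zero, sub_zero, add_zero] at h0
    rw [← Submodule.mem_bot ℂ]
    refine D.wedge_mem_of_reduce (p := p) (by omega) fun s t hst1 hst2 hst3 hst4 => ?_
    rw [Submodule.mem_bot]
    have e : (w.setPair p s t).1 (p + 1) = t := by simp [setPair_apply]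
    refine ih _ (p + 1) (b - 1) (fun j hj => ?_) ?_ ?_
    · rw [setPair_apply, if_neg (by omega), if_neg (by omega),
        show p + 1 + 1 + j = p + 1 + (j + 1) by ring, hb _ (by omega)]
      push_cast; ring
    · rw [e]; push_cast at h1; omega
    · rw [e]; omega

/-- A factor `u_x` to the right of a block `u_{b+B-1} ∧ ⋯ ∧ u_b` with `b ≤ x` moves to the left
of the block, and the result vanishes if `x` belongs to the block. -/
theorem Twist.wedge_mem_of_left {P : Submodule ℂ D.Fock} (B : ℕ) : ∀ (w : SemiInfinite) (p : ℕ)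
    (b : ℤ), (∀ j : ℕ, j < B → w.1 (p + j) = b + B - 1 - j) → b ≤ w.1 (p + B) →
    (∀ v : SemiInfinite, (∀ i, i < p → v.1 i = w.1 i) → (∀ i, p + B < i → v.1 i = w.1 i) →
      b + B ≤ v.1 p → b + B ≤ w.1 (p + B) → D.wedge v ∈ P) → D.wedge w ∈ P := by
  induction B with
  | zero =>
    intro w p b _ h1 h2
    exact h2 w (fun _ _ => rfl) (fun _ _ => rfl) (by simpa using h1) (by simpa using h1)
  | succ B ih =>
    intro w p b hb h1 h2
    have h0 := hb B (by omega)
    push_cast at h0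
    rw [← add_assoc] at h1
    refine D.wedge_mem_of_reduce (p := p + B) (by omega) fun s t hst1 hst2 hst3 hst4 => ?_
    have e : (w.setPair (p + B) s t).1 (p + B) = s := by simp [setPair_apply]
    refine ih _ p (b + 1) (fun j hj => ?_) (by rw [e]; omega) fun v hv1 hv2 hv3 hv4 => ?_
    · rw [setPair_apply, if_neg (by omega), if_neg (by omega), hb _ (by omega)]
      push_cast; ring
    · refine h2 v (fun i hi => ?_) (fun i hi => ?_) ?_ ?_
      · rw [hv1 i hi, setPair_apply, if_neg (by omega), if_neg (by omega)]
      · rw [hv2 i (by omega), setPair_apply, if_neg (by omega), if_neg (by omega)]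
      · push_cast; omega
      · rw [e] at hv4
        rw [← add_assoc]
        push_cast; omega

theorem Twist.wedge_eq_zero_of_left (w : SemiInfinite) (p : ℕ) (B : ℕ) (b : ℤ)
    (hb : ∀ j : ℕ, j < B → w.1 (p + j) = b + B - 1 - j) (h1 : b ≤ w.1 (p + B))
    (h2 : w.1 (p + B) < b + B) : D.wedge w = 0 := by
  rw [← Submodule.mem_bot ℂ]
  exact D.wedge_mem_of_left B w p b hb h1 fun _ _ _ _ h => absurd h2 (not_lt.mpr h)

end Fock

end ChargedModel

end

/-! ### Creation operators, degree and currents. -/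

noncomputable section

namespace ChargedModel

open Finset SemiInfinite

namespace SemiInfinite

/-- From position `r` on the sequence is `c - r, c - r - 1, …`. -/
def HasTail (w : SemiInfinite) (c : ℤ) (r : ℕ) : Prop := ∀ i, r ≤ i → w.1 i = c - i

theorem exists_hasTail (w : SemiInfinite) : ∃ c r, w.HasTail c r := w.2

theorem HasTail.mono {w : SemiInfinite} {c : ℤ} {r r' : ℕ} (h : w.HasTail c r) (hr : r ≤ r') :
    w.HasTail c r' := fun i hi => h i (hr.trans hi)

theorem HasTail.set {w : SemiInfinite} {c : ℤ} {r : ℕ} (h : w.HasTail c r) {p : ℕ} (hp : p < r)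
    (a : ℤ) : (w.set p a).HasTail c r := by
  intro i hi
  rw [set_apply, if_neg (by omega)]
  exact h i hi

theorem HasTail.setPair {w : SemiInfinite} {c : ℤ} {r : ℕ} (h : w.HasTail c r) {p : ℕ}
    (hp : p + 1 < r) (s t : ℤ) : (w.setPair p s t).HasTail c r :=
  (h.set (by omega) s).set hp t

theorem Settled.mono {r r' : ℕ} {w : SemiInfinite} (h : Settled r w) (hr : r ≤ r') :
    Settled r' w := by
  have h1 := h.1 r' hr
  refine ⟨fun i hi => ?_, fun i hi => ?_⟩
  · rw [h.1 i (hr.trans hi), h1]; ring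
  · rcases Nat.lt_or_ge i r with h2 | h2
    · have := h.2 i h2
      omega
    · have := h.1 i h2
      omega

theorem add_sub_le_of_strictAnti {f : ℕ → ℤ} (hf : StrictAnti f) {i j : ℕ} (hij : i ≤ j) :
    f j + (j - i) ≤ f i := by
  induction j, hij using Nat.le_induction with
  | base => simp
  | succ j hij ih =>
    have := hf (Nat.lt_succ_self j)
    push_cast
    simp only [Nat.succ_eq_add_one] at this
    omega

/-- Put an entry in front of a sequence. -/
def cons (m : ℤ) (w : SemiInfinite) : SemiInfinite :=
  ⟨fun i => Nat.casesOn i m w.1, by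
    obtain ⟨c, r, h⟩ := w.2
    refine ⟨c + 1, r + 1, fun i hi => ?_⟩
    obtain ⟨j, rfl⟩ : ∃ j, i = j + 1 := ⟨i - 1, by omega⟩
    change w.1 j = _
    rw [h j (by omega)]
    push_cast; ring⟩

theorem cons_zero (m : ℤ) (w : SemiInfinite) : (cons m w).1 0 = m := rfl

theorem cons_succ (m : ℤ) (w : SemiInfinite) (i : ℕ) : (cons m w).1 (i + 1) = w.1 i := rfl

theorem HasTail.cons {w : SemiInfinite} {c : ℤ} {r : ℕ} (h : w.HasTail c r) (m : ℤ) :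
    (cons m w).HasTail (c + 1) (r + 1) := by
  intro i hi
  obtain ⟨j, rfl⟩ : ∃ j, i = j + 1 := ⟨i - 1, by omega⟩
  rw [cons_succ, h j (by omega)]
  push_cast; ring

theorem cons_set_zero (m a : ℤ) (w : SemiInfinite) : (cons m w).set 0 a = cons a w := by
  apply ext
  rintro (_ | i)
  · rw [set_apply]; rfl
  · rw [set_apply, if_neg (by omega)]; rfl

theorem cons_set_succ (m a : ℤ) (w : SemiInfinite) (i : ℕ) :
    (cons m w).set (i + 1) a = cons m (w.set i a) := by
  apply ext
  rintro (_ | j)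
  · rw [set_apply, if_neg (by omega)]; rfl
  · rw [set_apply, cons_succ, cons_succ, set_apply]
    simp

theorem cons_setPair_succ (m s t : ℤ) (w : SemiInfinite) (i : ℕ) :
    (cons m w).setPair (i + 1) s t = cons m (w.setPair i s t) := by
  unfold setPair
  rw [cons_set_succ, cons_set_succ]

theorem cons_setPair_zero (m s t m' : ℤ) (w : SemiInfinite) :
    (cons m (cons m' w)).setPair 0 s t = cons s (cons t w) := by
  unfold setPair
  rw [cons_set_zero, cons_set_succ, cons_set_zero]

/-- The sequence `c, c - 1, c - 2, …`. -/
def descending (c : ℤ) : SemiInfinite := ⟨fun i => c - i, c, 0, fun _ _ => rfl⟩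

theorem eq_cons (w : SemiInfinite) : ∃ m v, w = cons m v := by
  obtain ⟨c, r, h⟩ := w.2
  refine ⟨w.1 0, ⟨fun i => w.1 (i + 1), c - 1, r, fun i hi => ?_⟩, ?_⟩
  · change w.1 (i + 1) = _
    rw [h _ (by omega)]; push_cast; ring
  · apply ext
    rintro (_ | i) <;> rfl

/-- This makes operators on Fock space comparable: it suffices to know them on the descending wedges
and to know how they pass creation operators. -/
theorem induction_cons {P : SemiInfinite → Prop} (h0 : ∀ c, P (descending c))
    (hs : ∀ m w, P w → P (cons m w)) (w : SemiInfinite) : P w := by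
  have key : ∀ r : ℕ, ∀ (w : SemiInfinite) (c : ℤ), w.HasTail c r → P w := by
    intro r
    induction r with
    | zero =>
      intro w c hw
      rw [show w = descending c from ext fun i => hw i (Nat.zero_le i)]
      exact h0 c
    | succ r ih =>
      intro w c hw
      obtain ⟨m, v, rfl⟩ := eq_cons w
      refine hs m v (ih v (c - 1) fun i hi => ?_)
      have := hw (i + 1) (by omega)
      rw [cons_succ] at this
      rw [this]; push_cast; ring
  obtain ⟨c, r, h⟩ := w.exists_hasTail
  exact key r w c h

end SemiInfinite

section Fock

variable {n : ℕ} (D : Twist n)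

/-- Exterior multiplication by `u_m` on the left. -/
def Twist.create (m : ℤ) : D.Fock →ₗ[ℂ] D.Fock :=
  D.lift (fun w => D.wedge (cons m w)) fun w p hp => by
    have := D.wedge_reducesAt (cons m w) (p + 1) hp
    unfold ReducesAt at this ⊢
    simp only [cons_setPair_succ] at this
    exact this

theorem Twist.create_wedge (m : ℤ) (w : SemiInfinite) :
    D.create m (D.wedge w) = D.wedge (cons m w) := D.lift_wedge _ _ w

theorem Twist.create_antisymmetric (v : D.Fock) :
    Antisymmetric D (fun s t => D.create s (D.create t v)) := by
  intro l m h
  have key : ((D.create l).comp (D.create m)) -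
      pairEval (fun s t => (D.create s).comp (D.create t)) (D.normalForm l m) = 0 := by
    apply D.ext_wedge
    intro w
    have e := map_pairEval (LinearMap.applyₗ (D.wedge w))
      (fun s t => (D.create s).comp (D.create t)) (D.normalForm l m)
    simp only [LinearMap.applyₗ_apply_apply] at e
    rw [LinearMap.sub_apply, e]
    have := D.antisymmetric_wedge (cons 0 (cons 0 w)) 0 l m h
    simp only [cons_setPair_zero, pairDefect] at this
    simpa [create_wedge] using this
  have e := map_pairEval (LinearMap.applyₗ v)
      (fun s t => (D.create s).comp (D.create t)) (D.normalForm l m)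
  simp only [LinearMap.applyₗ_apply_apply] at e
  have := congrArg (fun f => f v) key
  rw [LinearMap.sub_apply, e] at this
  exact this

/-! ### The degree filtration -/

/-- The degree of a wedge with the given tail. -/
def SemiInfinite.degree (w : SemiInfinite) (c : ℤ) (r : ℕ) : ℤ := ∑ i ∈ range r, (w.1 i - (c - i))

theorem SemiInfinite.HasTail.degree_eq {w : SemiInfinite} {c : ℤ} {r r' : ℕ} (h : w.HasTail c r)
    (hr : r ≤ r') : w.degree c r' = w.degree c r := by
  unfold degree
  rw [← sum_subset (range_subset_range.mpr hr)]
  intro i _ hi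
  rw [mem_range] at hi
  rw [h i (by omega), sub_self]

theorem SemiInfinite.degree_set {w : SemiInfinite} {c : ℤ} {r p : ℕ} (hp : p < r) (a : ℤ) :
    (w.set p a).degree c r = w.degree c r + (a - w.1 p) := by
  unfold degree
  rw [← sub_eq_iff_eq_add', ← sum_sub_distrib, sum_eq_single p]
  · rw [set_apply, if_pos rfl]; ring
  · intro i _ hi
    rw [set_apply, if_neg hi]; ring
  · intro h; exact absurd (mem_range.mpr hp) h

/-- The span of the wedges of degree at most `d`. -/
def Twist.filtration (d : ℤ) : Submodule ℂ D.Fock :=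
  Submodule.span ℂ {v | ∃ w c r, HasTail w c r ∧ w.degree c r ≤ d ∧ v = D.wedge w}

theorem Twist.wedge_mem_filtration {w : SemiInfinite} {c : ℤ} {r : ℕ} (hw : w.HasTail c r) {d : ℤ}
    (hd : w.degree c r ≤ d) : D.wedge w ∈ D.filtration d :=
  Submodule.subset_span ⟨w, c, r, hw, hd, rfl⟩

theorem Twist.filtration_mono {d d' : ℤ} (h : d ≤ d') : D.filtration d ≤ D.filtration d' := by
  refine Submodule.span_mono ?_
  rintro _ ⟨w, c, r, hw, hd, rfl⟩
  exact ⟨w, c, r, hw, hd.trans h, rfl⟩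

theorem Twist.exists_mem_filtration (v : D.Fock) : ∃ d : ℕ, v ∈ D.filtration d := by
  have : v ∈ (⨆ d : ℕ, D.filtration d : Submodule ℂ D.Fock) := by
    refine D.mem_of_wedge_mem (fun w => ?_) v
    obtain ⟨c, r, hw⟩ := w.exists_hasTail
    exact Submodule.mem_iSup_of_mem (w.degree c r).toNat
      (D.wedge_mem_filtration hw (Int.self_le_toNat _))
  rwa [Submodule.mem_iSup_of_directed] at this
  exact directed_of_isDirected_le fun i j h => D.filtration_mono (by exact_mod_cast h)

variable [NeZero n]

/-- A lowered tail entry repeats one of the k n consecutive entries that follow it. -/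
theorem Twist.wedge_shift_eq_zero_of_pos {k : ℤ} (hk : 0 < k) {w : SemiInfinite} {c : ℤ}
    {r i : ℕ} (hw : w.HasTail c r) (hi : r ≤ i) : D.wedge (w.set i (w.1 i - k * n)) = 0 := by
  have hn : (0 : ℤ) < n := by exact_mod_cast Nat.pos_of_ne_zero (NeZero.ne n)
  have hd : 0 < k * n := mul_pos hk hn
  have hwi := hw i hi
  generalize k * n = d at *
  have e : (w.set i (w.1 i - d)).1 i = c - i - d := by rw [set_apply, if_pos rfl, hwi]
  refine D.wedge_eq_zero_of_right d.natAbs _ i (c - i - 1) (fun j hj => ?_) ?_ ?_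
  · rw [set_apply, if_neg (by omega), hw _ (by omega)]
    push_cast; omega
  · rw [e]; omega
  · rw [e]; omega

/-- For k < 0 the raised entry repeats one of the |k n| entries in front of it. All of these must
belong to the tail, hence the bound. -/
theorem Twist.wedge_shift_eq_zero {k : ℤ} (hk : k ≠ 0) {w : SemiInfinite} {c : ℤ} {r i : ℕ}
    (hw : w.HasTail c r) (hi : r + (k * n).natAbs ≤ i) :
    D.wedge (w.set i (w.1 i - k * n)) = 0 := by
  rcases hk.lt_or_gt with hk | hk
  · have hn : (0 : ℤ) < n := by exact_mod_cast Nat.pos_of_ne_zero (NeZero.ne n)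
    have hd : k * n < 0 := mul_neg_of_neg_of_pos hk hn
    have hwi := hw i (by omega)
    generalize k * n = d at *
    have e : (w.set i (w.1 i - d)).1 i = c - i - d := by rw [set_apply, if_pos rfl, hwi]
    refine D.wedge_eq_zero_of_left _ (i - d.natAbs) d.natAbs (c - i + 1) (fun j hj => ?_) ?_ ?_
    · rw [set_apply, if_neg (by omega), hw _ (by omega)]
      push_cast [show d.natAbs ≤ i by omega]; omega
    · rw [Nat.sub_add_cancel (by omega), e]; omega
    · rw [Nat.sub_add_cancel (by omega), e]; omega
  · exact D.wedge_shift_eq_zero_of_pos hk hw (by omega)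

/-- The value of the current `J_k` on a wedge. -/
def Twist.currentOnWedge (k : ℤ) (w : SemiInfinite) : D.Fock :=
  ∑ᶠ i : ℕ, D.wedge (w.set i (w.1 i - k * n))

theorem Twist.currentOnWedge_eq_sum {k : ℤ} (hk : k ≠ 0) {w : SemiInfinite} {c : ℤ} {r K : ℕ}
    (hw : w.HasTail c r) (hK : r + (k * n).natAbs ≤ K) :
    D.currentOnWedge k w = ∑ i ∈ range K, D.wedge (w.set i (w.1 i - k * n)) := by
  refine finsum_eq_sum_of_support_subset _ fun i hi => ?_
  rw [Function.mem_support] at hi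
  by_contra h
  rw [mem_coe, mem_range] at h
  exact hi (D.wedge_shift_eq_zero hk hw (by omega))

/-- Summands that shift another position inherit the relation at p directly. The two that shift
position p or p + 1 satisfy it only together, by `Antisymmetric.shift`. -/
theorem Twist.currentOnWedge_antisymmetric {k : ℤ} (hk : k ≠ 0) (w : SemiInfinite) (p : ℕ) :
    Antisymmetric D (fun s t => D.currentOnWedge k (w.setPair p s t)) := by
  obtain ⟨c, r, hw⟩ := w.exists_hasTail
  set r' := max r (p + 2)
  have hw' : w.HasTail c r' := hw.mono (le_max_left _ _)
  have hp : p + 2 ≤ r' := le_max_right _ _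
  have e : (fun s t => D.currentOnWedge k (w.setPair p s t)) = fun s t =>
      (D.wedge (w.setPair p (s + n * (-k)) t) + D.wedge (w.setPair p s (t + n * (-k)))) +
      ∑ i ∈ range (r' + (k * n).natAbs) \ {p, p + 1},
        D.wedge ((w.set i (w.1 i - k * n)).setPair p s t) := by
    funext s t
    rw [D.currentOnWedge_eq_sum hk (hw'.setPair (by omega) s t) le_rfl,
      ← sum_sdiff (s₁ := {p, p + 1}), add_comm]
    · congr 1
      · rw [sum_pair (by omega)]
        congr 2
        · apply SemiInfinite.ext
          intro i
          simp only [set_apply, setPair_apply]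
          split_ifs <;> first | omega | ring
        · apply SemiInfinite.ext
          intro i
          simp only [set_apply, setPair_apply]
          split_ifs <;> first | omega | ring
      · refine sum_congr rfl fun i hi => ?_
        simp only [mem_sdiff, mem_insert, mem_singleton, not_or] at hi
        congr 1
        apply SemiInfinite.ext
        intro j
        simp only [set_apply, setPair_apply]
        split_ifs <;> omega
    · intro i
      simp only [mem_insert, mem_singleton, mem_range]
      omega
  rw [e]
  exact ((D.antisymmetric_wedge w p).shift (-k)).add
    (Antisymmetric.sum _ fun i _ => D.antisymmetric_wedge _ p)

theorem Twist.current_wedge {k : ℤ} (hk : k ≠ 0) (w : SemiInfinite) :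
    D.current k (D.wedge w) = D.currentOnWedge k w := by
  have h : ∃ T, D.IsCurrent k T :=
    ⟨D.lift (D.currentOnWedge k) (reducesAt_of_antisymmetric D
      (D.currentOnWedge_antisymmetric hk)), fun w => D.lift_wedge _ _ w⟩
  rw [Twist.current, dif_pos h]
  exact h.choose_spec w

theorem Twist.current_wedge_eq_sum {k : ℤ} (hk : k ≠ 0) {w : SemiInfinite} {c : ℤ} {r K : ℕ}
    (hw : w.HasTail c r) (hK : r + (k * n).natAbs ≤ K) :
    D.current k (D.wedge w) = ∑ i ∈ range K, D.wedge (w.set i (w.1 i - k * n)) := by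
  rw [D.current_wedge hk, D.currentOnWedge_eq_sum hk hw hK]

theorem Twist.current_create {k : ℤ} (hk : k ≠ 0) (m : ℤ) (v : D.Fock) :
    D.current k (D.create m v) = D.create (m - k * n) v + D.create m (D.current k v) := by
  have key : (D.current k).comp (D.create m) =
      D.create (m - k * n) + (D.create m).comp (D.current k) := by
    apply D.ext_wedge
    intro w
    obtain ⟨c, r, hw⟩ := w.exists_hasTail
    rw [LinearMap.comp_apply, LinearMap.add_apply, LinearMap.comp_apply, create_wedge,
      D.current_wedge_eq_sum hk (hw.cons m) (K := r + (k * n).natAbs + 1) (by omega),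
      D.current_wedge_eq_sum hk hw le_rfl, sum_range_succ', map_sum, add_comm, create_wedge]
    congr 1
    · rw [cons_set_zero, cons_zero]
    · refine sum_congr rfl fun i _ => ?_
      rw [cons_set_succ, create_wedge, cons_succ]
  exact congrArg (fun f => f v) key

theorem Twist.current_descending {k : ℤ} (hk : 0 < k) (c : ℤ) :
    D.current k (D.wedge (descending c)) = 0 := by
  have hw : (descending c).HasTail c 0 := fun i _ => rfl
  rw [D.current_wedge_eq_sum hk.ne' hw le_rfl]
  exact sum_eq_zero fun i _ => D.wedge_shift_eq_zero_of_pos hk hw (Nat.zero_le i)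

theorem Twist.create_descending {m c : ℤ} (h : m ≤ c) :
    D.create m (D.wedge (descending c)) = 0 := by
  rw [create_wedge]
  refine D.wedge_eq_zero_of_right (c - m + 1).toNat _ 0 c (fun j hj => ?_) ?_ ?_
  · rw [zero_add, add_comm, cons_succ]; rfl
  · rw [cons_zero]; omega
  · rw [cons_zero]; omega

/-- Straightening preserves the degree, and a strictly decreasing sequence with the given tail has
nonnegative degree. -/
theorem Twist.wedge_eq_zero_of_degree {w : SemiInfinite} {c : ℤ} {r : ℕ} (hw : w.HasTail c r)
    (hd : w.degree c r < 0) : D.wedge w = 0 := by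
  obtain ⟨r', hr'⟩ := exists_settled w
  set R := max r r'
  rw [← hw.degree_eq (le_max_left r r')] at hd
  refine Settled.induction (r := R) (P := fun w => w.1 R = c - R → w.degree c R < 0 →
    D.wedge w = 0) (fun w hw ih hc hd => ?_) w (hr'.mono (le_max_right _ _))
    (hw R (le_max_left _ _)) hd
  by_cases hp : ∃ p, w.1 p ≤ w.1 (p + 1)
  · obtain ⟨p, hp⟩ := hp
    have hpR := hw.lt_of_le hp
    rw [← Submodule.mem_bot ℂ]
    refine D.wedge_mem_of_reduce hp fun s t h1 h2 h3 h4 => ?_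
    have h5 := hw.setPair_inner hp (s := s) (t := t) ⟨h1, h2, h3, h4⟩
    refine ih _ h5.1 h5.2 ?_ ?_
    · rw [setPair_apply, if_neg (by omega), if_neg (by omega), hc]
    · unfold SemiInfinite.setPair
      rw [degree_set hpR, degree_set (by omega), set_apply, if_neg (by omega)]
      omega
  · push Not at hp
    refine absurd hd (not_lt.mpr (sum_nonneg fun i hi => ?_))
    rw [mem_range] at hi
    have := add_sub_le_of_strictAnti (strictAnti_nat_of_succ_lt hp) hi.le
    omega

theorem Twist.filtration_eq_bot {d : ℤ} (hd : d < 0) : D.filtration d = ⊥ := by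
  rw [filtration, Submodule.span_eq_bot]
  rintro _ ⟨w, c, r, hw, hd', rfl⟩
  exact D.wedge_eq_zero_of_degree hw (by omega)

theorem Twist.current_mem_filtration {k : ℤ} (hk : k ≠ 0) {d : ℤ} {v : D.Fock}
    (hv : v ∈ D.filtration d) : D.current k v ∈ D.filtration (d - k * n) := by
  have : D.filtration d ≤ (D.filtration (d - k * n)).comap (D.current k) := by
    refine Submodule.span_le.mpr ?_
    rintro _ ⟨w, c, r, hw, hd, rfl⟩
    rw [SetLike.mem_coe, Submodule.mem_comap, D.current_wedge_eq_sum hk hw le_rfl]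
    have hw' := hw.mono (Nat.le_add_right r (k * n).natAbs)
    refine Submodule.sum_mem _ fun i hi => D.wedge_mem_filtration (hw'.set (mem_range.mp hi) _) ?_
    rw [degree_set (mem_range.mp hi), hw.degree_eq (Nat.le_add_right _ _)]
    omega
  exact this hv

/-- On a single wedge a sufficiently small index makes the degree negative, and the vectors
admitting such a bound form a subspace. This makes all series of creation operators locally finite.
-/
theorem Twist.exists_create_eq_zero (v : D.Fock) : ∃ b : ℤ, ∀ m ≤ b, D.create m v = 0 := by
  let P : Submodule ℂ D.Fock :=
    { carrier := {v | ∃ b : ℤ, ∀ m ≤ b, D.create m v = 0}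
      add_mem' := by
        rintro v v' ⟨b, hb⟩ ⟨b', hb'⟩
        refine ⟨min b b', fun m hm => ?_⟩
        rw [map_add, hb m (hm.trans (min_le_left _ _)), hb' m (hm.trans (min_le_right _ _)),
          add_zero]
      zero_mem' := ⟨0, fun m _ => map_zero _⟩
      smul_mem' := by
        rintro a v ⟨b, hb⟩
        exact ⟨b, fun m hm => by rw [map_smul, hb m hm, smul_zero]⟩ }
  refine D.mem_of_wedge_mem (P := P) (fun w => ?_) v
  obtain ⟨c, r, hw⟩ := w.exists_hasTail
  refine ⟨c - (cons c w).degree (c + 1) (r + 1) - 1, fun m hm => ?_⟩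
  rw [create_wedge]
  refine D.wedge_eq_zero_of_degree (hw.cons m) ?_
  rw [← cons_set_zero c, degree_set (by omega), cons_zero]
  omega

end Fock

end ChargedModel

end

noncomputable section

namespace ChargedModel

open Finset SemiInfinite PowerSeries

/-! ### Exponentials of power series -/

section ExpSeries

/-- The exponential of a power series without constant term. -/
def expSeries (S : ℂ⟦X⟧) : ℂ⟦X⟧ :=
  PowerSeries.mk fun d => ∑ r ∈ range (d + 1), ((r.factorial : ℂ))⁻¹ * coeff d (S ^ r)

theorem coeff_pow_eq_zero {S : ℂ⟦X⟧} (hS : constantCoeff S = 0) {d r : ℕ} (h : d < r) :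
    coeff d (S ^ r) = 0 := by
  obtain ⟨T, rfl⟩ := X_dvd_iff.mpr hS
  rw [mul_pow]
  rw [coeff_X_pow_mul', if_neg (by omega)]

theorem coeff_expSeries {S : ℂ⟦X⟧} (hS : constantCoeff S = 0) {d N : ℕ} (h : d < N) :
    coeff d (expSeries S) = ∑ r ∈ range N, ((r.factorial : ℂ))⁻¹ * coeff d (S ^ r) := by
  rw [expSeries, coeff_mk]
  refine sum_subset (range_subset_range.mpr h) fun r _ hr => ?_
  rw [mem_range] at hr
  rw [coeff_pow_eq_zero hS (by omega), mul_zero]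

theorem constantCoeff_expSeries (S : ℂ⟦X⟧) : constantCoeff (expSeries S) = 1 := by
  rw [← coeff_zero_eq_constantCoeff_apply, expSeries, coeff_mk]
  simp

theorem derivative_expSeries {S : ℂ⟦X⟧} (hS : constantCoeff S = 0) :
    d⁄dX ℂ (expSeries S) = d⁄dX ℂ S * expSeries S := by
  ext d
  rw [coeff_derivative, coeff_expSeries hS (Nat.lt_succ_self (d + 1)), sum_range_succ', add_mul,
    sum_mul, coeff_mul]
  have h0 : ((Nat.factorial 0 : ℂ))⁻¹ * coeff (d + 1) (S ^ 0) * ((d : ℂ) + 1) = 0 := by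
    simp [coeff_one]
  rw [h0, add_zero]
  have h1 : ∀ p ∈ antidiagonal d, coeff p.1 (d⁄dX ℂ S) * coeff p.2 (expSeries S) =
      ∑ r ∈ range (d + 1), ((r.factorial : ℂ))⁻¹ *
        (coeff p.1 (d⁄dX ℂ S) * coeff p.2 (S ^ r)) := by
    intro p hp
    rw [HasAntidiagonal.mem_antidiagonal] at hp
    rw [coeff_expSeries hS (show p.2 < d + 1 by omega), mul_sum]
    exact sum_congr rfl fun r _ => by ring
  rw [sum_congr rfl h1, sum_comm]
  refine sum_congr rfl fun r _ => ?_
  rw [← mul_sum, ← coeff_mul, mul_assoc, ← coeff_derivative, Derivation.leibniz_pow]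
  rw [Nat.add_sub_cancel, smul_eq_mul, nsmul_eq_mul, mul_comm (S ^ r)]
  rw [← map_natCast (C (R := ℂ)), coeff_C_mul, ← mul_assoc, Nat.factorial_succ]
  congr 1
  push_cast
  field_simp

theorem eq_of_derivative_eq_mul {F G L : ℂ⟦X⟧} (hF : d⁄dX ℂ F = L * F) (hG : d⁄dX ℂ G = L * G)
    (h0 : constantCoeff F = constantCoeff G) : F = G := by
  have key : ∀ d, ∀ e ≤ d, coeff e F = coeff e G := by
    intro d
    induction d with
    | zero =>
      intro e he
      obtain rfl : e = 0 := by omega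
      simpa using h0
    | succ d ih =>
      intro e he
      rcases Nat.lt_or_ge e (d + 1) with h | h
      · exact ih e (by omega)
      · obtain rfl : e = d + 1 := by omega
        have hd : ((d : ℂ) + 1) ≠ 0 := by exact_mod_cast Nat.succ_ne_zero d
        apply mul_right_cancel₀ hd
        rw [← coeff_derivative, ← coeff_derivative, hF, hG, coeff_mul, coeff_mul]
        refine sum_congr rfl fun p hp => ?_
        rw [HasAntidiagonal.mem_antidiagonal] at hp
        rw [ih p.2 (by omega)]
  ext d
  exact key d d le_rfl

theorem eq_expSeries {S F : ℂ⟦X⟧} (hS : constantCoeff S = 0) (hF : d⁄dX ℂ F = d⁄dX ℂ S * F)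
    (h0 : constantCoeff F = 1) : F = expSeries S :=
  eq_of_derivative_eq_mul hF (derivative_expSeries hS) (by rw [h0, constantCoeff_expSeries])

theorem expSeries_add {S T : ℂ⟦X⟧} (hS : constantCoeff S = 0) (hT : constantCoeff T = 0) :
    expSeries (S + T) = expSeries S * expSeries T := by
  refine (eq_expSeries (by rw [map_add, hS, hT, add_zero]) ?_ ?_).symm
  · rw [Derivation.leibniz, derivative_expSeries hS, derivative_expSeries hT, map_add, smul_eq_mul,
      smul_eq_mul]
    ring
  · rw [map_mul, constantCoeff_expSeries, constantCoeff_expSeries, one_mul]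

theorem expSeries_zero : expSeries 0 = 1 :=
  (eq_expSeries (map_zero _) (by simp) (map_one _)).symm

/-- The logarithmic derivative of the exponential recovers the derivative of the exponent, and the
constant terms agree. -/
theorem expSeries_injective {S T : ℂ⟦X⟧} (hS : constantCoeff S = 0) (hT : constantCoeff T = 0)
    (h : expSeries S = expSeries T) : S = T := by
  have h1 := derivative_expSeries hS
  rw [h, derivative_expSeries hT] at h1
  have h2 : expSeries T ≠ 0 := by
    intro h
    have := constantCoeff_expSeries T
    rw [h, map_zero] at this
    exact zero_ne_one this
  have h3 := mul_right_cancel₀ h2 h1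
  exact (PowerSeries.derivative.ext h3 (by rw [hS, hT])).symm

end ExpSeries

/-! ### Locally finite sums of linear maps -/

section LocallyFinite

theorem sum_antidiagonal_eq_sum_rect {G : Type*} [AddCommMonoid G] {F : ℕ → ℕ → G} {I J N : ℕ}
    (hN : I + J ≤ N)
    (hI : ∀ i j, I ≤ i → F i j = 0) (hJ : ∀ i j, J ≤ j → F i j = 0) :
    ∑ r ∈ range N, ∑ p ∈ antidiagonal r, F p.1 p.2 = ∑ i ∈ range I, ∑ j ∈ range J, F i j := by
  simp only [Nat.sum_antidiagonal_eq_sum_range_succ F]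
  rw [sum_range_diag_flip]
  symm
  refine sum_subset_zero_on_sdiff (range_subset_range.mpr (by omega)) (fun i hi => ?_)
    fun i hi => ?_
  · simp only [mem_sdiff, mem_range, not_lt] at hi
    exact sum_eq_zero fun j _ => hI i j hi.2
  · rw [mem_range] at hi
    refine sum_subset_zero_on_sdiff (range_subset_range.mpr (by omega)) (fun j hj => ?_)
      fun _ _ => rfl
    simp only [mem_sdiff, mem_range, not_lt] at hj
    exact hJ i j hj.2

variable {V W ι : Type*} [AddCommGroup V] [Module ℂ V] [AddCommGroup W] [Module ℂ W]

/-- Only finitely many of the maps are nonzero at each vector. -/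
def LocallyFinite (T : ι → V →ₗ[ℂ] W) : Prop := ∀ v, (Function.support fun i => T i v).Finite

/-- The sum of a locally finite family of linear maps. -/
def locSum (T : ι → V →ₗ[ℂ] W) (h : LocallyFinite T) : V →ₗ[ℂ] W where
  toFun v := ∑ᶠ i, T i v
  map_add' v v' := by
    simp only [map_add]
    exact finsum_add_distrib (h v) (h v')
  map_smul' a v := by
    simp only [map_smul, RingHom.id_apply]
    exact (smul_finsum' a (h v)).symm

theorem locSum_apply {T : ι → V →ₗ[ℂ] W} (h : LocallyFinite T) {v : V} (A : Finset ι)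
    (hA : ∀ i, i ∉ A → T i v = 0) : locSum T h v = ∑ i ∈ A, T i v := by
  refine finsum_eq_sum_of_support_subset _ fun i hi => ?_
  by_contra hi'
  exact hi (hA i hi')

theorem locallyFinite_of_eventually {T : ℕ → V →ₗ[ℂ] W}
    (h : ∀ v, ∃ K, ∀ k, K ≤ k → T k v = 0) : LocallyFinite T := by
  intro v
  obtain ⟨K, hK⟩ := h v
  refine (Set.finite_lt_nat K).subset fun i hi => ?_
  by_contra hi'
  exact hi (hK i (not_lt.mp hi'))

theorem locSum_apply_range {T : ℕ → V →ₗ[ℂ] W} (h : LocallyFinite T) {v : V} {K : ℕ}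
    (hK : ∀ k, K ≤ k → T k v = 0) : locSum T h v = ∑ k ∈ range K, T k v :=
  locSum_apply h _ fun i hi => hK i (by simpa using hi)

end LocallyFinite

/-! ### Vertex operators and exponentials of Hamiltonians -/

section Hamiltonian

variable {n : ℕ} [NeZero n] (D : Twist n)

theorem Twist.exists_create_sub_eq_zero (m : ℤ) (v : D.Fock) :
    ∃ K : ℕ, ∀ k : ℕ, K ≤ k → D.create (m - n * k) v = 0 := by
  have hn : 1 ≤ n := Nat.pos_of_ne_zero (NeZero.ne n)
  obtain ⟨b, hb⟩ := D.exists_create_eq_zero v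
  refine ⟨(m - b).toNat, fun k hk => hb _ ?_⟩
  have : (1 : ℤ) * k ≤ n * k := by gcongr; exact_mod_cast hn
  omega

theorem Twist.series_locallyFinite (f : ℂ⟦X⟧) (m : ℤ) :
    LocallyFinite fun k : ℕ => coeff k f • D.create (m - n * k) := by
  refine locallyFinite_of_eventually fun v => ?_
  obtain ⟨K, hK⟩ := D.exists_create_sub_eq_zero m v
  exact ⟨K, fun k hk => by rw [LinearMap.smul_apply, hK k hk, smul_zero]⟩

/-- The operator `∑_k f_k ψ_{m - n k}` for a power series `f = ∑_k f_k X^k`. -/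
def Twist.series (f : ℂ⟦X⟧) (m : ℤ) : D.Fock →ₗ[ℂ] D.Fock :=
  locSum _ (D.series_locallyFinite f m)

theorem Twist.series_apply (f : ℂ⟦X⟧) {m : ℤ} {v : D.Fock} {K : ℕ}
    (hK : ∀ k : ℕ, K ≤ k → D.create (m - n * k) v = 0) :
    D.series f m v = ∑ k ∈ range K, coeff k f • D.create (m - n * k) v :=
  locSum_apply_range (D.series_locallyFinite f m)
    fun k hk => by rw [LinearMap.smul_apply, hK k hk, smul_zero]

theorem Twist.series_one (m : ℤ) : D.series 1 m = D.create m := by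
  refine LinearMap.ext fun v => ?_
  obtain ⟨K, hK⟩ := D.exists_create_sub_eq_zero m v
  rw [D.series_apply 1 (K := K + 1) (fun k hk => hK k (by omega)), sum_range_succ',
    sum_eq_zero]
  · simp
  · intro k _
    simp [coeff_one]

theorem Twist.series_mul (f g : ℂ⟦X⟧) {m : ℤ} {v : D.Fock} {K : ℕ}
    (hK : ∀ k : ℕ, K ≤ k → D.create (m - n * k) v = 0) :
    D.series (f * g) m v = ∑ k ∈ range K, coeff k f • D.series g (m - n * k) v := by
  have hK' : ∀ i j : ℕ, K ≤ i + j → D.create (m - n * i - n * j) v = 0 := by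
    intro i j h
    have := hK (i + j) h
    push_cast at this
    rwa [mul_add, ← sub_sub] at this
  rw [D.series_apply (f * g) (K := K + K) (fun k hk => hK k (by omega))]
  have h1 : ∀ k ∈ range K, coeff k f • D.series g (m - n * k) v =
      ∑ j ∈ range K, (coeff k f * coeff j g) • D.create (m - n * k - n * j) v := by
    intro k _
    rw [D.series_apply g (K := K) (fun j hj => hK' k j (by omega)), smul_sum]
    simp only [smul_smul]
  rw [sum_congr rfl h1, ← sum_antidiagonal_eq_sum_rect
    (F := fun i j => (coeff i f * coeff j g) • D.create (m - n * i - n * j) v) (N := K + K) le_rfl]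
  · refine sum_congr rfl fun k _ => ?_
    rw [coeff_mul, sum_smul]
    refine sum_congr rfl fun p hp => ?_
    rw [HasAntidiagonal.mem_antidiagonal] at hp
    rw [← hp]
    push_cast
    rw [mul_add, ← sub_sub]
  · intro i j hi
    rw [hK' i j (by omega), smul_zero]
  · intro i j hj
    rw [hK' i j (by omega), smul_zero]

theorem Twist.series_add (f g : ℂ⟦X⟧) (m : ℤ) (v : D.Fock) :
    D.series (f + g) m v = D.series f m v + D.series g m v := by
  obtain ⟨K, hK⟩ := D.exists_create_sub_eq_zero m v
  simp only [D.series_apply _ hK, ← sum_add_distrib, map_add, add_smul]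

theorem Twist.series_smul (a : ℂ) (f : ℂ⟦X⟧) (m : ℤ) (v : D.Fock) :
    D.series (a • f) m v = a • D.series f m v := by
  obtain ⟨K, hK⟩ := D.exists_create_sub_eq_zero m v
  simp only [D.series_apply _ hK, smul_sum, coeff_smul, smul_smul, smul_eq_mul]

theorem Twist.current_eq_zero {d : ℕ} {v : D.Fock} (hv : v ∈ D.filtration d) {k : ℕ} (hk : d < k) :
    D.current k v = 0 := by
  have hn : 1 ≤ n := Nat.pos_of_ne_zero (NeZero.ne n)
  have := D.current_mem_filtration (k := k) (by exact_mod_cast (by omega : k ≠ 0)) hv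
  rwa [D.filtration_eq_bot, Submodule.mem_bot] at this
  have : (k : ℤ) * 1 ≤ k * n := by gcongr; exact_mod_cast hn
  omega

theorem Twist.hamiltonian_locallyFinite (S : ℂ⟦X⟧) :
    LocallyFinite fun k : ℕ => if k = 0 then 0 else coeff k S • D.current k := by
  refine locallyFinite_of_eventually fun v => ?_
  obtain ⟨d, hd⟩ := D.exists_mem_filtration v
  refine ⟨d + 1, fun k hk => ?_⟩
  rw [if_neg (by omega), LinearMap.smul_apply, D.current_eq_zero hd (by omega), smul_zero]

/-- The Hamiltonian `∑_{k ≥ 1} s_k J_k` for the power series `S = ∑_k s_k X^k`. -/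
def Twist.hamiltonian (S : ℂ⟦X⟧) : D.Fock →ₗ[ℂ] D.Fock := locSum _ (D.hamiltonian_locallyFinite S)

theorem Twist.hamiltonian_apply (S : ℂ⟦X⟧) {d K : ℕ} {v : D.Fock} (hv : v ∈ D.filtration d)
    (hK : d ≤ K) : D.hamiltonian S v =
      ∑ k ∈ range K, coeff (k + 1) S • D.current ((k : ℤ) + 1) v := by
  rw [hamiltonian, locSum_apply_range _ (K := K + 1), sum_range_succ']
  · simp
  · intro k hk
    rw [if_neg (by omega), LinearMap.smul_apply, D.current_eq_zero hv (by omega), smul_zero]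

theorem Twist.hamiltonian_mem_filtration (S : ℂ⟦X⟧) {d : ℕ} {v : D.Fock}
    (hv : v ∈ D.filtration d) : D.hamiltonian S v ∈ D.filtration ((d : ℤ) - 1) := by
  have hn : 1 ≤ n := Nat.pos_of_ne_zero (NeZero.ne n)
  rw [D.hamiltonian_apply S hv le_rfl]
  refine Submodule.sum_mem _ fun k _ => Submodule.smul_mem _ _
    (D.filtration_mono ?_ (D.current_mem_filtration (by omega) hv))
  have : ((k : ℤ) + 1) * 1 ≤ (k + 1) * n := by gcongr; exact_mod_cast hn
  omega

/-- The Hamiltonian lowers the degree filtration by at least one, and the part of negative degree is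
zero; so it is locally nilpotent. -/
theorem Twist.hamiltonian_pow_eq_zero (S : ℂ⟦X⟧) {d : ℕ} : ∀ {v : D.Fock}, v ∈ D.filtration d →
    ∀ {r : ℕ}, d < r → (D.hamiltonian S ^ r) v = 0 := by
  induction d with
  | zero =>
    intro v hv r hr
    have := D.hamiltonian_mem_filtration S hv
    rw [D.filtration_eq_bot (by simp), Submodule.mem_bot] at this
    obtain ⟨r, rfl⟩ : ∃ r', r = r' + 1 := ⟨r - 1, by omega⟩
    rw [pow_succ, Module.End.mul_apply, this, map_zero]
  | succ d ih =>
    intro v hv r hr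
    obtain ⟨r, rfl⟩ : ∃ r', r = r' + 1 := ⟨r - 1, by omega⟩
    rw [pow_succ, Module.End.mul_apply]
    have := D.hamiltonian_mem_filtration S hv
    push_cast at this
    rw [add_sub_cancel_right] at this
    exact ih this (by omega)

theorem Twist.hamiltonian_create {S : ℂ⟦X⟧} (hS : constantCoeff S = 0) (m : ℤ) (v : D.Fock) :
    D.hamiltonian S (D.create m v) = D.create m (D.hamiltonian S v) + D.series S m v := by
  obtain ⟨d, hd⟩ := D.exists_mem_filtration v
  obtain ⟨d', hd'⟩ := D.exists_mem_filtration (D.create m v)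
  obtain ⟨K, hK⟩ := D.exists_create_sub_eq_zero m v
  set N := max (max d d') K
  rw [D.hamiltonian_apply S hd (K := N) (by omega), D.hamiltonian_apply S hd' (K := N) (by omega),
    D.series_apply S (K := N + 1) (fun k hk => hK k (by omega)), sum_range_succ' _ N,
    coeff_zero_eq_constantCoeff_apply, hS, zero_smul, add_zero, map_sum, ← sum_add_distrib]
  refine sum_congr rfl fun k _ => ?_
  rw [D.current_create (by omega), map_smul, smul_add, add_comm]
  push_cast
  rw [mul_comm (n : ℤ)]

theorem Twist.hamiltonian_series {S : ℂ⟦X⟧} (hS : constantCoeff S = 0) (f : ℂ⟦X⟧) (m : ℤ)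
    (v : D.Fock) : D.hamiltonian S (D.series f m v) =
      D.series (S * f) m v + D.series f m (D.hamiltonian S v) := by
  obtain ⟨K, hK⟩ := D.exists_create_sub_eq_zero m v
  obtain ⟨K', hK'⟩ := D.exists_create_sub_eq_zero m (D.hamiltonian S v)
  set N := max K K'
  have h1 : ∀ k : ℕ, N ≤ k → D.create (m - n * k) v = 0 := fun k hk => hK k (by omega)
  rw [mul_comm, D.series_mul f S h1, D.series_apply f h1,
    D.series_apply f (K := N) (fun k hk => hK' k (by omega)), map_sum, ← sum_add_distrib]
  refine sum_congr rfl fun k _ => ?_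
  rw [map_smul, D.hamiltonian_create hS, smul_add, add_comm]

theorem Twist.hamiltonian_descending (S : ℂ⟦X⟧) (c : ℤ) :
    D.hamiltonian S (D.wedge (descending c)) = 0 := by
  obtain ⟨d, hd⟩ := D.exists_mem_filtration (D.wedge (descending c))
  rw [D.hamiltonian_apply S hd le_rfl]
  refine sum_eq_zero fun k _ => ?_
  rw [D.current_descending (by omega), smul_zero]

theorem Twist.expH_locallyFinite (S : ℂ⟦X⟧) :
    LocallyFinite fun r : ℕ => ((r.factorial : ℂ))⁻¹ • D.hamiltonian S ^ r := by
  refine locallyFinite_of_eventually fun v => ?_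
  obtain ⟨d, hd⟩ := D.exists_mem_filtration v
  refine ⟨d + 1, fun k hk => ?_⟩
  rw [LinearMap.smul_apply, D.hamiltonian_pow_eq_zero S hd (by omega), smul_zero]

/-- The exponential of the Hamiltonian `∑_{k ≥ 1} s_k J_k`. -/
def Twist.expH (S : ℂ⟦X⟧) : D.Fock →ₗ[ℂ] D.Fock := locSum _ (D.expH_locallyFinite S)

theorem Twist.expH_apply (S : ℂ⟦X⟧) {v : D.Fock} {K : ℕ}
    (hK : ∀ r, K ≤ r → (D.hamiltonian S ^ r) v = 0) :
    D.expH S v = ∑ r ∈ range K, ((r.factorial : ℂ))⁻¹ • (D.hamiltonian S ^ r) v :=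
  locSum_apply_range (D.expH_locallyFinite S)
    fun r hr => by rw [LinearMap.smul_apply, hK r hr, smul_zero]

theorem Twist.expH_descending (S : ℂ⟦X⟧) (c : ℤ) :
    D.expH S (D.wedge (descending c)) = D.wedge (descending c) := by
  rw [D.expH_apply S (K := 1)]
  · simp
  · intro r hr
    obtain ⟨r, rfl⟩ : ∃ r', r = r' + 1 := ⟨r - 1, by omega⟩
    rw [pow_succ, Module.End.mul_apply, hamiltonian_descending, map_zero]

/-- The operators `∑_k f_k ψ_{m - n k}` as a bilinear map in `f` and the vector. -/
def Twist.seriesTensor (m : ℤ) : TensorProduct ℂ ℂ⟦X⟧ D.Fock →ₗ[ℂ] D.Fock :=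
  TensorProduct.lift (LinearMap.mk₂ ℂ (fun f v => D.series f m v)
    (fun f g v => D.series_add f g m v) (fun a f v => D.series_smul a f m v)
    (fun _ v v' => map_add _ v v') (fun a _ v => map_smul _ a v))

/-- On pairs (f, v) the Hamiltonian acts as the sum of multiplication of f by S and its action on v.
These commute on the tensor product, where the binomial theorem applies. -/
theorem Twist.hamiltonian_pow_series {S : ℂ⟦X⟧} (hS : constantCoeff S = 0) (f : ℂ⟦X⟧) (m : ℤ)
    (v : D.Fock) (r : ℕ) : (D.hamiltonian S ^ r) (D.series f m v) =
      ∑ p ∈ antidiagonal r, (r.choose p.1 : ℂ) •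
        D.series (S ^ p.1 * f) m ((D.hamiltonian S ^ p.2) v) := by
  set A := LinearMap.rTensor D.Fock (LinearMap.mulLeft ℂ S)
  set B := LinearMap.lTensor ℂ⟦X⟧ (D.hamiltonian S)
  have h1 : (D.hamiltonian S).comp (D.seriesTensor m) = (D.seriesTensor m).comp (A + B) := by
    apply TensorProduct.ext'
    intro f v
    simp [A, B, seriesTensor, D.hamiltonian_series hS]
  have h2 : ∀ (r : ℕ) x, (D.hamiltonian S ^ r) (D.seriesTensor m x) =
      D.seriesTensor m (((A + B) ^ r) x) := by
    intro r
    induction r with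
    | zero => intro x; simp
    | succ r ih =>
      intro x
      rw [pow_succ, pow_succ, Module.End.mul_apply, Module.End.mul_apply, ← ih]
      congr 1
      exact congrArg (fun g => g x) h1
  have hc : Commute A B := by
    apply TensorProduct.ext'
    intro f v
    simp [A, B]
  have h3 := h2 r (TensorProduct.tmul ℂ f v)
  rw [hc.add_pow'] at h3
  have hA : ∀ (i : ℕ) (f : ℂ⟦X⟧) (v : D.Fock), (A ^ i) (TensorProduct.tmul ℂ f v) =
      TensorProduct.tmul ℂ (S ^ i * f) v := by
    intro i f v
    rw [LinearMap.rTensor_pow, LinearMap.rTensor_tmul, LinearMap.pow_mulLeft,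
      LinearMap.mulLeft_apply]
  have hB : ∀ (i : ℕ) (f : ℂ⟦X⟧) (v : D.Fock), (B ^ i) (TensorProduct.tmul ℂ f v) =
      TensorProduct.tmul ℂ f ((D.hamiltonian S ^ i) v) := by
    intro i f v
    rw [LinearMap.lTensor_pow, LinearMap.lTensor_tmul]
  rw [LinearMap.sum_apply, map_sum] at h3
  refine h3.trans (sum_congr rfl fun p _ => ?_)
  rw [LinearMap.smul_apply, Module.End.mul_apply, hB, hA, map_nsmul, Nat.cast_smul_eq_nsmul]
  rfl

/-- Conjugation by e^H multiplies the coefficient series by e^S. The binomial expansion of the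
powers of H splits the double sum into the product of the two exponentials. -/
theorem Twist.expH_series {S : ℂ⟦X⟧} (hS : constantCoeff S = 0) (f : ℂ⟦X⟧) (m : ℤ)
    (v : D.Fock) : D.expH S (D.series f m v) = D.series (expSeries S * f) m (D.expH S v) := by
  obtain ⟨d, hd⟩ := D.exists_mem_filtration v
  obtain ⟨d', hd'⟩ := D.exists_mem_filtration (D.series f m v)
  choose K hK using fun u : D.Fock => D.exists_create_sub_eq_zero m u
  set u : ℕ → D.Fock := fun j => (D.hamiltonian S ^ j) v
  -- From index `I` on the creation operators kill all the vectors H^j v. Hence only coefficients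
  -- below `I` count, and to these the powers S^i with i ≥ I do not contribute.
  set I := (range (d + 1)).sup fun j => K (u j)
  have hu : ∀ j, d < j → u j = 0 := fun j hj => D.hamiltonian_pow_eq_zero S hd hj
  have hI : ∀ j k : ℕ, I ≤ k → D.create (m - n * k) (u j) = 0 := by
    intro j k hk
    rcases Nat.lt_or_ge d j with h | h
    · rw [hu j h, map_zero]
    · refine hK (u j) k (le_trans ?_ hk)
      exact le_sup (f := fun j => K (u j)) (mem_range.mpr (by omega))
  have hcoeff : ∀ i, ∀ k ∈ range I, I ≤ i → coeff k (S ^ i * f) = 0 := by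
    intro i k hk hi
    rw [mem_range] at hk
    rw [coeff_mul]
    refine sum_eq_zero fun p hp => ?_
    rw [HasAntidiagonal.mem_antidiagonal] at hp
    rw [coeff_pow_eq_zero hS (by omega), zero_mul]
  set F : ℕ → ℕ → D.Fock := fun i j =>
    (((i.factorial : ℂ))⁻¹ * ((j.factorial : ℂ))⁻¹) • D.series (S ^ i * f) m (u j) with hF
  set N := I + (d + 1) + (d' + 1)
  have hL : D.expH S (D.series f m v) = ∑ r ∈ range N, ∑ p ∈ antidiagonal r, F p.1 p.2 := by
    rw [D.expH_apply S (K := N) (fun r hr => D.hamiltonian_pow_eq_zero S hd' (by omega))]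
    refine sum_congr rfl fun r _ => ?_
    rw [D.hamiltonian_pow_series hS, smul_sum]
    refine sum_congr rfl fun p hp => ?_
    rw [HasAntidiagonal.mem_antidiagonal] at hp
    rw [hF, smul_smul]
    congr 1
    subst hp
    have h1 : ((p.1 + p.2).choose p.1 : ℂ) * p.1.factorial * p.2.factorial =
        (p.1 + p.2).factorial := by
      exact_mod_cast Nat.choose_symm_add ▸ Nat.add_choose_mul_factorial_mul_factorial p.1 p.2
    have h2 : ((p.1 + p.2).factorial : ℂ) ≠ 0 := by exact_mod_cast Nat.factorial_ne_zero _
    have h3 : (p.1.factorial : ℂ) ≠ 0 := by exact_mod_cast Nat.factorial_ne_zero _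
    have h4 : (p.2.factorial : ℂ) ≠ 0 := by exact_mod_cast Nat.factorial_ne_zero _
    field_simp
    linear_combination h1
  rw [hL, sum_antidiagonal_eq_sum_rect (I := I) (J := d + 1) (by omega), sum_comm,
    D.expH_apply S (K := d + 1) (fun r hr => D.hamiltonian_pow_eq_zero S hd (by omega)), map_sum]
  · refine sum_congr rfl fun j _ => ?_
    rw [map_smul]
    change _ = _ • D.series _ m (u j)
    rw [D.series_apply _ (hI j), smul_sum]
    simp only [hF, D.series_apply _ (hI j), smul_sum]
    rw [sum_comm]
    refine sum_congr rfl fun k hk => ?_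
    simp only [smul_smul, ← sum_smul]
    congr 1
    rw [coeff_mul, mul_sum]
    simp only [mul_assoc, coeff_mul]
    simp only [mul_sum]
    rw [sum_comm]
    refine sum_congr rfl fun p hp => ?_
    rw [HasAntidiagonal.mem_antidiagonal] at hp
    rw [mem_range] at hk
    rw [coeff_expSeries hS (show p.1 < I by omega), sum_mul, mul_sum]
    exact sum_congr rfl fun i _ => by ring
  · intro i j hi
    rw [hF]
    simp only
    rw [D.series_apply _ (hI j), sum_eq_zero, smul_zero]
    intro k hk
    rw [hcoeff i k hk hi, zero_smul]
  · intro i j hj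
    rw [hF]
    simp only
    rw [hu j (by omega), map_zero, smul_zero]

theorem Twist.expH_create {S : ℂ⟦X⟧} (hS : constantCoeff S = 0) (m : ℤ) (v : D.Fock) :
    D.expH S (D.create m v) = D.series (expSeries S) m (D.expH S v) := by
  rw [← D.series_one, D.expH_series hS, mul_one]

/-- Both sides fix the descending wedges and pass creation operators through the same series, so
they agree by induction on the factors. Commutativity of the currents is not needed. -/
theorem Twist.expH_add {S T : ℂ⟦X⟧} (hS : constantCoeff S = 0) (hT : constantCoeff T = 0) :
    D.expH (S + T) = (D.expH S).comp (D.expH T) := by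
  apply D.ext_wedge
  intro w
  refine induction_cons (P := fun w => D.expH (S + T) (D.wedge w) =
    (D.expH S).comp (D.expH T) (D.wedge w)) (fun c => ?_) (fun m w ih => ?_) w
  · simp only [LinearMap.comp_apply, expH_descending]
  · rw [LinearMap.comp_apply] at ih ⊢
    rw [← create_wedge, D.expH_create (by rw [map_add, hS, hT, add_zero]), ih, D.expH_create hT,
      D.expH_series hS, expSeries_add hS hT]

theorem Twist.expH_zero : D.expH 0 = LinearMap.id := by
  apply D.ext_wedge
  intro w
  refine induction_cons (P := fun w => D.expH 0 (D.wedge w) =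
    LinearMap.id (D.wedge w)) (fun c => ?_) (fun m w ih => ?_) w
  · simp only [LinearMap.id_apply, expH_descending]
  · rw [LinearMap.id_apply] at ih ⊢
    rw [← create_wedge, D.expH_create (map_zero _), ih, expSeries_zero, series_one]

end Hamiltonian

end ChargedModel

end

noncomputable section

namespace ChargedModel

open Finset SemiInfinite

/-! ### The vectors of strict partitions -/

section PartitionSeq

theorem partitionSeq_apply_of_lt {lam : Finset ℕ} {i : ℕ} (h : i < lam.card) :
    (partitionSeq lam).1 i = (lam.orderEmbOfFin rfl (Fin.rev ⟨i, h⟩) : ℤ) := by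
  simp [partitionSeq, h]

theorem partitionSeq_hasTail (lam : Finset ℕ) :
    (partitionSeq lam).HasTail ((lam.card : ℤ) - 1) lam.card := by
  intro i hi
  simp [partitionSeq, not_lt.mpr hi]

theorem partitionSeq_exists_mem {lam : Finset ℕ} {i : ℕ} (h : i < lam.card) :
    ∃ x ∈ lam, (partitionSeq lam).1 i = x :=
  ⟨_, orderEmbOfFin_mem lam rfl _, partitionSeq_apply_of_lt h⟩

theorem partitionSeq_normallyOrdered (lam : Finset ℕ) : (partitionSeq lam).NormallyOrdered := by
  refine strictAnti_nat_of_succ_lt fun i => ?_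
  rcases Nat.lt_or_ge (i + 1) lam.card with h | h
  · rw [partitionSeq_apply_of_lt h, partitionSeq_apply_of_lt (by omega : i < lam.card)]
    have : Fin.rev ⟨i + 1, h⟩ < Fin.rev (⟨i, by omega⟩ : Fin lam.card) := by
      rw [Fin.rev_lt_rev]; exact Fin.mk_lt_mk.mpr (Nat.lt_succ_self i)
    exact_mod_cast (lam.orderEmbOfFin rfl).strictMono this
  · rw [partitionSeq_hasTail lam _ h]
    rcases Nat.lt_or_ge i lam.card with h' | h'
    · obtain ⟨x, -, hx⟩ := partitionSeq_exists_mem h'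
      rw [hx]; push_cast; omega
    · rw [partitionSeq_hasTail lam _ h']; push_cast; omega

theorem partitionSeq_eq {lam : Finset ℕ} {w : SemiInfinite} (hw : w.NormallyOrdered)
    (hmem : ∀ i < lam.card, ∃ x ∈ lam, w.1 i = x)
    (htail : w.HasTail ((lam.card : ℤ) - 1) lam.card) : partitionSeq lam = w := by
  apply SemiInfinite.ext
  intro i
  rcases Nat.lt_or_ge i lam.card with h | h
  · have hf := orderEmbOfFin_unique (s := lam) (k := lam.card) rfl
      (f := fun x => (w.1 (Fin.rev x)).toNat) (fun x => by
        obtain ⟨y, hy, e⟩ := hmem (Fin.rev x) (Fin.rev x).2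
        rw [e]; simpa using hy) (fun x y hxy => by
        obtain ⟨a, -, ha⟩ := hmem (Fin.rev x) (Fin.rev x).2
        obtain ⟨b, -, hb⟩ := hmem (Fin.rev y) (Fin.rev y).2
        have : w.1 (Fin.rev x) < w.1 (Fin.rev y) := hw (Fin.rev_lt_rev.mpr hxy)
        change (w.1 (Fin.rev x)).toNat < (w.1 (Fin.rev y)).toNat
        omega)
    rw [partitionSeq_apply_of_lt h, ← hf]
    obtain ⟨a, -, ha⟩ := hmem i h
    simp only [Fin.rev_rev]
    rw [ha]; simp
  · rw [partitionSeq_hasTail lam i h, htail i h]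

theorem exists_partitionSeq_eq {w : SemiInfinite} (hw : w.NormallyOrdered) {l M : ℕ}
    (htail : w.HasTail ((l : ℤ) - 1) l) (hM : ∀ i < l, w.1 i ≤ M) :
    ∃ nu : Finset ℕ, (∀ x ∈ nu, x ≤ M) ∧ nu.card = l ∧ partitionSeq nu = w := by
  have hpos : ∀ i < l, 0 ≤ w.1 i := by
    intro i hi
    have := hw hi
    rw [htail l le_rfl] at this
    omega
  have hinj : Set.InjOn (fun i => (w.1 i).toNat) (range l) := by
    intro i hi j hj hij
    simp only [coe_range, Set.mem_Iio] at hi hj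
    have h1 := hpos i hi
    have h2 := hpos j hj
    exact hw.injective (show w.1 i = w.1 j by simp only at hij; omega)
  have hcard : ((range l).image fun i => (w.1 i).toNat).card = l := by
    rw [card_image_of_injOn hinj, card_range]
  refine ⟨(range l).image fun i => (w.1 i).toNat, fun x hx => ?_, hcard, partitionSeq_eq hw ?_ ?_⟩
  · simp only [mem_image, mem_range] at hx
    obtain ⟨i, hi, rfl⟩ := hx
    have := hM i hi
    omega
  · rw [hcard]
    exact fun i hi => ⟨_, mem_image_of_mem _ (mem_range.mpr hi), by have := hpos i hi; omega⟩
  · rw [hcard]; exact htail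

theorem mem_iff_partitionSeq {lam : Finset ℕ} {x : ℕ} :
    x ∈ lam ↔ ∃ i, (partitionSeq lam).1 i = x := by
  constructor
  · intro hx
    have : (x : ℕ) ∈ Set.range (lam.orderEmbOfFin rfl) := by rwa [range_orderEmbOfFin]
    obtain ⟨y, hy⟩ := this
    refine ⟨(Fin.rev y : ℕ), ?_⟩
    rw [partitionSeq_apply_of_lt (Fin.rev y).2, ← hy, Fin.eta, Fin.rev_rev]
  · rintro ⟨i, hi⟩
    rcases Nat.lt_or_ge i lam.card with h | h
    · obtain ⟨y, hy, e⟩ := partitionSeq_exists_mem h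
      rw [e] at hi
      rwa [← (by exact_mod_cast hi : y = x)]
    · rw [partitionSeq_hasTail lam i h] at hi
      omega

theorem partitionSeq_injective : Function.Injective partitionSeq := by
  intro lam mu h
  ext x
  rw [mem_iff_partitionSeq, mem_iff_partitionSeq, h]

theorem partitionSeq_empty : partitionSeq ∅ = descending (-1) :=
  partitionSeq_eq (fun i j hij => by change (-1 : ℤ) - j < -1 - i; omega)
    (fun i hi => by simp at hi) (fun i _ => by simp [descending])

theorem partitionSeq_insert {lam : Finset ℕ} {j : ℕ} (h : ∀ x ∈ lam, x < j) :
    partitionSeq (insert j lam) = cons j (partitionSeq lam) := by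
  have hj : j ∉ lam := fun hj => lt_irrefl _ (h j hj)
  refine partitionSeq_eq ?_ ?_ ?_
  · refine strictAnti_nat_of_succ_lt fun i => ?_
    rcases i with _ | i
    · rw [cons_succ, cons_zero]
      rcases Nat.lt_or_ge 0 lam.card with h' | h'
      · obtain ⟨x, hx, e⟩ := partitionSeq_exists_mem h'
        rw [e]; exact_mod_cast h x hx
      · rw [partitionSeq_hasTail lam 0 h']; omega
    · rw [cons_succ, cons_succ]
      exact partitionSeq_normallyOrdered lam (Nat.lt_succ_self i)
  · rw [card_insert_of_notMem hj]
    rintro (_ | i) hi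
    · exact ⟨j, mem_insert_self _ _, rfl⟩
    · obtain ⟨x, hx, e⟩ := partitionSeq_exists_mem (lam := lam) (i := i) (by omega)
      exact ⟨x, mem_insert_of_mem hx, e⟩
  · rw [card_insert_of_notMem hj]
    have := (partitionSeq_hasTail lam).cons j
    rw [sub_add_cancel] at this
    push_cast
    rwa [add_sub_cancel_right]

end PartitionSeq

section Kets

variable {n : ℕ} (D : Twist n)

theorem Twist.ket_empty : D.ket ∅ = D.wedge (descending (-1)) := by
  rw [ket, partitionSeq_empty]

theorem Twist.ket_insert {lam : Finset ℕ} {j : ℕ} (h : ∀ x ∈ lam, x < j) :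
    D.ket (insert j lam) = D.create j (D.ket lam) := by
  rw [ket, partitionSeq_insert h, ket, create_wedge]

/-- The span of the vectors of strict partitions with `l` parts, all at most `M`. -/
def Twist.ketSpan (M l : ℕ) : Submodule ℂ D.Fock :=
  Submodule.span ℂ {v | ∃ lam : Finset ℕ, (∀ x ∈ lam, x ≤ M) ∧ lam.card = l ∧ v = D.ket lam}

theorem Twist.ket_mem_ketSpan {lam : Finset ℕ} {M : ℕ} (h : ∀ x ∈ lam, x ≤ M) :
    D.ket lam ∈ D.ketSpan M lam.card := Submodule.subset_span ⟨lam, h, rfl, rfl⟩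

variable [NeZero n]

theorem Twist.bra_ket (mu lam : Finset ℕ) :
    D.bra mu (D.ket lam) = if lam = mu then 1 else 0 := by
  rw [ket, D.isBra_bra mu _ (partitionSeq_normallyOrdered lam)]
  simp [partitionSeq_injective.eq_iff]

/-- Straightening among the first l factors respects the bound M. An ascent at the border to the
tail means that the last of these factors is negative and repeats a tail entry, so the wedge is
zero. -/
theorem Twist.wedge_mem_ketSpan {M l : ℕ} {w : SemiInfinite} (hw : w.HasTail ((l : ℤ) - 1) l)
    (hM : ∀ i < l, w.1 i ≤ M) : D.wedge w ∈ D.ketSpan M l := by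
  obtain ⟨r, hr⟩ := exists_settled w
  refine Settled.induction (r := r) (P := fun w => w.HasTail ((l : ℤ) - 1) l →
    (∀ i < l, w.1 i ≤ M) → D.wedge w ∈ D.ketSpan M l) (fun w hr ih hw hM => ?_) w hr hw hM
  by_cases hp : ∃ p, w.1 p ≤ w.1 (p + 1)
  · obtain ⟨p, hp⟩ := hp
    rcases lt_trichotomy (p + 1) l with h | h | h
    · refine D.wedge_mem_of_reduce hp fun s t h1 h2 h3 h4 => ?_
      have h5 := hr.setPair_inner hp (s := s) (t := t) ⟨h1, h2, h3, h4⟩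
      refine ih _ h5.1 h5.2 (hw.setPair h s t) fun i hi => ?_
      have := hM (p + 1) h
      rw [setPair_apply]
      split_ifs
      · omega
      · omega
      · exact hM i hi
    · have h1 := hw (p + 1) (by omega)
      rw [D.wedge_eq_zero_of_right (- w.1 p).toNat w p (-1) (fun j hj => ?_) (by omega) (by omega)]
      · exact Submodule.zero_mem _
      · rw [hw _ (by omega)]; push_cast; omega
    · rw [hw p (by omega), hw (p + 1) (by omega)] at hp
      push_cast at hp
      omega
  · push Not at hp
    have hw' : w.NormallyOrdered := strictAnti_nat_of_succ_lt hp
    obtain ⟨nu, hnu, hcard, rfl⟩ := exists_partitionSeq_eq hw' hw hM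
    exact Submodule.subset_span ⟨nu, hnu, hcard, rfl⟩

theorem Twist.current_wedge_eq_sum_of_pos {k : ℤ} (hk : 0 < k) {w : SemiInfinite} {c : ℤ} {r : ℕ}
    (hw : w.HasTail c r) :
    D.current k (D.wedge w) = ∑ i ∈ range r, D.wedge (w.set i (w.1 i - k * n)) := by
  rw [D.current_wedge_eq_sum hk.ne' hw le_rfl]
  symm
  refine sum_subset (range_subset_range.mpr (Nat.le_add_right _ _)) fun i _ hi => ?_
  rw [mem_range, not_lt] at hi
  exact D.wedge_shift_eq_zero_of_pos hk hw hi

theorem Twist.current_mem_ketSpan {k : ℤ} (hk : 0 < k) {M l : ℕ} {v : D.Fock}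
    (hv : v ∈ D.ketSpan M l) : D.current k v ∈ D.ketSpan M l := by
  have : D.ketSpan M l ≤ (D.ketSpan M l).comap (D.current k) := by
    refine Submodule.span_le.mpr ?_
    rintro _ ⟨lam, hM, rfl, rfl⟩
    have hw := partitionSeq_hasTail lam
    rw [SetLike.mem_coe, Submodule.mem_comap, ket, D.current_wedge_eq_sum_of_pos hk hw]
    refine Submodule.sum_mem _ fun i hi => D.wedge_mem_ketSpan (hw.set (mem_range.mp hi) _)
      fun j hj => ?_
    have hle : ∀ i < lam.card, (partitionSeq lam).1 i ≤ M := by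
      intro i hi
      obtain ⟨x, hx, e⟩ := partitionSeq_exists_mem hi
      rw [e]; exact_mod_cast hM x hx
    rw [set_apply]
    split_ifs
    · have := hle i (mem_range.mp hi)
      have : 0 ≤ k * n := by positivity
      omega
    · exact hle j hj
  exact this hv

theorem Twist.expH_mem_ketSpan (S : PowerSeries ℂ) {M l : ℕ} {v : D.Fock}
    (hv : v ∈ D.ketSpan M l) : D.expH S v ∈ D.ketSpan M l := by
  have h1 : ∀ v ∈ D.ketSpan M l, D.hamiltonian S v ∈ D.ketSpan M l := by
    intro v hv
    obtain ⟨d, hd⟩ := D.exists_mem_filtration v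
    rw [D.hamiltonian_apply S hd le_rfl]
    exact Submodule.sum_mem _ fun k _ => Submodule.smul_mem _ _
      (D.current_mem_ketSpan (by omega) hv)
  have h2 : ∀ r : ℕ, (D.hamiltonian S ^ r) v ∈ D.ketSpan M l := by
    intro r
    induction r with
    | zero => exact hv
    | succ r ih => rw [pow_succ', Module.End.mul_apply]; exact h1 _ ih
  obtain ⟨d, hd⟩ := D.exists_mem_filtration v
  rw [D.expH_apply S (K := d + 1) (fun r hr => D.hamiltonian_pow_eq_zero S hd (by omega))]
  exact Submodule.sum_mem _ fun r _ => Submodule.smul_mem _ _ (h2 r)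

theorem Twist.eq_sum_bra_smul_ket {M l : ℕ} {v : D.Fock} (hv : v ∈ D.ketSpan M l) :
    v = ∑ nu ∈ (range (M + 1)).powerset, D.bra nu v • D.ket nu := by
  induction hv using Submodule.span_induction with
  | mem v hv =>
    obtain ⟨lam, hM, -, rfl⟩ := hv
    simp only [bra_ket, ite_smul, one_smul, zero_smul]
    rw [sum_ite_eq, if_pos]
    rw [mem_powerset]
    exact fun x hx => mem_range.mpr (Nat.lt_succ_of_le (hM x hx))
  | zero => simp
  | add v v' _ _ h h' =>
    simp only [map_add, add_smul, sum_add_distrib]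
    rw [← h, ← h']
  | smul a v _ h =>
    simp only [map_smul, smul_assoc]
    rw [← smul_sum, ← h]

theorem Twist.bra_eq_zero_of_card {M l : ℕ} {v : D.Fock} (hv : v ∈ D.ketSpan M l) {mu : Finset ℕ}
    (h : mu.card ≠ l) : D.bra mu v = 0 := by
  have : D.ketSpan M l ≤ LinearMap.ker (D.bra mu) := by
    refine Submodule.span_le.mpr ?_
    rintro _ ⟨lam, -, rfl, rfl⟩
    rw [SetLike.mem_coe, LinearMap.mem_ker, bra_ket, if_neg]
    rintro rfl
    exact h rfl
  exact this hv

end Kets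

/-! ### Matrix coefficients of the exponential -/

section ExpCoeff

variable {n : ℕ} (D : Twist n)

/-- The power series `∑_{k ≥ 1} s_k X^k`. -/
def toSeries (s : ℕ+ → ℂ) : PowerSeries ℂ :=
  PowerSeries.mk fun k => if h : 0 < k then s ⟨k, h⟩ else 0

theorem coeff_toSeries (s : ℕ+ → ℂ) (k : ℕ+) : PowerSeries.coeff (k : ℕ) (toSeries s) = s k := by
  rw [toSeries, PowerSeries.coeff_mk, dif_pos k.pos]
  rfl

theorem constantCoeff_toSeries (s : ℕ+ → ℂ) : PowerSeries.constantCoeff (toSeries s) = 0 := by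
  rw [← PowerSeries.coeff_zero_eq_constantCoeff_apply, toSeries, PowerSeries.coeff_mk]
  simp

theorem toSeries_injective : Function.Injective toSeries := by
  intro s t h
  funext k
  rw [← coeff_toSeries s, h, coeff_toSeries]

theorem toSeries_add (s t : ℕ+ → ℂ) :
    toSeries (fun k => s k + t k) = toSeries s + toSeries t := by
  ext k
  rw [map_add]
  simp only [toSeries, PowerSeries.coeff_mk]
  split_ifs <;> simp

/-- The lists of length `r` with entries in `A`. -/
def listsOf (A : Finset ℕ+) : ℕ → Finset (List ℕ+)
  | 0 => {[]}
  | r + 1 => (A ×ˢ listsOf A r).map ⟨fun p => p.1 :: p.2, fun p q h => by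
      simp only [List.cons.injEq] at h
      exact Prod.ext h.1 h.2⟩

theorem mem_listsOf {A : Finset ℕ+} {r : ℕ} {ks : List ℕ+} :
    ks ∈ listsOf A r ↔ ks.length = r ∧ ∀ k ∈ ks, k ∈ A := by
  induction r generalizing ks with
  | zero => simp +contextual [listsOf]
  | succ r ih =>
    rw [listsOf, mem_map]
    constructor
    · rintro ⟨⟨k, ks⟩, h, rfl⟩
      rw [mem_product, ih] at h
      change (k :: ks).length = r + 1 ∧ ∀ k' ∈ k :: ks, k' ∈ A
      simpa using ⟨h.2.1, h.1, h.2.2⟩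
    · rcases ks with _ | ⟨k, ks⟩
      · simp
      · intro h
        refine ⟨(k, ks), ?_, rfl⟩
        rw [mem_product, ih]
        simpa [and_comm, and_assoc, and_left_comm] using h

/-- The composition `J_{ε k₁} ⋯ J_{ε k_r}` of currents. -/
def Twist.currents (ε : ℤ) (ks : List ℕ+) (v : D.Fock) : D.Fock :=
  ks.foldr (fun k ψ => D.current (ε * (k : ℤ)) ψ) v

theorem Twist.sum_listsOf (A : Finset ℕ+) (s : ℕ+ → ℂ) (r : ℕ) (v : D.Fock) :
    ∑ ks ∈ listsOf A r, (ks.map s).prod • D.currents 1 ks v =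
      ((∑ k ∈ A, s k • D.current (1 * (k : ℤ))) ^ r) v := by
  induction r with
  | zero => simp [listsOf, currents]
  | succ r ih =>
    rw [listsOf, sum_map, sum_product, pow_succ', Module.End.mul_apply, ← ih, LinearMap.sum_apply]
    refine sum_congr rfl fun k _ => ?_
    rw [LinearMap.smul_apply, map_sum, smul_sum]
    refine sum_congr rfl fun ks _ => ?_
    change ((k :: ks).map s).prod • D.current (1 * (k : ℤ)) (D.currents 1 ks v) = _
    rw [List.map_cons, List.prod_cons, mul_smul, map_smul]

variable [NeZero n]

theorem Twist.currents_mem_filtration (ks : List ℕ+) {d : ℤ} {v : D.Fock}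
    (hv : v ∈ D.filtration d) :
    D.currents 1 ks v ∈ D.filtration (d - (ks.map PNat.val).sum) := by
  have hn : 1 ≤ n := Nat.pos_of_ne_zero (NeZero.ne n)
  induction ks with
  | nil => simpa [currents] using hv
  | cons k ks ih =>
    have := D.current_mem_filtration (k := 1 * (k : ℤ)) (by simp) ih
    refine D.filtration_mono ?_ this
    have : ((k : ℕ) : ℤ) * 1 ≤ k * n := by gcongr; exact_mod_cast hn
    simp only [List.map_cons, List.sum_cons]
    push_cast
    linarith

theorem Twist.hamiltonian_toSeries_apply (s : ℕ+ → ℂ) {d : ℕ} {A : Finset ℕ+}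
    (hA : ∀ k : ℕ+, (k : ℕ) ≤ d → k ∈ A) {v : D.Fock} (hv : v ∈ D.filtration d) :
    (∑ k ∈ A, s k • D.current (1 * (k : ℤ))) v = D.hamiltonian (toSeries s) v := by
  rw [D.hamiltonian_apply _ hv le_rfl, LinearMap.sum_apply]
  symm
  refine sum_bij_ne_zero (fun k _ _ => k.succPNat) (fun k hk _ => hA _ ?_) ?_ ?_ ?_
  · have := mem_range.mp hk
    simpa using this
  · intro a _ _ b _ _ h
    exact Nat.succPNat_injective h
  · intro k hk hne
    have hkd : (k : ℕ) ≤ d := by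
      by_contra h
      refine hne ?_
      have := D.current_eq_zero hv (k := k) (not_le.mp h)
      rw [LinearMap.smul_apply, one_mul, this, smul_zero]
    have hpos := k.pos
    refine ⟨(k : ℕ) - 1, mem_range.mpr (by omega), ?_, ?_⟩
    · have e : (k : ℕ) - 1 + 1 = k := by omega
      have e' : (((k : ℕ) - 1 : ℕ) : ℤ) + 1 = 1 * (k : ℤ) := by
        rw [one_mul]; exact_mod_cast e
      rw [e, e', coeff_toSeries]
      exact hne
    · exact PNat.eq (by simp; omega)
  · intro k _ _
    rw [LinearMap.smul_apply, ← coeff_toSeries s]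
    simp

/-- Only lists with total at most the degree d contribute. They are grouped by length, and the lists
of length r with entries in the finite set `A` expand the r-th power of a truncated Hamiltonian,
which agrees with the full one on the vectors of degree at most d that occur. -/
theorem Twist.expPlus_eq (s : ℕ+ → ℂ) (mu lam : Finset ℕ) :
    D.expPlus s mu lam = D.bra mu (D.expH (toSeries s) (D.ket lam)) := by
  classical
  obtain ⟨d, hd⟩ := D.exists_mem_filtration (D.ket lam)
  set A : Finset ℕ+ := Finset.Icc 1 d.succPNat
  have hA : ∀ k : ℕ+, (k : ℕ) ≤ d → k ∈ A := by
    intro k hk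
    rw [Finset.mem_Icc]
    refine ⟨one_le, ?_⟩
    rw [← PNat.coe_le_coe, Nat.succPNat_coe]
    omega
  have hzero : ∀ ks : List ℕ+, d < (ks.map PNat.val).sum →
      D.currents 1 ks (D.ket lam) = 0 := by
    intro ks h
    have := D.currents_mem_filtration ks hd
    rwa [D.filtration_eq_bot (by omega), Submodule.mem_bot] at this
  have hpow : ∀ r : ℕ, ((∑ k ∈ A, s k • D.current (1 * (k : ℤ))) ^ r) (D.ket lam) =
      (D.hamiltonian (toSeries s) ^ r) (D.ket lam) ∧
      (D.hamiltonian (toSeries s) ^ r) (D.ket lam) ∈ D.filtration d := by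
    intro r
    induction r with
    | zero => exact ⟨rfl, hd⟩
    | succ r ih =>
      rw [pow_succ', pow_succ', Module.End.mul_apply, Module.End.mul_apply, ih.1]
      exact ⟨D.hamiltonian_toSeries_apply s hA ih.2,
        D.filtration_mono (by omega) (D.hamiltonian_mem_filtration _ ih.2)⟩
  have hlen : ∀ ks : List ℕ+, ks.length ≤ (ks.map PNat.val).sum := by
    intro ks
    induction ks with
    | nil => simp
    | cons k ks ih =>
      have := k.pos
      simp only [List.length_cons, List.map_cons, List.sum_cons]
      omega
  rw [expPlus, expCoeff, finsum_eq_sum_of_support_subset (s := (range (d + 1)).biUnion (listsOf A)),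
    sum_biUnion, D.expH_apply _ (K := d + 1)
      (fun r hr => D.hamiltonian_pow_eq_zero _ hd (by omega)), map_sum]
  · refine sum_congr rfl fun r _ => ?_
    rw [map_smul, ← (hpow r).1, ← D.sum_listsOf, map_sum, smul_sum]
    refine sum_congr rfl fun ks hks => ?_
    rw [(mem_listsOf.mp hks).1, map_smul, smul_eq_mul, smul_eq_mul, mul_assoc]
    rfl
  · intro r _ r' _ hrr
    refine Finset.disjoint_left.mpr fun ks h h' => hrr ?_
    rw [← (mem_listsOf.mp h).1, (mem_listsOf.mp h').1]
  · intro ks hks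
    have h1 : ¬ d < (ks.map PNat.val).sum := by
      intro h
      refine hks ?_
      have := hzero ks h
      rw [currents] at this
      simp only [this, map_zero, mul_zero]
    rw [mem_coe, mem_biUnion]
    have := hlen ks
    refine ⟨ks.length, mem_range.mpr (by omega), mem_listsOf.mpr ⟨rfl, fun k hk => hA k ?_⟩⟩
    have : (k : ℕ) ≤ (ks.map PNat.val).sum :=
      List.single_le_sum (by simp) _ (List.mem_map_of_mem hk)
    omega

/-- The span of partitions with bounded parts and fixed length is stable under e^{H_+}, so its basis
can be inserted between the two exponentials. This mirrors the stacking of rows. -/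
theorem Twist.expPlus_add (s t : ℕ+ → ℂ) {M : ℕ} {mu lam : Finset ℕ} (h : ∀ x ∈ lam, x ≤ M) :
    D.expPlus (fun k => s k + t k) mu lam =
      ∑ nu ∈ (range (M + 1)).powerset, D.expPlus s mu nu * D.expPlus t nu lam := by
  rw [D.expPlus_eq, toSeries_add,
    D.expH_add (constantCoeff_toSeries s) (constantCoeff_toSeries t), LinearMap.comp_apply,
    D.eq_sum_bra_smul_ket (D.expH_mem_ketSpan _ (D.ket_mem_ketSpan h)), map_sum, map_sum]
  refine sum_congr rfl fun nu _ => ?_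
  rw [map_smul, map_smul, smul_eq_mul, D.expPlus_eq, D.expPlus_eq, mul_comm]

theorem Twist.expPlus_zero (mu lam : Finset ℕ) :
    D.expPlus (fun _ => 0) mu lam = if lam = mu then 1 else 0 := by
  have : toSeries (fun _ => 0) = 0 := by
    ext k
    simp [toSeries]
  rw [D.expPlus_eq, this, D.expH_zero, LinearMap.id_apply, bra_ket]

theorem Twist.expPlus_eq_zero_of_card (s : ℕ+ → ℂ) {mu lam : Finset ℕ} (h : mu.card ≠ lam.card) :
    D.expPlus s mu lam = 0 := by
  rw [D.expPlus_eq]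
  exact D.bra_eq_zero_of_card (D.expH_mem_ketSpan _ (D.ket_mem_ketSpan (M := lam.sup id)
    fun x hx => le_sup (f := id) hx)) h

end ExpCoeff

end ChargedModel

end

noncomputable section

namespace ChargedModel

open Finset SemiInfinite

/-! ### Reflection -/

section Reflection

variable {n : ℕ} {D : Twist n}

/-- The relation involves only m - l and the value of α at the two charges. Reflection followed by
reversal keeps the difference of the charges, so shift invariance leaves α unchanged. -/
theorem pairEval_normalForm_reflect {V : Type*} [AddCommGroup V] [Module ℂ V]
    (hD : D.IsShiftInvariant) (U : ℤ → ℤ → V) (M l m : ℤ) :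
    pairEval (fun s t => U (M - t) (M - s)) (D.normalForm (M - m) (M - l)) =
      pairEval U (D.normalForm l m) := by
  have hα : D.α ((M - m : ℤ) : ZMod n) ((M - l : ℤ) : ZMod n) = D.α (l : ZMod n) (m : ZMod n) := by
    have := hD ((M - m : ℤ) : ZMod n) ((M - l : ℤ) : ZMod n) ((l + m - M : ℤ) : ZMod n)
    rw [← Int.cast_add, ← Int.cast_add, show M - m + (l + m - M) = l by ring,
      show M - l + (l + m - M) = m by ring] at this
    exact this.symm
  have h1 : M - l - (M - m) = m - l := by ring
  by_cases h : l = m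
  · rw [h, D.normalForm_self, D.normalForm_self, map_zero, map_zero]
  rw [D.normalForm_of_ne h, D.normalForm_of_ne (by omega), Twist.straightenPair,
    Twist.straightenPair, h1, hα]
  split_ifs
  · simp [pairEval_single]
  · simp only [map_add, map_smul, map_sum, apply_ite (pairEval _), map_zero, pairEval_single,
      one_smul, sub_sub_cancel]
    congr 2
    refine sum_congr rfl fun j _ => ?_
    congr 1
    · refine if_congr ?_ (congrArg _ (congrArg₂ U (by ring) (by ring))) rfl
      constructor <;> intro h <;> linarith
    · refine if_congr ?_ (congrArg _ (congrArg₂ U (by ring) (by ring))) rfl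
      constructor <;> intro h <;> linarith

/-- Replace the entries `x` at the first `l` positions by `M - x`, in the opposite order. -/
def SemiInfinite.reflect (M : ℤ) (l : ℕ) (w : SemiInfinite) : SemiInfinite :=
  ⟨fun i => if i < l then M - w.1 (l - 1 - i) else (l : ℤ) - 1 - i, (l : ℤ) - 1, l,
    fun i hi => by simp [not_lt.mpr hi]⟩

theorem SemiInfinite.reflect_apply (M : ℤ) (l : ℕ) (w : SemiInfinite) (i : ℕ) :
    (w.reflect M l).1 i = if i < l then M - w.1 (l - 1 - i) else (l : ℤ) - 1 - i := rfl

theorem SemiInfinite.reflect_hasTail (M : ℤ) (l : ℕ) (w : SemiInfinite) :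
    (w.reflect M l).HasTail ((l : ℤ) - 1) l := by
  intro i hi
  rw [reflect_apply, if_neg (by omega)]

theorem SemiInfinite.reflect_set (M : ℤ) {l : ℕ} (w : SemiInfinite) {p : ℕ} (hp : p < l) (a : ℤ) :
    (w.set p a).reflect M l = (w.reflect M l).set (l - 1 - p) (M - a) := by
  apply SemiInfinite.ext
  intro i
  simp only [reflect_apply, set_apply]
  split_ifs <;> first | rfl | omega

theorem SemiInfinite.reflect_setPair (M : ℤ) {l : ℕ} (w : SemiInfinite) {p : ℕ} (hp : p + 1 < l)
    (s t : ℤ) :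
    (w.setPair p s t).reflect M l = (w.reflect M l).setPair (l - 2 - p) (M - t) (M - s) := by
  apply SemiInfinite.ext
  intro i
  simp only [reflect_apply, setPair_apply]
  split_ifs <;> first | rfl | omega

/-- The strict partition with parts `M - x`. -/
def reflectParts (M : ℕ) (lam : Finset ℕ) : Finset ℕ := (range (M + 1)).filter fun x => M - x ∈ lam

theorem mem_reflectParts {M : ℕ} {lam : Finset ℕ} {x : ℕ} :
    x ∈ reflectParts M lam ↔ x ≤ M ∧ M - x ∈ lam := by
  rw [reflectParts, mem_filter, mem_range, Nat.lt_succ_iff]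

theorem reflectParts_le {M : ℕ} {lam : Finset ℕ} : ∀ x ∈ reflectParts M lam, x ≤ M :=
  fun _ hx => (mem_reflectParts.mp hx).1

theorem reflectParts_reflectParts {M : ℕ} {lam : Finset ℕ} (h : ∀ x ∈ lam, x ≤ M) :
    reflectParts M (reflectParts M lam) = lam := by
  ext x
  rw [mem_reflectParts, mem_reflectParts]
  constructor
  · rintro ⟨h1, -, h2⟩
    rwa [Nat.sub_sub_self h1] at h2
  · intro hx
    have := h x hx
    exact ⟨this, by omega, by rwa [Nat.sub_sub_self this]⟩

theorem card_reflectParts {M : ℕ} {lam : Finset ℕ} (h : ∀ x ∈ lam, x ≤ M) :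
    (reflectParts M lam).card = lam.card := by
  refine card_bij (fun x _ => M - x) (fun x hx => (mem_reflectParts.mp hx).2) ?_ ?_
  · intro x hx y hy hxy
    have := reflectParts_le x hx
    have := reflectParts_le y hy
    omega
  · intro x hx
    have := h x hx
    exact ⟨M - x, mem_reflectParts.mpr ⟨by omega, by rwa [Nat.sub_sub_self this]⟩, by omega⟩

theorem partitionSeq_reflectParts {M : ℕ} {lam : Finset ℕ} (h : ∀ x ∈ lam, x ≤ M) :
    partitionSeq (reflectParts M lam) = (partitionSeq lam).reflect M lam.card := by
  have hc := card_reflectParts h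
  refine partitionSeq_eq ?_ ?_ ?_
  · refine strictAnti_nat_of_succ_lt fun i => ?_
    rw [reflect_apply, reflect_apply]
    rcases Nat.lt_or_ge (i + 1) lam.card with h1 | h1
    · rw [if_pos h1, if_pos (by omega)]
      have := partitionSeq_normallyOrdered lam (show lam.card - 1 - (i + 1) < lam.card - 1 - i by
        omega)
      omega
    · rw [if_neg (by omega)]
      split_ifs with h2
      · obtain ⟨x, hx, e⟩ := partitionSeq_exists_mem (lam := lam) (i := lam.card - 1 - i) (by omega)
        have := h x hx
        rw [e]
        push_cast
        omega
      · push_cast; omega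
  · rw [hc]
    intro i hi
    obtain ⟨x, hx, e⟩ := partitionSeq_exists_mem (lam := lam) (i := lam.card - 1 - i) (by omega)
    have := h x hx
    refine ⟨M - x, mem_reflectParts.mpr ⟨by omega, by rwa [Nat.sub_sub_self this]⟩, ?_⟩
    rw [reflect_apply, if_pos hi, e]
    omega
  · rw [hc]
    exact reflect_hasTail _ _ _

variable [NeZero n]

/-- Reversing both the positions and the order of the indices takes ascents to ascents and relations
to relations, so both sides can be straightened in parallel. -/
theorem Twist.bra_wedge_reflect (hD : D.IsShiftInvariant) {M l : ℕ} {lam : Finset ℕ}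
    (hlam : ∀ x ∈ lam, x ≤ M) {w : SemiInfinite} (hw : w.HasTail ((l : ℤ) - 1) l)
    (hpos : ∀ i < l, 0 ≤ w.1 i) :
    D.bra lam (D.wedge w) = D.bra (reflectParts M lam) (D.wedge (w.reflect M l)) := by
  classical
  obtain ⟨r, hr⟩ := exists_settled w
  refine Settled.induction (r := r) (P := fun w => w.HasTail ((l : ℤ) - 1) l →
    (∀ i < l, 0 ≤ w.1 i) → D.bra lam (D.wedge w) =
      D.bra (reflectParts M lam) (D.wedge (w.reflect M l)))
    (fun w hr ih hw hpos => ?_) w hr hw hpos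
  by_cases hp : ∃ p, w.1 p ≤ w.1 (p + 1)
  · obtain ⟨p, hp⟩ := hp
    have hpl : p + 1 < l := by
      by_contra h
      have h1 := hw (p + 1) (by omega)
      rcases Nat.lt_or_ge p l with h2 | h2
      · have := hpos p h2
        omega
      · have := hw p h2
        push_cast at h1
        omega
    have hq : l - 2 - p + 1 = l - 1 - p := by omega
    have e1 : (w.reflect M l).1 (l - 2 - p) = M - w.1 (p + 1) := by
      rw [reflect_apply, if_pos (by omega), show l - 1 - (l - 2 - p) = p + 1 by omega]
    have e2 : (w.reflect M l).1 (l - 2 - p + 1) = M - w.1 p := by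
      rw [reflect_apply, if_pos (by omega), show l - 1 - (l - 2 - p + 1) = p by omega]
    have h1 := congrArg (D.bra (reflectParts M lam))
      (D.wedge_reducesAt (w.reflect M l) (l - 2 - p) (by rw [e1, e2]; omega))
    rw [map_pairEval, e1, e2] at h1
    rw [h1, show D.wedge w = _ from D.wedge_reducesAt w p hp, map_pairEval,
      ← pairEval_normalForm_reflect hD _ M]
    have hsupp := D.normalForm_mem_supported (l := M - w.1 (p + 1)) (m := M - w.1 p) (by omega)
    refine pairEval_congr hsupp fun st hst => ?_
    obtain ⟨h2, h3, h4, h5⟩ := hst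
    have h6 := hr.setPair_inner hp (s := M - st.2) (t := M - st.1)
      ⟨by dsimp only; omega, by dsimp only; omega, by dsimp only; omega, by dsimp only; omega⟩
    rw [ih _ h6.1 h6.2 (hw.setPair hpl _ _) fun i hi => ?_, reflect_setPair _ _ hpl,
      sub_sub_cancel, sub_sub_cancel]
    have := hpos p (by omega)
    rw [setPair_apply]
    split_ifs
    · omega
    · omega
    · exact hpos i hi
  · push Not at hp
    have hw' : w.NormallyOrdered := strictAnti_nat_of_succ_lt hp
    by_cases hM : ∀ i < l, w.1 i ≤ M
    · obtain ⟨nu, hnu, rfl, rfl⟩ := exists_partitionSeq_eq hw' hw hM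
      rw [← partitionSeq_reflectParts hnu]
      change D.bra _ (D.ket nu) = D.bra _ (D.ket (reflectParts M nu))
      rw [D.bra_ket, D.bra_ket]
      refine if_congr ⟨fun h => by rw [h], fun h => ?_⟩ rfl rfl
      rw [← reflectParts_reflectParts hnu, h, reflectParts_reflectParts hlam]
    -- An entry above M reflects to a negative entry in front of the tail, so the reflected wedge
    -- vanishes; on the other side ⟨λ| does not see parts above M.
    · push Not at hM
      obtain ⟨i, hi, hiM⟩ := hM
      have h0 : (M : ℤ) < w.1 0 := lt_of_lt_of_le hiM (hw'.antitone (Nat.zero_le i))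
      rw [D.isBra_bra _ _ hw', if_neg, D.wedge_eq_zero_of_right (w.1 0 - M).toNat _ (l - 1) (-1),
        map_zero]
      · intro j hj
        rw [reflect_apply, if_neg (by omega)]
        push_cast; omega
      · rw [reflect_apply, if_pos (by omega), show l - 1 - (l - 1) = 0 by omega]
        omega
      · rw [reflect_apply, if_pos (by omega), show l - 1 - (l - 1) = 0 by omega]
        omega
      · rintro rfl
        rcases Nat.lt_or_ge 0 lam.card with h | h
        · obtain ⟨x, hx, e⟩ := partitionSeq_exists_mem h
          have := hlam x hx
          omega
        · have := partitionSeq_hasTail lam 0 h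
          omega

/-- The span of the wedges with more nonnegative factors in front than their charge allows in
normal order. -/
def Twist.overfull (D : Twist n) (c : ℤ) : Submodule ℂ D.Fock :=
  Submodule.span ℂ {v | ∃ (w : SemiInfinite) (r L : ℕ), w.HasTail c r ∧ c + 1 < L ∧
    (∀ i < L, 0 ≤ w.1 i) ∧ v = D.wedge w}

/-- Straightening cannot bring a negative entry among the first L, whereas a partition vector with
the same tail has exactly c + 1 < L nonnegative entries. -/
theorem Twist.bra_overfull {c : ℤ} {v : D.Fock} (hv : v ∈ D.overfull c) (lam : Finset ℕ) :
    D.bra lam v = 0 := by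
  classical
  have : D.overfull c ≤ LinearMap.ker (D.bra lam) := by
    refine Submodule.span_le.mpr ?_
    rintro _ ⟨w, r, L, hw, hL, hpos, rfl⟩
    obtain ⟨R, hR⟩ := exists_settled w
    rw [SetLike.mem_coe]
    refine Settled.induction (r := R) (P := fun w => (∃ r, w.HasTail c r) → (∀ i < L, 0 ≤ w.1 i) →
      D.wedge w ∈ LinearMap.ker (D.bra lam)) (fun w hR ih hw hpos => ?_) w hR ⟨r, hw⟩ hpos
    obtain ⟨r, hw⟩ := hw
    by_cases hp : ∃ p, w.1 p ≤ w.1 (p + 1)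
    · obtain ⟨p, hp⟩ := hp
      refine D.wedge_mem_of_reduce hp fun s t h1 h2 h3 h4 => ?_
      have h5 := hR.setPair_inner hp (s := s) (t := t) ⟨h1, h2, h3, h4⟩
      refine ih _ h5.1 h5.2 ⟨max r (p + 2), (hw.mono (le_max_left _ _)).setPair (by omega) s t⟩ ?_
      intro i hi
      rw [setPair_apply]
      split_ifs with h6 h7
      · have := hpos p (by omega)
        omega
      · have := hpos p (by omega)
        omega
      · exact hpos i hi
    · push Not at hp
      rw [LinearMap.mem_ker, D.isBra_bra lam w (strictAnti_nat_of_succ_lt hp), if_neg]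
      rintro rfl
      have h1 := partitionSeq_hasTail lam (max r lam.card) (le_max_right _ _)
      have h2 := hw (max r lam.card) (le_max_left _ _)
      have h3 := hpos lam.card (by omega)
      rw [partitionSeq_hasTail lam lam.card le_rfl] at h3
      omega
  exact this hv

theorem Twist.current_overfull {c : ℤ} {k : ℤ} (hk : 0 < k) {v : D.Fock}
    (hv : v ∈ D.overfull c) : D.current (-k) v ∈ D.overfull c := by
  have : D.overfull c ≤ (D.overfull c).comap (D.current (-k)) := by
    refine Submodule.span_le.mpr ?_
    rintro _ ⟨w, r, L, hw, hL, hpos, rfl⟩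
    rw [SetLike.mem_coe, Submodule.mem_comap, D.current_wedge_eq_sum (by omega) hw le_rfl]
    refine Submodule.sum_mem _ fun i hi => Submodule.subset_span
      ⟨_, _, L, (hw.mono (Nat.le_add_right _ _)).set (mem_range.mp hi) _, hL, fun j hj => ?_, rfl⟩
    have hkn : 0 ≤ k * n := by positivity
    rw [set_apply]
    split_ifs with h
    · have := hpos i (by omega)
      rw [neg_mul]
      omega
    · exact hpos j hj
  exact this hv

/-- A raised tail factor either repeats a negative factor, and the wedge dies, or it moves past all
of them and becomes an additional nonnegative factor. -/
theorem Twist.shift_tail_mem_overfull {k : ℤ} (hk : 0 < k) {l : ℕ} {w : SemiInfinite}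
    (hw : w.HasTail ((l : ℤ) - 1) l) (hpos : ∀ i < l, 0 ≤ w.1 i) {i : ℕ} (hi : l ≤ i) :
    D.wedge (w.set i (w.1 i - -k * n)) ∈ D.overfull ((l : ℤ) - 1) := by
  have hn : (0 : ℤ) < n := by exact_mod_cast Nat.pos_of_ne_zero (NeZero.ne n)
  have hd : 0 < k * n := mul_pos hk hn
  rw [neg_mul, sub_neg_eq_add]
  generalize k * n = d at *
  have hwi := hw i hi
  have e : (w.set i (w.1 i + d)).1 (l + (i - l)) = l - 1 - i + d := by
    rw [Nat.add_sub_cancel' hi, set_apply, if_pos rfl, hwi]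
  have ecast : ((i - l : ℕ) : ℤ) = i - l := by omega
  refine D.wedge_mem_of_left (i - l) _ l (l - i) (fun j hj => ?_) ?_ fun v h1 h2 h3 h4 => ?_
  · rw [set_apply, if_neg (by omega), hw _ (by omega)]
    push_cast; omega
  · rw [e]; omega
  · refine Submodule.subset_span ⟨v, i + 1, l + 1, fun j hj => ?_, by push_cast; omega,
      fun j hj => ?_, rfl⟩
    · rw [h2 j (by omega), set_apply, if_neg (by omega), hw j (by omega)]
    · rcases Nat.lt_or_ge j l with h | h
      · rw [h1 j h, set_apply, if_neg (by omega)]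
        exact hpos j h
      · obtain rfl : j = l := by omega
        omega

/-- Under reflection J_{-k} corresponds to J_k on the first l factors, but J_{-k} also raises tail
factors, which has no counterpart. Those terms are overfull and remain so under further currents, so
⟨λ| annihilates them; hence the two claims are proved together. -/
theorem Twist.bra_currents_reflect (hD : D.IsShiftInvariant) {M : ℕ} {lam : Finset ℕ}
    (hlam : ∀ x ∈ lam, x ≤ M) (l : ℕ) (ks : List ℕ+) :
    (∀ v ∈ D.overfull ((l : ℤ) - 1), D.bra lam (D.currents (-1) ks v) = 0) ∧
    ∀ w : SemiInfinite, w.HasTail ((l : ℤ) - 1) l → (∀ i < l, 0 ≤ w.1 i) →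
      D.bra lam (D.currents (-1) ks (D.wedge w)) =
        D.bra (reflectParts M lam) (D.currents 1 ks (D.wedge (w.reflect M l))) := by
  induction ks using List.reverseRecOn with
  | nil =>
    exact ⟨fun v hv => D.bra_overfull hv lam, fun w hw hpos => D.bra_wedge_reflect hD hlam hw hpos⟩
  | append_singleton ks k ih =>
    have hk : (0 : ℤ) < k := by exact_mod_cast k.pos
    have happ : ∀ (ε : ℤ) (v : D.Fock), D.currents ε (ks ++ [k]) v =
        D.currents ε ks (D.current (ε * k) v) := fun ε v => by simp [currents]
    have hlin : ∀ (ε : ℤ), ∃ T : D.Fock →ₗ[ℂ] D.Fock, ∀ v, D.currents ε ks v = T v := by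
      intro ε
      clear ih happ
      induction ks with
      | nil => exact ⟨LinearMap.id, fun v => rfl⟩
      | cons k' ks ih =>
        obtain ⟨T, hT⟩ := ih
        exact ⟨(D.current (ε * (k' : ℤ))).comp T, fun v => by
          rw [LinearMap.comp_apply, ← hT]; rfl⟩
    obtain ⟨T, hT⟩ := hlin (-1)
    obtain ⟨T', hT'⟩ := hlin 1
    refine ⟨fun v hv => ?_, fun w hw hpos => ?_⟩
    · rw [happ, neg_one_mul]
      exact ih.1 _ (D.current_overfull hk hv)
    · rw [happ, happ, neg_one_mul, one_mul,
        D.current_wedge_eq_sum (k := -(k : ℤ)) (by omega) hw le_rfl,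
        D.current_wedge_eq_sum_of_pos hk (reflect_hasTail _ _ _), hT, hT', map_sum, map_sum,
        map_sum, map_sum, ← sum_subset (range_subset_range.mpr (Nat.le_add_right _ _)),
        ← sum_range_reflect]
      · refine sum_congr rfl fun i hi => ?_
        rw [mem_range] at hi
        rw [← hT, ih.2 _ (hw.set (by omega) _) fun j hj => ?_, hT', reflect_set _ _ (by omega)]
        · rw [reflect_apply, if_pos hi, show l - 1 - (l - 1 - i) = i by omega]
          rw [show (M : ℤ) - (w.1 (l - 1 - i) - -(k : ℤ) * n) = M - w.1 (l - 1 - i) - k * n by ring]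
        · have hkn : 0 ≤ (k : ℤ) * n := by positivity
          rw [set_apply]
          split_ifs with h
          · have := hpos (l - 1 - i) (by omega)
            rw [neg_mul]
            omega
          · exact hpos j hj
      · intro i _ hi
        rw [mem_range, not_lt] at hi
        rw [← hT]
        exact ih.1 _ (D.shift_tail_mem_overfull hk hw hpos hi)

/-- Reflection exchanges the exponentials of `H_+` and `H_-`. -/
theorem Twist.expMinus_eq_expPlus (hD : D.IsShiftInvariant) (s : ℕ+ → ℂ) {M : ℕ}
    {lam mu : Finset ℕ} (hlam : ∀ x ∈ lam, x ≤ M) (hmu : ∀ x ∈ mu, x ≤ M) :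
    D.expMinus s lam mu = D.expPlus s (reflectParts M lam) (reflectParts M mu) := by
  refine finsum_congr fun ks => ?_
  congr 1
  have := (D.bra_currents_reflect hD hlam mu.card ks).2 (partitionSeq mu) (partitionSeq_hasTail mu)
    fun i hi => by
      obtain ⟨x, -, e⟩ := partitionSeq_exists_mem hi
      rw [e]; positivity
  rw [← partitionSeq_reflectParts hmu] at this
  exact this

end Reflection

end ChargedModel

end

noncomputable section

namespace ChargedModel

open Finset

/-! ### Transfer matrices -/

section Transfer

variable {X : Type*} [Fintype X] [DecidableEq X]

/-- The ordered product `R 0 * R 1 * ⋯ * R (N - 1)`. -/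
def matProd (R : ℕ → Matrix X X ℂ) : ℕ → Matrix X X ℂ
  | 0 => 1
  | N + 1 => matProd R N * R N

theorem matProd_succ_apply (R : ℕ → Matrix X X ℂ) (N : ℕ) (a b : X) :
    matProd R (N + 1) a b = ∑ c, matProd R N a c * R N c b := rfl

theorem sum_path_eq_matProd (R : ℕ → Matrix X X ℂ) (N : ℕ) (a b : X) :
    (∑ V : Fin (N + 1) → X, if V 0 = a ∧ V (Fin.last N) = b then
      ∏ i : Fin N, R i (V i.castSucc) (V i.succ) else 0) = matProd R N a b := by
  induction N generalizing b with
  | zero =>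
    rw [Fintype.sum_equiv (Equiv.funUnique (Fin 1) X) _
      (fun x => if x = a ∧ x = b then (1 : ℂ) else 0) (fun V => by simp [Fin.last_zero])]
    rw [matProd, Matrix.one_apply, sum_eq_single a]
    · simp
    · intro x _ hx
      rw [if_neg (fun h => hx h.1)]
    · intro h
      exact absurd (mem_univ a) h
  | succ N ih =>
    rw [← (Fin.snocEquiv fun _ : Fin (N + 2) => X).sum_comp, Fintype.sum_prod_type,
      matProd_succ_apply]
    simp only [← ih, sum_mul]
    rw [sum_comm]
    conv_rhs => rw [sum_comm]
    refine sum_congr rfl fun V _ => ?_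
    have h0 : ∀ x : X, (Fin.snocEquiv fun _ : Fin (N + 2) => X) (x, V) 0 = V 0 := fun x =>
      Fin.snoc_castSucc (α := fun _ => X) x V 0
    have hl : ∀ x : X, (Fin.snocEquiv fun _ : Fin (N + 2) => X) (x, V) (Fin.last (N + 1)) = x :=
      fun x => Fin.snoc_last (α := fun _ => X) x V
    have hc : ∀ (x : X) (i : Fin (N + 1)),
        (Fin.snocEquiv fun _ : Fin (N + 2) => X) (x, V) i.castSucc = V i := fun x i =>
      Fin.snoc_castSucc (α := fun _ => X) x V i
    simp only [Fin.prod_univ_castSucc, h0, hl, hc, Fin.succ_castSucc, Fin.succ_last]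
    rw [sum_eq_single b, sum_eq_single (V (Fin.last N))]
    · simp only [and_true]
      split_ifs
      · simp
      · simp
    · intro c _ hcb
      rw [if_neg (fun h => hcb h.2.symm), zero_mul]
    · intro h; exact absurd (mem_univ _) h
    · intro c _ hcb
      rw [if_neg (fun h => hcb h.2)]
    · intro h; exact absurd (mem_univ _) h

end Transfer

section Rows

variable {n : ℕ}

theorem dualVertex_eq (w : Weights n) (l : Option (ZMod n)) (t : Bool) (r : Option (ZMod n))
    (b : Bool) : w.dualVertex l t r b = w.vertex r t l b := by
  rcases l with _ | l <;> rcases r with _ | r <;> cases t <;> cases b <;> rfl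

variable [NeZero n]

/-- The partition function of a row with spins `bot` below and `top` above. -/
def rowSum (w : Weights n) (M : ℕ) (bot top : Fin (M + 1) → Bool) : ℂ :=
  ∑ E : Fin (M + 2) → Option (ZMod n),
    if E 0 = none ∧ E (Fin.last (M + 1)) = none then
      ∏ j : Fin (M + 1), w.vertex (E j.castSucc) (top j) (E j.succ) (bot j) else 0

/-- The partition function of a row of the dual model. -/
def dualRowSum (w : Weights n) (M : ℕ) (bot top : Fin (M + 1) → Bool) : ℂ :=
  ∑ E : Fin (M + 2) → Option (ZMod n),
    if E 0 = none ∧ E (Fin.last (M + 1)) = none then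
      ∏ j : Fin (M + 1), w.dualVertex (E j.castSucc) (top j) (E j.succ) (bot j) else 0

/-- Once the vertical spins are fixed, the horizontal edges of different rows are independent, so
the sum over them factors into row sums. -/
theorem sum_rows_eq (N M : ℕ) (a b : Fin (M + 1) → Bool)
    (F : ℕ → (Fin (M + 1) → Bool) → (Fin (M + 1) → Bool) →
      (Fin (M + 2) → Option (ZMod n)) → ℂ) :
    (∑ V : Fin (N + 1) → Fin (M + 1) → Bool, ∑ E : Fin N → Fin (M + 2) → Option (ZMod n),
      if V 0 = a ∧ V (Fin.last N) = b ∧ ∀ i, E i 0 = none ∧ E i (Fin.last (M + 1)) = none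
      then ∏ i : Fin N, F i (V i.castSucc) (V i.succ) (E i) else 0) =
    matProd (fun i => Matrix.of fun c d => ∑ E : Fin (M + 2) → Option (ZMod n),
      if E 0 = none ∧ E (Fin.last (M + 1)) = none then F i c d E else 0) N a b := by
  classical
  rw [← sum_path_eq_matProd]
  refine sum_congr rfl fun V _ => ?_
  simp only [Matrix.of_apply]
  by_cases h : V 0 = a ∧ V (Fin.last N) = b
  · rw [if_pos h]
    simp only [h.1, h.2, true_and]
    rw [prod_univ_sum, Fintype.piFinset_univ]
    refine sum_congr rfl fun E _ => ?_
    rw [prod_ite_zero]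
    simp
  · rw [if_neg h]
    refine sum_eq_zero fun E _ => if_neg fun h' => h ⟨h'.1, h'.2.1⟩

theorem partitionFunction_eq_matProd (W : ℕ → Weights n) (N M : ℕ) (lam mu : Finset ℕ) :
    partitionFunction W N M lam mu =
      matProd (fun i => Matrix.of fun c d => rowSum (W i) M c d) N
        (boundary lam M) (boundary mu M) :=
  sum_rows_eq N M _ _ fun i c d E =>
    ∏ j : Fin (M + 1), (W i).vertex (E j.castSucc) (d j) (E j.succ) (c j)

theorem dualPartitionFunction_eq_matProd (W : ℕ → Weights n) (N M : ℕ) (lam mu : Finset ℕ) :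
    dualPartitionFunction W N M lam mu =
      matProd (fun i => Matrix.of fun c d => dualRowSum (W i) M d c) N
        (boundary lam M) (boundary mu M) :=
  sum_rows_eq N M _ _ fun i c d E =>
    ∏ j : Fin (M + 1), (W i).dualVertex (E j.castSucc) (c j) (E j.succ) (d j)

/-- A dual vertex is a vertex with left and right interchanged, so reading the columns backwards
turns one row into the other. -/
theorem dualRowSum_eq (w : Weights n) (M : ℕ) (bot top : Fin (M + 1) → Bool) :
    dualRowSum w M bot top = rowSum w M (bot ∘ Fin.rev) (top ∘ Fin.rev) := by
  unfold dualRowSum rowSum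
  rw [← (Equiv.arrowCongr Fin.revPerm (Equiv.refl (Option (ZMod n)))).sum_comp]
  refine sum_congr rfl fun E _ => ?_
  have h : ∀ j, (Equiv.arrowCongr Fin.revPerm (Equiv.refl (Option (ZMod n)))) E j =
      E (Fin.rev j) := fun j => rfl
  simp only [h, Fin.rev_zero, Fin.rev_last, dualVertex_eq]
  refine if_congr and_comm ?_ rfl
  rw [← Equiv.prod_comp Fin.revPerm]
  simp only [Fin.revPerm_apply, Fin.rev_succ, Fin.rev_castSucc, Fin.rev_rev, Function.comp_apply]

/-- The transfer matrix of the column `j` for vertical spins given by `lam` below and `mu` above. -/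
def columnMatrix (w : Weights n) (lam mu : Finset ℕ) (j : ℕ) :
    Matrix (Option (ZMod n)) (Option (ZMod n)) ℂ :=
  Matrix.of fun x y => w.vertex x (decide (j ∈ mu)) y (decide (j ∈ lam))

theorem rowSum_eq_matProd (w : Weights n) (M : ℕ) (lam mu : Finset ℕ) :
    rowSum w M (boundary lam M) (boundary mu M) =
      matProd (columnMatrix w lam mu) (M + 1) none none := by
  rw [← sum_path_eq_matProd]
  rfl

end Rows

end ChargedModel

end

noncomputable section

namespace ChargedModel

open Finset PowerSeries

/-! ### Commutation relations of vertex operators -/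

section VertexOperators

/-- The geometric series `∑_k z^k X^k`. -/
def geomSeries (z : ℂ) : ℂ⟦X⟧ := PowerSeries.mk fun k => z ^ k

theorem geomSeries_eq (z : ℂ) : geomSeries z = 1 + z • (X * geomSeries z) := by
  ext k
  rcases k with _ | k
  · simp [geomSeries]
  · simp [geomSeries, coeff_succ_X_mul, coeff_one, pow_succ']

variable {n : ℕ} (D : Twist n)

theorem Twist.create_anticomm {a b : ℤ} (h : (n : ℤ) ∣ b - a) (v : D.Fock) :
    D.create a (D.create b v) = - D.create b (D.create a v) :=
  eq_neg_of_add_eq_zero_left ((D.create_antisymmetric v).swap_of_dvd h)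

variable [NeZero n]

theorem Twist.series_X_mul (f : ℂ⟦X⟧) (m : ℤ) (v : D.Fock) :
    D.series (X * f) m v = D.series f (m - n) v := by
  obtain ⟨K, hK⟩ := D.exists_create_sub_eq_zero m v
  rw [D.series_mul X f (K := K + 2) (fun k hk => hK k (by omega)), sum_eq_single 1]
  · simp
  · intro k _ hk
    rw [coeff_X, if_neg hk, zero_smul]
  · intro h
    exact absurd (mem_range.mpr (by omega)) h

theorem Twist.series_geomSeries (z : ℂ) (m : ℤ) (v : D.Fock) :
    D.series (geomSeries z) m v = D.create m v + z • D.series (geomSeries z) (m - n) v := by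
  conv_lhs => rw [geomSeries_eq]
  rw [series_add, series_one, series_smul, series_X_mul]

theorem Twist.series_create_anticomm (f : ℂ⟦X⟧) {p b : ℤ} (h : (n : ℤ) ∣ b - p) (v : D.Fock) :
    D.series f p (D.create b v) = - D.create b (D.series f p v) := by
  obtain ⟨K, hK⟩ := D.exists_create_sub_eq_zero p v
  obtain ⟨K', hK'⟩ := D.exists_create_sub_eq_zero p (D.create b v)
  rw [D.series_apply f (K := max K K') (fun k hk => hK k (by omega)),
    D.series_apply f (K := max K K') (fun k hk => hK' k (by omega)), map_sum, ← sum_neg_distrib]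
  refine sum_congr rfl fun k _ => ?_
  rw [D.create_anticomm, map_smul, smul_neg]
  rw [sub_sub_eq_add_sub, add_sub_right_comm]
  exact h.add (dvd_mul_right _ _)

theorem Twist.series_anticomm (f g : ℂ⟦X⟧) {p p' : ℤ} (h : (n : ℤ) ∣ p' - p) (v : D.Fock) :
    D.series f p (D.series g p' v) = - D.series g p' (D.series f p v) := by
  obtain ⟨K, hK⟩ := D.exists_create_sub_eq_zero p' v
  obtain ⟨K', hK'⟩ := D.exists_create_sub_eq_zero p' (D.series f p v)
  rw [D.series_apply g (K := max K K') (fun k hk => hK k (by omega)),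
    D.series_apply g (K := max K K') (fun k hk => hK' k (by omega)), map_sum, ← sum_neg_distrib]
  refine sum_congr rfl fun k _ => ?_
  rw [map_smul, D.series_create_anticomm, smul_neg]
  rw [sub_right_comm]
  exact h.sub (dvd_mul_right _ _)

theorem Twist.series_series_self (f : ℂ⟦X⟧) (p : ℤ) (v : D.Fock) :
    D.series f p (D.series f p v) = 0 := by
  have h := D.series_anticomm f f (p := p) (p' := p) (by simp) v
  have h2 : (2 : ℂ) • D.series f p (D.series f p v) = 0 := by
    rw [two_smul]; nth_rewrite 1 [h]; exact neg_add_cancel _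
  exact (smul_eq_zero.mp h2).resolve_left two_ne_zero

/-- The series `1 + κ ∑_{k ≥ 1} z^k X^k`. -/
def rowSeries (κ z : ℂ) : ℂ⟦X⟧ := (1 - κ) • 1 + κ • geomSeries z

theorem Twist.series_rowSeries (κ z : ℂ) (m : ℤ) (v : D.Fock) :
    D.series (rowSeries κ z) m v =
      D.create m v + (κ * z) • D.series (geomSeries z) (m - n) v := by
  rw [rowSeries, series_add, series_smul, series_smul, series_one, series_geomSeries]
  module

/-- Series of equal charge anticommute, so the square of the geometric one is zero and only its
product with ψ_m remains. There ψ_m ψ_m = 0 removes the leading term. -/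
theorem Twist.geomSeries_rowSeries (κ z : ℂ) (m : ℤ) (v : D.Fock) :
    D.series (geomSeries z) m (D.series (rowSeries κ z) m v) =
      ((κ - 1) * z) • D.create m (D.series (geomSeries z) (m - n) v) := by
  have h1 : D.series (geomSeries z) m (D.create m v) =
      -(z • D.create m (D.series (geomSeries z) (m - n) v)) := by
    rw [D.series_create_anticomm _ (by simp), series_geomSeries, map_add, map_smul]
    have h2 : D.create m (D.create m v) = 0 := by
      have := D.create_antisymmetric v m m le_rfl
      rwa [pairDefect_self] at this
    rw [h2, zero_add]
  rw [rowSeries, series_add, series_smul, series_smul, series_one, map_add, map_smul, map_smul,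
    series_series_self, h1]
  module

/-- In the form with constant coefficients, the relation of ψ_{p-nk} with ψ_j contributes k inner
pairs, whose exponents of z add up to k - 1. Summation over k reassembles them into a product of two
geometric series, with one factor z to spare. -/
theorem Twist.geomSeries_create (z : ℂ) {p j : ℤ} (h1 : p < j) (h2 : j < p + n) (v : D.Fock) :
    D.series (geomSeries z) p (D.create j v) =
      (-(D.q * D.α p j)) • D.create j (D.series (geomSeries z) p v) +
        ((D.q ^ 2 - 1) * z) •
          D.series (geomSeries z) p (D.series (geomSeries z) (j - n) v) := by
  choose B hB using fun u : D.Fock => D.exists_create_sub_eq_zero p u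
  obtain ⟨J, hJ⟩ := D.exists_create_sub_eq_zero (j - n) v
  set I := (range J).sup fun b => B (D.create (j - n - n * b) v)
  set F : ℕ → ℕ → D.Fock := fun a b =>
    (z ^ a * z ^ b) • D.create (p - n * a) (D.create (j - n - n * b) v) with hF
  have hFJ : ∀ a b, J ≤ b → F a b = 0 := by
    intro a b hb
    rw [hF]
    simp only
    rw [hJ b hb, map_zero, smul_zero]
  have hFI' : ∀ a b : ℕ, I ≤ a → b < J → D.create (p - n * a) (D.create (j - n - n * b) v) = 0 := by
    intro a b ha hb
    exact hB _ a (le_trans (le_sup (f := fun b : ℕ => B (D.create (j - n - n * b) v))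
      (mem_range.mpr hb)) ha)
  have hFI : ∀ a b, I ≤ a → F a b = 0 := by
    intro a b ha
    rcases Nat.lt_or_ge b J with hb | hb
    · rw [hF]
      simp only
      rw [hFI' a b ha hb, smul_zero]
    · exact hFJ a b hb
  set N := I + J + B v + B (D.create j v)
  have hrel : ∀ k : ℕ, D.create (p - n * k) (D.create j v) =
      (-(D.q * D.α p j)) • D.create j (D.create (p - n * k) v) + (D.q ^ 2 - 1) •
        ∑ r ∈ range k, D.create (p - n * (k - 1 - r : ℕ)) (D.create (j - n - n * r) v) := by
    intro k
    have hU := D.create_antisymmetric v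
    have h3 := pairDefect_eq_sum_left D _ (l := p - n * k) (m := j) (i := j - p) (N := k)
      (by omega) (by omega) (by ring) (hU.inner _ _)
    rw [hU _ _ (by have : (0 : ℤ) ≤ n * k := by positivity
                   omega)] at h3
    have e : ((p - n * k : ℤ) : ZMod n) = (p : ZMod n) := by push_cast; simp
    rw [e] at h3
    have h4 : ∑ r ∈ range k, D.create (p - n * k + n * (r + 1 : ℕ)) (D.create (j - n * (r + 1 : ℕ)) v)
        = ∑ r ∈ range k, D.create (p - n * (k - 1 - r : ℕ)) (D.create (j - n - n * r) v) := by
      refine sum_congr rfl fun r hr => ?_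
      rw [mem_range] at hr
      rw [show ((k - 1 - r : ℕ) : ℤ) = (k : ℤ) - 1 - r by omega,
        show p - n * k + n * (r + 1 : ℕ) = p - n * ((k : ℤ) - 1 - r) by push_cast; ring,
        show j - n * (r + 1 : ℕ) = j - n - n * r by push_cast; ring]
    rw [h4] at h3
    rw [eq_comm, sub_eq_zero] at h3
    rw [eq_sub_of_add_eq h3, neg_smul]
    abel
  have hE : D.series (geomSeries z) p (D.series (geomSeries z) (j - n) v) =
      ∑ r ∈ range N, ∑ x ∈ antidiagonal r, F x.1 x.2 := by
    rw [sum_antidiagonal_eq_sum_rect (I := I) (J := J) (by omega) hFI hFJ, sum_comm,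
      D.series_apply _ hJ, map_sum]
    refine sum_congr rfl fun b hb => ?_
    rw [map_smul, D.series_apply _ (fun k hk => hFI' k b hk (mem_range.mp hb)), smul_sum]
    refine sum_congr rfl fun a _ => ?_
    rw [hF, smul_smul]
    simp only [geomSeries, coeff_mk]
    rw [mul_comm]
  rw [hE, D.series_apply _ (K := N + 1) (v := D.create j v) (fun k hk => hB _ k (by omega)),
    D.series_apply _ (K := N + 1) (v := v) (fun k hk => hB _ k (by omega)), map_sum, smul_sum]
  have hs : ∀ k ∈ range (N + 1), coeff k (geomSeries z) • D.create (p - n * k) (D.create j v) =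
      (-(D.q * D.α p j)) • D.create j (coeff k (geomSeries z) • D.create (p - n * k) v) +
      ((D.q ^ 2 - 1) * z ^ k) •
        ∑ r ∈ range k, D.create (p - n * (k - 1 - r : ℕ)) (D.create (j - n - n * r) v) := by
    intro k _
    rw [hrel k, map_smul, geomSeries, coeff_mk]
    module
  rw [sum_congr rfl hs, sum_add_distrib]
  congr 1
  rw [sum_range_succ', range_zero, sum_empty, smul_zero, add_zero, smul_sum]
  refine sum_congr rfl fun r _ => ?_
  rw [Nat.sum_antidiagonal_eq_sum_range_succ F, ← sum_range_reflect, smul_sum, smul_sum]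
  refine sum_congr rfl fun b hb => ?_
  rw [mem_range] at hb
  rw [hF, smul_smul, Nat.add_sub_cancel, show r - (r - b) = b by omega]
  congr 1
  rw [← pow_add, Nat.add_sub_cancel' (by omega)]
  ring

theorem Twist.geomSeries_rowSeries_of_lt (κ z : ℂ) {p j : ℤ} (h1 : p < j) (h2 : j < p + n)
    (v : D.Fock) :
    D.series (geomSeries z) p (D.series (rowSeries κ z) j v) =
      (-(D.q * D.α p j)) • D.create j (D.series (geomSeries z) p v) +
        ((κ + D.q ^ 2 - 1) * z) •
          D.series (geomSeries z) p (D.series (geomSeries z) (j - n) v) := by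
  rw [series_rowSeries, map_add, D.geomSeries_create z h1 h2, map_smul]
  module

end VertexOperators

end ChargedModel

end

noncomputable section

namespace ChargedModel

open Finset SemiInfinite

/-! ### Row vectors -/

section RowVectors

theorem matProd_congr {X : Type*} [Fintype X] [DecidableEq X] {R R' : ℕ → Matrix X X ℂ} {N : ℕ}
    (h : ∀ i < N, R i = R' i) : matProd R N = matProd R' N := by
  induction N with
  | zero => rfl
  | succ N ih => rw [matProd, matProd, ih fun i hi => h i (by omega), h N (by omega)]

variable {n : ℕ} [NeZero n] (D : Twist n) (w : Weights n) (lam : Finset ℕ)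

/-- The generating vector `∑_mu Z(mu) |mu⟩` of the first `m` columns of a row whose lower spins are
given by `lam` and whose last horizontal spin is `e`. -/
def rowVec (m : ℕ) (e : Option (ZMod n)) : D.Fock :=
  ∑ mu ∈ (range m).powerset, matProd (columnMatrix w lam mu) m none e • D.ket mu

theorem rowVec_zero_none : rowVec D w lam 0 none = D.ket ∅ := by
  simp [rowVec, matProd]

theorem rowVec_zero_some (a : ZMod n) : rowVec D w lam 0 (some a) = 0 := by
  simp [rowVec, matProd]

theorem matProd_columnMatrix_insert (m : ℕ) (mu : Finset ℕ) :
    matProd (columnMatrix w lam (insert m mu)) m = matProd (columnMatrix w lam mu) m := by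
  refine matProd_congr fun i hi => ?_
  simp [columnMatrix, mem_insert, hi.ne]

/-- The upper spins of earlier columns give parts below m, so a minus spin above column m multiplies
by u_m on the left; the sum is split according to that spin. -/
theorem rowVec_succ (m : ℕ) (e : Option (ZMod n)) :
    rowVec D w lam (m + 1) e =
      ∑ x, w.vertex x false e (decide (m ∈ lam)) • rowVec D w lam m x +
      ∑ x, w.vertex x true e (decide (m ∈ lam)) • D.create m (rowVec D w lam m x) := by
  unfold rowVec
  rw [range_add_one, sum_powerset_insert (by simp)]
  congr 1
  · simp only [smul_sum]
    rw [sum_comm]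
    refine sum_congr rfl fun mu hmu => ?_
    have hm : m ∉ mu := fun h => by simpa using mem_powerset.mp hmu h
    rw [matProd_succ_apply, sum_smul]
    refine sum_congr rfl fun x _ => ?_
    rw [smul_smul, mul_comm, columnMatrix, Matrix.of_apply, decide_eq_false hm]
  · simp only [map_sum, smul_sum]
    rw [sum_comm]
    refine sum_congr rfl fun mu hmu => ?_
    rw [D.ket_insert fun x hx => by simpa using mem_powerset.mp hmu hx, matProd_succ_apply,
      sum_smul]
    refine sum_congr rfl fun x _ => ?_
    rw [matProd_columnMatrix_insert, map_smul, smul_smul, mul_comm, columnMatrix, Matrix.of_apply,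
      decide_eq_true (mem_insert_self m mu)]

variable {lam} {m : ℕ}

theorem rowVec_succ_none_of_notMem (h : m ∉ lam) :
    rowVec D w lam (m + 1) none = w.a1 • rowVec D w lam m none := by
  rw [rowVec_succ, decide_eq_false h, Fintype.sum_option, Fintype.sum_option]
  simp [Weights.vertex]

theorem rowVec_succ_none_of_mem (h : m ∈ lam) :
    rowVec D w lam (m + 1) none =
      w.c1 • rowVec D w lam m (some 1) + w.b1 • D.create m (rowVec D w lam m none) := by
  rw [rowVec_succ, decide_eq_true h, Fintype.sum_option, Fintype.sum_option]
  simp [Weights.vertex, ite_smul]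

theorem rowVec_succ_some_of_notMem (h : m ∉ lam) (a : ZMod n) :
    rowVec D w lam (m + 1) (some a) = w.b2 a • rowVec D w lam m (some (a + 1)) +
      (if a = 0 then w.c2 else 0) • D.create m (rowVec D w lam m none) := by
  rw [rowVec_succ, decide_eq_false h, Fintype.sum_option, Fintype.sum_option]
  simp [Weights.vertex, ite_smul]

theorem rowVec_succ_some_of_mem (h : m ∈ lam) (a : ZMod n) :
    rowVec D w lam (m + 1) (some a) =
      w.a2 a • D.create m (rowVec D w lam m (some (a + 1))) := by
  rw [rowVec_succ, decide_eq_true h, Fintype.sum_option, Fintype.sum_option]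
  simp [Weights.vertex, ite_smul]

end RowVectors

/-! ### Starting columns and weights of charged paths. -/

section RowParameters

variable {n : ℕ}

/-- The position, among the last `n` of the columns `0, …, m - 1`, congruent to that at which a
horizontal spin of charge `a` after these columns has started. -/
def startPos (m : ℕ) (a : ZMod n) : ℤ := m - 1 - ((-a).val : ℤ)

/-- The weight of a path of horizontal spins ending in the charge `a`. -/
def pathWeight (w : Weights n) (a : ZMod n) : ℂ :=
  w.c2 / w.a1 * ∏ i ∈ range (-a).val, w.b2 (-((i + 1 : ℕ) : ZMod n)) / w.a1

theorem startPos_zero (m : ℕ) : startPos m (0 : ZMod n) = m - 1 := by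
  simp [startPos]

theorem pathWeight_zero (w : Weights n) : pathWeight w 0 = w.c2 / w.a1 := by
  simp [pathWeight]

theorem pathWeight_ne_zero {w : Weights n} (hw : w.Nonvanishing) (a : ZMod n) :
    pathWeight w a ≠ 0 := by
  obtain ⟨ha1, ha2, hb1, hb2, hc1, hc2⟩ := hw
  exact mul_ne_zero (div_ne_zero hc2 ha1)
    (prod_ne_zero_iff.mpr fun i _ => div_ne_zero (hb2 _) ha1)

variable [NeZero n]

theorem val_neg_one : (-1 : ZMod n).val = n - 1 := by
  obtain ⟨k, rfl⟩ : ∃ k, n = k + 1 := ⟨n - 1, by have := NeZero.pos n; omega⟩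
  rw [ZMod.val_neg_one, Nat.add_sub_cancel]

/-- A path runs through the charges 0, -1, -2, …, so charge 1 is the last of a period and belongs to
a start n columns back. -/
theorem startPos_one (m : ℕ) : startPos m (1 : ZMod n) = m - n := by
  have := NeZero.pos n
  rw [startPos, val_neg_one]
  omega

theorem val_neg_add_one {a : ZMod n} (ha : a ≠ 0) : (-a).val = (-(a + 1)).val + 1 := by
  have h0 : (-a).val ≠ 0 := by rwa [ne_eq, ZMod.val_eq_zero, neg_eq_zero]
  have h1 : (-(a + 1)).val = (-a).val - 1 := by
    have h2 : -(a + 1) = (((-a).val - 1 : ℕ) : ZMod n) := by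
      rw [Nat.cast_sub (by omega), ZMod.natCast_zmod_val, Nat.cast_one]; ring
    rw [h2]
    exact ZMod.val_natCast_of_lt (lt_of_le_of_lt (Nat.sub_le _ _) (ZMod.val_lt _))
  omega

theorem startPos_succ {a : ZMod n} (ha : a ≠ 0) (m : ℕ) :
    startPos (m + 1) a = startPos m (a + 1) := by
  rw [startPos, startPos, val_neg_add_one ha]
  push_cast; ring

theorem pathWeight_of_ne {a : ZMod n} (ha : a ≠ 0) (w : Weights n) :
    pathWeight w a = w.b2 a / w.a1 * pathWeight w (a + 1) := by
  rw [pathWeight, pathWeight, val_neg_add_one ha, prod_range_succ, ← val_neg_add_one ha,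
    ZMod.natCast_zmod_val, neg_neg]
  ring

/-- The product of the normalized weights `b₂(a) / a₁` over all charges. -/
def rowParam (w : Weights n) : ℂ := ∏ a, w.b2 a / w.a1

theorem prod_range_cast (F : ZMod n → ℂ) : ∏ i ∈ range n, F (i : ZMod n) = ∏ a, F a := by
  refine prod_nbij' (fun i => (i : ZMod n)) ZMod.val (by simp)
    (fun a _ => mem_range.mpr (ZMod.val_lt a)) (fun i hi => ?_) (fun a _ => ?_) (fun _ _ => rfl)
  · exact ZMod.val_natCast_of_lt (mem_range.mp hi)
  · exact ZMod.natCast_zmod_val a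

/-- One more step, with the weight of charge 0, completes the product over all charges. -/
theorem pathWeight_one (w : Weights n) :
    w.b2 0 / w.a1 * pathWeight w 1 = rowParam w * (w.c2 / w.a1) := by
  have h : rowParam w = ∏ i ∈ range n, w.b2 (-(i : ZMod n)) / w.a1 := by
    rw [prod_range_cast (fun a => w.b2 (-a) / w.a1), rowParam]
    exact (Equiv.prod_comp (Equiv.neg (ZMod n)) fun a => w.b2 a / w.a1).symm
  have h2 : range n = range (n - 1 + 1) := by rw [Nat.sub_add_cancel (NeZero.pos n)]
  rw [pathWeight, val_neg_one, h, h2, prod_range_succ']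
  simp only [Nat.cast_zero, neg_zero]
  ring

/-- The ratio `c₁ c₂ / (b₁ b₂(0))`. -/
def turnRatio (w : Weights n) : ℂ := w.c1 * w.c2 / (w.b1 * w.b2 0)

theorem c1_mul_pathWeight_one {w : Weights n} (hw : w.Nonvanishing) :
    w.c1 * pathWeight w 1 = w.b1 * (turnRatio w * rowParam w) := by
  obtain ⟨ha1, ha2, hb1, hb2, hc1, hc2⟩ := hw
  have h := pathWeight_one w
  have h0 := hb2 0
  have h3 : pathWeight w 1 = rowParam w * w.c2 / w.b2 0 := by
    field_simp at h ⊢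
    linear_combination h
  rw [h3, turnRatio]
  field_simp

theorem rowParam_ne_zero {w : Weights n} (hw : w.Nonvanishing) : rowParam w ≠ 0 :=
  prod_ne_zero_iff.mpr fun a _ => div_ne_zero (hw.2.2.2.1 a) hw.1

end RowParameters

/-! ### The shape of the partial row vectors and its propagation. -/

section RowInvariant

variable {n : ℕ} [NeZero n] {D : Twist n} {w : Weights n} {lam : Finset ℕ}

theorem Twist.series_ket_empty (f : PowerSeries ℂ) {p : ℤ} (hp : p < 0) :
    D.series f p (D.ket ∅) = 0 := by
  have hn : (0 : ℤ) < n := by exact_mod_cast NeZero.pos n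
  rw [D.series_apply f (K := 0), range_zero, sum_empty]
  intro k _
  rw [D.ket_empty]
  refine D.create_descending ?_
  have : (0 : ℤ) ≤ n * k := by positivity
  omega

/-- The operator `∑_k z^k ψ_{p - n k}` attached to a row. -/
def rowOp (D : Twist n) (w : Weights n) (p : ℤ) : D.Fock →ₗ[ℂ] D.Fock :=
  D.series (geomSeries (rowParam w)) p

/-- The operator by which a row transforms `ψ_m`. -/
def rowImage (D : Twist n) (w : Weights n) (m : ℤ) : D.Fock →ₗ[ℂ] D.Fock :=
  D.series (rowSeries (turnRatio w) (rowParam w)) m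

/-- The row vectors of the first `m` columns are determined by the vector `v`. -/
def RowInvariant (D : Twist n) (w : Weights n) (lam : Finset ℕ) (m : ℕ) (c : ℂ) (v : D.Fock) :
    Prop :=
  rowVec D w lam m none = c • v ∧
    ∀ a, rowVec D w lam m (some a) = (c * pathWeight w a) • rowOp D w (startPos m a) v

theorem rowInvariant_zero : RowInvariant D w lam 0 1 (D.ket ∅) := by
  refine ⟨by rw [rowVec_zero_none, one_smul], fun a => ?_⟩
  rw [rowVec_zero_some, rowOp, D.series_ket_empty _ (by rw [startPos]; push_cast; omega), smul_zero]

/-- Stated for the deviation from the expected shape, which is merely multiplied by b₂(a). The shape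
thus propagates forwards and, as b₂(a) ≠ 0, also backwards; the converse direction of the theorem
uses the latter. -/
theorem rowVec_defect_of_notMem (hw : w.Nonvanishing) {m : ℕ} (h : m ∉ lam) {c : ℂ} {v : D.Fock}
    (hv : rowVec D w lam m none = c • v) (a : ZMod n) :
    rowVec D w lam (m + 1) (some a) -
        (w.a1 * c * pathWeight w a) • rowOp D w (startPos (m + 1) a) v =
      w.b2 a • (rowVec D w lam m (some (a + 1)) -
        (c * pathWeight w (a + 1)) • rowOp D w (startPos m (a + 1)) v) := by
  have ha1 := hw.1
  rw [rowVec_succ_some_of_notMem D w h, hv]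
  by_cases ha : a = 0
  -- Only charge 0 admits a path starting in this column; it supplies the leading term in the
  -- recursion E_m = ψ_m + z E_{m-n}.
  · subst ha
    have h1 := pathWeight_one w
    have h2 : w.b2 0 * pathWeight w 1 = rowParam w * w.c2 := by
      field_simp at h1
      linear_combination h1
    rw [if_pos rfl, zero_add, startPos_one, startPos_zero, pathWeight_zero, rowOp, rowOp,
      show (((m + 1 : ℕ) : ℤ) - 1) = m by push_cast; ring, D.series_geomSeries, map_smul,
      smul_sub, smul_smul, smul_smul,
      show w.b2 0 * (c * pathWeight w 1) = c * (rowParam w * w.c2) by linear_combination c * h2,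
      show w.a1 * c * (w.c2 / w.a1) = c * w.c2 by field_simp]
    module
  · rw [if_neg ha, zero_smul, add_zero, startPos_succ ha, pathWeight_of_ne ha, smul_sub, smul_smul]
    congr 2
    field_simp

theorem RowInvariant.of_notMem (hw : w.Nonvanishing) {m : ℕ} (h : m ∉ lam) {c : ℂ} {v : D.Fock}
    (hv : RowInvariant D w lam m c v) : RowInvariant D w lam (m + 1) (w.a1 * c) v := by
  refine ⟨by rw [rowVec_succ_none_of_notMem D w h, hv.1, smul_smul], fun a => ?_⟩
  have := rowVec_defect_of_notMem hw h hv.1 a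
  rw [hv.2, sub_self, smul_zero, sub_eq_zero] at this
  exact this

/-- At a part a path of charge 1 ends, with weight c₁, or the vertical line passes straight, with
weight b₁. Together these give ψ_m + κ z E_{m-n}. -/
theorem RowInvariant.none_of_mem (hw : w.Nonvanishing) {m : ℕ} (h : m ∈ lam) {c : ℂ} {v : D.Fock}
    (hv : RowInvariant D w lam m c v) :
    rowVec D w lam (m + 1) none = (w.b1 * c) • rowImage D w m v := by
  rw [rowVec_succ_none_of_mem D w h, hv.1, hv.2, startPos_one, rowImage, D.series_rowSeries,
    smul_smul, map_smul, rowOp]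
  have := c1_mul_pathWeight_one hw
  rw [show w.c1 * (c * pathWeight w 1) = w.b1 * c * (turnRatio w * rowParam w) by
    linear_combination c * this]
  module

theorem RowInvariant.some_of_mem {m : ℕ} (h : m ∈ lam) {c : ℂ} {v : D.Fock}
    (hv : RowInvariant D w lam m c v) (a : ZMod n) :
    rowVec D w lam (m + 1) (some a) = (w.a2 a * (c * pathWeight w (a + 1))) •
      D.create m (rowOp D w (startPos m (a + 1)) v) := by
  rw [rowVec_succ_some_of_mem D w h, hv.2, map_smul, smul_smul]

theorem startPos_bounds {a : ZMod n} (ha : a ≠ 0) (m : ℕ) :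
    startPos (m + 1) a < m ∧ (m : ℤ) < startPos (m + 1) a + n := by
  have h0 : (-a).val ≠ 0 := by rwa [ne_eq, ZMod.val_eq_zero, neg_eq_zero]
  have h1 := ZMod.val_lt (-a)
  rw [startPos]
  push_cast
  omega

theorem cast_startPos (a : ZMod n) (m : ℕ) :
    ((startPos (m + 1) a : ℤ) : ZMod n) = a + m := by
  rw [startPos]
  push_cast
  rw [ZMod.natCast_zmod_val]
  ring

/-- The row exchange relation at a part of `lam`. -/
theorem rowOp_rowImage (hw : w.Nonvanishing) (a : ZMod n) (m : ℕ) (v : D.Fock)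
    (h0 : w.a1 * w.a2 0 = (turnRatio w - 1) * (w.b1 * w.b2 0))
    (h1 : a ≠ 0 → turnRatio w + D.q ^ 2 - 1 = 0)
    (h2 : a ≠ 0 → w.a1 * w.a2 a = -(D.q * D.α (a + m) m) * (w.b1 * w.b2 a)) :
    (w.b1 * pathWeight w a) • rowOp D w (startPos (m + 1) a) (rowImage D w m v) =
      (w.a2 a * pathWeight w (a + 1)) • D.create m (rowOp D w (startPos m (a + 1)) v) := by
  have ha1 := hw.1
  have hb1 := hw.2.2.1
  by_cases ha : a = 0
  · subst ha
    have h3 := pathWeight_one w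
    rw [zero_add, startPos_one, startPos_zero, pathWeight_zero, rowOp, rowOp, rowImage,
      show (((m + 1 : ℕ) : ℤ) - 1) = m by push_cast; ring, D.geomSeries_rowSeries, smul_smul]
    congr 1
    have h4 : w.b2 0 * pathWeight w 1 = rowParam w * w.c2 := by
      field_simp at h3
      linear_combination h3
    field_simp
    linear_combination (-(turnRatio w - 1) * w.b1) * h4 - pathWeight w 1 * h0
  -- For a nonzero charge, `h1` removes the term quadratic in the series and `h2` matches the
  -- remaining multiple of ψ_m E_p.
  · obtain ⟨hp1, hp2⟩ := startPos_bounds ha m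
    rw [rowOp, rowImage, D.geomSeries_rowSeries_of_lt _ _ hp1 hp2, h1 ha, zero_mul, zero_smul,
      add_zero, smul_smul, cast_startPos, ← startPos_succ ha, pathWeight_of_ne ha, ← rowOp]
    congr 1
    have h3 := h2 ha
    push_cast
    field_simp
    linear_combination (-pathWeight w (a + 1)) * h3

theorem RowInvariant.of_mem (hw : w.Nonvanishing) {m : ℕ} (h : m ∈ lam) {c : ℂ} {v : D.Fock}
    (hv : RowInvariant D w lam m c v)
    (hrel : ∀ a, (w.b1 * pathWeight w a) • rowOp D w (startPos (m + 1) a) (rowImage D w m v) =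
      (w.a2 a * pathWeight w (a + 1)) • D.create m (rowOp D w (startPos m (a + 1)) v)) :
    RowInvariant D w lam (m + 1) (w.b1 * c) (rowImage D w m v) := by
  refine ⟨hv.none_of_mem hw h, fun a => ?_⟩
  rw [hv.some_of_mem h, mul_left_comm, mul_smul, ← hrel, smul_smul]
  congr 1
  ring

end RowInvariant

end ChargedModel

end

noncomputable section

namespace ChargedModel

open Finset SemiInfinite

/-! ### Matching of a single row -/

theorem Twist.create_ket_empty {n : ℕ} (D : Twist n) (x : ℕ) :
    D.create x (D.ket ∅) = D.ket {x} := by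
  rw [← D.ket_insert (by simp)]
  rfl

section RowMatch

variable {n : ℕ} [NeZero n] (D : Twist n) (w : Weights n)

/-- The row with weights `w` matches the exponential of the Hamiltonian with parameters `s`. -/
def RowMatch (s : ℕ+ → ℂ) : Prop :=
  ∀ (M : ℕ) (lam mu : Finset ℕ), (∀ p ∈ lam, p ≤ M) → (∀ p ∈ mu, p ≤ M) →
    matProd (columnMatrix w lam mu) (M + 1) none none =
      w.a1 ^ (M + 1) * (w.b1 / w.a1) ^ lam.card * D.expPlus s mu lam

variable {D w}

theorem bra_rowVec (lam : Finset ℕ) {m : ℕ} (e : Option (ZMod n)) {mu : Finset ℕ}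
    (hmu : ∀ x ∈ mu, x < m) :
    D.bra mu (rowVec D w lam m e) = matProd (columnMatrix w lam mu) m none e := by
  rw [rowVec, map_sum, sum_eq_single mu]
  · rw [map_smul, D.bra_ket, if_pos rfl, smul_eq_mul, mul_one]
  · intro nu _ hnu
    rw [map_smul, D.bra_ket, if_neg hnu, smul_zero]
  · intro h
    exact absurd (mem_powerset.mpr fun x hx => mem_range.mpr (hmu x hx)) h

theorem rowMatch_iff_rowVec (s : ℕ+ → ℂ) :
    RowMatch D w s ↔ ∀ (M : ℕ) (lam : Finset ℕ), (∀ p ∈ lam, p ≤ M) →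
      rowVec D w lam (M + 1) none =
        (w.a1 ^ (M + 1) * (w.b1 / w.a1) ^ lam.card) • D.expH (toSeries s) (D.ket lam) := by
  constructor
  · intro h M lam hlam
    rw [D.eq_sum_bra_smul_ket (D.expH_mem_ketSpan (toSeries s) (D.ket_mem_ketSpan hlam)), smul_sum,
      rowVec]
    refine sum_congr rfl fun mu hmu => ?_
    rw [h M lam mu hlam fun p hp => Nat.lt_succ_iff.mp (mem_range.mp (mem_powerset.mp hmu hp)),
      smul_smul, D.expPlus_eq]
  · intro h M lam mu hlam hmu
    rw [← bra_rowVec (D := D) lam none fun x hx => Nat.lt_succ_of_le (hmu x hx), h M lam hlam,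
      map_smul, smul_eq_mul, D.expPlus_eq]

/-- Each part of λ acts on the row by R_m and on the exponential by the series of e^S at m. These
coincide by hypothesis, so the row follows e^H applied to the parts already passed. -/
theorem rowInvariant_expH (hw : w.Nonvanishing) {S : PowerSeries ℂ}
    (hS : PowerSeries.constantCoeff S = 0)
    (hexp : expSeries S = rowSeries (turnRatio w) (rowParam w))
    (hrel : ∀ (a : ZMod n) (m : ℕ) (v : D.Fock),
      (w.b1 * pathWeight w a) • rowOp D w (startPos (m + 1) a) (rowImage D w m v) =
        (w.a2 a * pathWeight w (a + 1)) • D.create m (rowOp D w (startPos m (a + 1)) v))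
    (lam : Finset ℕ) (m : ℕ) :
    RowInvariant D w lam m (w.a1 ^ m * (w.b1 / w.a1) ^ (lam.filter (· < m)).card)
      (D.expH S (D.ket (lam.filter (· < m)))) := by
  have ha1 := hw.1
  induction m with
  | zero =>
    have : lam.filter (· < 0) = ∅ := by simp
    rw [this, D.ket_empty, D.expH_descending, ← D.ket_empty]
    simpa using rowInvariant_zero
  | succ m ih =>
    by_cases h : m ∈ lam
    · have hf : lam.filter (· < m + 1) = insert m (lam.filter (· < m)) := by
        ext x
        simp only [mem_filter, mem_insert]
        constructor
        · rintro ⟨h1, h2⟩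
          rcases Nat.lt_succ_iff_lt_or_eq.mp h2 with h3 | h3
          · exact Or.inr ⟨h1, h3⟩
          · exact Or.inl h3
        · rintro (rfl | ⟨h1, h2⟩)
          · exact ⟨h, Nat.lt_succ_self _⟩
          · exact ⟨h1, by omega⟩
      rw [hf, card_insert_of_notMem (by simp), D.ket_insert (by simp), D.expH_create hS, hexp,
        ← rowImage]
      have := ih.of_mem hw h fun a => hrel a m _
      convert this using 1
      rw [pow_succ, pow_succ]
      field_simp
    · have hf : lam.filter (· < m + 1) = lam.filter (· < m) := by
        ext x
        simp only [mem_filter]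
        refine and_congr_right fun hx => ?_
        have : x ≠ m := fun h' => h (h' ▸ hx)
        omega
      rw [hf, pow_succ', mul_assoc]
      exact ih.of_notMem hw h

/-- The conditions on the weights of a row under which it matches some Hamiltonian. -/
def RowCondition (D : Twist n) (w : Weights n) : Prop :=
  w.a1 * w.a2 0 = (turnRatio w - 1) * (w.b1 * w.b2 0) ∧
    ∀ a : ZMod n, a ≠ 0 → turnRatio w + D.q ^ 2 - 1 = 0 ∧
      w.a1 * w.a2 a = -(D.q * D.α a 0) * (w.b1 * w.b2 a)

theorem RowCondition.rowMatch (hD : D.IsShiftInvariant) (hw : w.Nonvanishing)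
    (h : RowCondition D w) {s : ℕ+ → ℂ}
    (hexp : expSeries (toSeries s) = rowSeries (turnRatio w) (rowParam w)) : RowMatch D w s := by
  rw [rowMatch_iff_rowVec]
  intro M lam hlam
  have hα : ∀ (a : ZMod n) (m : ℕ), D.α (a + m) m = D.α a 0 := by
    intro a m
    have := hD a 0 m
    rwa [zero_add] at this
  have := (rowInvariant_expH (D := D) hw (constantCoeff_toSeries s) hexp
    (fun a m v => rowOp_rowImage hw a m v h.1 (fun ha => (h.2 a ha).1)
      (fun ha => by rw [hα]; exact (h.2 a ha).2)) lam (M + 1)).1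
  rwa [filter_true_of_mem fun x hx => Nat.lt_succ_of_le (hlam x hx)] at this

theorem Twist.create_ket_empty_of_neg (D : Twist n) {x : ℤ} (hx : x < 0) :
    D.create x (D.ket ∅) = 0 := by
  rw [D.ket_empty]
  exact D.create_descending (by omega)

theorem Twist.bra_series_ket_empty (D : Twist n) (f : PowerSeries ℂ) (k : ℕ) :
    D.bra {0} (D.series f (n * k : ℕ) (D.ket ∅)) = PowerSeries.coeff k f := by
  have hn : (0 : ℤ) < n := by exact_mod_cast NeZero.pos n
  rw [D.series_apply f (K := k + 1), map_sum, sum_eq_single k]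
  · have : ((n * k : ℕ) : ℤ) - n * k = ((0 : ℕ) : ℤ) := by push_cast; ring
    rw [this, D.create_ket_empty, map_smul, D.bra_ket, if_pos rfl, smul_eq_mul, mul_one]
  · intro j hj hjk
    have hjk' : j ≤ k := by rw [mem_range] at hj; omega
    have : ((n * k : ℕ) : ℤ) - n * j = ((n * (k - j) : ℕ) : ℤ) := by
      push_cast [hjk']; ring
    rw [this, D.create_ket_empty, map_smul, D.bra_ket, if_neg, smul_zero]
    rw [singleton_inj]
    exact (Nat.mul_pos (NeZero.pos n) (by omega)).ne'
  · intro h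
    exact absurd (mem_range.mpr (Nat.lt_succ_self k)) h
  · intro j hj
    refine D.create_ket_empty_of_neg ?_
    push_cast
    have : (n : ℤ) * (k + 1) ≤ n * j := by gcongr; exact_mod_cast hj
    linarith

theorem rowInvariant_of_empty (hw : w.Nonvanishing) {lam : Finset ℕ} {m : ℕ}
    (h : ∀ x ∈ lam, m ≤ x) : RowInvariant D w lam m (w.a1 ^ m) (D.ket ∅) := by
  induction m with
  | zero => simpa using rowInvariant_zero
  | succ m ih =>
    rw [pow_succ']
    exact (ih fun x hx => (Nat.le_succ m).trans (h x hx)).of_notMem hw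
      fun hm => absurd (h m hm) (by omega)

/-- Test with the single part n k: the row gives R_{nk} and the exponential gives the series of e^S,
both on the vacuum. The coefficient at the partition with the single part 0 is the k-th coefficient
of the series. -/
theorem RowMatch.expSeries_eq (hw : w.Nonvanishing) {s : ℕ+ → ℂ} (h : RowMatch D w s) :
    expSeries (toSeries s) = rowSeries (turnRatio w) (rowParam w) := by
  have ha1 := hw.1
  have hb1 := hw.2.2.1
  rw [rowMatch_iff_rowVec] at h
  ext k
  have h1 := h (n * k) {n * k} (by simp)
  have h2 := (rowInvariant_of_empty (D := D) hw (lam := {n * k}) (m := n * k) (by simp)).none_of_mem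
    hw (mem_singleton_self _)
  rw [h2, card_singleton, pow_one, ← D.create_ket_empty, D.expH_create (constantCoeff_toSeries s),
    D.ket_empty, D.expH_descending, ← D.ket_empty,
    show w.a1 ^ (n * k + 1) * (w.b1 / w.a1) = w.b1 * w.a1 ^ (n * k) by
      rw [pow_succ]; field_simp] at h1
  have h3 := smul_right_injective _ (mul_ne_zero hb1 (pow_ne_zero (n * k) ha1)) h1
  rw [← D.bra_series_ket_empty, ← D.bra_series_ket_empty, ← h3]
  rfl

/-- A matching row satisfies the exchange relation at the column `n` on the vacuum. -/
theorem RowMatch.exchange (hw : w.Nonvanishing) {s : ℕ+ → ℂ} (h : RowMatch D w s) (a : ZMod n) :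
    (w.b1 * pathWeight w a) • rowOp D w (startPos (n + 1) a) (rowImage D w n (D.ket ∅)) =
      (w.a2 a * pathWeight w (a + 1)) •
        D.create n (rowOp D w (startPos n (a + 1)) (D.ket ∅)) := by
  have hexp := h.expSeries_eq hw
  obtain ⟨ha1, ha2, hb1, hb2, hc1, hc2⟩ := id hw
  rw [rowMatch_iff_rowVec] at h
  -- A second part behind `k` empty columns probes charge a after column n: in these columns the
  -- charge drops from a to 1, and the part at `m` absorbs it through c₁.
  set k := (a - 1).val
  set m := n + 1 + k
  set lam : Finset ℕ := {n, m}
  have hnm : n ≠ m := by omega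
  have hn : n ∈ lam := by simp [lam]
  have hm : m ∈ lam := by simp [lam]
  have hmem : ∀ j < k, n + 1 + j ∉ lam := by
    intro j hj
    simp only [lam, mem_insert, mem_singleton]
    omega
  have hinv := rowInvariant_of_empty (D := D) hw (lam := lam) (m := n)
    (by simp only [lam, mem_insert, mem_singleton]; omega)
  set v := rowImage D w n (D.ket ∅)
  set c : ℕ → ℂ := fun j => w.a1 ^ j * (w.b1 * w.a1 ^ n)
  have hc : ∀ j, c (j + 1) = w.a1 * c j := fun j => by simp only [c, pow_succ']; ring
  have hnone : ∀ j ≤ k, rowVec D w lam (n + 1 + j) none = c j • v := by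
    intro j
    induction j with
    | zero =>
      intro _
      rw [add_zero, hinv.none_of_mem hw hn]
      simp [c, v]
    | succ j ih =>
      intro hj
      rw [← add_assoc, rowVec_succ_none_of_notMem D w (hmem j (by omega)), ih (by omega), smul_smul,
        hc]
  have hket : D.expH (toSeries s) (D.ket lam) = rowImage D w m v := by
    have e : lam = insert m {n} := by simp only [lam]; exact pair_comm n m
    rw [e, D.ket_insert (by simp; omega), ← D.create_ket_empty,
      D.expH_create (constantCoeff_toSeries s), D.expH_create (constantCoeff_toSeries s),
      D.ket_empty, D.expH_descending, ← D.ket_empty, hexp]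
    rfl
  have hcard : lam.card = 2 := card_pair hnm
  have h1 := h m lam (by simp only [lam, mem_insert, mem_singleton]; omega)
  rw [rowVec_succ_none_of_mem D w hm, hket, hcard, hnone k le_rfl, rowImage, D.series_rowSeries,
    show w.a1 ^ (m + 1) * (w.b1 / w.a1) ^ 2 = w.b1 * c k by
      simp only [c, m]; rw [pow_add, pow_add, pow_add]; field_simp] at h1
  have h2 : rowVec D w lam m (some 1) =
      (c k * pathWeight w 1) • rowOp D w (startPos m (1 : ZMod n)) v := by
    rw [map_smul, smul_add, smul_smul, smul_smul, add_comm] at h1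
    have h3 := add_left_cancel h1
    apply smul_right_injective _ hc1
    simp only
    rw [h3, startPos_one, rowOp, smul_smul]
    congr 1
    linear_combination (-c k) * c1_mul_pathWeight_one hw
  -- Backward propagation: as b₂ ≠ 0, the expected shape after an empty column forces it before that
  -- column.
  have hdef : ∀ j ≤ k, ∀ b : ZMod n,
      rowVec D w lam (n + 1 + j) (some b) =
        (c j * pathWeight w b) • rowOp D w (startPos (n + 1 + j) b) v →
      rowVec D w lam (n + 1) (some (b + (j : ZMod n))) =
        (c 0 * pathWeight w (b + (j : ZMod n))) •
          rowOp D w (startPos (n + 1) (b + (j : ZMod n))) v := by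
    intro j
    induction j with
    | zero => intro _ b hb; simpa using hb
    | succ j ih =>
      intro hj b hb
      have h3 := rowVec_defect_of_notMem hw (hmem j (by omega)) (hnone j (by omega)) b
      rw [← hc, show n + 1 + j + 1 = n + 1 + (j + 1) by ring, hb, sub_self, eq_comm,
        smul_eq_zero_iff_right (hb2 b), sub_eq_zero] at h3
      have := ih (by omega) (b + 1) h3
      rw [show b + ((j + 1 : ℕ) : ZMod n) = b + 1 + j by push_cast; ring]
      exact this
  have h3 := hdef k le_rfl 1 h2
  have h4 : (1 : ZMod n) + (k : ZMod n) = a := by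
    simp only [k]; rw [ZMod.natCast_zmod_val]; ring
  rw [h4, hinv.some_of_mem hn] at h3
  apply smul_right_injective _ (pow_ne_zero n ha1)
  simp only
  rw [smul_smul, smul_smul, mul_left_comm (w.a1 ^ n) (w.a2 a), h3]
  congr 1
  simp only [c]
  ring

/-- Every pair in the normal form has a negative second index, and that factor kills the vacuum. -/
theorem Twist.create_create_zero (D : Twist n) {x : ℤ} (hx : x < 0) :
    D.create x (D.create 0 (D.ket ∅)) = 0 := by
  have h := D.create_antisymmetric (D.ket ∅) x 0 hx.le
  rw [pairDefect, sub_eq_zero] at h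
  rw [h, ← Submodule.mem_bot ℂ]
  refine pairEval_mem _ (D.normalForm_mem_supported hx.le) _ fun st hst => ?_
  rw [Submodule.mem_bot, D.create_ket_empty_of_neg (by have := hst.2.1; have := hst.2.2.1; omega),
    map_zero]

theorem rowOp_ket_empty {i : ℕ} (hi : i < n) : rowOp D w i (D.ket ∅) = D.ket {i} := by
  rw [rowOp, D.series_geomSeries, D.series_ket_empty _ (by omega), smul_zero, add_zero,
    D.create_ket_empty]

theorem rowOp_rowOp_ket_empty {i : ℕ} (hi : 0 < i) (hin : i < n) :
    rowOp D w i (rowOp D w 0 (D.ket ∅)) = D.ket {0, i} := by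
  have h0 : rowOp D w 0 (D.ket ∅) = D.create 0 (D.ket ∅) := by
    have := rowOp_ket_empty (D := D) (w := w) (i := 0) (NeZero.pos n)
    rw [Nat.cast_zero] at this
    rw [this, ← D.create_ket_empty, Nat.cast_zero]
  have h1 : D.series (geomSeries (rowParam w)) ((i : ℤ) - n) (D.create 0 (D.ket ∅)) = 0 := by
    rw [D.series_apply _ (K := 0), range_zero, sum_empty]
    intro k _
    refine D.create_create_zero ?_
    have : (0 : ℤ) ≤ n * k := by positivity
    omega
  have h2 := D.create_ket_empty 0
  rw [Nat.cast_zero] at h2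
  rw [h0, rowOp, D.series_geomSeries, h1, smul_zero, add_zero, h2, pair_comm, D.ket_insert]
  simpa using hi

/-- Column n is the first at which the series of the preceding period acts nontrivially on the
vacuum. For a nonzero charge, the quadratic term then gives the partition {0, i} and the linear one
{n, i}, so their coefficients can be compared separately; for charge zero the coefficient at {n, 0}
suffices. -/
theorem RowMatch.rowCondition (hw : w.Nonvanishing) {s : ℕ+ → ℂ} (h : RowMatch D w s) :
    RowCondition D w := by
  obtain ⟨ha1, ha2, hb1, hb2, hc1, hc2⟩ := id hw
  have hpos := NeZero.pos n
  have hket : ∀ i : ℕ, i < n → D.create n (D.ket {i}) = D.ket {n, i} := fun i hi =>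
    (D.ket_insert (by simpa using hi)).symm
  constructor
  · have h1 := h.exchange hw 0
    have h3 := pathWeight_one w
    have h4 : w.b2 0 * pathWeight w 1 = rowParam w * w.c2 := by
      field_simp at h3
      linear_combination h3
    have h0 := rowOp_ket_empty (D := D) (w := w) (i := 0) hpos
    rw [Nat.cast_zero] at h0
    rw [zero_add, startPos_one, startPos_zero, pathWeight_zero, rowImage, rowOp,
      show (((n + 1 : ℕ) : ℤ) - 1) = n by push_cast; ring, D.geomSeries_rowSeries, smul_smul,
      sub_self, ← rowOp, h0, hket 0 hpos] at h1
    have h2 := congrArg (D.bra {n, 0}) h1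
    rw [map_smul, map_smul, D.bra_ket, if_pos rfl, smul_eq_mul, smul_eq_mul, mul_one, mul_one] at h2
    apply mul_right_cancel₀ (pathWeight_ne_zero hw 1)
    field_simp at h2
    linear_combination -h2 - (turnRatio w - 1) * w.b1 * h4
  · intro a ha
    have h1 := h.exchange hw a
    obtain ⟨hp1, hp2⟩ := startPos_bounds ha n
    obtain ⟨i, hi⟩ : ∃ i : ℕ, startPos (n + 1) a = i := ⟨(startPos (n + 1) a).toNat, by omega⟩
    rw [hi] at hp1 hp2
    have hi0 : 0 < i := by omega
    have hin : i < n := by omega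
    have hcast : ((i : ℤ) : ZMod n) = a := by
      rw [← hi, cast_startPos]; simp
    rw [← startPos_succ ha, hi, rowOp, rowImage, D.geomSeries_rowSeries_of_lt _ _ hp1 hp2, sub_self,
      ← rowOp, ← rowOp, rowOp_rowOp_ket_empty hi0 hin, rowOp_ket_empty hin, hket i hin, hcast,
      pathWeight_of_ne ha] at h1
    have hne : ({0, i} : Finset ℕ) ≠ {n, i} := by
      intro h
      have : n ∈ ({0, i} : Finset ℕ) := by rw [h]; simp
      simp only [mem_insert, mem_singleton] at this
      omega
    have h2 := congrArg (D.bra {n, i}) h1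
    have h3 := congrArg (D.bra {0, i}) h1
    have hω := pathWeight_ne_zero hw (a + 1)
    simp only [map_smul, map_add, D.bra_ket, if_neg hne, if_neg hne.symm, if_true, smul_eq_mul,
      mul_one, mul_zero, add_zero, zero_add, Int.cast_natCast, CharP.cast_eq_zero] at h2 h3
    constructor
    · have hz := rowParam_ne_zero hw
      have h5 := hb2 a
      simpa [hb1, ha1, hω, hz, h5] using h3
    · field_simp at h2
      linear_combination -h2

end RowMatch

end ChargedModel

end

noncomputable section

namespace ChargedModel

open Finset

/-! ### Passing from one row to many -/

section Parts

variable {M : ℕ}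

/-- The finite set whose boundary spins are `v`. -/
def parts (v : Fin (M + 1) → Bool) : Finset ℕ :=
  (univ.filter fun j => v j = true).map Fin.valEmbedding

theorem mem_parts {v : Fin (M + 1) → Bool} {p : ℕ} :
    p ∈ parts v ↔ ∃ h : p < M + 1, v ⟨p, h⟩ = true := by
  simp only [parts, mem_map, mem_filter, mem_univ, true_and, Fin.valEmbedding_apply]
  constructor
  · rintro ⟨j, hj, rfl⟩
    exact ⟨j.2, hj⟩
  · rintro ⟨h, hp⟩
    exact ⟨⟨p, h⟩, hp, rfl⟩

theorem parts_le (v : Fin (M + 1) → Bool) : ∀ p ∈ parts v, p ≤ M := fun p hp => by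
  obtain ⟨h, -⟩ := mem_parts.1 hp
  omega

theorem boundary_parts (v : Fin (M + 1) → Bool) : boundary (parts v) M = v := by
  funext j
  simp only [boundary, mem_parts, Fin.is_lt, exists_true_left, Fin.eta, Bool.decide_eq_true]

theorem parts_boundary {lam : Finset ℕ} (h : ∀ p ∈ lam, p ≤ M) :
    parts (boundary lam M) = lam := by
  ext p
  simp only [mem_parts, boundary, decide_eq_true_eq, exists_prop, and_iff_right_iff_imp]
  exact fun hp => Nat.lt_succ_of_le (h p hp)

theorem parts_comp_rev (v : Fin (M + 1) → Bool) :
    parts (v ∘ Fin.rev) = reflectParts M (parts v) := by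
  ext p
  rw [mem_parts, mem_reflectParts, mem_parts]
  constructor
  · rintro ⟨h, hp⟩
    have : Fin.rev (⟨p, h⟩ : Fin (M + 1)) = ⟨M - p, by omega⟩ := by
      ext
      simp [Fin.val_rev]
    rw [Function.comp_apply, this] at hp
    exact ⟨by omega, by omega, hp⟩
  · rintro ⟨h, h', hp⟩
    have : Fin.rev (⟨p, by omega⟩ : Fin (M + 1)) = ⟨M - p, h'⟩ := by
      ext
      simp [Fin.val_rev]
    exact ⟨by omega, by rw [Function.comp_apply, this]; exact hp⟩

theorem sum_powerset_range_eq (F : Finset ℕ → ℂ) :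
    ∑ nu ∈ (range (M + 1)).powerset, F nu = ∑ v : Fin (M + 1) → Bool, F (parts v) := by
  symm
  refine sum_bij' (fun v _ => parts v) (fun nu _ => boundary nu M) ?_ ?_ ?_ ?_ ?_
  · intro v _
    rw [mem_powerset]
    intro p hp
    exact mem_range.2 (Nat.lt_succ_of_le (parts_le v p hp))
  · intro nu _
    exact mem_univ _
  · intro v _
    exact boundary_parts v
  · intro nu hnu
    exact parts_boundary fun p hp => Nat.le_of_lt_succ (mem_range.1 (mem_powerset.1 hnu hp))
  · intro v _
    rfl

end Parts

section MatProd

variable {X : Type*} [Fintype X] [DecidableEq X]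

/-- A sequence of invertible partial products determines its factors. -/
theorem matProd_eq_iff {P Q F : ℕ → Matrix X X ℂ} (h0 : F 0 = 1)
    (hF : ∀ N, F (N + 1) = F N * Q N) (hu : ∀ N, IsUnit (F N)) :
    (∀ N, matProd P N = F N) ↔ ∀ i, P i = Q i := by
  constructor
  · intro h i
    have h1 := h (i + 1)
    rw [hF, matProd, h i] at h1
    exact (hu i).mul_left_cancel h1
  · intro h N
    induction N with
    | zero => rw [h0, matProd]
    | succ N ih => rw [hF, matProd, ih, h]

end MatProd

section TwistTranspose

variable {X : Type*}

/-- Transposition composed with a relabelling of the index set. -/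
def twistTranspose (e : X ≃ X) (A : Matrix X X ℂ) : Matrix X X ℂ := (A.submatrix e e).transpose

theorem twistTranspose_mul [Fintype X] (e : X ≃ X) (A B : Matrix X X ℂ) :
    twistTranspose e (A * B) = twistTranspose e B * twistTranspose e A := by
  rw [twistTranspose, ← Matrix.submatrix_mul_equiv A B e e e, Matrix.transpose_mul]
  rfl

theorem twistTranspose_one [DecidableEq X] (e : X ≃ X) :
    twistTranspose e (1 : Matrix X X ℂ) = 1 := by
  rw [twistTranspose, Matrix.submatrix_one_equiv, Matrix.transpose_one]

theorem twistTranspose_injective (e : X ≃ X) :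
    Function.Injective (twistTranspose e) := by
  intro A B h
  ext a b
  have := congrFun (congrFun h (e.symm b)) (e.symm a)
  simpa [twistTranspose] using this

end TwistTranspose

variable {n : ℕ}

/-- The normalizing factor of a row. -/
def rowNorm (w : Weights n) (M l : ℕ) : ℂ := w.a1 ^ (M + 1) * (w.b1 / w.a1) ^ l

theorem rowNorm_ne_zero {w : Weights n} (hw : w.Nonvanishing) (M l : ℕ) : rowNorm w M l ≠ 0 :=
  mul_ne_zero (pow_ne_zero _ hw.1) (pow_ne_zero _ (div_ne_zero hw.2.2.1 hw.1))

variable [NeZero n]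

/-- The matrix of `e^{H_+}` on boundary spins, with a normalizing factor depending on the length. -/
def expMatrix (D : Twist n) (M : ℕ) (d : ℕ → ℂ) (s : ℕ+ → ℂ) :
    Matrix (Fin (M + 1) → Bool) (Fin (M + 1) → Bool) ℂ :=
  Matrix.of fun b t => d (parts b).card * D.expPlus s (parts t) (parts b)

/-- The exponential preserves the number of parts, so factors depending on the length behave like
scalars on each block. -/
theorem expMatrix_mul (D : Twist n) (M : ℕ) (d d' : ℕ → ℂ) (s s' : ℕ+ → ℂ) :
    expMatrix D M d s * expMatrix D M d' s' =
      expMatrix D M (fun l => d l * d' l) (fun k => s k + s' k) := by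
  ext b t
  have hc : (fun k => s k + s' k) = fun k => s' k + s k := funext fun k => add_comm _ _
  rw [Matrix.mul_apply]
  simp only [expMatrix, Matrix.of_apply]
  rw [hc, D.expPlus_add s' s (parts_le b), sum_powerset_range_eq, mul_sum]
  refine sum_congr rfl fun c _ => ?_
  by_cases hcard : (parts c).card = (parts b).card
  · rw [hcard]
    ring
  · rw [D.expPlus_eq_zero_of_card s hcard]
    ring

theorem expMatrix_one (D : Twist n) (M : ℕ) : expMatrix D M (fun _ => 1) (fun _ => 0) = 1 := by
  ext b t
  simp only [expMatrix, Matrix.of_apply, D.expPlus_zero, Matrix.one_apply, one_mul]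
  refine if_congr ⟨fun h => ?_, fun h => by rw [h]⟩ rfl rfl
  rw [← boundary_parts b, h, boundary_parts]

theorem isUnit_expMatrix (D : Twist n) (M : ℕ) {d : ℕ → ℂ} (hd : ∀ l, d l ≠ 0) (s : ℕ+ → ℂ) :
    IsUnit (expMatrix D M d s) := by
  refine (Units.mk (expMatrix D M d s) (expMatrix D M (fun l => (d l)⁻¹) fun k => -s k)
    ?_ ?_).isUnit
  · rw [expMatrix_mul, ← expMatrix_one D]
    congr 1
    · exact funext fun l => mul_inv_cancel₀ (hd l)
    · exact funext fun k => add_neg_cancel _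
  · rw [expMatrix_mul, ← expMatrix_one D]
    congr 1
    · exact funext fun l => inv_mul_cancel₀ (hd l)
    · exact funext fun k => neg_add_cancel _

theorem matrix_ext_boundary {M : ℕ} {A B : Matrix (Fin (M + 1) → Bool) (Fin (M + 1) → Bool) ℂ} :
    A = B ↔ ∀ lam mu : Finset ℕ, (∀ p ∈ lam, p ≤ M) → (∀ p ∈ mu, p ≤ M) →
      A (boundary lam M) (boundary mu M) = B (boundary lam M) (boundary mu M) := by
  refine ⟨fun h lam mu _ _ => by rw [h], fun h => ?_⟩
  ext b t
  rw [← boundary_parts b, ← boundary_parts t]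
  exact h _ _ (parts_le b) (parts_le t)

theorem rowMatch_iff (D : Twist n) (w : Weights n) (s : ℕ+ → ℂ) :
    RowMatch D w s ↔ ∀ M, (Matrix.of fun c d => rowSum w M c d) =
      expMatrix D M (rowNorm w M) s := by
  refine forall_congr' fun M => ?_
  rw [matrix_ext_boundary]
  refine forall₄_congr fun lam mu hl hm => ?_
  rw [Matrix.of_apply, rowSum_eq_matProd, expMatrix, Matrix.of_apply, parts_boundary hl,
    parts_boundary hm, rowNorm]

/-- The matrix of `e^{H_+}` for the first `N` rows. -/
def expMatrixRows (D : Twist n) (W : ℕ → Weights n) (s : ℕ → ℕ+ → ℂ) (M N : ℕ) :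
    Matrix (Fin (M + 1) → Bool) (Fin (M + 1) → Bool) ℂ :=
  expMatrix D M (fun l => ∏ i ∈ range N, rowNorm (W i) M l) fun k => ∑ j ∈ range N, s j k

theorem expMatrixRows_zero (D : Twist n) (W : ℕ → Weights n) (s : ℕ → ℕ+ → ℂ) (M : ℕ) :
    expMatrixRows D W s M 0 = 1 := by
  simp only [expMatrixRows, range_zero, prod_empty, sum_empty, expMatrix_one]

theorem expMatrixRows_succ (D : Twist n) (W : ℕ → Weights n) (s : ℕ → ℕ+ → ℂ) (M N : ℕ) :
    expMatrixRows D W s M (N + 1) =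
      expMatrixRows D W s M N * expMatrix D M (rowNorm (W N) M) (s N) := by
  simp only [expMatrixRows, expMatrix_mul, prod_range_succ, sum_range_succ]

/-- Exponentials of different rows commute. The new factor is needed on the left because
transposition reverses products. -/
theorem expMatrixRows_succ' (D : Twist n) (W : ℕ → Weights n) (s : ℕ → ℕ+ → ℂ) (M N : ℕ) :
    expMatrixRows D W s M (N + 1) =
      expMatrix D M (rowNorm (W N) M) (s N) * expMatrixRows D W s M N := by
  simp only [expMatrixRows, expMatrix_mul, prod_range_succ_comm, sum_range_succ_comm]

theorem isUnit_expMatrixRows (D : Twist n) {W : ℕ → Weights n} (hW : ∀ i, (W i).Nonvanishing)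
    (s : ℕ → ℕ+ → ℂ) (M N : ℕ) : IsUnit (expMatrixRows D W s M N) :=
  isUnit_expMatrix D M (fun l => prod_ne_zero_iff.2 fun i _ => rowNorm_ne_zero (hW i) M l) _

/-- Matching for N and for N + 1 rows isolates the last row, since the matrix of the first N
exponentials is invertible. -/
theorem matches_iff_rowMatch (D : Twist n) {W : ℕ → Weights n} (hW : ∀ i, (W i).Nonvanishing)
    (s : ℕ → ℕ+ → ℂ) : Matches D W s ↔ ∀ i, RowMatch D (W i) (s i) := by
  have key : ∀ M, (∀ N, matProd (fun i => Matrix.of fun c d => rowSum (W i) M c d) N =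
      expMatrixRows D W s M N) ↔
      ∀ i, (Matrix.of fun c d => rowSum (W i) M c d) = expMatrix D M (rowNorm (W i) M) (s i) :=
    fun M => matProd_eq_iff (expMatrixRows_zero D W s M) (expMatrixRows_succ D W s M)
      (isUnit_expMatrixRows D hW s M)
  simp only [rowMatch_iff]
  rw [forall_comm, ← forall_congr' key]
  unfold Matches
  rw [forall_comm]
  refine forall₂_congr fun M N => ?_
  rw [matrix_ext_boundary]
  refine forall₄_congr fun lam mu hl hm => ?_
  rw [partitionFunction_eq_matProd, expMatrixRows, expMatrix, Matrix.of_apply,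
    parts_boundary hl, parts_boundary hm]
  rfl

/-- Reversal of the boundary spins. -/
def revSpins (M : ℕ) : (Fin (M + 1) → Bool) ≃ (Fin (M + 1) → Bool) where
  toFun v := v ∘ Fin.rev
  invFun v := v ∘ Fin.rev
  left_inv v := by funext j; simp
  right_inv v := by funext j; simp

theorem twistTranspose_expMatrixRows {D : Twist n} (hD : D.IsShiftInvariant)
    (W : ℕ → Weights n) (s : ℕ → ℕ+ → ℂ) {M N : ℕ} {lam mu : Finset ℕ}
    (hl : ∀ p ∈ lam, p ≤ M) (hm : ∀ p ∈ mu, p ≤ M) :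
    twistTranspose (revSpins M) (expMatrixRows D W s M N) (boundary lam M) (boundary mu M) =
      (∏ i ∈ range N, rowNorm (W i) M lam.card) *
        D.expMinus (fun k => ∑ j ∈ range N, s j k) lam mu := by
  have h : ∀ v : Fin (M + 1) → Bool, parts (revSpins M v) = reflectParts M (parts v) :=
    parts_comp_rev
  simp only [twistTranspose, expMatrixRows, expMatrix, Matrix.transpose_apply,
    Matrix.submatrix_apply, Matrix.of_apply, h, parts_boundary hl, parts_boundary hm,
    Twist.expMinus_eq_expPlus hD _ hl hm]
  by_cases hc : lam.card = mu.card
  · rw [card_reflectParts hm, hc]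
  · rw [D.expPlus_eq_zero_of_card _ (by rwa [card_reflectParts hl, card_reflectParts hm]),
      mul_zero, mul_zero]

/-- Reversing the spins and transposing turns the dual transfer matrix into the ordinary one and, by
reflection, H_- into H_+. Both models therefore reduce to the same condition on single rows. -/
theorem dualMatches_iff_rowMatch {D : Twist n} (hD : D.IsShiftInvariant) {W : ℕ → Weights n}
    (hW : ∀ i, (W i).Nonvanishing) (s : ℕ → ℕ+ → ℂ) :
    DualMatches D W s ↔ ∀ i, RowMatch D (W i) (s i) := by
  have hrow : ∀ M i, (Matrix.of fun c d => dualRowSum (W i) M d c) =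
      twistTranspose (revSpins M) (Matrix.of fun c d => rowSum (W i) M c d) := by
    intro M i
    ext c d
    exact dualRowSum_eq (W i) M d c
  have key : ∀ M, (∀ N, matProd (fun i => Matrix.of fun c d => dualRowSum (W i) M d c) N =
      twistTranspose (revSpins M) (expMatrixRows D W s M N)) ↔
      ∀ i, (Matrix.of fun c d => rowSum (W i) M c d) = expMatrix D M (rowNorm (W i) M) (s i) := by
    intro M
    rw [matProd_eq_iff (Q := fun i =>
      twistTranspose (revSpins M) (expMatrix D M (rowNorm (W i) M) (s i)))]
    · refine forall_congr' fun i => ?_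
      rw [hrow, (twistTranspose_injective (revSpins M)).eq_iff]
    · rw [expMatrixRows_zero, twistTranspose_one]
    · intro N
      rw [expMatrixRows_succ', twistTranspose_mul]
    · intro N
      obtain ⟨u, hu⟩ := isUnit_expMatrixRows D hW s M N
      rw [← hu]
      exact (Units.mk (twistTranspose (revSpins M) (u : Matrix _ _ ℂ))
        (twistTranspose (revSpins M) ((u⁻¹ : (Matrix _ _ ℂ)ˣ) : Matrix _ _ ℂ))
        (by rw [← twistTranspose_mul, Units.inv_mul, twistTranspose_one])
        (by rw [← twistTranspose_mul, Units.mul_inv, twistTranspose_one])).isUnit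
  simp only [rowMatch_iff]
  rw [forall_comm, ← forall_congr' key]
  unfold DualMatches
  rw [forall_comm]
  refine forall₂_congr fun M N => ?_
  rw [matrix_ext_boundary]
  refine forall₄_congr fun lam mu hl hm => ?_
  rw [dualPartitionFunction_eq_matProd, twistTranspose_expMatrixRows hD W s hl hm]
  rfl

end ChargedModel

end

noncomputable section

namespace ChargedModel

open Finset

/-! ### Hamiltonian parameters -/

section Parameters

open PowerSeries

theorem one_sub_mul_geomSeries (z : ℂ) : (1 - C z * X) * geomSeries z = 1 := by
  have h := geomSeries_eq z
  rw [smul_eq_C_mul] at h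
  linear_combination h

theorem derivative_geomSeries (z : ℂ) :
    d⁄dX ℂ (geomSeries z) = C z * geomSeries z * geomSeries z := by
  have h := one_sub_mul_geomSeries z
  have h1 := congrArg (d⁄dX ℂ) h
  rw [Derivation.leibniz] at h1
  simp only [map_sub, Derivation.leibniz, derivative_C, derivative_X, smul_eq_mul,
    Derivation.map_one_eq_zero, mul_zero, add_zero, mul_one, zero_sub] at h1
  linear_combination (geomSeries z) * h1 - d⁄dX ℂ (geomSeries z) * h

theorem expSeries_toSeries_pow_div (z : ℂ) :
    expSeries (toSeries fun k => z ^ (k : ℕ) / (k : ℂ)) = geomSeries z := by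
  symm
  refine eq_expSeries (constantCoeff_toSeries _) ?_ ?_
  · rw [derivative_geomSeries]
    congr 1
    ext k
    have h := coeff_toSeries (fun k : ℕ+ => z ^ (k : ℕ) / (k : ℂ)) ⟨k + 1, k.succ_pos⟩
    rw [PNat.mk_coe] at h
    rw [coeff_C_mul, coeff_derivative, h, geomSeries, coeff_mk]
    have : (k : ℂ) + 1 ≠ 0 := Nat.cast_add_one_ne_zero k
    push_cast
    field_simp
    ring
  · rw [← coeff_zero_eq_constantCoeff_apply, geomSeries, coeff_mk, pow_zero]

/-- The Hamiltonian parameters of a free fermionic row. -/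
def freeParam (ρ z : ℂ) (k : ℕ+) : ℂ :=
  1 / (k : ℂ) * (z ^ (k : ℕ) + (-1) ^ ((k : ℕ) - 1) * (ρ * z) ^ (k : ℕ))

/-- Adding the logarithm of 1/(1 + ρzX) to the parameters yields that of 1/(1 - zX). So the
exponential is (1 + ρzX)/(1 - zX), which expands to the row series with κ = 1 + ρ. -/
theorem expSeries_toSeries_freeParam (ρ z : ℂ) :
    expSeries (toSeries (freeParam ρ z)) = rowSeries (1 + ρ) z := by
  set u := -(ρ * z)
  have hsum : (toSeries fun k : ℕ+ => z ^ (k : ℕ) / (k : ℂ)) =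
      toSeries (freeParam ρ z) + toSeries fun k : ℕ+ => u ^ (k : ℕ) / (k : ℂ) := by
    rw [← toSeries_add]
    congr 1
    funext k
    obtain ⟨j, hj⟩ := Nat.exists_eq_succ_of_ne_zero k.ne_zero
    simp only [freeParam, u, neg_pow (ρ * z), hj, Nat.succ_eq_add_one, Nat.add_sub_cancel]
    rw [pow_succ (-1 : ℂ)]
    ring
  have h := congrArg expSeries hsum
  rw [expSeries_add (constantCoeff_toSeries _) (constantCoeff_toSeries _),
    expSeries_toSeries_pow_div, expSeries_toSeries_pow_div] at h
  have h1 := one_sub_mul_geomSeries z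
  have h2 := one_sub_mul_geomSeries u
  have h3 : (C u : ℂ⟦X⟧) = -(C ρ * C z) := by simp [u]
  rw [rowSeries, smul_eq_C_mul, smul_eq_C_mul]
  simp only [map_sub, map_add, map_one]
  rw [h3] at h2
  linear_combination (-expSeries (toSeries (freeParam ρ z))) * h2 +
    (-(1 + C ρ * C z * X)) * h - C ρ * h1

theorem expSeries_toSeries_eq_iff (s : ℕ+ → ℂ) (ρ z : ℂ) :
    expSeries (toSeries s) = rowSeries (1 + ρ) z ↔ ∀ k, s k = freeParam ρ z k := by
  rw [← expSeries_toSeries_freeParam, ← funext_iff]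
  refine ⟨fun h => toSeries_injective ?_, fun h => by rw [h]⟩
  exact expSeries_injective (constantCoeff_toSeries _) (constantCoeff_toSeries _) h

end Parameters

/-! ### The free fermion conditions -/

section Conditions

variable {n : ℕ} {D : Twist n} {w : Weights n}

theorem Weights.Nonvanishing.ratio_ne_zero (hw : w.Nonvanishing) (a : ZMod n) : w.ratio a ≠ 0 :=
  div_ne_zero (mul_ne_zero hw.1 (hw.2.1 a)) (mul_ne_zero hw.2.2.1 (hw.2.2.2.1 a))

theorem Weights.Nonvanishing.ratio_eq_iff (hw : w.Nonvanishing) (a : ZMod n) (c : ℂ) :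
    w.ratio a = c ↔ w.a1 * w.a2 a = c * (w.b1 * w.b2 a) :=
  div_eq_iff (mul_ne_zero hw.2.2.1 (hw.2.2.2.1 a))

theorem Weights.Nonvanishing.zeroCharge_iff (hw : w.Nonvanishing) :
    w.ZeroChargeFreeFermion ↔ turnRatio w = 1 + w.ratio 0 := by
  have hb : w.b1 * w.b2 0 ≠ 0 := mul_ne_zero hw.2.2.1 (hw.2.2.2.1 0)
  rw [Weights.ZeroChargeFreeFermion, turnRatio, Weights.ratio, div_eq_iff hb, add_mul,
    div_mul_cancel₀ _ hb]
  constructor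
  · intro h; linear_combination -h
  · intro h; linear_combination -h

theorem Weights.Nonvanishing.chargeCondition_iff (hw : w.Nonvanishing) :
    w.ChargeCondition ↔ ∀ a : ZMod n, a ≠ 0 → w.ratio a * w.ratio (-a) = -w.ratio 0 := by
  obtain ⟨ha1, ha2, hb1, hb2, -, -⟩ := hw
  refine forall₂_congr fun a _ => ?_
  have h1 := hb2 a
  have h2 := hb2 (-a)
  have h3 := hb2 0
  have hc : w.a1 / w.b1 ≠ 0 := div_ne_zero ha1 hb1
  have e1 : w.ratio a * w.ratio (-a) = w.a1 / w.b1 *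
      (w.a1 * w.a2 a * w.a2 (-a) / (w.b1 * w.b2 a * w.b2 (-a))) := by
    simp only [Weights.ratio]
    field_simp
  have e2 : -w.ratio 0 = w.a1 / w.b1 * -(w.a2 0 / w.b2 0) := by
    simp only [Weights.ratio]
    field_simp
  rw [e1, e2, mul_right_inj' hc]

theorem exists_ne_zero_of_ne_one (hn : n ≠ 1) : ∃ a : ZMod n, a ≠ 0 := by
  have : Nontrivial (ZMod n) := ZMod.nontrivial_iff.2 hn
  exact exists_ne 0

theorem eq_zero_of_eq_one (hn : n = 1) (a : ZMod n) : a = 0 := by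
  subst hn
  exact Subsingleton.elim _ _

theorem Twist.IsShiftInvariant.star (hD : D.IsShiftInvariant) : D.star.IsShiftInvariant := hD

theorem Twist.star_star (D : Twist n) : D.star.star = D := by
  cases D
  simp [Twist.star]

theorem Twist.g_mul_g_neg (hD : D.IsShiftInvariant) {a : ZMod n} (ha : a ≠ 0) :
    D.g a * D.g (-a) = -D.g 0 := by
  have h1 : D.α (-a) 0 = D.α 0 a := by simpa using (hD (-a) 0 a).symm
  rw [g, g, g, if_neg ha, if_neg (neg_ne_zero.2 ha), if_pos rfl, h1]
  linear_combination D.q ^ 2 * D.α_mul a 0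

/-- For n > 1 a nonzero charge exists and forces κ = 1 - q²; with κ = 1 + ρ this becomes ρ = -q²,
the value of g at 0. For n = 1 nothing is required of q. -/
theorem rowCondition_iff (hw : w.Nonvanishing) :
    RowCondition D w ↔ w.ZeroChargeFreeFermion ∧ (n ≠ 1 → ∀ a, w.ratio a = D.g a) := by
  rw [RowCondition, ← hw.ratio_eq_iff, hw.zeroCharge_iff, eq_comm (a := w.ratio 0),
    sub_eq_iff_eq_add']
  refine and_congr_right fun h0 => ?_
  constructor
  · intro h hn a
    by_cases ha : a = 0
    · subst ha
      obtain ⟨b, hb⟩ := exists_ne_zero_of_ne_one hn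
      rw [Twist.g, if_pos rfl]
      linear_combination (h b hb).1 - h0
    · rw [Twist.g, if_neg ha, hw.ratio_eq_iff, (h a ha).2, neg_mul D.q]
  · intro h a ha
    have hn : n ≠ 1 := fun hn => ha (eq_zero_of_eq_one hn a)
    have h1 := h hn 0
    have h2 := h hn a
    rw [Twist.g, if_pos rfl] at h1
    rw [Twist.g, if_neg ha, hw.ratio_eq_iff, neg_mul D.q] at h2
    exact ⟨by linear_combination h0 + h1, h2⟩

variable {W : ℕ → Weights n}

/-- A function on charges with `ρ(a) ρ(-a) = -ρ(0)` comes from a metaplectic Fock space. -/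
theorem exists_twist {ρ : ZMod n → ℂ} (h0 : ∀ a, ρ a ≠ 0)
    (h : ∀ a, a ≠ 0 → ρ a * ρ (-a) = -ρ 0) :
    ∃ D : Twist n, D.IsShiftInvariant ∧ ∀ a, ρ a = D.g a := by
  -- Since g(0) = -q², the parameter q must be a square root of -ρ(0); then α is forced off the
  -- diagonal.
  obtain ⟨q, hq⟩ := IsAlgClosed.exists_pow_nat_eq (-ρ 0) two_pos
  have hq0 : q ≠ 0 := by
    rintro rfl
    exact h0 0 (by simpa using hq.symm)
  refine ⟨⟨q, hq0, fun i j => if i = j then 1 else -ρ (i - j) / q, fun i => if_pos rfl, ?_⟩, ?_, ?_⟩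
  · intro i j
    by_cases hij : i = j
    · simp [hij]
    · have h1 := h (i - j) (sub_ne_zero.2 hij)
      rw [neg_sub] at h1
      simp only [if_neg hij, if_neg (Ne.symm hij)]
      field_simp
      linear_combination h1 - hq
  · intro i j c
    simp only [add_left_inj, add_sub_add_right_eq_sub]
  · intro a
    by_cases ha : a = 0
    · subst ha
      rw [Twist.g, if_pos rfl]
      linear_combination hq
    · rw [Twist.g, if_neg ha]
      simp only [if_neg ha, sub_zero]
      field_simp

theorem generalizedFreeFermionic_iff (hW : ∀ i, (W i).Nonvanishing) :
    GeneralizedFreeFermionic W ↔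
      (∀ i, (W i).ZeroChargeFreeFermion ∧ (W i).ChargeCondition) ∧
        (n ≠ 1 → ∀ i j a, (W i).ratio a = (W j).ratio a) := by
  constructor
  · rintro ⟨D, hD, hz, hg⟩
    refine ⟨fun i => ⟨hz i, (hW i).chargeCondition_iff.2 fun a ha => ?_⟩, fun hn i j a => ?_⟩
    · have hn : n ≠ 1 := fun hn => ha (eq_zero_of_eq_one hn a)
      rw [hg hn, hg hn, hg hn, Twist.g_mul_g_neg hD ha]
    · rw [hg hn, hg hn]
  · rintro ⟨h, hr⟩
    obtain ⟨D, hD, hg⟩ := exists_twist (hW 0).ratio_ne_zero ((hW 0).chargeCondition_iff.1 (h 0).2)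
    exact ⟨D, hD, fun i => (h i).1, fun hn i a => by rw [hr hn i 0, hg]⟩

/-- If the quotients of different rows are proportional, the charge condition makes them equal. -/
theorem generalizedFreeFermionic_iff_of_proportional (hW : ∀ i, (W i).Nonvanishing) {t : ℕ → ℂ}
    {φ : ZMod n → ℂ} (hr : ∀ i a, (W i).ratio a = t i * φ a) :
    GeneralizedFreeFermionic W ↔
      ∀ i, (W i).ZeroChargeFreeFermion ∧ (W i).ChargeCondition := by
  rw [generalizedFreeFermionic_iff hW, and_iff_left_iff_imp]
  intro h hn i j a
  obtain ⟨b, hb⟩ := exists_ne_zero_of_ne_one hn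
  -- The charge condition is quadratic in `t i` on one side and linear on the other, so cancelling
  -- one factor determines `t i` independently of the row.
  have key : ∀ i, t i * (φ b * φ (-b)) = -φ 0 := by
    intro i
    have h1 := (hW i).chargeCondition_iff.1 (h i).2 b hb
    have h2 := (hW i).ratio_ne_zero 0
    rw [hr] at h2
    rw [hr, hr, hr] at h1
    apply mul_left_cancel₀ (left_ne_zero_of_mul h2)
    linear_combination h1
  have hφ : ∀ c, φ c ≠ 0 := fun c => right_ne_zero_of_mul (hr 0 c ▸ (hW 0).ratio_ne_zero c)
  have : t i = t j := mul_right_cancel₀ (mul_ne_zero (hφ b) (hφ (-b))) ((key i).trans (key j).symm)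
  rw [hr, hr, this]

variable [NeZero n]

theorem rowMatch_iff_freeParam (hD : D.IsShiftInvariant) (hw : w.Nonvanishing) (s : ℕ+ → ℂ) :
    RowMatch D w s ↔ (w.ZeroChargeFreeFermion ∧ (n ≠ 1 → ∀ a, w.ratio a = D.g a)) ∧
      ∀ k, s k = freeParam (w.ratio 0) (rowParam w) k := by
  rw [← rowCondition_iff hw]
  constructor
  · intro h
    have h1 := h.rowCondition hw
    refine ⟨h1, ?_⟩
    rw [← expSeries_toSeries_eq_iff, ← hw.zeroCharge_iff.1 ((rowCondition_iff hw).1 h1).1]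
    exact h.expSeries_eq hw
  · rintro ⟨h1, h2⟩
    rw [← expSeries_toSeries_eq_iff, ← hw.zeroCharge_iff.1 ((rowCondition_iff hw).1 h1).1] at h2
    exact h1.rowMatch hD hw h2

theorem forall_rowMatch_iff (hD : D.IsShiftInvariant) (hW : ∀ i, (W i).Nonvanishing)
    (s : ℕ → ℕ+ → ℂ) : (∀ i, RowMatch D (W i) (s i)) ↔ FreeFermionicFor D W ∧
      ∀ j k, s j k = freeParam ((W j).ratio 0) (rowParam (W j)) k := by
  rw [FreeFermionicFor, forall_congr' fun i => rowMatch_iff_freeParam hD (hW i) (s i), forall_and,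
    forall_and, forall_comm (β := n ≠ 1)]

theorem matches_iff (hD : D.IsShiftInvariant) (hW : ∀ i, (W i).Nonvanishing) (s : ℕ → ℕ+ → ℂ) :
    Matches D W s ↔ FreeFermionicFor D W ∧
      ∀ j k, s j k = freeParam ((W j).ratio 0) (rowParam (W j)) k := by
  rw [matches_iff_rowMatch D hW, forall_rowMatch_iff hD hW]

theorem dualMatches_iff (hD : D.IsShiftInvariant) (hW : ∀ i, (W i).Nonvanishing)
    (s : ℕ → ℕ+ → ℂ) :
    DualMatches D W s ↔ FreeFermionicFor D W ∧
      ∀ j k, s j k = freeParam ((W j).ratio 0) (rowParam (W j)) k := by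
  rw [dualMatches_iff_rowMatch hD hW, forall_rowMatch_iff hD hW]

theorem exists_matches_iff (hW : ∀ i, (W i).Nonvanishing) :
    (∃ D : Twist n, D.IsShiftInvariant ∧ ∃ s, Matches D W s) ↔ GeneralizedFreeFermionic W := by
  refine exists_congr fun D => and_congr_right fun hD => ?_
  simp only [matches_iff hD hW]
  exact ⟨fun ⟨s, h, _⟩ => h, fun h => ⟨_, h, fun _ _ => rfl⟩⟩

/-- The passage to 𝓕_* is an involution on shift invariant twists, so both spaces range over the
same family. -/
theorem exists_dualMatches_iff (hW : ∀ i, (W i).Nonvanishing) :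
    (∃ D : Twist n, D.IsShiftInvariant ∧ ∃ s, DualMatches D.star W s) ↔
      GeneralizedFreeFermionic W := by
  constructor
  · rintro ⟨D, hD, s, h⟩
    exact ⟨D.star, hD.star, ((dualMatches_iff hD.star hW s).1 h).1⟩
  · rintro ⟨D, hD, h⟩
    refine ⟨D.star, hD.star, fun j k => freeParam ((W j).ratio 0) (rowParam (W j)) k, ?_⟩
    rw [D.star_star, dualMatches_iff hD hW]
    exact ⟨h, fun _ _ => rfl⟩

end Conditions

/-! ### The parametrized models -/

section Models

variable {n : ℕ} {x y A B : ℕ → ℂ} {f h : ZMod n → ℂ}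

theorem modelWeights_ratio (hW : ∀ i, (modelWeights x y A B f h i).Nonvanishing) (i : ℕ)
    (a : ZMod n) : (modelWeights x y A B f h i).ratio a = y i / x i * (h a / f a) := by
  obtain ⟨h1, h2, h3, h4, -, -⟩ := hW i
  have h4 := h4 a
  simp only [modelWeights, mul_ne_zero_iff] at h1 h3 h4
  obtain ⟨⟨h5, h6⟩, -⟩ := h4
  have h7 := h3.2
  simp only [Weights.ratio, modelWeights]
  field_simp

theorem dualModelWeights_ratio (hW : ∀ i, (dualModelWeights x y A B f h i).Nonvanishing) (i : ℕ)
    (a : ZMod n) : (dualModelWeights x y A B f h i).ratio a = x i / y i * (f a / h a) := by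
  obtain ⟨h1, h2, h3, h4, -, -⟩ := hW i
  have h4 := h4 a
  simp only [dualModelWeights, mul_ne_zero_iff, ne_eq, inv_eq_zero] at h1 h3 h4
  obtain ⟨⟨h5, h6⟩, -⟩ := h4
  have h7 := h3.2
  simp only [Weights.ratio, dualModelWeights]
  field_simp

variable [NeZero n]

/-- Serves both parametrized models: `v` is the row variable in b₂ and `u` the one in a₂, so x and y
trade places in the dual model. -/
theorem freeParam_eq (ρ r z u v p : ℂ) (hv : v ≠ 0) (hz : z = v ^ n * p) (hρ : ρ = u / v * r)
    (k : ℕ+) :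
    freeParam ρ z k = 1 / (k : ℂ) * (v ^ (n * (k : ℕ)) * p ^ (k : ℕ) +
      (-1) ^ ((k : ℕ) - 1) * r ^ (k : ℕ) * u ^ (k : ℕ) * v ^ ((n - 1) * (k : ℕ)) *
        p ^ (k : ℕ)) := by
  have h1 : ρ * z = r * u * v ^ (n - 1) * p := by
    obtain ⟨m, rfl⟩ := Nat.exists_eq_succ_of_ne_zero (NeZero.ne n)
    rw [hz, hρ, Nat.succ_eq_add_one, Nat.add_sub_cancel, pow_succ]
    field_simp
  rw [freeParam, h1, hz]
  simp only [mul_pow, ← pow_mul, mul_assoc]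

theorem rowParam_modelWeights (hW : ∀ i, (modelWeights x y A B f h i).Nonvanishing) (i : ℕ) :
    rowParam (modelWeights x y A B f h i) = x i ^ n * ∏ a, f a := by
  have hA : A i ≠ 0 := (hW i).1
  simp only [rowParam, modelWeights, mul_div_cancel_right₀ _ hA, prod_mul_distrib, prod_const,
    card_univ, ZMod.card]
  ring

theorem rowParam_dualModelWeights (hW : ∀ i, (dualModelWeights x y A B f h i).Nonvanishing)
    (i : ℕ) : rowParam (dualModelWeights x y A B f h i) = y i ^ n * ∏ a, h a := by
  have hA : (A i)⁻¹ ≠ 0 := (hW i).1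
  simp only [rowParam, dualModelWeights, mul_div_cancel_right₀ _ hA, prod_mul_distrib, prod_const,
    card_univ, ZMod.card]
  ring

end Models

end ChargedModel

end

open ChargedModel in
theorem mainTheorem2 (n : ℕ) [NeZero n] :
    -- the model `𝔖^q(x, y, A, B, f, h)` and `e^{H_+}` on a metaplectic Fock space
    (∀ (x y A B : ℕ → ℂ) (f h : ZMod n → ℂ),
      (∀ i, (modelWeights x y A B f h i).Nonvanishing) →
      (∀ (D : Twist n), D.IsShiftInvariant → ∀ s : ℕ → ℕ+ → ℂ,
        (Matches D (modelWeights x y A B f h) s ↔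
          FreeFermionicFor D (modelWeights x y A B f h) ∧
          ∀ (j : ℕ) (k : ℕ+), s j k = 1 / (k : ℂ) *
            (x j ^ (n * (k : ℕ)) * (∏ a, f a) ^ (k : ℕ) +
              (-1) ^ ((k : ℕ) - 1) * (h 0 / f 0) ^ (k : ℕ) * y j ^ (k : ℕ) *
                x j ^ ((n - 1) * (k : ℕ)) * (∏ a, f a) ^ (k : ℕ)))) ∧
      (GeneralizedFreeFermionic (modelWeights x y A B f h) ↔
        ∀ i, (modelWeights x y A B f h i).ZeroChargeFreeFermion ∧
          (modelWeights x y A B f h i).ChargeCondition)) ∧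
    -- the dual model `𝔖^{*,q}(x, y, A, B, f, h)` and `e^{H_-}` on `𝓕_*`
    (∀ (x y A B : ℕ → ℂ) (f h : ZMod n → ℂ),
      (∀ i, (dualModelWeights x y A B f h i).Nonvanishing) →
      (∀ (D : Twist n), D.IsShiftInvariant → ∀ s : ℕ → ℕ+ → ℂ,
        (DualMatches D.star (dualModelWeights x y A B f h) s ↔
          FreeFermionicFor D.star (dualModelWeights x y A B f h) ∧
          ∀ (j : ℕ) (k : ℕ+), s j k = 1 / (k : ℂ) *
            (y j ^ (n * (k : ℕ)) * (∏ a, h a) ^ (k : ℕ) +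
              (-1) ^ ((k : ℕ) - 1) * (h 0 / f 0)⁻¹ ^ (k : ℕ) * x j ^ (k : ℕ) *
                y j ^ ((n - 1) * (k : ℕ)) * (∏ a, h a) ^ (k : ℕ)))) ∧
      (GeneralizedFreeFermionic (dualModelWeights x y A B f h) ↔
        ∀ i, (dualModelWeights x y A B f h i).ZeroChargeFreeFermion ∧
          (dualModelWeights x y A B f h i).ChargeCondition)) ∧
    -- both models with arbitrary nonvanishing row weights
    (∀ W : ℕ → Weights n, (∀ i, (W i).Nonvanishing) →
      (GeneralizedFreeFermionic W ↔
        (∀ i, (W i).ZeroChargeFreeFermion ∧ (W i).ChargeCondition) ∧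
          (n ≠ 1 → ∀ i j a, (W i).ratio a = (W j).ratio a)) ∧
      ((∃ D : Twist n, D.IsShiftInvariant ∧ ∃ s, Matches D W s) ↔ GeneralizedFreeFermionic W) ∧
      ((∃ D : Twist n, D.IsShiftInvariant ∧ ∃ s, DualMatches D.star W s) ↔
        GeneralizedFreeFermionic W)) := by
  refine ⟨fun x y A B f h hW => ⟨fun D hD s => ?_, ?_⟩,
    fun x y A B f h hW => ⟨fun D hD s => ?_, ?_⟩, fun W hW =>
      ⟨generalizedFreeFermionic_iff hW, exists_matches_iff hW, exists_dualMatches_iff hW⟩⟩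
  · rw [matches_iff hD hW]
    refine and_congr_right fun _ => forall₂_congr fun j k => ?_
    have hx : x j ≠ 0 := right_ne_zero_of_mul (left_ne_zero_of_mul ((hW j).2.2.2.1 0))
    rw [freeParam_eq _ (h 0 / f 0) _ (y j) (x j) (∏ a, f a) hx (rowParam_modelWeights hW j)
      (modelWeights_ratio hW j 0)]
  · exact generalizedFreeFermionic_iff_of_proportional hW (modelWeights_ratio hW)
  · rw [dualMatches_iff hD.star hW]
    refine and_congr_right fun _ => forall₂_congr fun j k => ?_
    have hy : y j ≠ 0 := right_ne_zero_of_mul (left_ne_zero_of_mul ((hW j).2.2.2.1 0))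
    rw [freeParam_eq _ (h 0 / f 0)⁻¹ _ (x j) (y j) (∏ a, h a) hy (rowParam_dualModelWeights hW j)
      (by rw [dualModelWeights_ratio hW j 0, inv_div])]
  · exact generalizedFreeFermionic_iff_of_proportional hW (dualModelWeights_ratio hW)
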